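/- Let $\mathbb{H}^2$ be the hyperbolic plane of curvature $-1$ and $\mathcal G$ its group of orientation preserving isometries. A body is a compact connected set that is the closure of its interior; a tile is a homeomorphic image of the closed unit disk. A packing by a finite collection $\mathcal B$ of bodies is a collection of congruent copies (under arbitrary isometries) of members of $\mathcal B$ with pairwise disjoint interiors, and a tiling is a packing by tiles that covers $\mathbb{H}^2$. A packing is completely saturated if it is not possible to replace finitely many of its bodies by finitely many copies of members of $\mathcal B$ of greater total area and still have a packing. It is periodic if its symmetry group in $\mathcal G$ is cocompact. Let $\Sigma_{\mathcal B}$ be the space of all packings $\mathcal P$ by $\mathcal B$ such that every congruent copy of a member of $\mathcal B$ meets a body of $\mathcal P$, with the topology of uniform convergence (of bodies, in the Hausdorff metric) on compact sets. For a $\mathcal G$-invariant Borel probability measure $\mu$ on $\Sigma_{\mathcal B}$ let $D(\mu)$ be the $\mu$-probability that a fixed origin is covered by the packing. The optimal density of $\mathcal B$ is the supremum $D(\mathcal B)$ of $D(\mu)$ over the ergodic measures $\mu$ (the extreme points of the set of invariant probability measures). A packing $\mathcal P\in\Sigma_{\mathcal B}$ is optimally dense if there is an ergodic $\mu$ with $D(\mu)=D(\mathcal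 B)$ such that the $\mathcal G$-orbit of $\mathcal P$ is dense in the support of $\mu$ and, for every $p\in\mathbb{H}^2$, the fraction of the area of the ball of radius $r$ about $p$ that is covered by $\mathcal P$ tends to $D(\mu)$ as $r\to\infty$. A periodic packing $\mathcal P\in\Sigma_{\mathcal B}$ has density $d$ if its symmetry group in $\mathcal G$ has a fundamental domain, the bodies of $\mathcal P$ take up the fraction $d$ of the area of every such fundamental domain, and there is an ergodic measure $\mu$ carried by the orbit of $\mathcal P$ with $D(\mu)=d$. There are a regular octagon $\beta_1\subset\mathbb{H}^2$ with all interior angles equal to $2\pi/8$, a subgroup $\Gamma\le\mathcal G$ and a tile $\beta_2'$ with the following properties. (i) $\mathcal T_1=\{\gamma\beta_1:\gamma\in\Gamma\}$ is a tiling, and $\gamma\beta_1\ne\gamma'\beta_1$ for $\gamma\neq\gamma'$ in $\Gamma$. (ii) $\beta_2'$ is formed from $\beta_1$ by adding protrusions to four of its sides and matching indentations to the four others: the eight sides are $s_1,\dots,s_4,s_1',\dots,s_4'$, and there are $g_1,\dots,g_4\in\Gamma$ with $g_i s_i'=s_i=\beta_1\cap g_i\beta_1$, and bodies $Q_i\subset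 g_i\beta_1$ that meet the boundary of $g_i\beta_1$ exactly in a nondegenerate segment contained in $s_i$ without its end points, such that the sets $g_i^{-1}Q_i$ are pairwise disjoint and $\beta_2'=\overline{\beta_1\setminus\bigcup_i g_i^{-1}Q_i}\;\cup\;\bigcup_i Q_i$. Moreover $\mathcal T_2=\{\gamma\beta_2':\gamma\in\Gamma\}$ is a tiling. (iii) For every point $c$ in the interior of $\beta_2'$ there is $r_0>0$ such that for all $0<r<r_0$ the following holds. The closed disk of radius $r$ about $c$ lies in the interior of $\beta_2'$; let $\beta_2$ be $\beta_2'$ with the open disk of radius $r$ about $c$ (a small hole) removed. Then $\beta_1$ and $\beta_2$ are bodies, the optimal density of $\{\beta_1,\beta_2\}$ is $1$, and $\operatorname{area}(\beta_2)/\operatorname{area}(\beta_1)<1$. Both $\mathcal T_1$ and $\mathcal P=\{\gamma\beta_2:\gamma\in\Gamma\}$ belong to $\Sigma_{\{\beta_1,\beta_2\}}$ and are periodic and completely saturated packings by $\{\beta_1,\beta_2\}$; the density of $\mathcal T_1$ is $1$, and the density of $\mathcal P$ is $\operatorname{area}(\beta_2)/\operatorname{area}(\beta_1)$. In particular the completely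 saturated packing $\mathcal P$ is not optimally dense: in hyperbolic space locally densest does not imply globally densest. -/

import Mathlib

open Set Filter Topology MeasureTheory UpperHalfPlane TopologicalSpace
open scoped NNReal ENNReal MatrixGroups

noncomputable section

namespace HypPacking

/-! ### Isometries, segments, angles and polygons in the hyperbolic plane

`ℍ` is the upper half-plane with Mathlib's hyperbolic metric (curvature `-1`) and area measure
`dx dy / y ^ 2`; `ℍ ≃ᵢ ℍ` is its full isometry group. -/

/-- The isometry group acts on the hyperbolic plane by evaluation. -/
instance isomAction : MulAction (ℍ ≃ᵢ ℍ) ℍ where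
  smul φ z := φ z
  one_smul _ := rfl
  mul_smul _ _ _ := rfl

/-- The group of orientation preserving isometries: those given by Möbius transformations. -/
def orientedIsom : Subgroup (ℍ ≃ᵢ ℍ) where
  carrier := {φ | ∃ g : SL(2, ℝ), ∀ z, φ z = g • z}
  one_mem' := ⟨1, fun z => by simp⟩
  mul_mem' := by
    rintro φ ψ ⟨g, hg⟩ ⟨h, hh⟩
    exact ⟨g * h, fun z => by rw [IsometryEquiv.mul_apply, hh, hg, mul_smul]⟩
  inv_mem' := by
    rintro φ ⟨g, hg⟩
    refine ⟨g⁻¹, fun z => φ.injective ?_⟩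
    rw [IsometryEquiv.apply_inv_self, hg, smul_inv_smul]

/-- The geodesic segment with end points `a` and `b`. -/
def geodesicSegment (a b : ℍ) : Set ℍ := {z | dist a z + dist z b = dist a b}

/-- Geodesic convexity. -/
def IsGeodesicallyConvex (S : Set ℍ) : Prop := ∀ a ∈ S, ∀ b ∈ S, geodesicSegment a b ⊆ S

/-- The hyperbolic convex hull. -/
def geodesicHull (S : Set ℍ) : Set ℍ := ⋂₀ {C | S ⊆ C ∧ IsGeodesicallyConvex C}

/-- The angle at `b` between the geodesic segments from `b` to `a` and from `b` to `c`, given by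
the hyperbolic law of cosines (for `a ≠ b` and `c ≠ b`). -/
def hypAngle (a b c : ℍ) : ℝ :=
  Real.arccos ((Real.cosh (dist a b) * Real.cosh (dist b c) - Real.cosh (dist a c)) /
    (Real.sinh (dist a b) * Real.sinh (dist b c)))

/-- `S` is a regular octagon with vertices `v 0, …, v 7`, in cyclic order: the vertices are
permuted cyclically by a rotation by an eighth of a turn about some centre `o`, and `S` is their
convex hull. -/
structure IsRegularOctagon (v : ZMod 8 → ℍ) (S : Set ℍ) : Prop where
  injective : Function.Injective v
  rotation : ∃ (o : ℍ) (ρ : ℍ ≃ᵢ ℍ), ρ o = o ∧ (∀ k, ρ (v k) = v (k + 1)) ∧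
    hypAngle (v 0) o (v 1) = 2 * Real.pi / 8
  eq_hull : S = geodesicHull (range v)

/-- The `k`-th side of the polygon with vertices `v`. -/
def side (v : ZMod 8 → ℍ) (k : ZMod 8) : Set ℍ := geodesicSegment (v k) (v (k + 1))

/-! ### Bodies, packings and tilings -/

/-- A body: a compact connected set that is the closure of its interior. -/
def IsBody (S : Set ℍ) : Prop := IsCompact S ∧ IsConnected S ∧ closure (interior S) = S

/-- A tile: a homeomorphic image of the closed unit disk. -/
def IsTile (S : Set ℍ) : Prop :=
  Nonempty (S ≃ₜ Metric.closedBall (0 : EuclideanSpace ℝ (Fin 2)) 1)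

/-- The image of a compact set under an isometry. -/
def move (φ : ℍ ≃ᵢ ℍ) (K : NonemptyCompacts ℍ) : NonemptyCompacts ℍ := K.map φ φ.continuous

theorem coe_move (φ : ℍ ≃ᵢ ℍ) (K : NonemptyCompacts ℍ) : (move φ K : Set ℍ) = φ '' K := rfl

theorem move_one (K : NonemptyCompacts ℍ) : move 1 K = K :=
  SetLike.coe_injective (by rw [coe_move]; exact image_id _)

theorem move_mul (φ ψ : ℍ ≃ᵢ ℍ) (K : NonemptyCompacts ℍ) :
    move (φ * ψ) K = move φ (move ψ K) :=
  SetLike.coe_injective (by rw [coe_move, coe_move, coe_move, image_image]; rfl)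

theorem move_injective (φ : ℍ ≃ᵢ ℍ) : Function.Injective (move φ) := fun K L h => by
  have h' := congrArg (move φ⁻¹) h
  rwa [← move_mul, ← move_mul, inv_mul_cancel, move_one, move_one] at h'

/-- The portion of the plane covered by the members of a collection. -/
def covered (P : Set (NonemptyCompacts ℍ)) : Set ℍ := ⋃ K ∈ P, (K : Set ℍ)

/-- `P` is a packing by congruent copies of members of `B`: the interiors of distinct members of
`P` are disjoint. -/
def IsPacking (B P : Set (NonemptyCompacts ℍ)) : Prop :=
  (∀ K ∈ P, ∃ β ∈ B, ∃ φ : ℍ ≃ᵢ ℍ, K = move φ β) ∧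
    P.PairwiseDisjoint fun K => interior (K : Set ℍ)

/-- A tiling: a packing by tiles that covers the plane. -/
def IsTiling (B P : Set (NonemptyCompacts ℍ)) : Prop :=
  IsPacking B P ∧ (∀ K ∈ P, IsTile K) ∧ covered P = univ

/-- The collection of all images of `K` under the elements of `Γ`. -/
def translates (Γ : Subgroup (ℍ ≃ᵢ ℍ)) (K : NonemptyCompacts ℍ) : Set (NonemptyCompacts ℍ) :=
  {L | ∃ γ ∈ Γ, L = move γ K}

/-- A packing by copies of members of `B` is completely saturated if one cannot replace a finite
number of its bodies by finitely many bodies of greater total area, and still have a packing. -/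
def IsCompletelySaturated (B P : Set (NonemptyCompacts ℍ)) : Prop :=
  IsPacking B P ∧ ∀ P' P'' : Finset (NonemptyCompacts ℍ), (P' : Set (NonemptyCompacts ℍ)) ⊆ P →
    Disjoint (P \ P') (P'' : Set (NonemptyCompacts ℍ)) → IsPacking B ((P \ P') ∪ P'') →
    ∑ K ∈ P'', volume (K : Set ℍ) ≤ ∑ K ∈ P', volume (K : Set ℍ)

/-- The group of orientation preserving symmetries of a collection of compact sets. -/
def symmetryGroup (P : Set (NonemptyCompacts ℍ)) : Subgroup (ℍ ≃ᵢ ℍ) where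
  carrier := {φ | φ ∈ orientedIsom ∧ move φ '' P = P}
  one_mem' := ⟨one_mem _, by simp [move_one]⟩
  mul_mem' := by
    rintro φ ψ ⟨hφ, h⟩ ⟨hψ, h'⟩
    refine ⟨mul_mem hφ hψ, ?_⟩
    calc move (φ * ψ) '' P = move φ '' (move ψ '' P) := by simp only [image_image, move_mul]
      _ = P := by rw [h', h]
  inv_mem' := by
    rintro φ ⟨hφ, h⟩
    refine ⟨inv_mem hφ, ?_⟩
    calc move φ⁻¹ '' P = move φ⁻¹ '' (move φ '' P) := by rw [h]
      _ = P := by simp only [image_image, ← move_mul, inv_mul_cancel, move_one, image_id']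

/-- Periodicity: the symmetry group is cocompact. -/
def IsPeriodic (P : Set (NonemptyCompacts ℍ)) : Prop :=
  ∃ C : Set ℍ, IsCompact C ∧ ∀ z, ∃ γ ∈ symmetryGroup P, γ z ∈ C

/-- `d` is the relative area taken up by the members of `P` in any fundamental domain of the
symmetry group of `P`. -/
def HasPeriodicDensity (P : Set (NonemptyCompacts ℍ)) (d : ℝ) : Prop :=
  (∃ F : Set ℍ, IsFundamentalDomain (symmetryGroup P) F) ∧
    ∀ F : Set ℍ, IsFundamentalDomain (symmetryGroup P) F →
      volume F ≠ 0 ∧ volume F ≠ ∞ ∧ volume.real (F ∩ covered P) / volume.real F = d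

/-! ### The space of packings and its invariant measures -/

/-- The space of relatively dense packings: those that meet every congruent copy of every body
of `B`. -/
def PackingSpace (B : Set (NonemptyCompacts ℍ)) : Type :=
  {P : Set (NonemptyCompacts ℍ) // IsPacking B P ∧
    ∀ β ∈ B, ∀ φ : ℍ ≃ᵢ ℍ, ∃ K ∈ P, ((move φ β : Set ℍ) ∩ K).Nonempty}

/-- The topology of uniform convergence of the bodies on compact subsets of the plane: the
Chabauty–Fell topology of (closed, locally finite) subsets of the locally compact space of nonempty
compact sets with the Hausdorff metric. -/
instance (B : Set (NonemptyCompacts ℍ)) : TopologicalSpace (PackingSpace B) :=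
  generateFrom
    ({S | ∃ U : Set (NonemptyCompacts ℍ), IsOpen U ∧ S = {P | (P.1 ∩ U).Nonempty}} ∪
      {S | ∃ C : Set (NonemptyCompacts ℍ), IsCompact C ∧ S = {P | P.1 ∩ C = ∅}})

instance (B : Set (NonemptyCompacts ℍ)) : MeasurableSpace (PackingSpace B) := borel _

instance (B : Set (NonemptyCompacts ℍ)) : BorelSpace (PackingSpace B) := ⟨rfl⟩

variable {B : Set (NonemptyCompacts ℍ)}

/-- The action of isometries on the space of packings. -/
def PackingSpace.act (g : ℍ ≃ᵢ ℍ) (P : PackingSpace B) : PackingSpace B :=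
  ⟨move g '' P.1, by
    obtain ⟨⟨hc, hd⟩, hr⟩ := P.2
    refine ⟨⟨?_, ?_⟩, ?_⟩
    · rintro _ ⟨K, hK, rfl⟩
      obtain ⟨β, hβ, φ, rfl⟩ := hc K hK
      exact ⟨β, hβ, g * φ, (move_mul g φ β).symm⟩
    · rintro _ ⟨K, hK, rfl⟩ _ ⟨L, hL, rfl⟩ hne
      have hKL : K ≠ L := fun h => hne (by rw [h])
      have h := hd hK hL hKL
      change Disjoint (interior (g '' (K : Set ℍ))) (interior (g '' (L : Set ℍ)))
      have e : ∀ S : Set ℍ, interior (g '' S) = g '' interior S := fun S =>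
        (g.toHomeomorph.image_interior S).symm
      rw [e, e]
      exact (disjoint_image_iff g.injective).2 h
    · intro β hβ φ
      obtain ⟨K, hK, z, hz, hzK⟩ := hr β hβ (g⁻¹ * φ)
      refine ⟨move g K, ⟨K, hK, rfl⟩, g z, ?_, ⟨z, hzK, rfl⟩⟩
      have : move φ β = move g (move (g⁻¹ * φ) β) := by
        rw [← move_mul, mul_inv_cancel_left]
      rw [this]
      exact ⟨z, hz, rfl⟩⟩

/-- The orbit of a packing under the orientation preserving isometries. -/
def PackingSpace.orbit (P : PackingSpace B) : Set (PackingSpace B) :=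
  {Q | ∃ g ∈ orientedIsom, Q = P.act g}

/-- The invariant Borel probability measures on the space of packings. -/
def invariantMeasures (B : Set (NonemptyCompacts ℍ)) : Set (Measure (PackingSpace B)) :=
  {μ | IsProbabilityMeasure μ ∧ ∀ g ∈ orientedIsom, ∀ E : Set (PackingSpace B), MeasurableSet E →
    μ (PackingSpace.act g '' E) = μ E}

/-- The ergodic measures: the extreme points of the convex set of invariant measures. -/
def ergodicMeasures (B : Set (NonemptyCompacts ℍ)) : Set (Measure (PackingSpace B)) :=
  (invariantMeasures B).extremePoints ℝ≥0

/-- The average density of an invariant measure: the integral of the indicator function of the set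
of packings that cover the origin. -/
def averageDensity (μ : Measure (PackingSpace B)) : ℝ :=
  ∫ P, {P : PackingSpace B | UpperHalfPlane.I ∈ covered P.1}.indicator (fun _ => (1 : ℝ)) P ∂μ

/-- The optimal density for `B`. -/
def optimalDensity (B : Set (NonemptyCompacts ℍ)) : ℝ :=
  sSup (averageDensity '' ergodicMeasures B)

/-- An optimally dense packing: there is an optimally dense ergodic measure in whose support the
orbit of the packing is dense, and whose average density is the limiting fraction of area that the
bodies take up in expanding balls about any point. -/
def IsOptimallyDense (P : PackingSpace B) : Prop :=
  ∃ μ ∈ ergodicMeasures B, averageDensity μ = optimalDensity B ∧ μ.support ⊆ closure P.orbit ∧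
    ∀ p : ℍ, Tendsto (fun r : ℝ => volume.real (covered P.1 ∩ Metric.closedBall p r) /
      volume.real (Metric.closedBall p r)) atTop (𝓝 (averageDensity μ))

/-- The density of a periodic packing: both the relative area in fundamental domains of its symmetry
group, and the average density of the ergodic measure carried by its orbit, are equal to `d`. -/
def HasDensity (P : PackingSpace B) (d : ℝ) : Prop :=
  HasPeriodicDensity P.1 d ∧
    ∃ μ ∈ ergodicMeasures B, μ P.orbitᶜ = 0 ∧ averageDensity μ = d

/-! ### Modified octagons -/

/-- `S'` arises from the octagon `S` with vertices `v` by adding protrusions to four of its sides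
and matching indentations to the other four sides.

The sides `q i` and `p i` are paired by `g i ∈ Γ`, and `g i` maps `S` to its neighbour across the
side `p i`. The protrusion `Q i` is attached to `S` along a segment inside the side `p i`, and
lies in that neighbour; the indentation of `S'` at the side `q i` has the shape
`(g i)⁻¹ (Q i)`, so that `Q i` fills the indentation of `g i (S')`. -/
def IsModifiedOctagon (v : ZMod 8 → ℍ) (Γ : Subgroup (ℍ ≃ᵢ ℍ)) (S S' : Set ℍ) : Prop :=
  ∃ (p q : Fin 4 → ZMod 8) (g : Fin 4 → (ℍ ≃ᵢ ℍ)) (Q : Fin 4 → Set ℍ) (a b : Fin 4 → ℍ),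
    Function.Bijective (Sum.elim p q) ∧
    (∀ i, g i ∈ Γ ∧ g i '' side v (q i) = side v (p i) ∧ S ∩ g i '' S = side v (p i)) ∧
    (∀ i, IsBody (Q i) ∧ Q i ⊆ g i '' S ∧ a i ≠ b i ∧
      geodesicSegment (a i) (b i) ⊆ side v (p i) \ {v (p i), v (p i + 1)} ∧
      Q i ∩ frontier (g i '' S) = geodesicSegment (a i) (b i)) ∧
    (Pairwise fun i j => Disjoint ((g i).symm '' Q i) ((g j).symm '' Q j)) ∧
    S' = closure (S \ ⋃ i, (g i).symm '' Q i) ∪ ⋃ i, Q i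

end HypPacking

end

noncomputable section

namespace HypPacking
/-! ### The hyperboloid model -/

/-! The plane is treated as a sheet of the hyperboloid in Minkowski space. Isometries are linear
there, geodesics and circles are sections by planes, and most geometric claims become algebra with
the form `mink`.

The octagon with angles `π/4` is made of triangles with angles `π/8`, `π/8`, `π/2` around its
centre. The reflections in the sides of one triangle generate an image of a Coxeter group.
Positivity of roots (`lin_root_mem_rootCone`) shows that the open triangles are disjoint, and moving
a point as close as possible to the base triangle (`exists_mem_halfPlanes`) shows that the closed
ones cover. The Coxeter group retracts onto the dihedral subgroup of symmetries of the octagon. The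
image `surfGroup` of the kernel of this retraction acts simply transitively on the octagons and
pairs opposite sides. The modified octagon moves a half disk from the middle of each of four sides
to the opposite side by elements of this group, so it is again a tile for the group
(`isPrototile_modTile`).

Removing a hole from the modified octagon lowers the density of the packing by a fixed ratio, so it
is far from optimal once the octagon tiling is seen to have density `1`. The surprising part is
complete saturation (`isCompletelySaturated_holePacking`): putting octagons without holes into a
finite region does not pay. Fill all holes, so that octagons compete with modified octagons of the
same area. A modified octagon has circular arcs in its boundary, which only another modified octagon
can match; hence a tiling with one modified octagon contains no octagon
(`octBody_notMem_of_tiling`). By compactness, wherever an octagon comes close to a modified octagon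
a definite area near it is left uncovered (`exists_waste`). In the hyperbolic plane the unit
neighbourhood of a region has at least twice its area (`volume_thickening_ge`), so a cluster of
octagons has a boundary layer proportional to its size, whatever its shape. Together these give a
waste of at least `κ` per octagon (`exists_waste_bound`). If a hole has area at most `κ / 2`, the
waste outweighs the holes that are saved. This is where negative curvature enters: in the Euclidean
plane the boundary of a large cluster would be negligible.

The density statements come from invariant measures. A packing that is periodic under `surfGroup`
carries the image of Haar measure of `SL(2, ℝ)` modulo the group. This measure is ergodic because
the group acts transitively on the orbit, and its average density is the covered fraction of the
octagon (`orbitMeasure_mem_ergodicMeasures`, `averageDensity_orbitMeasure`). The octagon tiling thus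
shows that the optimal density is `1`, while every large ball contains holes of the other packing in
positive proportion (`not_isOptimallyDense_holePacking`). -/

/-- The Minkowski form on `ℝ³`. -/
def mink (v w : Fin 3 → ℝ) : ℝ := v 0 * w 0 + v 1 * w 1 - v 2 * w 2

theorem mink_comm (v w : Fin 3 → ℝ) : mink v w = mink w v := by unfold mink; ring

theorem mink_add_left (u v w : Fin 3 → ℝ) : mink (u + v) w = mink u w + mink v w := by
  simp only [mink, Pi.add_apply]; ring

theorem mink_add_right (u v w : Fin 3 → ℝ) : mink u (v + w) = mink u v + mink u w := by
  simp only [mink, Pi.add_apply]; ring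

theorem mink_sub_left (u v w : Fin 3 → ℝ) : mink (u - v) w = mink u w - mink v w := by
  simp only [mink, Pi.sub_apply]; ring

theorem mink_sub_right (u v w : Fin 3 → ℝ) : mink u (v - w) = mink u v - mink u w := by
  simp only [mink, Pi.sub_apply]; ring

theorem mink_smul_left (c : ℝ) (v w : Fin 3 → ℝ) : mink (c • v) w = c * mink v w := by
  simp only [mink, Pi.smul_apply, smul_eq_mul]; ring

theorem mink_smul_right (c : ℝ) (v w : Fin 3 → ℝ) : mink v (c • w) = c * mink v w := by
  simp only [mink, Pi.smul_apply, smul_eq_mul]; ring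

theorem mink_neg_left (v w : Fin 3 → ℝ) : mink (-v) w = -mink v w := by
  simp only [mink, Pi.neg_apply]; ring

theorem mink_neg_right (v w : Fin 3 → ℝ) : mink v (-w) = -mink v w := by
  simp only [mink, Pi.neg_apply]; ring

@[simp] theorem mink_zero_left (v : Fin 3 → ℝ) : mink 0 v = 0 := by simp [mink]

@[simp] theorem mink_zero_right (v : Fin 3 → ℝ) : mink v 0 = 0 := by simp [mink]

theorem continuous_mink {X : Type*} [TopologicalSpace X] {f g : X → Fin 3 → ℝ}
    (hf : Continuous f) (hg : Continuous g) : Continuous fun x => mink (f x) (g x) := by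
  unfold mink; fun_prop

/-- The point of the hyperboloid that corresponds to a point of the upper half-plane. -/
def hyp (z : ℍ) : Fin 3 → ℝ :=
  ![z.re / z.im, (z.re ^ 2 + z.im ^ 2 - 1) / (2 * z.im), (z.re ^ 2 + z.im ^ 2 + 1) / (2 * z.im)]

theorem hyp_zero (z : ℍ) : hyp z 0 = z.re / z.im := rfl

theorem hyp_one (z : ℍ) : hyp z 1 = (z.re ^ 2 + z.im ^ 2 - 1) / (2 * z.im) := rfl

theorem hyp_two (z : ℍ) : hyp z 2 = (z.re ^ 2 + z.im ^ 2 + 1) / (2 * z.im) := rfl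

theorem hyp_two_pos (z : ℍ) : 0 < hyp z 2 := by
  have := z.im_pos
  rw [hyp_two]; positivity

@[fun_prop]
theorem continuous_hyp : Continuous hyp := by
  have h : ∀ z : ℍ, z.im ≠ 0 := fun z => z.im_pos.ne'
  have h2 : ∀ z : ℍ, 2 * z.im ≠ 0 := fun z => mul_ne_zero two_ne_zero (h z)
  have hr := UpperHalfPlane.continuous_re
  have hi := UpperHalfPlane.continuous_im
  refine continuous_pi fun i => ?_
  fin_cases i
  · exact hr.div hi h
  · exact (((hr.pow 2).add (hi.pow 2)).sub continuous_const).div (continuous_const.mul hi) h2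
  · exact (((hr.pow 2).add (hi.pow 2)).add continuous_const).div (continuous_const.mul hi) h2

theorem mink_hyp (z w : ℍ) : mink (hyp z) (hyp w) = -Real.cosh (dist z w) := by
  have hz := z.im_pos.ne'
  have hw := w.im_pos.ne'
  rw [UpperHalfPlane.cosh_dist', mink, hyp_zero, hyp_zero, hyp_one, hyp_one, hyp_two, hyp_two]
  field_simp
  ring

theorem cosh_dist_eq (z w : ℍ) : Real.cosh (dist z w) = -mink (hyp z) (hyp w) := by
  rw [mink_hyp, neg_neg]

theorem mink_hyp_self (z : ℍ) : mink (hyp z) (hyp z) = -1 := by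
  rw [mink_hyp, dist_self, Real.cosh_zero]

theorem eq_of_cosh_eq_cosh {x y : ℝ} (hx : 0 ≤ x) (hy : 0 ≤ y)
    (h : Real.cosh x = Real.cosh y) : x = y := by
  have h1 := Real.cosh_le_cosh.1 h.le
  have h2 := Real.cosh_le_cosh.1 h.ge
  rw [abs_of_nonneg hx, abs_of_nonneg hy] at h1 h2
  exact le_antisymm h1 h2

theorem dist_eq_of_cosh_eq {z w z' w' : ℍ}
    (h : Real.cosh (dist z w) = Real.cosh (dist z' w')) : dist z w = dist z' w' := by
  exact eq_of_cosh_eq_cosh dist_nonneg dist_nonneg h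

theorem hyp_injective : Function.Injective hyp := fun z w h => by
  have h1 : Real.cosh (dist z w) = Real.cosh (dist z z) := by
    rw [cosh_dist_eq, cosh_dist_eq, h]
  exact dist_eq_zero.1 ((dist_eq_of_cosh_eq h1).trans (dist_self z))

/-- From `cosh d = 1 + 2 sinh² (d/2)` and `x ≤ sinh x`. It turns convergence of Minkowski products
to `-1` into convergence of points, so continuity can be checked on hyperboloid coordinates. -/
theorem dist_sq_le (z w : ℍ) : dist z w ^ 2 ≤ 2 * (-mink (hyp z) (hyp w) - 1) := by
  rw [← cosh_dist_eq]
  have h1 : Real.cosh (dist z w) = 1 + 2 * Real.sinh (dist z w / 2) ^ 2 := by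
    have h2 := Real.cosh_two_mul (dist z w / 2)
    have h3 := Real.cosh_sq (dist z w / 2)
    rw [mul_div_cancel₀ _ (two_ne_zero' ℝ)] at h2
    rw [h2, h3]; ring
  have h4 : dist z w / 2 ≤ Real.sinh (dist z w / 2) :=
    Real.self_le_sinh_iff.2 (by positivity)
  have h5 : 0 ≤ dist z w / 2 := by positivity
  rw [h1]
  nlinarith

theorem tendsto_of_mink_tendsto {ι : Type*} {l : Filter ι} {f : ι → ℍ} {z : ℍ}
    (h : Tendsto (fun i => mink (hyp (f i)) (hyp z)) l (𝓝 (-1))) : Tendsto f l (𝓝 z) := by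
  rw [tendsto_iff_dist_tendsto_zero]
  have h1 : Tendsto (fun i => √(2 * (-mink (hyp (f i)) (hyp z) - 1))) l (𝓝 0) := by
    have := (((h.neg.sub_const 1).const_mul 2)).sqrt
    simpa using this
  refine squeeze_zero (fun _ => dist_nonneg) (fun i => ?_) h1
  exact Real.le_sqrt_of_sq_le (dist_sq_le _ _)

/-- A map to the upper half-plane is continuous if it is so in the hyperboloid model. -/
theorem continuous_of_hyp_comp {X : Type*} [TopologicalSpace X] {f : X → ℍ}
    (h : Continuous fun x => hyp (f x)) : Continuous f := by
  refine continuous_iff_continuousAt.2 fun x => tendsto_of_mink_tendsto ?_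
  have := (continuous_mink h (continuous_const (y := hyp (f x)))).tendsto x
  rwa [mink_hyp_self] at this

/-- The inverse chart is `(v₀ + i) / (v₂ - v₁)`. The denominator is positive because `(v₂ - v₁)(v₂ +
v₁) = 1 + v₀²`. -/
theorem exists_hyp_eq {v : Fin 3 → ℝ} (h : mink v v = -1) (hv : 0 < v 2) :
    ∃ z : ℍ, hyp z = v := by
  have h1 : v 0 ^ 2 + v 1 ^ 2 - v 2 ^ 2 = -1 := by rw [← h, mink]; ring
  have hd : 0 < v 2 - v 1 := by nlinarith [sq_nonneg (v 0), sq_nonneg (v 1 + v 2)]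
  refine ⟨⟨⟨v 0 / (v 2 - v 1), 1 / (v 2 - v 1)⟩, by positivity⟩, ?_⟩
  have hd' := hd.ne'
  ext i
  fin_cases i
  · simp only [hyp, UpperHalfPlane.re, UpperHalfPlane.im, Fin.zero_eta, Matrix.cons_val_zero]
    field_simp
  · simp only [hyp, UpperHalfPlane.re, UpperHalfPlane.im, Fin.mk_one, Matrix.cons_val_one,
      Matrix.cons_val_zero]
    rw [div_eq_iff (by positivity)]
    field_simp
    linear_combination h1
  · simp only [hyp, UpperHalfPlane.re, UpperHalfPlane.im, Fin.reduceFinMk, Matrix.cons_val]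
    field_simp
    linear_combination h1

theorem mink_hyp_le (z w : ℍ) : mink (hyp z) (hyp w) ≤ -1 := by
  rw [mink_hyp]; linarith [Real.one_le_cosh (dist z w)]

/-- Vectors orthogonal to a point of the hyperboloid are space-like. -/
theorem mink_self_pos_of_orthogonal {v : Fin 3 → ℝ} {z : ℍ} (h : mink (hyp z) v = 0)
    (hv : v ≠ 0) : 0 < mink v v := by
  have h1 := mink_hyp_self z
  have h2 := hyp_two_pos z
  generalize hyp z = x at *
  simp only [mink] at *
  have hcs : (x 2 * v 2) ^ 2 ≤ (x 0 ^ 2 + x 1 ^ 2) * (v 0 ^ 2 + v 1 ^ 2) := by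
    have : x 2 * v 2 = x 0 * v 0 + x 1 * v 1 := by linarith
    rw [this]; nlinarith [sq_nonneg (x 0 * v 1 - x 1 * v 0)]
  have hx : x 0 ^ 2 + x 1 ^ 2 = x 2 ^ 2 - 1 := by linarith
  have hpos : 0 < v 0 ^ 2 + v 1 ^ 2 := by
    by_contra hcon
    have h0 : v 0 = 0 := by nlinarith [sq_nonneg (v 0), sq_nonneg (v 1)]
    have h1 : v 1 = 0 := by nlinarith [sq_nonneg (v 0), sq_nonneg (v 1)]
    have h3 : v 2 = 0 := by
      rw [h0, h1] at h
      have : x 2 * v 2 = 0 := by linarith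
      rcases mul_eq_zero.1 this with h | h
      · exact absurd h h2.ne'
      · exact h
    exact hv (by ext i; fin_cases i <;> simp [h0, h1, h3])
  have : x 2 ^ 2 * (v 0 * v 0 + v 1 * v 1 - v 2 * v 2) ≥ v 0 ^ 2 + v 1 ^ 2 := by
    rw [hx] at hcs; nlinarith
  by_contra hcon
  nlinarith [sq_nonneg (x 2)]

theorem mink_nondegenerate {v : Fin 3 → ℝ} (h : ∀ w, mink v w = 0) : v = 0 := by
  have h0 := h ![1, 0, 0]
  have h1 := h ![0, 1, 0]
  have h2 := h ![0, 0, 1]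
  simp [mink] at h0 h1 h2
  ext i; fin_cases i <;> simp [h0, h1, h2]

/-- Time-like vectors in opposite halves of the light cone have positive product: there
Cauchy–Schwarz makes the spatial part strictly smaller than the time part. -/
theorem two_pos_of_mink_neg {v : Fin 3 → ℝ} {z : ℍ} (h : mink v v < 0)
    (hz : mink (hyp z) v < 0) : 0 < v 2 := by
  have h1 := mink_hyp_self z
  have h2 := hyp_two_pos z
  generalize hyp z = x at *
  simp only [mink] at *
  by_contra hcon
  have hcs : (x 0 * v 0 + x 1 * v 1) ^ 2 ≤ (x 0 ^ 2 + x 1 ^ 2) * (v 0 ^ 2 + v 1 ^ 2) := by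
    nlinarith [sq_nonneg (x 0 * v 1 - x 1 * v 0)]
  have h3 : 0 ≤ -(x 2 * v 2) := by nlinarith
  have h5 : (x 0 ^ 2 + x 1 ^ 2) * (v 0 ^ 2 + v 1 ^ 2) ≤ x 2 ^ 2 * v 2 ^ 2 :=
    mul_le_mul (by linarith) (by linarith) (by positivity) (by positivity)
  have h4 : -(x 2 * v 2) ≤ |x 0 * v 0 + x 1 * v 1| := by
    refine le_trans ?_ (neg_le_abs _); linarith
  have h6 : |x 0 * v 0 + x 1 * v 1| ≤ -(x 2 * v 2) := by
    refine abs_le_of_sq_le_sq ?_ h3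
    nlinarith
  have h7 : (x 0 ^ 2 + x 1 ^ 2) * (v 0 ^ 2 + v 1 ^ 2) < x 2 ^ 2 * v 2 ^ 2 ∨ v 2 = 0 := by
    by_cases hv : v 2 = 0
    · exact Or.inr hv
    · left
      have : 0 < v 2 ^ 2 := by positivity
      nlinarith [sq_nonneg (v 0), sq_nonneg (v 1)]
  rcases h7 with h7 | h7
  · have : |x 0 * v 0 + x 1 * v 1| ^ 2 < (-(x 2 * v 2)) ^ 2 := by
      rw [sq_abs]; nlinarith
    have h8 := abs_lt_of_sq_lt_sq this h3
    rw [abs_abs] at h8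
    linarith
  · rw [h7] at h; nlinarith [sq_nonneg (v 0), sq_nonneg (v 1)]

/-- The normalization of a future time-like vector. -/
theorem exists_hyp_eq_smul {v : Fin 3 → ℝ} (h : mink v v < 0) (hv : 0 < v 2) :
    ∃ z : ℍ, ∃ c : ℝ, 0 < c ∧ hyp z = c • v := by
  have h1 : 0 < √(-mink v v) := Real.sqrt_pos.2 (by linarith)
  obtain ⟨z, hz⟩ := exists_hyp_eq (v := (√(-mink v v))⁻¹ • v)
    (by
      rw [mink_smul_left, mink_smul_right]
      have := Real.mul_self_sqrt (show 0 ≤ -mink v v by linarith)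
      field_simp
      nlinarith)
    (by simp only [Pi.smul_apply, smul_eq_mul]; positivity)
  exact ⟨z, (√(-mink v v))⁻¹, inv_pos.2 h1, hz⟩

/-! ### Geodesics -/

/-- The geodesic through `z` in the direction of the unit tangent vector `u`. -/
theorem exists_geodesic_line {z : ℍ} {u : Fin 3 → ℝ} (hu : mink u u = 1)
    (hz : mink (hyp z) u = 0) : ∃ γ : ℝ → ℍ, Isometry γ ∧ γ 0 = z ∧
      ∀ s, hyp (γ s) = Real.cosh s • hyp z + Real.sinh s • u := by
  have key : ∀ s t, mink (Real.cosh s • hyp z + Real.sinh s • u)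
      (Real.cosh t • hyp z + Real.sinh t • u) = -Real.cosh (s - t) := fun s t => by
    simp only [mink_add_left, mink_add_right, mink_smul_left, mink_smul_right, mink_hyp_self,
      mink_comm u (hyp z), hu, hz, Real.cosh_sub]
    ring
  have hex : ∀ s, ∃ w : ℍ, hyp w = Real.cosh s • hyp z + Real.sinh s • u := fun s => by
    have h1 := key s s
    rw [sub_self, Real.cosh_zero] at h1
    refine exists_hyp_eq h1 (two_pos_of_mink_neg (z := z) (by rw [h1]; norm_num) ?_)
    rw [mink_add_right, mink_smul_right, mink_smul_right, hz, mink_hyp_self]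
    have := Real.cosh_pos s
    linarith
  choose γ hγ using hex
  refine ⟨γ, Isometry.of_dist_eq fun s t => ?_, hyp_injective (by rw [hγ]; simp), hγ⟩
  have h : Real.cosh (dist (γ s) (γ t)) = Real.cosh (dist s t) := by
    rw [cosh_dist_eq, hγ, hγ, key, neg_neg, Real.dist_eq, Real.cosh_abs]
  exact eq_of_cosh_eq_cosh dist_nonneg dist_nonneg h

/-- The geodesic from `a` to `b`. -/
theorem exists_geodesic (a b : ℍ) (hab : a ≠ b) : ∃ u : Fin 3 → ℝ, mink u u = 1 ∧
    mink (hyp a) u = 0 ∧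
    hyp b = Real.cosh (dist a b) • hyp a + Real.sinh (dist a b) • u := by
  have hs : 0 < Real.sinh (dist a b) := Real.sinh_pos_iff.2 (dist_pos.2 hab)
  have hs' := hs.ne'
  refine ⟨(Real.sinh (dist a b))⁻¹ • (hyp b - Real.cosh (dist a b) • hyp a), ?_, ?_, ?_⟩
  · simp only [mink_sub_left, mink_sub_right, mink_smul_left, mink_smul_right, mink_hyp,
      dist_self, Real.cosh_zero, dist_comm b a]
    field_simp
    rw [Real.cosh_sq]; ring
  · simp only [mink_sub_right, mink_smul_right, mink_hyp, dist_self, Real.cosh_zero]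
    ring
  · rw [smul_smul, mul_inv_cancel₀ hs', one_smul]
    abel

/-- A segment is the part of the hyperboloid in the cone over its end points. This makes half
planes, and everything cut out by them, visibly convex. The coefficients are ratios of hyperbolic
sines of the partial lengths. -/
theorem mem_geodesicSegment_iff {a b z : ℍ} :
    z ∈ geodesicSegment a b ↔
      ∃ s t : ℝ, 0 ≤ s ∧ 0 ≤ t ∧ hyp z = s • hyp a + t • hyp b := by
  constructor
  · intro h
    by_cases hab : a = b
    · subst hab
      have h' : dist a z + dist z a = dist a a := h
      rw [dist_self, dist_comm z a] at h'
      have : dist a z = 0 := by linarith [dist_nonneg (x := a) (y := z)]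
      rw [dist_eq_zero] at this
      exact ⟨1, 0, zero_le_one, le_rfl, by simp [this]⟩
    have h' : dist a z + dist z b = dist a b := h
    have hs : 0 < Real.sinh (dist a b) := Real.sinh_pos_iff.2 (dist_pos.2 hab)
    have hs' := hs.ne'
    have ha : 0 ≤ Real.sinh (dist a z) := Real.sinh_nonneg_iff.2 dist_nonneg
    have hb : 0 ≤ Real.sinh (dist z b) := Real.sinh_nonneg_iff.2 dist_nonneg
    refine ⟨Real.sinh (dist z b) / Real.sinh (dist a b),
      Real.sinh (dist a z) / Real.sinh (dist a b), by positivity, by positivity, ?_⟩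
    set s := Real.sinh (dist z b) / Real.sinh (dist a b) with hsdef
    set t := Real.sinh (dist a z) / Real.sinh (dist a b) with htdef
    have e1 := Real.cosh_sq (dist a z)
    have e2 := Real.cosh_sq (dist z b)
    have c0 : Real.cosh (dist a b) = Real.cosh (dist a z) * Real.cosh (dist z b) +
        Real.sinh (dist a z) * Real.sinh (dist z b) := by rw [← h', Real.cosh_add]
    have s0 : Real.sinh (dist a b) = Real.sinh (dist a z) * Real.cosh (dist z b) +
        Real.cosh (dist a z) * Real.sinh (dist z b) := by rw [← h', Real.sinh_add]
    have m1 : mink (hyp z - (s • hyp a + t • hyp b)) (hyp a) = 0 := by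
      simp only [mink_sub_left, mink_add_left, mink_smul_left, mink_hyp, dist_self,
        Real.cosh_zero, dist_comm z a, dist_comm b a]
      rw [hsdef, htdef]; field_simp; rw [c0, s0]; linear_combination
        (-Real.sinh (dist z b)) * e1
    have m2 : mink (hyp z - (s • hyp a + t • hyp b)) (hyp b) = 0 := by
      simp only [mink_sub_left, mink_add_left, mink_smul_left, mink_hyp, dist_self,
        Real.cosh_zero]
      rw [hsdef, htdef]; field_simp; rw [c0, s0]; linear_combination
        (-Real.sinh (dist a z)) * e2
    have m3 : mink (hyp z) (hyp z - (s • hyp a + t • hyp b)) = 0 := by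
      simp only [mink_sub_right, mink_add_right, mink_smul_right, mink_hyp, dist_self,
        Real.cosh_zero, dist_comm z a]
      rw [hsdef, htdef]; field_simp; rw [s0]; ring
    -- The error vector is orthogonal to `hyp z`, hence space-like unless it vanishes; it is also
    -- orthogonal to both end points, and then its square is zero.
    by_contra hne
    have hpos := mink_self_pos_of_orthogonal m3 (sub_ne_zero.2 hne)
    rw [mink_sub_right, mink_comm _ (hyp z), m3, mink_add_right, mink_smul_right,
      mink_smul_right, m1, m2] at hpos
    simp at hpos
  · rintro ⟨s, t, hs, ht, h⟩
    have c1 : Real.cosh (dist a z) = s + t * Real.cosh (dist a b) := by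
      rw [cosh_dist_eq, h, mink_add_right, mink_smul_right, mink_smul_right, mink_hyp_self,
        mink_hyp]; ring
    have c2 : Real.cosh (dist z b) = s * Real.cosh (dist a b) + t := by
      rw [cosh_dist_eq, h, mink_add_left, mink_smul_left, mink_smul_left, mink_hyp_self,
        mink_hyp]; ring
    have c3 : 1 = s ^ 2 + t ^ 2 + 2 * s * t * Real.cosh (dist a b) := by
      have := mink_hyp_self z
      rw [h] at this
      simp only [mink_add_left, mink_add_right, mink_smul_left, mink_smul_right, mink_hyp,
        dist_self, Real.cosh_zero, dist_comm b a] at this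
      linarith
    have hS := Real.sinh_nonneg_iff.2 (dist_nonneg (x := a) (y := b))
    have e0 := Real.cosh_sq (dist a b)
    have s1 : Real.sinh (dist a z) = t * Real.sinh (dist a b) := by
      refine (pow_left_inj₀ (Real.sinh_nonneg_iff.2 dist_nonneg) (by positivity)
        two_ne_zero).1 ?_
      have := Real.cosh_sq (dist a z)
      rw [c1] at this
      linear_combination -this + t ^ 2 * e0 - c3
    have s2 : Real.sinh (dist z b) = s * Real.sinh (dist a b) := by
      refine (pow_left_inj₀ (Real.sinh_nonneg_iff.2 dist_nonneg) (by positivity)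
        two_ne_zero).1 ?_
      have := Real.cosh_sq (dist z b)
      rw [c2] at this
      linear_combination -this + s ^ 2 * e0 - c3
    have hc : Real.cosh (dist a z + dist z b) = Real.cosh (dist a b) := by
      rw [Real.cosh_add, c1, c2, s1, s2]
      linear_combination (-s * t) * e0 - Real.cosh (dist a b) * c3
    exact eq_of_cosh_eq_cosh (by positivity) dist_nonneg hc

theorem left_mem_geodesicSegment (a b : ℍ) : a ∈ geodesicSegment a b := by
  simp [geodesicSegment]

theorem right_mem_geodesicSegment (a b : ℍ) : b ∈ geodesicSegment a b := by
  simp [geodesicSegment]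

theorem isConnected_geodesicSegment (a b : ℍ) : IsConnected (geodesicSegment a b) := by
  by_cases hab : a = b
  · subst hab
    have : geodesicSegment a a = {a} := by
      ext z
      simp only [geodesicSegment, dist_self, mem_ofPred_eq, mem_singleton_iff, dist_comm z a]
      constructor
      · intro h
        exact (dist_eq_zero.1 (show dist a z = 0 by linarith)).symm
      · rintro rfl; simp
    rw [this]; exact isConnected_singleton
  obtain ⟨u, hu, hau, hb⟩ := exists_geodesic a b hab
  obtain ⟨γ, hγ, h0, hγs⟩ := exists_geodesic_line hu hau
  have hd : γ (dist a b) = b := hyp_injective (by rw [hγs, hb])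
  have : geodesicSegment a b = γ '' Icc 0 (dist a b) := by
    ext z
    constructor
    · intro hz
      obtain ⟨s, t, hs, ht, hz'⟩ := mem_geodesicSegment_iff.1 hz
      have hz : dist a z + dist z b = dist a b := hz
      refine ⟨dist a z, ⟨dist_nonneg, by linarith [dist_nonneg (x := z) (y := b)]⟩, ?_⟩
      have e1 : hyp z = (s + t * Real.cosh (dist a b)) • hyp a +
          (t * Real.sinh (dist a b)) • u := by
        rw [hz', hb]; module
      have e2 : Real.cosh (dist a z) = s + t * Real.cosh (dist a b) := by
        rw [cosh_dist_eq, e1, mink_add_right, mink_smul_right, mink_smul_right, mink_hyp_self,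
          hau]; ring
      have hS := Real.sinh_nonneg_iff.2 (dist_nonneg (x := a) (y := b))
      have e3 : Real.sinh (dist a z) = t * Real.sinh (dist a b) := by
        refine (pow_left_inj₀ (Real.sinh_nonneg_iff.2 dist_nonneg) (by positivity)
          two_ne_zero).1 ?_
        have h1 := mink_hyp_self z
        rw [e1] at h1
        simp only [mink_add_left, mink_add_right, mink_smul_left, mink_smul_right,
          mink_hyp_self, hau, mink_comm u (hyp a), hu] at h1
        have := Real.cosh_sq (dist a z)
        rw [e2] at this
        linear_combination -this - h1
      apply hyp_injective
      rw [hγs, e1, e2, e3]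
    · rintro ⟨s, ⟨hs0, hs1⟩, rfl⟩
      change dist a (γ s) + dist (γ s) b = dist a b
      have h1 : dist a (γ s) = s := by
        rw [← h0, hγ.dist_eq, Real.dist_eq, zero_sub, abs_neg, abs_of_nonneg hs0]
      have h2 : dist (γ s) b = dist a b - s := by
        rw [← hd, hγ.dist_eq, hd, Real.dist_eq, abs_sub_comm, abs_of_nonneg (by linarith)]
      rw [h1, h2]; ring
  rw [this]
  exact (isConnected_Icc dist_nonneg).image _ hγ.continuous.continuousOn
/-! ### Reflections and isometries -/

/-- The reflection of Minkowski space in the plane orthogonal to the unit vector `n`. -/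
def reflVec (n v : Fin 3 → ℝ) : Fin 3 → ℝ := v - (2 * mink v n) • n

theorem mink_reflVec {n : Fin 3 → ℝ} (hn : mink n n = 1) (v w : Fin 3 → ℝ) :
    mink (reflVec n v) (reflVec n w) = mink v w := by
  simp only [reflVec, mink_sub_left, mink_sub_right, mink_smul_left, mink_smul_right, hn,
    mink_comm n w]
  ring

theorem reflVec_reflVec {n : Fin 3 → ℝ} (hn : mink n n = 1) (v : Fin 3 → ℝ) :
    reflVec n (reflVec n v) = v := by
  simp only [reflVec, mink_sub_left, mink_smul_left, hn]
  module

/-- The matrix whose action on the upper half-plane is the reflection in the geodesic `n^⊥`. -/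
def reflMat (n : Fin 3 → ℝ) (hn : mink n n = 1) : GL (Fin 2) ℝ :=
  .mkOfDetNeZero !![-n 0, n 1 + n 2; n 1 - n 2, n 0] (by
    rw [Matrix.det_fin_two_of]
    have : n 0 * n 0 + n 1 * n 1 - n 2 * n 2 = 1 := hn
    intro h
    nlinarith)

theorem det_reflMat (n : Fin 3 → ℝ) (hn : mink n n = 1) : (reflMat n hn).det.val = -1 := by
  have h : n 0 * n 0 + n 1 * n 1 - n 2 * n 2 = 1 := hn
  change Matrix.det !![-n 0, n 1 + n 2; n 1 - n 2, n 0] = -1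
  rw [Matrix.det_fin_two_of]
  linarith

/-- The two pictures of a reflection agree: a matrix of determinant `-1` acting anti-holomorphically
on the half-plane, and a linear reflection of Minkowski space. The first gives invariance of area,
the second linear algebra. -/
theorem hyp_reflMat_smul (n : Fin 3 → ℝ) (hn : mink n n = 1) (z : ℍ) :
    hyp (reflMat n hn • z) = reflVec n (hyp z) := by
  have h : n 0 * n 0 + n 1 * n 1 - n 2 * n 2 = 1 := hn
  have hy := z.im_pos.ne'
  set D := ((n 1 - n 2) * z.re + n 0) ^ 2 + ((n 1 - n 2) * z.im) ^ 2 with hD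
  have hnum : num (reflMat n hn) z = -(n 0 : ℂ) * z + (n 1 + n 2 : ℝ) := by
    simp [num, reflMat]
  have hden : denom (reflMat n hn) z = ((n 1 - n 2 : ℝ) : ℂ) * z + (n 0 : ℝ) := by
    simp [denom, reflMat]
  have hnd : Complex.normSq (denom (reflMat n hn) z) = D := by
    rw [hden, Complex.normSq_apply]
    simp [hD]; ring
  have hDpos : 0 < D := by
    rw [← hnd]; exact normSq_denom_pos _ z.im_ne_zero
  have hD' := hDpos.ne'
  have him : (reflMat n hn • z).im = z.im / D := by
    rw [UpperHalfPlane.im_smul_eq_div_normSq, hnd, det_reflMat]; simp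
  set N := (-n 0 * z.re + n 1 + n 2) * ((n 1 - n 2) * z.re + n 0) -
    n 0 * z.im * ((n 1 - n 2) * z.im) with hN
  have hre : (reflMat n hn • z).re = N / D := by
    rw [UpperHalfPlane.re_smul, Complex.div_re, hnd, hnum, hden]
    simp
    field_simp
    ring
  have e : N ^ 2 + z.im ^ 2 = ((-n 0 * z.re + n 1 + n 2) ^ 2 + (n 0 * z.im) ^ 2) * D := by
    rw [hN, hD]
    linear_combination (-(1 + (n 0 * n 0 + n 1 * n 1 - n 2 * n 2)) * z.im ^ 2) * h
  have e' : (N / D) ^ 2 + (z.im / D) ^ 2 =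
      ((-n 0 * z.re + n 1 + n 2) ^ 2 + (n 0 * z.im) ^ 2) / D := by
    rw [div_pow, div_pow, ← add_div, e]; field_simp
  ext i
  fin_cases i
  · change hyp _ 0 = hyp z 0 - 2 * mink (hyp z) n * n 0
    rw [hyp_zero, him, hre, mink, hyp_zero, hyp_one, hyp_two]
    field_simp
    rw [hN]
    linear_combination z.re * h
  · change hyp _ 1 = hyp z 1 - 2 * mink (hyp z) n * n 1
    rw [hyp_one, him, hre, e', mink, hyp_zero, hyp_one, hyp_two]
    field_simp
    rw [hD]
    linear_combination (z.re ^ 2 + z.im ^ 2 - 1) * h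
  · change hyp _ 2 = hyp z 2 - 2 * mink (hyp z) n * n 2
    rw [hyp_two, him, hre, e', mink, hyp_zero, hyp_one, hyp_two]
    field_simp
    rw [hD]
    linear_combination (z.re ^ 2 + z.im ^ 2 + 1) * h

/-- The reflection of the hyperbolic plane in the geodesic `n^⊥`. -/
def refl (n : Fin 3 → ℝ) (hn : mink n n = 1) : ℍ ≃ᵢ ℍ where
  toEquiv := MulAction.toPerm (reflMat n hn)
  isometry_toFun := Isometry.of_dist_eq fun z w => dist_eq_of_cosh_eq (by
    rw [cosh_dist_eq, cosh_dist_eq]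
    change -mink (hyp (reflMat n hn • z)) (hyp (reflMat n hn • w)) = _
    rw [hyp_reflMat_smul, hyp_reflMat_smul, mink_reflVec hn])

theorem hyp_refl (n : Fin 3 → ℝ) (hn : mink n n = 1) (z : ℍ) :
    hyp (refl n hn z) = reflVec n (hyp z) := hyp_reflMat_smul n hn z

theorem refl_refl (n : Fin 3 → ℝ) (hn : mink n n = 1) (z : ℍ) :
    refl n hn (refl n hn z) = z :=
  hyp_injective (by rw [hyp_refl, hyp_refl, reflVec_reflVec hn])

theorem refl_mul_self (n : Fin 3 → ℝ) (hn : mink n n = 1) : refl n hn * refl n hn = 1 := by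
  ext1 z; exact refl_refl n hn z

theorem refl_eq_self_iff {n : Fin 3 → ℝ} (hn : mink n n = 1) {z : ℍ} :
    refl n hn z = z ↔ mink (hyp z) n = 0 := by
  rw [← hyp_injective.eq_iff, hyp_refl, reflVec, sub_eq_self]
  constructor
  · intro h
    have := congrArg (fun v => mink v n) h
    simp only [mink_smul_left, hn, mink_zero_left] at this
    linarith
  · intro h; rw [h]; simp

theorem mem_orientedIsom_of_det_pos {φ : ℍ ≃ᵢ ℍ} (g : GL (Fin 2) ℝ) (hg : 0 < g.det.val)
    (h : ∀ z, φ z = g • z) : φ ∈ orientedIsom := by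
  set d := g.det.val with hd
  have hs : 0 < √d := Real.sqrt_pos.2 hg
  have hdet : g 0 0 * g 1 1 - g 0 1 * g 1 0 = d := by
    rw [hd, ← Matrix.det_fin_two]; rfl
  obtain ⟨k, hk⟩ : ∃ k : SL(2, ℝ), ∀ i j, k i j = g.val i j / √d := by
    refine ⟨⟨Matrix.of fun i j => g.val i j / √d, ?_⟩, fun i j => rfl⟩
    rw [Matrix.det_fin_two]
    simp only [Matrix.of_apply]
    field_simp
    rw [hdet, Real.sq_sqrt hg.le]
  refine ⟨k, fun z => ?_⟩
  rw [h]
  ext1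
  rw [coe_smul_of_det_pos hg, coe_specialLinearGroup_apply, hk, hk, hk, hk]
  have hs' : ((√d : ℝ) : ℂ) ≠ 0 := by exact_mod_cast hs.ne'
  have e : ∀ a b : ℝ, (algebraMap ℝ ℝ (a / √d) : ℂ) * z + (algebraMap ℝ ℝ (b / √d) : ℂ) =
      (a * z + b) / (√d : ℝ) := fun a b => by
    simp only [Algebra.algebraMap_self, RingHom.id_apply, Complex.ofReal_div]; ring
  rw [e, e, div_div_div_cancel_right₀ hs']
  rfl

/-- This is the reflection in the perpendicular bisector, whose normal is the normalised difference
of the position vectors. -/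
theorem exists_refl_swap {p q : ℍ} (hpq : p ≠ q) : ∃ n, ∃ hn : mink n n = 1,
    refl n hn p = q ∧ ∀ z, dist z p = dist z q → refl n hn z = z := by
  have hpos : 0 < mink (hyp p - hyp q) (hyp p - hyp q) := by
    have h1 : 1 < Real.cosh (dist p q) := Real.one_lt_cosh.2 (dist_ne_zero.2 hpq)
    simp only [mink_sub_left, mink_sub_right, mink_hyp, dist_self, Real.cosh_zero,
      dist_comm q p]
    linarith
  set c := √(mink (hyp p - hyp q) (hyp p - hyp q)) with hc
  have hcpos : 0 < c := Real.sqrt_pos.2 hpos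
  have hcsq : c ^ 2 = mink (hyp p - hyp q) (hyp p - hyp q) := Real.sq_sqrt hpos.le
  have hn : mink (c⁻¹ • (hyp p - hyp q)) (c⁻¹ • (hyp p - hyp q)) = 1 := by
    rw [mink_smul_left, mink_smul_right, ← hcsq]; field_simp
  refine ⟨_, hn, hyp_injective ?_, fun z hz => ?_⟩
  · rw [hyp_refl, reflVec, mink_smul_right, smul_smul]
    have : mink (hyp p) (hyp p - hyp q) = c ^ 2 / 2 := by
      rw [hcsq]
      simp only [mink_sub_left, mink_sub_right, mink_hyp_self, mink_comm (hyp q) (hyp p)]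
      ring
    rw [this]
    have e : 2 * (c⁻¹ * (c ^ 2 / 2)) * c⁻¹ = 1 := by field_simp
    rw [e]; simp
  · rw [refl_eq_self_iff, mink_smul_right, mink_sub_right, mink_hyp, mink_hyp, hz]
    simp

theorem mink_hyp_isometry (φ : ℍ ≃ᵢ ℍ) (z w : ℍ) :
    mink (hyp (φ z)) (hyp (φ w)) = mink (hyp z) (hyp w) := by
  rw [mink_hyp, mink_hyp, φ.dist_eq]

/-- The standard points of the upper half-plane used as a frame. -/
def framePoint : Fin 3 → ℍ := ![⟨⟨0, 1⟩, by simp⟩, ⟨⟨0, 2⟩, by simp⟩, ⟨⟨1, 1⟩, by simp⟩]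

theorem eq_zero_of_mink_framePoint {v : Fin 3 → ℝ} (h : ∀ i, mink v (hyp (framePoint i)) = 0) :
    v = 0 := by
  have h0 := h 0
  have h1 := h 1
  have h2 := h 2
  simp [mink, hyp, framePoint, UpperHalfPlane.re, UpperHalfPlane.im] at h0 h1 h2
  norm_num at h0 h1 h2
  have e1 : v 1 = 0 := by linarith
  have e0 : v 0 = 0 := by linarith
  ext i; fin_cases i <;> simp [h0, e1, e0]

theorem eq_one_of_fixes_frame {φ : ℍ ≃ᵢ ℍ} (h : ∀ i, φ (framePoint i) = framePoint i) :
    φ = 1 := by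
  ext1 z
  refine hyp_injective (sub_eq_zero.1 (eq_zero_of_mink_framePoint fun i => ?_))
  rw [mink_sub_left, sub_eq_zero]
  conv_lhs => rw [← h i]
  exact mink_hyp_isometry φ z _

/-- Every isometry of the hyperbolic plane is a product of reflections. -/
theorem closure_refl_eq_top :
    Subgroup.closure {φ : ℍ ≃ᵢ ℍ | ∃ n, ∃ hn : mink n n = 1, φ = refl n hn} = ⊤ := by
  set G := Subgroup.closure {φ : ℍ ≃ᵢ ℍ | ∃ n, ∃ hn : mink n n = 1, φ = refl n hn} with hG
  have hmem : ∀ n hn, refl n hn ∈ G := fun n hn => Subgroup.subset_closure ⟨n, hn, rfl⟩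
  -- One more reflection fixes one more frame point. The bisector of `φ pᵢ` and `pᵢ` passes through
  -- every frame point already fixed, since `φ` preserves its distance to `pᵢ`.
  have step : ∀ (S : Set (Fin 3)) (i : Fin 3) (φ : ℍ ≃ᵢ ℍ),
      (∀ j ∈ S, φ (framePoint j) = framePoint j) →
      ∃ r ∈ G, ∀ j ∈ insert i S, (r * φ) (framePoint j) = framePoint j := by
    intro S i φ hφ
    by_cases hi : φ (framePoint i) = framePoint i
    · refine ⟨1, one_mem _, ?_⟩
      rintro j (rfl | hj)
      · simpa using hi
      · simpa using hφ j hj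
    · obtain ⟨n, hn, h1, h2⟩ := exists_refl_swap hi
      refine ⟨refl n hn, hmem n hn, ?_⟩
      rintro j (rfl | hj)
      · exact h1
      · have h3 := hφ j hj
        change refl n hn (φ (framePoint j)) = _
        rw [h3]
        apply h2
        rw [← φ.dist_eq (framePoint j) (framePoint i), h3]
  rw [eq_top_iff]
  rintro φ -
  obtain ⟨r₀, hr₀, h0⟩ := step ∅ 0 φ (by simp)
  obtain ⟨r₁, hr₁, h1⟩ := step _ 1 _ h0
  obtain ⟨r₂, hr₂, h2⟩ := step _ 2 _ h1
  have h3 : r₂ * (r₁ * (r₀ * φ)) = 1 := eq_one_of_fixes_frame fun i => h2 i (by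
    fin_cases i <;> simp)
  have h4 : φ = (r₂ * r₁ * r₀)⁻¹ := by
    rw [eq_inv_iff_mul_eq_one, mul_eq_one_iff_eq_inv, eq_comm, inv_eq_iff_mul_eq_one]
    simpa [mul_assoc] using h3
  rw [h4]
  exact inv_mem (mul_mem (mul_mem hr₂ hr₁) hr₀)

/-- Every isometry of the hyperbolic plane is given by the action of a matrix. -/
theorem exists_gl_smul (φ : ℍ ≃ᵢ ℍ) : ∃ g : GL (Fin 2) ℝ, ∀ z, φ z = g • z := by
  have h : φ ∈ Subgroup.closure {φ : ℍ ≃ᵢ ℍ | ∃ n, ∃ hn : mink n n = 1, φ = refl n hn} := by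
    rw [closure_refl_eq_top]; exact Subgroup.mem_top φ
  induction h using Subgroup.closure_induction with
  | mem φ h =>
    obtain ⟨n, hn, rfl⟩ := h
    exact ⟨reflMat n hn, fun z => rfl⟩
  | one => exact ⟨1, fun z => by simp⟩
  | mul φ ψ _ _ h1 h2 =>
    obtain ⟨g, hg⟩ := h1
    obtain ⟨k, hk⟩ := h2
    exact ⟨g * k, fun z => by rw [IsometryEquiv.mul_apply, hk, hg, mul_smul]⟩
  | inv φ _ h =>
    obtain ⟨g, hg⟩ := h
    refine ⟨g⁻¹, fun z => φ.injective ?_⟩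
    rw [IsometryEquiv.apply_inv_self, hg, smul_inv_smul]

/-! ### Invariance of area, and linear extensions of isometries -/

theorem measurePreserving_isometry (φ : ℍ ≃ᵢ ℍ) :
    MeasurePreserving φ (volume : Measure ℍ) volume := by
  obtain ⟨g, hg⟩ := exists_gl_smul φ
  have : (φ : ℍ → ℍ) = fun z => g • z := funext hg
  rw [this]
  exact measurePreserving_smul g volume

theorem volume_image_isometry (φ : ℍ ≃ᵢ ℍ) (S : Set ℍ) : volume (φ '' S) = volume S := by
  obtain ⟨g, hg⟩ := exists_gl_smul φ
  have : φ '' S = (fun z => g • z) '' S := image_congr fun z _ => hg z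
  rw [this, image_smul]
  exact measure_smul volume g S

theorem exists_lin (φ : ℍ ≃ᵢ ℍ) : ∃ A : (Fin 3 → ℝ) →ₗ[ℝ] (Fin 3 → ℝ),
    (∀ z, hyp (φ z) = A (hyp z)) ∧ ∀ v w, mink (A v) (A w) = mink v w := by
  have h : φ ∈ Subgroup.closure {φ : ℍ ≃ᵢ ℍ | ∃ n, ∃ hn : mink n n = 1, φ = refl n hn} := by
    rw [closure_refl_eq_top]; exact Subgroup.mem_top φ
  induction h using Subgroup.closure_induction with
  | mem φ h =>
    obtain ⟨n, hn, rfl⟩ := h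
    refine ⟨{ toFun := reflVec n, map_add' := fun v w => ?_, map_smul' := fun c v => ?_ },
      hyp_refl n hn, mink_reflVec hn⟩
    · simp only [reflVec, mink_add_left]; module
    · simp only [reflVec, mink_smul_left, RingHom.id_apply]; module
  | one => exact ⟨LinearMap.id, fun z => rfl, fun v w => rfl⟩
  | mul φ ψ _ _ h1 h2 =>
    obtain ⟨A, hA, hA'⟩ := h1
    obtain ⟨B, hB, hB'⟩ := h2
    exact ⟨A ∘ₗ B, fun z => by rw [IsometryEquiv.mul_apply, hA, hB]; rfl,
      fun v w => (hA' _ _).trans (hB' _ _)⟩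
  | inv φ _ h =>
    obtain ⟨A, hA, hA'⟩ := h
    have hinj : Function.Injective A := by
      refine (injective_iff_map_eq_zero A).2 fun v hv => mink_nondegenerate fun w => ?_
      rw [← hA', hv, mink_zero_left]
    set e := LinearEquiv.ofInjectiveEndo A hinj with he
    have hAe : ∀ v, A (e.symm v) = v := fun v => by
      have := e.apply_symm_apply v
      rwa [he, LinearEquiv.coe_ofInjectiveEndo] at this
    refine ⟨e.symm.toLinearMap, fun z => hinj ?_, fun v w => ?_⟩
    · rw [← hA, IsometryEquiv.apply_inv_self]; exact (hAe _).symm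
    · rw [← hA']; exact congrArg₂ mink (hAe v) (hAe w)

/-- The linear extension of an isometry to Minkowski space. -/
def lin (φ : ℍ ≃ᵢ ℍ) : (Fin 3 → ℝ) →ₗ[ℝ] (Fin 3 → ℝ) := (exists_lin φ).choose

theorem hyp_apply (φ : ℍ ≃ᵢ ℍ) (z : ℍ) : hyp (φ z) = lin φ (hyp z) :=
  (exists_lin φ).choose_spec.1 z

theorem mink_lin (φ : ℍ ≃ᵢ ℍ) (v w : Fin 3 → ℝ) : mink (lin φ v) (lin φ w) = mink v w :=
  (exists_lin φ).choose_spec.2 v w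

/-- Position vectors of points span Minkowski space, so products with them determine a vector. The
functoriality of `lin` follows from this characterisation. -/
theorem lin_eq_of_forall {φ : ℍ ≃ᵢ ℍ} {v w : Fin 3 → ℝ}
    (h : ∀ z, mink (hyp (φ z)) w = mink (hyp z) v) : lin φ v = w := by
  refine sub_eq_zero.1 (eq_zero_of_mink_framePoint fun i => ?_)
  rw [mink_sub_left, sub_eq_zero, mink_comm w, ← IsometryEquiv.apply_inv_self φ (framePoint i), h,
    hyp_apply, mink_lin, mink_comm]

theorem lin_mul (φ ψ : ℍ ≃ᵢ ℍ) (v : Fin 3 → ℝ) : lin (φ * ψ) v = lin φ (lin ψ v) :=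
  lin_eq_of_forall fun z => by
    rw [IsometryEquiv.mul_apply, hyp_apply, mink_lin, hyp_apply, mink_lin]

theorem lin_one (v : Fin 3 → ℝ) : lin 1 v = v := lin_eq_of_forall fun _ => rfl

theorem lin_inv_apply (φ : ℍ ≃ᵢ ℍ) (v : Fin 3 → ℝ) : lin φ⁻¹ (lin φ v) = v := by
  rw [← lin_mul, inv_mul_cancel, lin_one]

theorem lin_apply_inv (φ : ℍ ≃ᵢ ℍ) (v : Fin 3 → ℝ) : lin φ (lin φ⁻¹ v) = v := by
  rw [← lin_mul, mul_inv_cancel, lin_one]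

theorem lin_refl (n : Fin 3 → ℝ) (hn : mink n n = 1) (v : Fin 3 → ℝ) :
    lin (refl n hn) v = reflVec n v :=
  lin_eq_of_forall fun z => by rw [hyp_refl, mink_reflVec hn]

theorem mink_hyp_lin (φ : ℍ ≃ᵢ ℍ) (z : ℍ) (v : Fin 3 → ℝ) :
    mink (hyp (φ z)) (lin φ v) = mink (hyp z) v := by rw [hyp_apply, mink_lin]

theorem eq_of_lin_eq {φ ψ : ℍ ≃ᵢ ℍ} (h : ∀ v, lin φ v = lin ψ v) : φ = ψ := by
  ext1 z; exact hyp_injective (by rw [hyp_apply, hyp_apply, h])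

/-! ### The reflection group of the triangle with angles `π/8`, `π/8`, `π/2` -/

/-- `2 cos (π/8)`. -/
def kap : ℝ := √(2 + √2)

theorem sqrt_two_sq : √2 ^ 2 = (2 : ℝ) := Real.sq_sqrt (by norm_num)

theorem sqrt_two_pos : (0 : ℝ) < √2 := Real.sqrt_pos.2 (by norm_num)

theorem kap_sq : kap ^ 2 = 2 + √2 := Real.sq_sqrt (by positivity)

theorem kap_pos : 0 < kap := Real.sqrt_pos.2 (by positivity)

/-- The hyperbolic sine of the inradius of the octagon. -/
def inS : ℝ := √(2 + 2 * √2)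

theorem inS_sq : inS ^ 2 = 2 + 2 * √2 := Real.sq_sqrt (by positivity)

theorem inS_pos : 0 < inS := Real.sqrt_pos.2 (by positivity)

/-- The unit normal vectors of the sides of the triangle. -/
def root : Fin 3 → Fin 3 → ℝ :=
  ![![0, -1, 0], ![-(kap / (2 * (1 + √2))), kap / 2, 0], ![1 + √2, 0, inS]]

theorem mink_root_self (i : Fin 3) : mink (root i) (root i) = 1 := by
  have h1 := kap_sq
  have h2 := inS_sq
  have h3 := sqrt_two_sq
  have h4 := sqrt_two_pos
  fin_cases i
  · simp [root, mink]
  · simp [root, mink]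
    field_simp
    linear_combination (4 + 2 * √2 + (√2 ^ 2 - 2)) * h1 + √2 * h3
  · simp [root, mink]
    linear_combination h3 - h2

theorem mink_root_zero_one : mink (root 0) (root 1) = -kap / 2 := by
  simp [root, mink]; ring

theorem mink_root_one_two : mink (root 1) (root 2) = -kap / 2 := by
  have h4 := sqrt_two_pos
  simp [root, mink]; field_simp

theorem mink_root_zero_two : mink (root 0) (root 2) = 0 := by
  simp [root, mink]

/-- The reflections in the sides of the triangle. -/
def triRefl (i : Fin 3) : ℍ ≃ᵢ ℍ := refl (root i) (mink_root_self i)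

/-- The product of the two reflections is a rotation by `π/4` of the plane of `n` and `m`. Its
fourth power is `-1` on that plane, that is, the identity minus twice the orthogonal projection; the
constant is `8 + 4√2 = 2 / sin² (π/8)`. -/
theorem reflVec_pow_four {n m : Fin 3 → ℝ} (hn : mink n n = 1) (hm : mink m m = 1)
    (h : mink n m = -kap / 2) (v : Fin 3 → ℝ) :
    (fun w => reflVec n (reflVec m w))^[4] v =
      v - ((8 + 4 * √2) * (mink v n + kap / 2 * mink v m)) • n -
        ((8 + 4 * √2) * (mink v m + kap / 2 * mink v n)) • m := by
  have hk := kap_sq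
  have hq := sqrt_two_sq
  set T := fun w => reflVec n (reflVec m w) with hT
  have hmn : mink m n = -kap / 2 := by rw [mink_comm, h]
  have h1 : ∀ w, T w = w - (2 * mink w n + 2 * kap * mink w m) • n - (2 * mink w m) • m := by
    intro w
    simp only [hT, reflVec, mink_sub_left, mink_smul_left, hmn]
    module
  have h2 : ∀ w, T (T w) = w - (2 * (2 + √2) * mink w n + 2 * kap * (1 + √2) * mink w m) • n -
      (2 * kap * mink w n + 2 * (2 + √2) * mink w m) • m := by
    intro w
    rw [h1 (T w), h1 w]
    simp only [mink_sub_left, mink_smul_left, hn, hm, h, hmn]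
    set x := mink w n
    set y := mink w m
    match_scalars
    · ring
    · linear_combination (-2 * x - 2 * kap * y) * hk
    · linear_combination (-2 * y) * hk
  have h4 : T^[4] v = T (T (T (T v))) := rfl
  rw [h4, h2 (T (T v)), h2 v]
  simp only [mink_sub_left, mink_smul_left, hn, hm, h, hmn]
  set x := mink v n
  set y := mink v m
  match_scalars
  · ring
  · grind
  · grind

theorem refl_mul_refl_pow_eight {n m : Fin 3 → ℝ} (hn : mink n n = 1) (hm : mink m m = 1)
    (h : mink n m = -kap / 2) : (refl n hn * refl m hm) ^ 8 = 1 := by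
  have hk := kap_sq
  have hq := sqrt_two_sq
  have hmn : mink m n = -kap / 2 := by rw [mink_comm, h]
  have key : ∀ k z, hyp (((refl n hn * refl m hm) ^ k) z) =
      (fun w => reflVec n (reflVec m w))^[k] (hyp z) := by
    intro k
    induction k with
    | zero => intro z; rfl
    | succ k ih =>
      intro z
      rw [pow_succ, Function.iterate_succ_apply, IsometryEquiv.mul_apply, ih,
        IsometryEquiv.mul_apply, hyp_refl, hyp_refl]
  ext1 z
  apply hyp_injective
  rw [key, show 8 = 4 + 4 from rfl, Function.iterate_add_apply, reflVec_pow_four hn hm h,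
    reflVec_pow_four hn hm h]
  simp only [mink_sub_left, mink_smul_left, hn, hm, h, hmn]
  change _ = hyp z
  set x := mink (hyp z) n
  set y := mink (hyp z) m
  match_scalars
  · ring
  · grind
  · grind

theorem refl_mul_refl_sq {n m : Fin 3 → ℝ} (hn : mink n n = 1) (hm : mink m m = 1)
    (h : mink n m = 0) : (refl n hn * refl m hm) ^ 2 = 1 := by
  have hmn : mink m n = 0 := by rw [mink_comm, h]
  ext1 z
  apply hyp_injective
  rw [sq]
  simp only [IsometryEquiv.mul_apply, hyp_refl, reflVec, mink_sub_left, mink_smul_left, hn, hm,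
    h, hmn]
  change _ = hyp z
  module

/-- The Coxeter matrix of the triangle group. -/
def triMatrix : CoxeterMatrix (Fin 3) where
  M := !![1, 8, 2; 8, 1, 8; 2, 8, 1]
  isSymm := by decide
  diagonal := by decide
  off_diagonal := by
    intro i j
    fin_cases i <;> fin_cases j <;> simp

/-- The Coxeter group of the triangle. -/
abbrev TriGroup : Type := triMatrix.Group

/-- The Coxeter system of the triangle. -/
def triSys : CoxeterSystem triMatrix TriGroup := triMatrix.toCoxeterSystem

theorem isLiftable_triRefl : triMatrix.IsLiftable triRefl := by
  have h01 := mink_root_zero_one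
  have h12 := mink_root_one_two
  have h02 := mink_root_zero_two
  intro i j
  fin_cases i <;> fin_cases j
  · change (triRefl 0 * triRefl 0) ^ 1 = 1
    rw [pow_one]; exact refl_mul_self _ _
  · exact refl_mul_refl_pow_eight _ _ h01
  · exact refl_mul_refl_sq _ _ h02
  · exact refl_mul_refl_pow_eight _ _ (by rw [mink_comm]; exact h01)
  · change (triRefl 1 * triRefl 1) ^ 1 = 1
    rw [pow_one]; exact refl_mul_self _ _
  · exact refl_mul_refl_pow_eight _ _ h12
  · exact refl_mul_refl_sq _ _ (by rw [mink_comm]; exact h02)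
  · exact refl_mul_refl_pow_eight _ _ (by rw [mink_comm]; exact h12)
  · change (triRefl 2 * triRefl 2) ^ 1 = 1
    rw [pow_one]; exact refl_mul_self _ _

/-- The action of the triangle group on the hyperbolic plane. -/
def triHom : TriGroup →* (ℍ ≃ᵢ ℍ) := triSys.lift ⟨triRefl, isLiftable_triRefl⟩

@[simp] theorem triHom_simple (i : Fin 3) : triHom (triSys.simple i) = triRefl i :=
  triSys.lift_apply_simple isLiftable_triRefl i

/-! ### Positivity of roots and disjointness of the triangles -/

/-- The cone spanned by the simple roots. -/
def rootCone : Set (Fin 3 → ℝ) := {v | ∃ x : Fin 3 → ℝ, (∀ i, 0 ≤ x i) ∧ v = ∑ i, x i • root i}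

theorem root_mem_rootCone (i : Fin 3) : root i ∈ rootCone :=
  ⟨Pi.single i 1, fun j => by
    by_cases h : j = i
    · subst h; simp
    · simp [h], by simp [Pi.single_apply, ite_smul]⟩

theorem add_smul_mem_rootCone {v w : Fin 3 → ℝ} {a b : ℝ} (hv : v ∈ rootCone)
    (hw : w ∈ rootCone) (ha : 0 ≤ a) (hb : 0 ≤ b) : a • v + b • w ∈ rootCone := by
  obtain ⟨x, hx, rfl⟩ := hv
  obtain ⟨y, hy, rfl⟩ := hw
  refine ⟨fun i => a * x i + b * y i, fun i => ?_, ?_⟩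
  · have := hx i
    have := hy i
    positivity
  · simp only [Finset.smul_sum, ← Finset.sum_add_distrib, smul_smul, add_smul]

/-- The coefficients `sin (k θ) / sin θ` in terms of `c = 2 cos θ`. -/
def chebCoeff (c : ℝ) : ℕ → ℝ
  | 0 => 0
  | 1 => 1
  | k + 2 => c * chebCoeff c (k + 1) - chebCoeff c k

/-- For `c = 2 cos (π/8)` the coefficients are `sin (kπ/8) / sin (π/8)`, which stay nonnegative
until the half turn `k = 8`. -/
theorem chebCoeff_kap_nonneg {k : ℕ} (hk : k ≤ 8) : 0 ≤ chebCoeff kap k := by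
  have h := kap_sq
  have h' := sqrt_two_sq
  have hk0 := kap_pos
  have hs := sqrt_two_pos
  have c0 : chebCoeff kap 0 = 0 := rfl
  have c1 : chebCoeff kap 1 = 1 := rfl
  have c2 : chebCoeff kap 2 = kap := by rw [chebCoeff, c0, c1]; ring
  have c3 : chebCoeff kap 3 = 1 + √2 := by rw [chebCoeff, c2, c1]; linarith
  have c4 : chebCoeff kap 4 = kap * √2 := by rw [chebCoeff, c2, c3]; ring
  have c5 : chebCoeff kap 5 = 1 + √2 := by rw [chebCoeff, c4, c3]; grind
  have c6 : chebCoeff kap 6 = kap := by rw [chebCoeff, c4, c5]; ring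
  have c7 : chebCoeff kap 7 = 1 := by rw [chebCoeff, c6, c5]; linarith
  have c8 : chebCoeff kap 8 = 0 := by rw [chebCoeff, c6, c7]; ring
  interval_cases k
  · rw [c0]
  · rw [c1]; norm_num
  · rw [c2]; positivity
  · rw [c3]; positivity
  · rw [c4]; positivity
  · rw [c5]; positivity
  · rw [c6]; positivity
  · rw [c7]; norm_num
  · rw [c8]

theorem lin_triRefl_self (i : Fin 3) : lin (triRefl i) (root i) = -root i := by
  rw [triRefl, lin_refl, reflVec, mink_root_self]; module

theorem lin_triRefl_of_mink {i j : Fin 3} {c : ℝ} (h : mink (root i) (root j) = -c / 2) :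
    lin (triRefl j) (root i) = root i + c • root j := by
  rw [triRefl, lin_refl, reflVec, h]; module

-- The orbit of a root under a dihedral group. Peeling off the last two letters of the word gives
-- the three-term recurrence of `chebCoeff`. The word ends in `t`, so the first reflection applied
-- to `root s` is the one in `root t`.
open CoxeterSystem in
theorem lin_alternatingWord {c : ℝ} (k : ℕ) : ∀ {s t : Fin 3},
    mink (root s) (root t) = -c / 2 →
    lin (triHom (triSys.wordProd (alternatingWord s t k))) (root s) =
      if Even k then chebCoeff c (k + 1) • root s + chebCoeff c k • root t
      else chebCoeff c k • root s + chebCoeff c (k + 1) • root t := by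
  induction k using Nat.twoStepInduction with
  | zero => intro s t h; simp [alternatingWord, lin_one, chebCoeff]
  | one =>
    intro s t h
    simp [alternatingWord, chebCoeff, lin_triRefl_of_mink h]
  | more k ih1 ih2 =>
    intro s t h
    have h' : mink (root t) (root s) = -c / 2 := by rw [mink_comm, h]
    rw [alternatingWord_succ, List.concat_eq_append, wordProd_append, wordProd_singleton,
      map_mul, triHom_simple, lin_mul, lin_triRefl_of_mink h, map_add, map_smul, ih2 h',
      alternatingWord_succ, List.concat_eq_append, wordProd_append, wordProd_singleton,
      map_mul, triHom_simple, lin_mul, lin_triRefl_self, map_neg, ih1 h]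
    by_cases hk : Even k
    · have hk1 : ¬ Even (k + 1) := by rw [Nat.even_add_one]; simpa using hk
      have hk2 : Even (k + 1 + 1) := by rw [Nat.even_add_one]; exact hk1
      simp only [hk, hk1, hk2, if_true, if_false]
      rw [show chebCoeff c (k + 1 + 1 + 1) = c * chebCoeff c (k + 1 + 1) - chebCoeff c (k + 1)
        from rfl, show chebCoeff c (k + 1 + 1) = c * chebCoeff c (k + 1) - chebCoeff c k from rfl]
      module
    · have hk1 : Even (k + 1) := by rw [Nat.even_add_one]; exact hk
      have hk2 : ¬ Even (k + 1 + 1) := by rw [Nat.even_add_one]; simpa using hk1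
      simp only [hk, hk1, hk2, if_true, if_false]
      rw [show chebCoeff c (k + 1 + 1 + 1) = c * chebCoeff c (k + 1 + 1) - chebCoeff c (k + 1)
        from rfl, show chebCoeff c (k + 1 + 1) = c * chebCoeff c (k + 1) - chebCoeff c k from rfl]
      module

open CoxeterSystem in
theorem exists_lin_alternatingWord {s t : Fin 3} (hst : s ≠ t) {k : ℕ}
    (hk : k < triMatrix s t) : ∃ a b : ℝ, 0 ≤ a ∧ 0 ≤ b ∧
      lin (triHom (triSys.wordProd (alternatingWord s t k))) (root s) =
        a • root s + b • root t := by
  have main : ∀ c : ℝ, mink (root s) (root t) = -c / 2 → 0 ≤ chebCoeff c k →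
      0 ≤ chebCoeff c (k + 1) → ∃ a b : ℝ, 0 ≤ a ∧ 0 ≤ b ∧
      lin (triHom (triSys.wordProd (alternatingWord s t k))) (root s) =
        a • root s + b • root t := by
    intro c h h1 h2
    rw [lin_alternatingWord k h]
    split_ifs
    · exact ⟨_, _, h2, h1, rfl⟩
    · exact ⟨_, _, h1, h2, rfl⟩
  have h8 : mink (root s) (root t) = -kap / 2 → k < 8 → ∃ a b : ℝ, 0 ≤ a ∧ 0 ≤ b ∧
      lin (triHom (triSys.wordProd (alternatingWord s t k))) (root s) =
        a • root s + b • root t := fun h hk =>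
    main kap h (chebCoeff_kap_nonneg hk.le) (chebCoeff_kap_nonneg hk)
  have h2 : mink (root s) (root t) = 0 → k < 2 → ∃ a b : ℝ, 0 ≤ a ∧ 0 ≤ b ∧
      lin (triHom (triSys.wordProd (alternatingWord s t k))) (root s) =
        a • root s + b • root t := fun h hk => by
    refine main 0 (by rw [h]; simp) ?_ ?_ <;> interval_cases k <;> simp [chebCoeff]
  have h01 := mink_root_zero_one
  have h12 := mink_root_one_two
  have h02 := mink_root_zero_two
  fin_cases s <;> fin_cases t <;> first | exact absurd rfl hst | skip
  · exact h8 h01 hk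
  · exact h2 h02 hk
  · exact h8 (by rw [mink_comm]; exact h01) hk
  · exact h8 h12 hk
  · exact h2 (by rw [mink_comm]; exact h02) hk
  · exact h8 (by rw [mink_comm]; exact h12) hk

open CoxeterSystem in
/-- A reduced word in two letters is alternating. -/
theorem eq_alternatingWord_of_isReduced {s t : Fin 3} (ω : List (Fin 3))
    (hω : triSys.IsReduced ω) (hst : ∀ x ∈ ω, x = s ∨ x = t) :
    ω = alternatingWord s t ω.length ∨ ω = alternatingWord t s ω.length := by
  induction ω using List.reverseRecOn with
  | nil => left; rfl
  | append_singleton l x ih =>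
    have hl : triSys.IsReduced l := by
      have := hω.take l.length
      rwa [List.take_left] at this
    have key : ∀ s t : Fin 3, x = t →
        (l = alternatingWord s t l.length ∨ l = alternatingWord t s l.length) →
        l ++ [x] = alternatingWord s t (l ++ [x]).length := by
      rintro s t rfl (h | h)
      · cases hn : l.length with
        | zero =>
          have : l = [] := List.length_eq_zero_iff.1 hn
          subst this; rfl
        | succ n =>
          exfalso
          rw [hn, alternatingWord_succ, List.concat_eq_append] at h
          have h1 := hω.eq
          rw [h, wordProd_append, wordProd_append, wordProd_singleton, mul_assoc,
            triSys.simple_mul_simple_self, mul_one] at h1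
          have h2 := triSys.length_wordProd_le (alternatingWord x s n)
          simp at h1 h2
          omega
      · rw [List.length_append, List.length_singleton, alternatingWord_succ,
          List.concat_eq_append, ← h]
    have ih' := ih hl fun y hy => hst y (by simp [hy])
    rcases hst x (by simp) with h | h
    · right; exact key t s h ih'.symm
    · left; exact key s t h ih'

-- The basic positivity property of Coxeter groups: if `w s` is longer than `w`, then `w` keeps the
-- root of `s` positive. Split off from `w` the longest tail in the dihedral group of `s` and a
-- descent `t`. The tail sends the root of `s` to a nonnegative combination of the two roots, and
-- the remaining factor, which both `s` and `t` lengthen, keeps these two positive by induction.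
open CoxeterSystem in
theorem lin_root_mem_rootCone (N : ℕ) : ∀ (w : TriGroup) (s : Fin 3), triSys.length w = N →
    triSys.length w < triSys.length (w * triSys.simple s) →
    lin (triHom w) (root s) ∈ rootCone := by
  induction N using Nat.strong_induction_on with
  | _ N ih =>
  intro w s hN hws
  by_cases hw : w = 1
  · subst hw; rw [map_one, lin_one]; exact root_mem_rootCone s
  obtain ⟨t, ht⟩ := triSys.exists_rightDescent_of_ne_one hw
  have ht : triSys.length (w * triSys.simple t) < triSys.length w := ht
  have hst : s ≠ t := by rintro rfl; omega
  -- Factorisations of `w` with a tail of length `k` in the letters `s`, `t` and additive lengths; a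
  -- maximal `k` is taken.
  let p : ℕ → Prop := fun k => ∃ (v : TriGroup) (ω : List (Fin 3)),
    (∀ x ∈ ω, x = s ∨ x = t) ∧ ω.length = k ∧ w = v * triSys.wordProd ω ∧
      triSys.length v + k = triSys.length w
  have hp1 : p 1 := by
    refine ⟨w * triSys.simple t, [t], by simp, rfl, by simp, ?_⟩
    rcases triSys.length_mul_simple w t with h | h <;> omega
  have hmax : ∃ k, p k ∧ 1 ≤ k ∧ ∀ j, p j → j ≤ k := by
    classical
    have hb : ∀ j, p j → j ≤ triSys.length w := by
      rintro j ⟨v, ω, -, -, -, h⟩; omega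
    exact ⟨Nat.findGreatest p (triSys.length w), Nat.findGreatest_spec (hb 1 hp1) hp1,
      Nat.le_findGreatest (hb 1 hp1) hp1, fun j hj => Nat.le_findGreatest (hb j hj) hj⟩
  obtain ⟨k, ⟨v, ω, hω, hlen, hwv, hl⟩, hk1, hmax⟩ := hmax
  have hup : ∀ x, (x = s ∨ x = t) → triSys.length v < triSys.length (v * triSys.simple x) := by
    intro x hx
    by_contra hcon
    have h1 : triSys.length (v * triSys.simple x) + 1 = triSys.length v := by
      rcases triSys.length_mul_simple v x with h | h <;> omega
    have : p (k + 1) := by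
      refine ⟨v * triSys.simple x, x :: ω, ?_, by simp [hlen], ?_, by omega⟩
      · intro y hy
        rcases List.mem_cons.1 hy with rfl | hy
        · exact hx
        · exact hω y hy
      · rw [wordProd_cons, mul_assoc, triSys.simple_mul_simple_cancel_left]; exact hwv
    have := hmax _ this
    omega
  have hred : triSys.IsReduced ω := by
    have h1 := triSys.length_mul_le v (triSys.wordProd ω)
    have h2 := triSys.length_wordProd_le ω
    rw [← hwv] at h1
    change triSys.length (triSys.wordProd ω) = ω.length
    omega
  -- The tail cannot be rewritten to end in `s` without growing, since then `w s` would be no longer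
  -- than `w`. This forces the tail to be alternating and to end in `t`.
  have hno : ∀ ω', triSys.wordProd ω = triSys.wordProd (ω' ++ [s]) → ω'.length + 1 ≤ k →
      False := by
    intro ω' h h'
    rw [wordProd_append, wordProd_singleton] at h
    have h1 : w * triSys.simple s = v * triSys.wordProd ω' := by
      rw [hwv, h, mul_assoc, mul_assoc, triSys.simple_mul_simple_self, mul_one]
    have h2 := triSys.length_mul_le v (triSys.wordProd ω')
    have h3 := triSys.length_wordProd_le ω'
    rw [← h1] at h2
    omega
  have halt : ω = alternatingWord s t k := by
    rcases eq_alternatingWord_of_isReduced ω hred hω with h | h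
    · rw [hlen] at h; exact h
    · exfalso
      rw [hlen] at h
      obtain ⟨j, rfl⟩ : ∃ j, k = j + 1 := ⟨k - 1, by omega⟩
      rw [alternatingWord_succ, List.concat_eq_append] at h
      exact hno _ (by rw [h]) (by simp)
  have hM0 : triMatrix s t ≠ 0 := by
    fin_cases s <;> fin_cases t <;> simp [triMatrix]
  -- At length equal to the order of `s t` the braid relation rewrites the tail so that it ends in
  -- `s`; beyond it alternating words are not reduced.
  have hkM : k < triMatrix s t := by
    rcases lt_trichotomy k (triMatrix s t) with h | h | h
    · exact h
    · exfalso
      obtain ⟨j, hj⟩ : ∃ j, triMatrix s t = j + 1 := ⟨triMatrix s t - 1, by omega⟩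
      have h1 := triSys.prod_alternatingWord_eq_prod_alternatingWord_sub s t k (by omega)
      rw [← halt, show triMatrix s t * 2 - k = j + 1 by omega, alternatingWord_succ,
        List.concat_eq_append] at h1
      refine hno _ h1 (by simp; omega)
    · rw [halt] at hred
      exact absurd hred (triSys.not_isReduced_alternatingWord s t hM0 h)
  obtain ⟨a, b, ha, hb, hab⟩ := exists_lin_alternatingWord hst hkM
  rw [hwv, map_mul, lin_mul, halt, hab, map_add, map_smul, map_smul]
  have hv : triSys.length v < N := by omega
  exact add_smul_mem_rootCone (ih _ hv v s rfl (hup s (Or.inl rfl)))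
    (ih _ hv v t rfl (hup t (Or.inr rfl))) ha hb

/-- The open triangle. -/
def chamber : Set ℍ := {z | ∀ i, mink (hyp z) (root i) < 0}

/-- The closed triangle. -/
def closedChamber : Set ℍ := {z | ∀ i, mink (hyp z) (root i) ≤ 0}

theorem mink_hyp_neg_of_mem_rootCone {z : ℍ} (hz : z ∈ chamber) {v : Fin 3 → ℝ}
    (hv : v ∈ rootCone) (h0 : v ≠ 0) : mink (hyp z) v < 0 := by
  obtain ⟨x, hx, rfl⟩ := hv
  have hs : mink (hyp z) (∑ i, x i • root i) = ∑ i, x i * mink (hyp z) (root i) := by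
    simp only [Fin.sum_univ_three, mink_add_right, mink_smul_right]
  rw [hs]
  have hle : ∀ i, x i * mink (hyp z) (root i) ≤ 0 := fun i =>
    mul_nonpos_of_nonneg_of_nonpos (hx i) (hz i).le
  obtain ⟨i, hi⟩ : ∃ i, x i ≠ 0 := by
    by_contra! h
    exact h0 (by simp [h])
  exact Finset.sum_neg' (fun j _ => hle j)
    ⟨i, Finset.mem_univ i, mul_neg_of_pos_of_neg (lt_of_le_of_ne (hx i) hi.symm) (hz i)⟩

/-- The translates of the open triangle are pairwise disjoint. -/
theorem eq_one_of_mem_chamber {w : TriGroup} {z : ℍ} (hz : z ∈ chamber)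
    (hw : triHom w z ∈ chamber) : w = 1 := by
  by_contra hne
  -- For a descent `s` of `w⁻¹`, positivity applied to `w⁻¹ s` shows that `w⁻¹` makes the root of
  -- `s` negative. Hence `w z` lies on the wrong side of the wall of `s`.
  obtain ⟨s, hs⟩ := triSys.exists_rightDescent_of_ne_one (inv_ne_one.2 hne)
  have hs : triSys.length (w⁻¹ * triSys.simple s) < triSys.length w⁻¹ := hs
  have h1 := lin_root_mem_rootCone _ (w⁻¹ * triSys.simple s) s rfl
    (by rw [mul_assoc, triSys.simple_mul_simple_self, mul_one]; exact hs)
  have h2 : lin (triHom (w⁻¹ * triSys.simple s)) (root s) = -lin (triHom w⁻¹) (root s) := by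
    rw [map_mul, lin_mul, triHom_simple, lin_triRefl_self, map_neg]
  have h3 : lin (triHom (w⁻¹ * triSys.simple s)) (root s) ≠ 0 := by
    intro h
    have := mink_lin (triHom (w⁻¹ * triSys.simple s)) (root s) (root s)
    rw [h, mink_root_self] at this
    simp at this
  have h4 := mink_hyp_neg_of_mem_rootCone hz h1 h3
  have h5 := hw s
  rw [h2, mink_neg_right, map_inv] at h4
  rw [hyp_apply, ← lin_apply_inv (triHom w) (root s), mink_lin] at h5
  linarith
/-! ### Points near a geodesic segment, positive volume -/

/-- The strict inequality `0 < t` is the point: a weak inequality at `z` and a strict one at `q`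
combine to a strict one at `p`. Closed convex regions are shown in this way to be closures of their
interiors. -/
theorem exists_near_mem_segment {z q : ℍ} (hzq : z ≠ q) {ε : ℝ} (hε : 0 < ε) :
    ∃ p : ℍ, dist z p < ε ∧ ∃ s t : ℝ, 0 ≤ s ∧ 0 < t ∧ hyp p = s • hyp z + t • hyp q := by
  obtain ⟨u, hu, hzu, hq⟩ := exists_geodesic z q hzq
  obtain ⟨γ, hγ, h0, hγs⟩ := exists_geodesic_line hu hzu
  have hd : 0 < dist z q := dist_pos.2 hzq
  have hdq : γ (dist z q) = q := hyp_injective (by rw [hγs, hq])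
  obtain ⟨r, hr0, hr⟩ : ∃ r, 0 < r ∧ r < min ε (dist z q) := exists_between (lt_min hε hd)
  have h1 : dist z (γ r) = r := by
    rw [← h0, hγ.dist_eq, Real.dist_eq, zero_sub, abs_neg, abs_of_pos hr0]
  have h2 : dist (γ r) q = dist z q - r := by
    have := lt_of_lt_of_le hr (min_le_right _ _)
    rw [← hdq, hγ.dist_eq, hdq, Real.dist_eq, abs_sub_comm, abs_of_pos (by linarith)]
  refine ⟨γ r, by rw [h1]; exact lt_of_lt_of_le hr (min_le_left _ _), ?_⟩
  obtain ⟨s, t, hs, ht, h⟩ := mem_geodesicSegment_iff.1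
    (show γ r ∈ geodesicSegment z q by change dist z (γ r) + dist (γ r) q = _; rw [h1, h2]; ring)
  refine ⟨s, t, hs, lt_of_le_of_ne ht ?_, h⟩
  rintro rfl
  rw [zero_smul, add_zero] at h
  have h3 := mink_hyp_self (γ r)
  rw [h, mink_smul_left, mink_smul_right, mink_hyp_self] at h3
  have h4 : s = 1 := by nlinarith
  rw [h4, one_smul] at h
  rw [hyp_injective h, dist_self] at h1
  exact hr0.ne h1

instance : (volume : Measure ℍ).IsOpenPosMeasure where
  open_pos U hU hne h0 := by
    rw [UpperHalfPlane.volume_def, withDensity_apply_eq_zero'] at h0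
    · have h1 : {x : ℍ | ((((1 / NNReal.mk x.im x.im_pos.le : ℝ≥0) ^ 2 : ℝ≥0)) : ℝ≥0∞) ≠ 0} ∩ U
          = U := by
        refine inter_eq_right.2 fun x _ => ?_
        simp only [mem_ofPred_eq, ne_eq, ENNReal.coe_eq_zero]
        exact pow_ne_zero 2 (one_div_ne_zero fun h => x.im_pos.ne' (congrArg NNReal.toReal h))
      rw [h1, measurableEmbedding_coe.comap_apply] at h0
      exact (isOpenEmbedding_coe.isOpenMap U hU).measure_ne_zero volume (hne.image _) h0
    · refine Measurable.aemeasurable ?_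
      refine ((Continuous.pow (Continuous.div₀ continuous_const ?_ ?_) _).measurable).coe_nnreal_ennreal
      · exact continuous_im.subtype_mk _
      · exact fun x ↦ NNReal.ne_iff.mp x.im_ne_zero

theorem volume_ne_top_of_isBounded {S : Set ℍ} (h : Bornology.IsBounded S) : volume S ≠ ∞ :=
  ((measure_mono subset_closure).trans_lt h.isCompact_closure.measure_lt_top).ne

/-- Disjoint sets with volume bounded below, inside a bounded region: there are finitely many. -/
theorem finite_of_disjoint_of_volume_le {ι : Type*} {I : Set ι} {S : ι → Set ℍ} {A : Set ℍ}
    (hA : Bornology.IsBounded A) {ε : ℝ≥0∞} (hε : 0 < ε) (hm : ∀ i ∈ I, MeasurableSet (S i))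
    (hd : I.PairwiseDisjoint S) (hv : ∀ i ∈ I, ε ≤ volume (S i)) (hS : ∀ i ∈ I, S i ⊆ A) :
    I.Finite := by
  have h := Measure.finite_const_le_meas_of_disjoint_iUnion (ι := I) volume hε
    (As := fun i => S i) (fun i => hm i i.2)
    (fun i j hij => hd i.2 j.2 (fun h => hij (Subtype.ext h)))
    (ne_top_of_le_ne_top (volume_ne_top_of_isBounded hA)
      (measure_mono (iUnion_subset fun i => hS i i.2)))
  have h2 : {i : I | ε ≤ volume (S i)} = univ := eq_univ_of_forall fun i => hv i i.2
  rw [h2] at h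
  exact finite_coe_iff.1 (finite_univ_iff.1 h)

/-! ### The tiling by triangles -/

theorem isOpen_mink_lt (n : Fin 3 → ℝ) (c : ℝ) : IsOpen {z : ℍ | mink (hyp z) n < c} :=
  isOpen_lt (continuous_mink continuous_hyp continuous_const) continuous_const

theorem isClosed_mink_le (n : Fin 3 → ℝ) (c : ℝ) : IsClosed {z : ℍ | mink (hyp z) n ≤ c} :=
  isClosed_le (continuous_mink continuous_hyp continuous_const) continuous_const

theorem isOpen_chamber : IsOpen chamber := by
  have : chamber = ⋂ i, {z : ℍ | mink (hyp z) (root i) < 0} := by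
    ext z; simp [chamber]
  rw [this]
  exact isOpen_iInter_of_finite fun i => isOpen_mink_lt _ _

theorem chamber_nonempty : chamber.Nonempty := by
  have h4 := sqrt_two_pos
  have hk := kap_pos
  have h3 := sqrt_two_sq
  have hlt : √2 < 3 / 2 := by nlinarith
  have hS : 2 < inS := by
    have := inS_sq
    have := inS_pos
    nlinarith [show (1 : ℝ) < √2 by nlinarith]
  obtain ⟨z, c, hc, hz⟩ := exists_hyp_eq_smul (v := ![1 / 2, 1 / 10, 1])
    (by simp [mink]; norm_num) (by simp)
  refine ⟨z, fun i => ?_⟩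
  rw [hz, mink_smul_left]
  refine mul_neg_of_pos_of_neg hc ?_
  fin_cases i
  · simp [mink, root]
  · simp [mink, root]
    rw [← sub_pos]
    have : 2⁻¹ * (kap / (2 * (1 + √2))) - 10⁻¹ * (kap / 2) =
        kap * (4 - √2) / (20 * (1 + √2)) := by field_simp; ring
    rw [this]
    have : 0 < 4 - √2 := by linarith
    positivity
  · simp [mink, root]
    linarith

/-- The images of a small ball in the triangle are disjoint, have equal area and lie in a bounded
region. -/
theorem finite_triHom_near {q : ℍ} (hq : q ∈ chamber) (z : ℍ) (R : ℝ) :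
    {w : TriGroup | dist (triHom w q) z ≤ R}.Finite := by
  obtain ⟨r, hr, hrq⟩ := Metric.isOpen_iff.1 isOpen_chamber q hq
  refine finite_of_disjoint_of_volume_le (S := fun w => triHom w '' Metric.ball q r)
    (A := Metric.closedBall z (R + r)) Metric.isBounded_closedBall
    (Metric.isOpen_ball.measure_pos volume ⟨q, Metric.mem_ball_self hr⟩)
    (fun w _ => ?_) ?_ (fun w _ => (volume_image_isometry _ _).ge) ?_
  · rw [IsometryEquiv.image_ball]; exact measurableSet_ball
  · intro w _ w' _ hne
    refine Set.disjoint_left.2 ?_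
    rintro x ⟨y, hy, rfl⟩ ⟨y', hy', h⟩
    refine hne ?_
    have : triHom (w'⁻¹ * w) y = y' := by
      rw [map_mul, map_inv, IsometryEquiv.mul_apply, ← h, IsometryEquiv.inv_apply_self]
    have h1 := eq_one_of_mem_chamber (hrq hy) (w := w'⁻¹ * w) (this ▸ hrq hy')
    exact (inv_mul_eq_one.1 h1).symm
  · intro w hw
    rw [IsometryEquiv.image_ball]
    intro x hx
    have hw : dist (triHom w q) z ≤ R := hw
    rw [Metric.mem_closedBall]
    have := dist_triangle x (triHom w q) z
    rw [Metric.mem_ball] at hx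
    linarith

/-- Every point is moved by a subgroup into the intersection of the half planes of the simple
reflections in that subgroup. -/
theorem exists_mem_halfPlanes (H : Subgroup TriGroup) (z : ℍ) :
    ∃ w ∈ H, ∀ s, triSys.simple s ∈ H → mink (hyp (triHom w z)) (root s) ≤ 0 := by
  obtain ⟨q, hq⟩ := chamber_nonempty
  have e : ∀ w : TriGroup, dist (triHom w z) q = dist (triHom w⁻¹ q) z := fun w => by
    rw [← (triHom w⁻¹).dist_eq, ← IsometryEquiv.mul_apply, ← map_mul, inv_mul_cancel, map_one,
      dist_comm]; rfl
  have hfin : {w : TriGroup | w ∈ H ∧ dist (triHom w z) q ≤ dist z q}.Finite := by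
    refine ((finite_triHom_near hq z (dist z q)).image (·⁻¹)).subset ?_
    rintro w ⟨-, hw⟩
    refine ⟨w⁻¹, ?_, inv_inv w⟩
    rw [e] at hw
    exact hw
  -- Take the image of `z` under the subgroup that is closest to an interior point `q` of the
  -- triangle. If it were on the wrong side of a wall, reflecting it would bring it closer to `q`.
  obtain ⟨w, ⟨hwH, hw⟩, hmin⟩ := exists_min_image _ (fun w => dist (triHom w z) q) hfin
    ⟨1, one_mem H, by rw [map_one]; rfl⟩
  refine ⟨w, hwH, fun s hs => ?_⟩
  have h1 : dist (triHom w z) q ≤ dist (triHom (triSys.simple s * w) z) q := by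
    by_cases h : dist (triHom (triSys.simple s * w) z) q ≤ dist z q
    · exact hmin _ ⟨mul_mem hs hwH, h⟩
    · linarith
  have h2 : Real.cosh (dist (triHom w z) q) ≤
      Real.cosh (dist (triHom (triSys.simple s * w) z) q) := by
    rw [Real.cosh_le_cosh, abs_of_nonneg dist_nonneg, abs_of_nonneg dist_nonneg]; exact h1
  rw [cosh_dist_eq, cosh_dist_eq, map_mul, IsometryEquiv.mul_apply, triHom_simple, triRefl,
    hyp_refl, reflVec, mink_sub_left, mink_smul_left, mink_comm (root s)] at h2
  have h3 := hq s
  by_contra! hcon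
  nlinarith

/-! ### The octagon -/

/-- The cosine of `k π / 4`. -/
def ck : ZMod 8 → ℝ := ![1, √2 / 2, 0, -(√2 / 2), -1, -(√2 / 2), 0, √2 / 2]

/-- The sine of `k π / 4`. -/
def sk : ZMod 8 → ℝ := ![0, √2 / 2, 1, √2 / 2, 0, -(√2 / 2), -1, -(√2 / 2)]

theorem ck_neg (k : ZMod 8) : ck (-k) = ck k := by fin_cases k <;> rfl

theorem sk_neg (k : ZMod 8) : sk (-k) = -sk k := by
  fin_cases k <;> first | exact neg_zero.symm | exact (neg_neg _).symm | rfl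

theorem ck_one_sub (k : ZMod 8) : ck (1 - k) = √2 / 2 * (ck k + sk k) := by
  have h := sqrt_two_sq
  fin_cases k
  · change √2 / 2 = √2 / 2 * (1 + 0); ring
  · change (1 : ℝ) = √2 / 2 * (√2 / 2 + √2 / 2); linarith
  · change √2 / 2 = √2 / 2 * (0 + 1); ring
  · change (0 : ℝ) = √2 / 2 * (-(√2 / 2) + √2 / 2); ring
  · change -(√2 / 2) = √2 / 2 * (-1 + 0); ring
  · change (-1 : ℝ) = √2 / 2 * (-(√2 / 2) + -(√2 / 2)); linarith
  · change -(√2 / 2) = √2 / 2 * (0 + -1); ring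
  · change (0 : ℝ) = √2 / 2 * (√2 / 2 + -(√2 / 2)); ring

theorem sk_one_sub (k : ZMod 8) : sk (1 - k) = √2 / 2 * (ck k - sk k) := by
  have h := sqrt_two_sq
  fin_cases k
  · change √2 / 2 = √2 / 2 * (1 - 0); ring
  · change (0 : ℝ) = √2 / 2 * (√2 / 2 - √2 / 2); ring
  · change -(√2 / 2) = √2 / 2 * (0 - 1); ring
  · change (-1 : ℝ) = √2 / 2 * (-(√2 / 2) - √2 / 2); linarith
  · change -(√2 / 2) = √2 / 2 * (-1 - 0); ring
  · change (0 : ℝ) = √2 / 2 * (-(√2 / 2) - -(√2 / 2)); ring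
  · change √2 / 2 = √2 / 2 * (0 - -1); ring
  · change (1 : ℝ) = √2 / 2 * (√2 / 2 - -(√2 / 2)); linarith

theorem ck_sq_add_sk_sq (k : ZMod 8) : ck k ^ 2 + sk k ^ 2 = 1 := by
  have h := sqrt_two_sq
  fin_cases k
  · change (1 : ℝ) ^ 2 + 0 ^ 2 = 1; ring
  · change (√2 / 2) ^ 2 + (√2 / 2) ^ 2 = 1; linarith
  · change (0 : ℝ) ^ 2 + 1 ^ 2 = 1; ring
  · change (-(√2 / 2)) ^ 2 + (√2 / 2) ^ 2 = 1; linarith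
  · change (-1 : ℝ) ^ 2 + 0 ^ 2 = 1; ring
  · change (-(√2 / 2)) ^ 2 + (-(√2 / 2)) ^ 2 = 1; linarith
  · change (0 : ℝ) ^ 2 + (-1) ^ 2 = 1; ring
  · change (√2 / 2) ^ 2 + (-(√2 / 2)) ^ 2 = 1; linarith

/-- The outer unit normal vector of the `k`-th side of the octagon. -/
def nrm (k : ZMod 8) : Fin 3 → ℝ := ![(1 + √2) * ck k, (1 + √2) * sk k, inS]

theorem mink_nrm_self (k : ZMod 8) : mink (nrm k) (nrm k) = 1 := by
  have h := ck_sq_add_sk_sq k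
  have h1 := inS_sq
  have h2 := sqrt_two_sq
  simp [nrm, mink]
  linear_combination (1 + √2) ^ 2 * h - h1 + h2

theorem nrm_zero : nrm 0 = root 2 := by
  ext i
  fin_cases i
  · change (1 + √2) * 1 = 1 + √2; ring
  · change (1 + √2) * 0 = 0; ring
  · rfl

theorem lin_triRefl_zero_nrm (k : ZMod 8) : lin (triRefl 0) (nrm k) = nrm (-k) := by
  rw [triRefl, lin_refl, nrm, nrm, ck_neg, sk_neg]
  ext i
  fin_cases i <;> simp [reflVec, mink, root]
  ring

theorem lin_triRefl_one_nrm (k : ZMod 8) : lin (triRefl 1) (nrm k) = nrm (1 - k) := by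
  rw [triRefl, lin_refl, nrm, nrm, ck_one_sub, sk_one_sub]
  have h4 := sqrt_two_pos
  have h1 := kap_sq
  have h2 := sqrt_two_sq
  have h3 : 1 + √2 ≠ 0 := by positivity
  ext i
  fin_cases i
  · simp [reflVec, mink, root]
    field_simp
    generalize ck k = x
    generalize sk k = y
    grind
  · simp [reflVec, mink, root]
    field_simp
    generalize ck k = x
    generalize sk k = y
    grind
  · simp [reflVec, mink, root]

/-- The regular octagon with angles `π/4`. -/
def octagon : Set ℍ := {z | ∀ k, mink (hyp z) (nrm k) ≤ 0}

theorem isClosed_octagon : IsClosed octagon := by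
  have : octagon = ⋂ k, {z : ℍ | mink (hyp z) (nrm k) ≤ 0} := by
    ext z; simp [octagon]
  rw [this]
  exact isClosed_iInter fun i => isClosed_mink_le _ _

/-- The walls through the centre give `0 ≤ y ≤ (√2 - 1) x`, so the direction of the point is within
`π/8` of the normal of side `0`; among the eight side conditions that of side `0` is then the
strongest. -/
theorem closedChamber_subset_octagon : closedChamber ⊆ octagon := by
  intro z hz
  have h0 := hz 0
  have h1 := hz 1
  have h2 := hz 2
  have hs := sqrt_two_pos
  have hs2 := sqrt_two_sq
  have hk := kap_pos
  simp [mink, root] at h0 h1 h2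
  set x := hyp z 0
  set y := hyp z 1
  have hxy : y * (1 + √2) ≤ x := by
    have e : y * (kap / 2) - x * (kap / (2 * (1 + √2))) =
        (y * (1 + √2) - x) * (kap / (2 * (1 + √2))) := by field_simp
    have h3 : (y * (1 + √2) - x) * (kap / (2 * (1 + √2))) ≤ 0 := by rw [← e]; linarith
    have h4 : 0 < kap / (2 * (1 + √2)) := by positivity
    nlinarith
  have hx : 0 ≤ x := le_trans (by positivity) hxy
  have hl : √2 < 3 / 2 := by nlinarith
  have key : ∀ k, ck k * x + sk k * y ≤ x := by
    have hyx : y ≤ x := by nlinarith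
    have hb : √2 / 2 * x + √2 / 2 * y ≤ x := by
      have : y ≤ x * (√2 - 1) := by nlinarith
      nlinarith
    have hs' : 0 ≤ √2 / 2 * x := by positivity
    have hs'' : 0 ≤ √2 / 2 * y := by positivity
    intro k
    fin_cases k
    · change 1 * x + 0 * y ≤ x; linarith
    · exact hb
    · change 0 * x + 1 * y ≤ x; linarith
    · change -(√2 / 2) * x + √2 / 2 * y ≤ x; linarith
    · change -1 * x + 0 * y ≤ x; linarith
    · change -(√2 / 2) * x + -(√2 / 2) * y ≤ x; linarith
    · change 0 * x + -1 * y ≤ x; linarith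
    · change √2 / 2 * x + -(√2 / 2) * y ≤ x; linarith
  intro k
  have := key k
  simp [mink, nrm]
  nlinarith

/-- The symmetry group of the octagon. -/
def octSym : Subgroup TriGroup := Subgroup.closure {triSys.simple 0, triSys.simple 1}

theorem simple_zero_mem_octSym : triSys.simple 0 ∈ octSym :=
  Subgroup.subset_closure (by simp)

theorem simple_one_mem_octSym : triSys.simple 1 ∈ octSym :=
  Subgroup.subset_closure (by simp)

theorem exists_lin_nrm_of_mem_octSym {d : TriGroup} (hd : d ∈ octSym) :
    ∃ e : ZMod 8 ≃ ZMod 8, ∀ k, lin (triHom d) (nrm k) = nrm (e k) := by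
  induction hd using Subgroup.closure_induction with
  | mem x hx =>
    rcases hx with rfl | rfl
    · exact ⟨Equiv.neg _, fun k => by rw [triHom_simple, lin_triRefl_zero_nrm]; rfl⟩
    · exact ⟨Equiv.subLeft 1, fun k => by rw [triHom_simple, lin_triRefl_one_nrm]; rfl⟩
  | one => exact ⟨Equiv.refl _, fun k => by rw [map_one, lin_one]; rfl⟩
  | mul x y _ _ hx hy =>
    obtain ⟨e, he⟩ := hx
    obtain ⟨f, hf⟩ := hy
    exact ⟨f.trans e, fun k => by rw [map_mul, lin_mul, hf, he]; rfl⟩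
  | inv x _ hx =>
    obtain ⟨e, he⟩ := hx
    exact ⟨e.symm, fun k => by
      conv_lhs => rw [← e.apply_symm_apply k, ← he, map_inv, lin_inv_apply]⟩

theorem image_octagon_of_lin {φ : ℍ ≃ᵢ ℍ} {e : ZMod 8 ≃ ZMod 8}
    (h : ∀ k, lin φ (nrm k) = nrm (e k)) : φ '' octagon = octagon := by
  have key : ∀ z, φ z ∈ octagon ↔ z ∈ octagon := fun z => by
    constructor
    · intro hz k
      have := hz (e k)
      rwa [← h, mink_hyp_lin] at this
    · intro hz k
      rw [← e.apply_symm_apply k, ← h, mink_hyp_lin]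
      exact hz _
  ext z
  constructor
  · rintro ⟨y, hy, rfl⟩; exact (key y).2 hy
  · intro hz
    exact ⟨φ⁻¹ z, (key _).1 (by rwa [IsometryEquiv.apply_inv_self]),
      IsometryEquiv.apply_inv_self _ _⟩

theorem image_octagon_of_mem_octSym {d : TriGroup} (hd : d ∈ octSym) :
    triHom d '' octagon = octagon := by
  obtain ⟨e, he⟩ := exists_lin_nrm_of_mem_octSym hd
  exact image_octagon_of_lin he

/-- Folding the octagon by its symmetries onto one triangle. Two walls come from
`exists_mem_halfPlanes`, the third is side `0` of the octagon. Estimates on the octagon thereby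
reduce to the triangle. -/
theorem octagon_subset_iUnion {z : ℍ} (hz : z ∈ octagon) :
    ∃ d ∈ octSym, triHom d z ∈ closedChamber := by
  obtain ⟨d, hd, h⟩ := exists_mem_halfPlanes octSym z
  refine ⟨d, hd, fun i => ?_⟩
  fin_cases i
  · exact h 0 simple_zero_mem_octSym
  · exact h 1 simple_one_mem_octSym
  · have : triHom d z ∈ octagon := by
      rw [← image_octagon_of_mem_octSym hd]; exact mem_image_of_mem _ hz
    have := this 0
    rwa [nrm_zero] at this

theorem closedChamber_subset_closure : closedChamber ⊆ closure chamber := by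
  intro z hz
  obtain ⟨q, hq⟩ := chamber_nonempty
  by_cases hzq : z = q
  · subst hzq; exact subset_closure hq
  rw [Metric.mem_closure_iff]
  intro ε hε
  obtain ⟨p, hp, s, t, hs, ht, h⟩ := exists_near_mem_segment hzq hε
  refine ⟨p, fun i => ?_, hp⟩
  rw [h, mink_add_left, mink_smul_left, mink_smul_left]
  have h1 := hz i
  have h2 := hq i
  nlinarith

theorem exists_triHom_mem_octagon (z : ℍ) : ∃ w : TriGroup, triHom w z ∈ octagon := by
  obtain ⟨w, -, hw⟩ := exists_mem_halfPlanes ⊤ z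
  exact ⟨w, closedChamber_subset_octagon fun i => hw i (Subgroup.mem_top _)⟩

/-- Octagons of the tiling whose interiors meet are equal. -/
theorem mem_octSym_of_interior_inter {w : TriGroup}
    (h : (interior (triHom w '' octagon) ∩ interior octagon).Nonempty) : w ∈ octSym := by
  -- An open part of an octagon of the tiling meets one of the open triangles inside it. Using this
  -- for both octagons in turn produces a triangle common to both, which identifies the group
  -- elements up to `octSym`.
  have key : ∀ (O : Set ℍ) (w : TriGroup), IsOpen O → O.Nonempty → O ⊆ triHom w '' octagon →
      ∃ d ∈ octSym, (O ∩ triHom (w * d) '' chamber).Nonempty := by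
    rintro O w hO ⟨x, hx⟩ hsub
    obtain ⟨y, hy, rfl⟩ := hsub hx
    obtain ⟨d, hd, hdy⟩ := octagon_subset_iUnion hy
    have h1 := closedChamber_subset_closure hdy
    have h2 : (triHom (w * d⁻¹) '' chamber ∩ O).Nonempty := by
      have hcl : triHom w y ∈ closure (triHom (w * d⁻¹) '' chamber) := by
        have h3 := image_closure_subset_closure_image (triHom (w * d⁻¹)).continuous
          (mem_image_of_mem (triHom (w * d⁻¹)) h1)
        rwa [← IsometryEquiv.mul_apply, ← map_mul, inv_mul_cancel_right] at h3
      rw [inter_comm]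
      exact mem_closure_iff.1 hcl O hO hx
    exact ⟨d⁻¹, inv_mem hd, by rwa [inter_comm]⟩
  obtain ⟨d, hd, hne⟩ := key _ 1 (isOpen_interior.inter isOpen_interior) h
    (by rw [map_one]; exact (inter_subset_right.trans interior_subset).trans (image_id _).ge)
  have hopen : IsOpen (triHom (1 * d) '' chamber) :=
    (triHom (1 * d)).toHomeomorph.isOpenMap _ isOpen_chamber
  obtain ⟨d', hd', x, ⟨-, y, hy, hxy⟩, y', hy', hxy'⟩ := key _ w
    ((isOpen_interior.inter isOpen_interior).inter hopen) hne
    ((inter_subset_left.trans inter_subset_left).trans interior_subset)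
  have h1 : triHom ((w * d')⁻¹ * d) y = y' := by
    rw [map_mul, map_inv, IsometryEquiv.mul_apply]
    rw [one_mul] at hxy
    rw [hxy, ← hxy', IsometryEquiv.inv_apply_self]
  have h2 := inv_mul_eq_one.1 (eq_one_of_mem_chamber hy (h1 ▸ hy'))
  have h3 : w = d * d'⁻¹ := by rw [← h2]; group
  rw [h3]
  exact mul_mem hd (inv_mem hd')

/-! ### The surface group -/

/-- The images of the simple reflections under the retraction onto the symmetry group of the
octagon. -/
def retrFun : Fin 3 → TriGroup :=
  ![triSys.simple 0, triSys.simple 1,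
    triSys.simple 0 * (triSys.simple 0 * triSys.simple 1) ^ 4]

/-- With `a`, `b` the first two generators, the third goes to `f = a (ab)⁴`, the reflection `a`
composed with the half turn. It is an involution, `a f` is the half turn, and `b f = (ab)³`, so the
orders `2` and `8` are respected. -/
theorem isLiftable_retrFun : triMatrix.IsLiftable retrFun := by
  set a := triSys.simple 0 with ha
  set b := triSys.simple 1 with hb
  have haa : a * a = 1 := triSys.simple_mul_simple_self 0
  have hbb : b * b = 1 := triSys.simple_mul_simple_self 1
  have hab : (a * b) ^ 8 = 1 := triSys.simple_mul_simple_pow 0 1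
  have hba : (b * a) ^ 8 = 1 := triSys.simple_mul_simple_pow 1 0
  have hainv : a⁻¹ = a := inv_eq_of_mul_eq_one_left haa
  have hbinv : b⁻¹ = b := inv_eq_of_mul_eq_one_left hbb
  have hinv : (a * b)⁻¹ = b * a := by rw [mul_inv_rev, hainv, hbinv]
  have hc : ∀ n : ℕ, a * (a * b) ^ n * a = ((a * b)⁻¹) ^ n := by
    intro n
    have : a * (a * b) ^ n * a = a * (a * b) ^ n * a⁻¹ := by rw [hainv]
    rw [this, ← conj_pow, hinv, hainv, ← mul_assoc a a b, haa, one_mul]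
  set f := a * (a * b) ^ 4 with hf
  have hff : f * f = 1 := by
    rw [hf, ← mul_assoc, hc, inv_pow, inv_mul_cancel]
  have hfinv : f⁻¹ = f := inv_eq_of_mul_eq_one_left hff
  have haf : (a * f) ^ 2 = 1 := by
    rw [hf, ← mul_assoc, haa, one_mul, ← pow_mul, hab]
  have hbf : (b * f) ^ 8 = 1 := by
    rw [hf, ← mul_assoc, ← hinv, pow_succ' (a * b) 3, inv_mul_cancel_left, ← pow_mul,
      mul_comm, pow_mul, hab, one_pow]
  have hfa : (f * a) ^ 2 = 1 := by
    rw [← hfinv, ← hainv, ← mul_inv_rev, inv_pow, haf, inv_one]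
  have hfb : (f * b) ^ 8 = 1 := by
    rw [← hfinv, ← hbinv, ← mul_inv_rev, inv_pow, hbf, inv_one]
  intro i j
  fin_cases i <;> fin_cases j
  · change (a * a) ^ 1 = 1; rw [pow_one, haa]
  · exact hab
  · exact haf
  · exact hba
  · change (b * b) ^ 1 = 1; rw [pow_one, hbb]
  · exact hbf
  · exact hfa
  · exact hfb
  · change (f * f) ^ 1 = 1; rw [pow_one, hff]

/-- The retraction of the triangle group onto the symmetry group of the octagon. -/
def retr : TriGroup →* TriGroup := triSys.lift ⟨retrFun, isLiftable_retrFun⟩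

@[simp] theorem retr_simple (i : Fin 3) : retr (triSys.simple i) = retrFun i :=
  triSys.lift_apply_simple isLiftable_retrFun i

theorem retr_mem_octSym (w : TriGroup) : retr w ∈ octSym := by
  have h0 := simple_zero_mem_octSym
  have h1 := simple_one_mem_octSym
  refine triSys.simple_induction (p := fun w => retr w ∈ octSym) w (fun i => ?_) ?_ fun w w' h h' => ?_
  · rw [retr_simple]
    fin_cases i
    · exact h0
    · exact h1
    · exact mul_mem h0 (pow_mem (mul_mem h0 h1) 4)
  · rw [map_one]; exact one_mem _
  · rw [map_mul]; exact mul_mem h h'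

theorem retr_of_mem_octSym {d : TriGroup} (hd : d ∈ octSym) : retr d = d := by
  induction hd using Subgroup.closure_induction with
  | mem x hx =>
    rcases hx with rfl | rfl
    · rw [retr_simple]; rfl
    · rw [retr_simple]; rfl
  | one => exact map_one _
  | mul x y _ _ hx hy => rw [map_mul, hx, hy]
  | inv x _ hx => rw [map_inv, hx]

/-- The surface group. -/
def surfGroup : Subgroup (ℍ ≃ᵢ ℍ) := retr.ker.map triHom

/-- Because `retr` is the identity on `octSym`, the triangle group is the semidirect product of the
kernel and `octSym`. As `octSym` stabilises the octagon, the kernel already reaches every octagon,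
and only its identity fixes one. -/
theorem exists_surfGroup_mul (w : TriGroup) :
    ∃ γ ∈ surfGroup, ∃ d ∈ octSym, triHom w = γ * triHom d := by
  refine ⟨triHom (w * (retr w)⁻¹), ⟨_, ?_, rfl⟩, retr w, retr_mem_octSym w, ?_⟩
  · change retr (w * (retr w)⁻¹) = 1
    rw [map_mul, map_inv, retr_of_mem_octSym (retr_mem_octSym w), mul_inv_cancel]
  · rw [← map_mul, inv_mul_cancel_right]

theorem eq_one_of_surfGroup_interior {γ : ℍ ≃ᵢ ℍ} (hγ : γ ∈ surfGroup)
    (h : (interior (γ '' octagon) ∩ interior octagon).Nonempty) : γ = 1 := by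
  obtain ⟨w, hw, rfl⟩ := hγ
  have h1 := mem_octSym_of_interior_inter h
  have h2 : retr w = 1 := hw
  rw [retr_of_mem_octSym h1] at h2
  rw [h2, map_one]

theorem exists_surfGroup_mem_octagon (z : ℍ) : ∃ γ ∈ surfGroup, z ∈ γ '' octagon := by
  obtain ⟨w, hw⟩ := exists_triHom_mem_octagon z
  obtain ⟨γ, hγ, d, hd, h⟩ := exists_surfGroup_mul w⁻¹
  refine ⟨γ, hγ, triHom d (triHom w z), ?_, ?_⟩
  · rw [← image_octagon_of_mem_octSym hd]; exact mem_image_of_mem _ hw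
  · rw [← IsometryEquiv.mul_apply, ← h, ← IsometryEquiv.mul_apply, ← map_mul, inv_mul_cancel,
      map_one]; rfl

theorem exists_gl_wordProd (ω : List (Fin 3)) : ∃ g : GL (Fin 2) ℝ,
    (∀ z, triHom (triSys.wordProd ω) z = g • z) ∧ g.det.val = (-1) ^ ω.length := by
  induction ω with
  | nil => exact ⟨1, fun z => by simp, by simp⟩
  | cons i ω ih =>
    obtain ⟨g, hg, hd⟩ := ih
    refine ⟨reflMat (root i) (mink_root_self i) * g, fun z => ?_, ?_⟩
    · rw [CoxeterSystem.wordProd_cons, map_mul, IsometryEquiv.mul_apply, hg, mul_smul,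
        triHom_simple]; rfl
    · rw [map_mul, Units.val_mul, hd, det_reflMat, List.length_cons, pow_succ]; ring

/-- The retraction preserves the parity of word length: the third generator goes to a product of
nine generators. Elements of the kernel are therefore products of an even number of reflections. -/
theorem surfGroup_le_orientedIsom : surfGroup ≤ orientedIsom := by
  rintro _ ⟨w, hw, rfl⟩
  have hw : retr w = 1 := hw
  have hpar : triSys.lengthParity w = 1 := by
    have hcomp : triSys.lengthParity.comp retr = triSys.lengthParity := by
      refine triSys.ext_simple fun i => ?_
      rw [MonoidHom.comp_apply, retr_simple]
      fin_cases i
      · rfl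
      · rfl
      · change triSys.lengthParity (triSys.simple 0 * (triSys.simple 0 * triSys.simple 1) ^ 4) =
          triSys.lengthParity (triSys.simple 2)
        rw [map_mul, map_pow, map_mul, CoxeterSystem.lengthParity_simple,
          CoxeterSystem.lengthParity_simple, CoxeterSystem.lengthParity_simple]
        rfl
    rw [← hcomp, MonoidHom.comp_apply, hw, map_one]
  obtain ⟨ω, hω, rfl⟩ := triSys.exists_isReduced w
  rw [CoxeterSystem.lengthParity_eq_ofAdd_length, hω.eq] at hpar
  have heven : Even ω.length := by
    have : ((ω.length : ℕ) : ZMod 2) = 0 := hpar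
    exact (ZMod.natCast_eq_zero_iff_even).1 this
  obtain ⟨g, hg, hd⟩ := exists_gl_wordProd ω
  exact mem_orientedIsom_of_det_pos g (by rw [hd, heven.neg_one_pow]; norm_num) hg
/-! ### Geometry of the octagon -/

theorem hyp_I : hyp UpperHalfPlane.I = ![0, 0, 1] := by
  ext i
  fin_cases i <;> simp [hyp]

theorem mink_hyp_I (v : Fin 3 → ℝ) : mink (hyp UpperHalfPlane.I) v = -v 2 := by
  rw [hyp_I]; simp [mink]

theorem lin_triRefl_zero (v : Fin 3 → ℝ) : lin (triRefl 0) v = ![v 0, -v 1, v 2] := by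
  rw [triRefl, lin_refl]
  ext i
  fin_cases i <;> simp [reflVec, mink, root]
  ring

theorem lin_triRefl_one (v : Fin 3 → ℝ) :
    lin (triRefl 1) v = ![√2 / 2 * (v 0 + v 1), √2 / 2 * (v 0 - v 1), v 2] := by
  rw [triRefl, lin_refl]
  have h4 := sqrt_two_pos
  have h1 := kap_sq
  have h2 := sqrt_two_sq
  have h3 : 1 + √2 ≠ 0 := by positivity
  ext i
  fin_cases i
  · simp [reflVec, mink, root]
    field_simp
    grind
  · simp [reflVec, mink, root]
    field_simp
    grind
  · simp [reflVec, mink, root]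

theorem ck_add_one (k : ZMod 8) : ck (k + 1) = √2 / 2 * (ck k - sk k) := by
  have := ck_one_sub (-k)
  rw [sub_neg_eq_add, add_comm, ck_neg, sk_neg] at this
  rw [this]; ring

theorem sk_add_one (k : ZMod 8) : sk (k + 1) = √2 / 2 * (ck k + sk k) := by
  have := sk_one_sub (-k)
  rw [sub_neg_eq_add, add_comm, ck_neg, sk_neg] at this
  rw [this]; ring

theorem ck_sub_one (k : ZMod 8) : ck (k - 1) = √2 / 2 * (ck k + sk k) := by
  rw [← ck_one_sub, ← ck_neg, neg_sub]

theorem sk_sub_one (k : ZMod 8) : sk (k - 1) = √2 / 2 * (sk k - ck k) := by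
  have := sk_one_sub k
  rw [← neg_sub, sk_neg] at this
  linarith

theorem ck_sub (k j : ZMod 8) : ck (k - j) = ck k * ck j + sk k * sk j := by
  obtain ⟨n, rfl⟩ : ∃ n : ℕ, (n : ZMod 8) = j := ⟨j.val, ZMod.natCast_zmod_val j⟩
  have h2 := sqrt_two_sq
  suffices ck (k - n) = ck k * ck n + sk k * sk n ∧ sk (k - n) = sk k * ck n - ck k * sk n from
    this.1
  induction n with
  | zero =>
    have h1 : ck 0 = 1 := rfl
    have h2 : sk 0 = 0 := rfl
    simp [h1, h2]
  | succ n ih =>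
    obtain ⟨i1, i2⟩ := ih
    have e : k - ((n + 1 : ℕ) : ZMod 8) = k - n - 1 := by push_cast; ring
    rw [e, ck_sub_one, sk_sub_one, i1, i2, Nat.cast_succ, ck_add_one, sk_add_one]
    constructor <;> ring

/-! ### Vertices, midpoints and the rotation of the octagon -/

/-- The position vectors of the vertices of the octagon. -/
def vtxVec (k : ZMod 8) : Fin 3 → ℝ :=
  ![√2 * inS * (ck (k - 1) + ck k), √2 * inS * (sk (k - 1) + sk k), 3 + 2 * √2]

/-- The position vectors of the midpoints of the sides of the octagon. -/
def midVec (k : ZMod 8) : Fin 3 → ℝ := ![inS * ck k, inS * sk k, 1 + √2]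

theorem mink_vtxVec (j k : ZMod 8) :
    mink (vtxVec j) (vtxVec k) = (16 + 12 * √2) * ck (j - k) - (17 + 12 * √2) := by
  have h2 := sqrt_two_sq
  have hS := inS_sq
  rw [ck_sub]
  simp only [vtxVec, mink, Matrix.cons_val_zero, Matrix.cons_val_one, Matrix.cons_val,
    ck_sub_one, sk_sub_one]
  generalize ck j = a
  generalize sk j = b
  generalize ck k = c
  generalize sk k = d
  grind

theorem mink_vtxVec_nrm (j k : ZMod 8) : mink (vtxVec j) (nrm k) =
    (3 + 2 * √2) * inS * ((ck (j - 1 - k) + ck (j - k)) * (2 - √2) - 1) := by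
  have h2 := sqrt_two_sq
  rw [ck_sub (j - 1) k, ck_sub j k]
  simp only [vtxVec, nrm, mink, Matrix.cons_val_zero, Matrix.cons_val_one, Matrix.cons_val]
  generalize ck j = a
  generalize sk j = b
  generalize ck (j - 1) = a'
  generalize sk (j - 1) = b'
  generalize ck k = c
  generalize sk k = d
  grind

theorem mink_midVec_nrm (j k : ZMod 8) : mink (midVec j) (nrm k) =
    (1 + √2) * inS * (ck (j - k) - 1) := by
  rw [ck_sub]
  simp only [midVec, nrm, mink, Matrix.cons_val_zero, Matrix.cons_val_one, Matrix.cons_val]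
  ring

theorem exists_vtx (k : ZMod 8) : ∃ z : ℍ, hyp z = vtxVec k := by
  refine exists_hyp_eq ?_ ?_
  · rw [mink_vtxVec, sub_self]
    change (16 + 12 * √2) * 1 - _ = _
    ring
  · change 0 < 3 + 2 * √2; positivity

theorem exists_mid (k : ZMod 8) : ∃ z : ℍ, hyp z = midVec k := by
  refine exists_hyp_eq ?_ ?_
  · have h := ck_sq_add_sk_sq k
    have hS := inS_sq
    have h2 := sqrt_two_sq
    simp only [midVec, mink, Matrix.cons_val_zero, Matrix.cons_val_one, Matrix.cons_val]
    linear_combination inS ^ 2 * h + hS - h2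
  · have := sqrt_two_pos
    change 0 < 1 + √2; positivity

/-- The vertices of the octagon. -/
def vtx (k : ZMod 8) : ℍ := (exists_vtx k).choose

theorem hyp_vtx (k : ZMod 8) : hyp (vtx k) = vtxVec k := (exists_vtx k).choose_spec

/-- The midpoints of the sides of the octagon. -/
def mid (k : ZMod 8) : ℍ := (exists_mid k).choose

theorem hyp_mid (k : ZMod 8) : hyp (mid k) = midVec k := (exists_mid k).choose_spec

theorem ck_le_one (k : ZMod 8) : ck k ≤ 1 := by
  nlinarith [ck_sq_add_sk_sq k, sq_nonneg (sk k)]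

theorem ck_le_of_ne {k : ZMod 8} (hk : k ≠ 0) : ck k ≤ √2 / 2 := by
  have h := sqrt_two_pos
  fin_cases k
  · exact absurd rfl hk
  · exact le_rfl
  · change (0 : ℝ) ≤ √2 / 2; positivity
  · change -(√2 / 2) ≤ √2 / 2; linarith
  · change (-1 : ℝ) ≤ √2 / 2; linarith
  · change -(√2 / 2) ≤ √2 / 2; linarith
  · change (0 : ℝ) ≤ √2 / 2; positivity
  · exact le_rfl

theorem sqrt_two_lt : √2 < (3 / 2 : ℝ) := by nlinarith [sqrt_two_sq, sqrt_two_pos]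

theorem one_lt_sqrt_two : (1 : ℝ) < √2 := by nlinarith [sqrt_two_sq, sqrt_two_pos]

theorem mink_mid_nrm_self (k : ZMod 8) : mink (hyp (mid k)) (nrm k) = 0 := by
  rw [hyp_mid, mink_midVec_nrm, sub_self]
  change _ * (1 - 1 : ℝ) = 0
  ring

theorem mink_mid_nrm_neg {j k : ZMod 8} (h : j ≠ k) : mink (hyp (mid j)) (nrm k) < 0 := by
  rw [hyp_mid, mink_midVec_nrm]
  have h1 := ck_le_of_ne (sub_ne_zero.2 h)
  have h2 := sqrt_two_lt
  have h3 := inS_pos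
  have h4 := sqrt_two_pos
  refine mul_neg_of_pos_of_neg (by positivity) (by linarith)

theorem vtx_mem_octagon (j : ZMod 8) : vtx j ∈ octagon := by
  intro k
  rw [hyp_vtx, mink_vtxVec_nrm]
  have h2 := sqrt_two_lt
  have h3 := inS_pos
  have h4 := sqrt_two_pos
  have h5 := sqrt_two_sq
  have hle : ck (j - 1 - k) + ck (j - k) ≤ 1 + √2 / 2 := by
    by_cases h : j - k = 0
    · have : j - 1 - k ≠ 0 := by
        rw [show j - 1 - k = j - k - 1 by ring, h]; decide
      linarith [ck_le_of_ne this, ck_le_one (j - k)]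
    · linarith [ck_le_of_ne h, ck_le_one (j - 1 - k)]
  have : (ck (j - 1 - k) + ck (j - k)) * (2 - √2) - 1 ≤ 0 := by nlinarith
  have h6 : 0 < (3 + 2 * √2) * inS := by positivity
  nlinarith

theorem mink_vtx_nrm_self (k : ZMod 8) : mink (hyp (vtx k)) (nrm k) = 0 := by
  rw [hyp_vtx, mink_vtxVec_nrm, sub_self, show k - 1 - k = -1 by ring]
  have h5 := sqrt_two_sq
  change _ * ((√2 / 2 + 1) * (2 - √2) - 1) = 0
  linear_combination (-(3 + 2 * √2) * inS / 2) * h5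

theorem mink_vtx_succ_nrm (k : ZMod 8) : mink (hyp (vtx (k + 1))) (nrm k) = 0 := by
  rw [hyp_vtx, mink_vtxVec_nrm, show k + 1 - 1 - k = 0 by ring, show k + 1 - k = 1 by ring]
  have h5 := sqrt_two_sq
  change _ * ((1 + √2 / 2) * (2 - √2) - 1) = 0
  linear_combination (-(3 + 2 * √2) * inS / 2) * h5

/-- The rotation of the octagon by an eighth of a turn. -/
def rotT : TriGroup := triSys.simple 1 * triSys.simple 0

theorem rotT_mem : rotT ∈ octSym := mul_mem simple_one_mem_octSym simple_zero_mem_octSym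

theorem lin_rotT (v : Fin 3 → ℝ) :
    lin (triHom rotT) v = ![√2 / 2 * (v 0 - v 1), √2 / 2 * (v 0 + v 1), v 2] := by
  rw [rotT, map_mul, triHom_simple, triHom_simple, lin_mul, lin_triRefl_zero, lin_triRefl_one]
  ext i
  fin_cases i
  · change √2 / 2 * (v 0 + -v 1) = √2 / 2 * (v 0 - v 1); ring
  · change √2 / 2 * (v 0 - -v 1) = √2 / 2 * (v 0 + v 1); ring
  · rfl

theorem rotT_nrm (k : ZMod 8) : lin (triHom rotT) (nrm k) = nrm (k + 1) := by
  rw [lin_rotT, nrm, nrm, ck_add_one, sk_add_one]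
  ext i
  fin_cases i <;> simp only [Fin.zero_eta, Fin.mk_one, Fin.reduceFinMk, Matrix.cons_val_zero,
    Matrix.cons_val_one, Matrix.cons_val] <;> ring

theorem rotT_mid (k : ZMod 8) : triHom rotT (mid k) = mid (k + 1) := by
  apply hyp_injective
  rw [hyp_apply, hyp_mid, hyp_mid, lin_rotT, midVec, midVec, ck_add_one, sk_add_one]
  ext i
  fin_cases i <;> simp only [Fin.zero_eta, Fin.mk_one, Fin.reduceFinMk, Matrix.cons_val_zero,
    Matrix.cons_val_one, Matrix.cons_val] <;> ring

theorem rotT_vtx (k : ZMod 8) : triHom rotT (vtx k) = vtx (k + 1) := by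
  apply hyp_injective
  rw [hyp_apply, hyp_vtx, hyp_vtx, lin_rotT, vtxVec, vtxVec, ck_add_one, sk_add_one,
    show k + 1 - 1 = k - 1 + 1 by ring, ck_add_one, sk_add_one]
  ext i
  fin_cases i <;> simp only [Fin.zero_eta, Fin.mk_one, Fin.reduceFinMk, Matrix.cons_val_zero,
    Matrix.cons_val_one, Matrix.cons_val] <;> ring

theorem octSym_fixes_I {d : TriGroup} (hd : d ∈ octSym) :
    triHom d UpperHalfPlane.I = UpperHalfPlane.I := by
  induction hd using Subgroup.closure_induction with
  | mem x hx =>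
    apply hyp_injective
    rcases hx with rfl | rfl
    · rw [hyp_apply, triHom_simple, lin_triRefl_zero, hyp_I]
      ext i; fin_cases i <;> simp
    · rw [hyp_apply, triHom_simple, lin_triRefl_one, hyp_I]
      ext i; fin_cases i <;> simp
  | one => rw [map_one]; rfl
  | mul x y _ _ hx hy => rw [map_mul, IsometryEquiv.mul_apply, hy, hx]
  | inv x _ hx =>
    rw [map_inv]
    conv_lhs => rw [← hx]
    exact IsometryEquiv.inv_apply_self _ _

theorem octSym_vtx {d : TriGroup} (hd : d ∈ octSym) :
    ∃ e : ZMod 8 ≃ ZMod 8, ∀ k, triHom d (vtx k) = vtx (e k) := by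
  induction hd using Subgroup.closure_induction with
  | mem x hx =>
    rcases hx with rfl | rfl
    · refine ⟨Equiv.subLeft 1, fun k => hyp_injective ?_⟩
      rw [triHom_simple, hyp_apply, hyp_vtx, hyp_vtx, lin_triRefl_zero, Equiv.subLeft_apply,
        vtxVec, vtxVec, show (1 : ZMod 8) - k - 1 = -k by ring, ck_neg, sk_neg,
        ← neg_sub k 1, ck_neg, sk_neg]
      ext i
      fin_cases i <;> simp only [Fin.zero_eta, Fin.mk_one, Fin.reduceFinMk, Matrix.cons_val_zero,
    Matrix.cons_val_one, Matrix.cons_val] <;> ring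
    · refine ⟨Equiv.subLeft 2, fun k => hyp_injective ?_⟩
      rw [triHom_simple, hyp_apply, hyp_vtx, hyp_vtx, lin_triRefl_one, Equiv.subLeft_apply,
        vtxVec, vtxVec, show (2 : ZMod 8) - k - 1 = 1 - k by ring,
        show (2 : ZMod 8) - k = 1 - (k - 1) by ring, ck_one_sub, sk_one_sub, ck_one_sub,
        sk_one_sub]
      ext i
      fin_cases i <;> simp only [Fin.zero_eta, Fin.mk_one, Fin.reduceFinMk, Matrix.cons_val_zero,
    Matrix.cons_val_one, Matrix.cons_val] <;> ring
  | one => exact ⟨Equiv.refl _, fun k => by rw [map_one]; rfl⟩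
  | mul x y _ _ hx hy =>
    obtain ⟨e, he⟩ := hx
    obtain ⟨f, hf⟩ := hy
    exact ⟨f.trans e, fun k => by rw [map_mul, IsometryEquiv.mul_apply, hf, he]; rfl⟩
  | inv x _ hx =>
    obtain ⟨e, he⟩ := hx
    exact ⟨e.symm, fun k => by
      conv_lhs => rw [← e.apply_symm_apply k, ← he, map_inv, IsometryEquiv.inv_apply_self]⟩

theorem zmod_rec {P : ZMod 8 → Prop} (h0 : P 0) (hs : ∀ k, P k → P (k + 1)) (k : ZMod 8) :
    P k := by
  obtain ⟨n, rfl⟩ : ∃ n : ℕ, (n : ZMod 8) = k := ⟨k.val, ZMod.natCast_zmod_val k⟩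
  induction n with
  | zero => simpa using h0
  | succ n ih => rw [Nat.cast_succ]; exact hs _ ih

theorem geodesicSegment_image (φ : ℍ ≃ᵢ ℍ) (a b : ℍ) :
    φ '' geodesicSegment a b = geodesicSegment (φ a) (φ b) := by
  ext z
  constructor
  · rintro ⟨y, hy, rfl⟩
    change dist (φ a) (φ y) + dist (φ y) (φ b) = dist (φ a) (φ b)
    rw [φ.dist_eq, φ.dist_eq, φ.dist_eq]; exact hy
  · intro hz
    refine ⟨φ⁻¹ z, ?_, IsometryEquiv.apply_inv_self _ _⟩
    change dist a (φ⁻¹ z) + dist (φ⁻¹ z) b = dist a b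
    rw [← φ.dist_eq a, ← φ.dist_eq _ b, ← φ.dist_eq a b, IsometryEquiv.apply_inv_self]
    exact hz

theorem IsGeodesicallyConvex.image {S : Set ℍ} (h : IsGeodesicallyConvex S) (φ : ℍ ≃ᵢ ℍ) :
    IsGeodesicallyConvex (φ '' S) := by
  rintro _ ⟨a, ha, rfl⟩ _ ⟨b, hb, rfl⟩
  rw [← geodesicSegment_image]
  exact image_mono (h a ha b hb)

/-- Normalising `s b + t c` gives a point of the segment from `b` to `c`, and `z` lies on the
segment from `a` to that point. -/
theorem IsGeodesicallyConvex.mem_of_cone {S : Set ℍ} (h : IsGeodesicallyConvex S) {a b c z : ℍ}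
    (ha : a ∈ S) (hb : b ∈ S) (hc : c ∈ S) {r s t : ℝ} (hr : 0 ≤ r) (hs : 0 ≤ s) (ht : 0 ≤ t)
    (hz : hyp z = r • hyp a + (s • hyp b + t • hyp c)) : z ∈ S := by
  by_cases h0 : s = 0 ∧ t = 0
  · rw [h0.1, h0.2] at hz
    exact h a ha b hb (mem_geodesicSegment_iff.2 ⟨r, 0, hr, le_rfl, by rw [hz]; simp⟩)
  have hst : 0 < s + t := by
    rcases hs.eq_or_lt with h1 | h1
    · rcases ht.eq_or_lt with h2 | h2
      · exact absurd ⟨h1.symm, h2.symm⟩ h0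
      · linarith
    · linarith
  have hbc := mink_hyp_le b c
  have hneg : mink (s • hyp b + t • hyp c) (s • hyp b + t • hyp c) < 0 := by
    simp only [mink_add_left, mink_add_right, mink_smul_left, mink_smul_right, mink_hyp_self,
      mink_comm (hyp c) (hyp b)]
    nlinarith [mul_nonneg hs ht, sq_pos_of_pos hst]
  have h2 : 0 < (s • hyp b + t • hyp c) 2 := by
    have h1 := hyp_two_pos b
    have h2 := hyp_two_pos c
    simp only [Pi.add_apply, Pi.smul_apply, smul_eq_mul]
    rcases hs.eq_or_lt with h3 | h3
    · have : 0 < t := by linarith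
      rw [← h3]; nlinarith [mul_pos this h2]
    · have := mul_pos h3 h1
      have := mul_nonneg ht h2.le
      linarith
  obtain ⟨y, c', hc', hy⟩ := exists_hyp_eq_smul hneg h2
  have hyS : y ∈ S := h b hb c hc (mem_geodesicSegment_iff.2
    ⟨c' * s, c' * t, by positivity, by positivity, by rw [hy]; module⟩)
  refine h a ha y hyS (mem_geodesicSegment_iff.2 ⟨r, c'⁻¹, hr, by positivity, ?_⟩)
  rw [hz, hy, smul_smul, inv_mul_cancel₀ hc'.ne', one_smul]

theorem isGeodesicallyConvex_octagon : IsGeodesicallyConvex octagon := by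
  intro a ha b hb z hz k
  obtain ⟨s, t, hs, ht, h⟩ := mem_geodesicSegment_iff.1 hz
  rw [h, mink_add_left, mink_smul_left, mink_smul_left]
  nlinarith [ha k, hb k]

theorem vtxVec_zero : vtxVec 0 = ![inS * (1 + √2), -inS, 3 + 2 * √2] := by
  have h := sqrt_two_sq
  ext i
  fin_cases i
  · change √2 * inS * (√2 / 2 + 1) = inS * (1 + √2)
    linear_combination inS / 2 * h
  · change √2 * inS * (-(√2 / 2) + 0) = -inS
    linear_combination -inS / 2 * h
  · rfl

theorem vtxVec_one : vtxVec 1 = ![inS * (1 + √2), inS, 3 + 2 * √2] := by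
  have h := sqrt_two_sq
  ext i
  fin_cases i
  · change √2 * inS * (1 + √2 / 2) = inS * (1 + √2)
    linear_combination inS / 2 * h
  · change √2 * inS * (0 + √2 / 2) = inS
    linear_combination inS / 2 * h
  · rfl

theorem vtxVec_add_four (k : ZMod 8) (i : Fin 3) (hi : i ≠ 2) :
    vtxVec (k + 4) i = -vtxVec k i := by
  have h := sqrt_two_sq
  have c4 : ∀ j, ck (j + 4) = -ck j := fun j => by
    rw [show j + 4 = j - (-4) by ring, ck_sub]
    change ck j * (-1) + sk j * 0 = _; ring
  have s4 : ∀ j, sk (j + 4) = -sk j := fun j => by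
    have e : j + 4 = j + 1 + 1 + 1 + 1 := by ring
    rw [e]; simp only [ck_add_one, sk_add_one]; grind
  fin_cases i
  · simp only [vtxVec, show k + 4 - 1 = k - 1 + 4 by ring, c4]; simp; ring
  · simp only [vtxVec, show k + 4 - 1 = k - 1 + 4 by ring, s4]; simp; ring
  · exact absurd rfl hi

/-- After folding, the point lies in the triangle with corners the centre and the vertices `0` and
`1`. The centre belongs to every convex set containing the vertices because it is the midpoint of
the opposite vertices `0` and `4`. -/
theorem octagon_eq_hull : octagon = geodesicHull (range vtx) := by
  refine Subset.antisymm ?_ ?_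
  · rintro z hz C ⟨hC, hconv⟩
    obtain ⟨d, hd, hdz⟩ := octagon_subset_iUnion hz
    obtain ⟨e, he⟩ := octSym_vtx hd
    have hC' : ∀ k, vtx k ∈ triHom d '' C := fun k =>
      ⟨vtx (e.symm k), hC ⟨_, rfl⟩, by rw [he, e.apply_symm_apply]⟩
    have hconv' := hconv.image (triHom d)
    have hpos := sqrt_two_pos
    have h2 := sqrt_two_sq
    have hS := inS_pos
    have hI : UpperHalfPlane.I ∈ triHom d '' C := by
      refine hconv' _ (hC' 0) _ (hC' 4) (mem_geodesicSegment_iff.2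
        ⟨1 / (2 * (3 + 2 * √2)), 1 / (2 * (3 + 2 * √2)), by positivity, by positivity, ?_⟩)
      have a4 := vtxVec_add_four 0
      rw [zero_add] at a4
      rw [hyp_I, hyp_vtx, hyp_vtx]
      ext i
      fin_cases i
      · simp [a4 0 (by decide)]
      · simp [a4 1 (by decide)]
      · simp [vtxVec]; field_simp; ring
    have key : triHom d z ∈ triHom d '' C := by
      have h0 := hdz 0
      have h1 := hdz 1
      have h2' := hdz 2
      have hk := kap_pos
      simp [mink, root] at h0 h1 h2'
      set x := hyp (triHom d z) 0
      set y := hyp (triHom d z) 1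
      set w := hyp (triHom d z) 2
      have hxy : y * (1 + √2) ≤ x := by
        have e : y * (kap / 2) - x * (kap / (2 * (1 + √2))) =
            (y * (1 + √2) - x) * (kap / (2 * (1 + √2))) := by field_simp
        have h3 : (y * (1 + √2) - x) * (kap / (2 * (1 + √2))) ≤ 0 := by rw [← e]; linarith
        have h4 : 0 < kap / (2 * (1 + √2)) := by positivity
        nlinarith
      have hx : 0 ≤ x := le_trans (by positivity) hxy
      -- The coefficients solve the linear system for these three corners; their signs are the
      -- inequalities of side `0` and of the two walls through the centre.
      refine hconv'.mem_of_cone hI (hC' 0) (hC' 1) (r := (w * inS - (1 + √2) * x) / inS)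
        (s := (x - y * (1 + √2)) / (2 * inS * (1 + √2)))
        (t := (x + y * (1 + √2)) / (2 * inS * (1 + √2))) ?_ ?_ ?_ ?_
      · exact div_nonneg (by linarith) hS.le
      · exact div_nonneg (by linarith) (by positivity)
      · exact div_nonneg (by positivity) (by positivity)
      · rw [hyp_I, hyp_vtx, hyp_vtx, vtxVec_zero, vtxVec_one]
        have e3 : 3 + 2 * √2 = (1 + √2) ^ 2 := by linear_combination -h2
        ext i
        fin_cases i
        · simp; change x = _; field_simp; ring
        · simp; change y = _; field_simp; ring
        · simp; change w = _; rw [e3]; field_simp; ring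
    obtain ⟨z', hz', h⟩ := key
    rwa [← (triHom d).injective h]
  · refine sInter_subset_of_mem ⟨?_, isGeodesicallyConvex_octagon⟩
    rintro _ ⟨k, rfl⟩
    exact vtx_mem_octagon k

/-- On the triangle the wall inequalities bound `x² + y² = w² - 1` by a multiple of `w²` smaller
than one. The bound is `(3 + 2√2)²`, the value at the vertices. -/
theorem cosh_dist_I_le {z : ℍ} (hz : z ∈ octagon) : hyp z 2 ^ 2 ≤ 17 + 12 * √2 := by
  obtain ⟨d, hd, hdz⟩ := octagon_subset_iUnion hz
  have e : hyp z 2 = hyp (triHom d z) 2 := by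
    have := mink_hyp_isometry (triHom d) UpperHalfPlane.I z
    rw [octSym_fixes_I hd, mink_hyp_I, mink_hyp_I] at this
    linarith
  rw [e]
  have h0 := hdz 0
  have h1 := hdz 1
  have h2' := hdz 2
  have hk := kap_pos
  have hpos := sqrt_two_pos
  have h2 := sqrt_two_sq
  have hS := inS_sq
  have hn := mink_hyp_self (triHom d z)
  have hw := hyp_two_pos (triHom d z)
  simp [mink, root] at h0 h1 h2' hn
  set x := hyp (triHom d z) 0
  set y := hyp (triHom d z) 1
  set w := hyp (triHom d z) 2
  have hxy : y * (1 + √2) ≤ x := by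
    have e : y * (kap / 2) - x * (kap / (2 * (1 + √2))) =
        (y * (1 + √2) - x) * (kap / (2 * (1 + √2))) := by field_simp
    have h3 : (y * (1 + √2) - x) * (kap / (2 * (1 + √2))) ≤ 0 := by rw [← e]; linarith
    have h4 : 0 < kap / (2 * (1 + √2)) := by positivity
    nlinarith
  have hx : 0 ≤ x := le_trans (by positivity) hxy
  have a1 : (y * (1 + √2)) ^ 2 ≤ x ^ 2 := pow_le_pow_left₀ (by positivity) hxy 2
  have a2 : (x * (1 + √2)) ^ 2 ≤ (w * inS) ^ 2 :=
    pow_le_pow_left₀ (by positivity) (by linarith) 2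
  have a3 : x ^ 2 * (3 + 2 * √2) ≤ w ^ 2 * (2 + 2 * √2) := by
    have : (w * inS) ^ 2 = w ^ 2 * (2 + 2 * √2) := by rw [mul_pow, hS]
    nlinarith
  have a4 : y ^ 2 * (3 + 2 * √2) ≤ x ^ 2 := by nlinarith
  have a5 : x ^ 2 + y ^ 2 = w ^ 2 - 1 := by linarith
  have c1 : (3 + 2 * √2) ^ 2 = 17 + 12 * √2 := by linear_combination 4 * h2
  have a6 : (x ^ 2 + y ^ 2) * (17 + 12 * √2) ≤ w ^ 2 * (16 + 12 * √2) := by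
    have b1 : x ^ 2 * (3 + 2 * √2) * (4 + 2 * √2) ≤ w ^ 2 * (2 + 2 * √2) * (4 + 2 * √2) :=
      mul_le_mul_of_nonneg_right a3 (by positivity)
    have b2 : y ^ 2 * (3 + 2 * √2) * (3 + 2 * √2) ≤ x ^ 2 * (3 + 2 * √2) :=
      mul_le_mul_of_nonneg_right a4 (by positivity)
    have e1 : w ^ 2 * (2 + 2 * √2) * (4 + 2 * √2) = w ^ 2 * (16 + 12 * √2) := by
      linear_combination 4 * w ^ 2 * h2
    have e2 : (x ^ 2 + y ^ 2) * (17 + 12 * √2) =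
        x ^ 2 * (3 + 2 * √2) * (3 + 2 * √2) + y ^ 2 * (3 + 2 * √2) * (3 + 2 * √2) := by
      rw [← c1]; ring
    rw [e2]
    nlinarith
  rw [a5] at a6
  linarith

theorem isCompact_octagon : IsCompact octagon := by
  refine Metric.isCompact_of_isClosed_isBounded isClosed_octagon
    ((Metric.isBounded_closedBall (x := UpperHalfPlane.I) (r := 17 + 12 * √2)).subset ?_)
  intro z hz
  have h1 := cosh_dist_I_le hz
  have h2 := hyp_two_pos z
  have h3 := sqrt_two_pos
  have h4 : Real.cosh (dist z UpperHalfPlane.I) = hyp z 2 := by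
    rw [cosh_dist_eq, mink_comm, mink_hyp_I, neg_neg]
  have h5 := Real.one_le_cosh (dist z UpperHalfPlane.I)
  have h6 := dist_sq_le z UpperHalfPlane.I
  rw [← cosh_dist_eq, h4] at h6
  rw [h4] at h5
  rw [Metric.mem_closedBall]
  have h7 : hyp z 2 ≤ 17 + 12 * √2 := by nlinarith
  by_contra hcon
  push Not at hcon
  nlinarith

theorem octagon_interior_eq : interior octagon = {z | ∀ k, mink (hyp z) (nrm k) < 0} := by
  refine Subset.antisymm ?_ (interior_maximal (fun z hz k => (hz k).le) ?_)
  · intro z hz k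
    by_contra hcon
    have h0 : mink (hyp z) (nrm k) = 0 :=
      le_antisymm (interior_subset hz k) (not_lt.1 hcon)
    -- A point on side `k` leaves the octagon along the geodesic in the direction of the normal of
    -- that side, so it is not interior.
    obtain ⟨γ, hγ, hγ0, hγs⟩ := exists_geodesic_line (mink_nrm_self k) h0
    have h1 : ∀ᶠ s in 𝓝 (0 : ℝ), γ s ∈ interior octagon :=
      hγ.continuous.continuousAt.eventually (by rw [hγ0]; exact isOpen_interior.mem_nhds hz)
    obtain ⟨ε, hε, h2⟩ := Metric.eventually_nhds_iff.1 h1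
    have h3 := interior_subset (h2 (y := ε / 2) (by
      rw [Real.dist_eq, sub_zero, abs_of_pos (by positivity)]; linarith)) k
    rw [hγs, mink_add_left, mink_smul_left, mink_smul_left, h0, mink_nrm_self] at h3
    have : 0 < Real.sinh (ε / 2) := Real.sinh_pos_iff.2 (by positivity)
    linarith
  · have : {z : ℍ | ∀ k, mink (hyp z) (nrm k) < 0} = ⋂ k, {z : ℍ | mink (hyp z) (nrm k) < 0} := by
      ext z; simp
    rw [this]
    exact isOpen_iInter_of_finite fun i => isOpen_mink_lt _ _

theorem I_mem_interior_octagon : UpperHalfPlane.I ∈ interior octagon := by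
  rw [octagon_interior_eq]
  intro k
  rw [mink_hyp_I]
  change -inS < 0
  linarith [inS_pos]

theorem segment_subset_interior_octagon {z : ℍ} (hz : z ∈ octagon) {p : ℍ} {s t : ℝ}
    (hs : 0 ≤ s) (ht : 0 < t) (h : hyp p = s • hyp z + t • hyp UpperHalfPlane.I) :
    p ∈ interior octagon := by
  rw [octagon_interior_eq]
  intro k
  rw [h, mink_add_left, mink_smul_left, mink_smul_left]
  have h1 := hz k
  have h2 := I_mem_interior_octagon
  rw [octagon_interior_eq] at h2
  nlinarith [h2 k]

theorem closure_interior_octagon : closure (interior octagon) = octagon := by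
  refine Subset.antisymm (closure_minimal interior_subset isClosed_octagon) fun z hz => ?_
  by_cases hzI : z = UpperHalfPlane.I
  · rw [hzI]; exact subset_closure I_mem_interior_octagon
  rw [Metric.mem_closure_iff]
  intro ε hε
  obtain ⟨p, hp, s, t, hs, ht, h⟩ := exists_near_mem_segment hzI hε
  exact ⟨p, segment_subset_interior_octagon hz hs ht h, hp⟩

theorem isConnected_interior_octagon : IsConnected (interior octagon) := by
  refine ⟨⟨_, I_mem_interior_octagon⟩, isPreconnected_of_forall UpperHalfPlane.I fun z hz => ?_⟩
  refine ⟨geodesicSegment z UpperHalfPlane.I, ?_, right_mem_geodesicSegment _ _,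
    left_mem_geodesicSegment _ _, (isConnected_geodesicSegment _ _).isPreconnected⟩
  intro p hp
  obtain ⟨s, t, hs, ht, h⟩ := mem_geodesicSegment_iff.1 hp
  rcases ht.eq_or_lt with rfl | ht
  · rw [zero_smul, add_zero] at h
    have h3 := mink_hyp_self p
    rw [h, mink_smul_left, mink_smul_right, mink_hyp_self] at h3
    have h4 : s = 1 := by nlinarith
    rw [h4, one_smul] at h
    rwa [hyp_injective h]
  · exact segment_subset_interior_octagon (interior_subset hz) hs ht h

theorem isBody_octagon : IsBody octagon := by
  refine ⟨isCompact_octagon, ?_, closure_interior_octagon⟩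
  rw [← closure_interior_octagon]
  exact isConnected_interior_octagon.closure

/-! ### The regular octagon, its sides and the side pairings -/

theorem hypAngle_eq {a b c : ℍ} {x y : ℝ} (h1 : Real.cosh (dist a b) = x)
    (h2 : Real.cosh (dist b c) = x) (h3 : Real.cosh (dist a c) = y)
    (h : x ^ 2 - y = √2 / 2 * (x ^ 2 - 1)) (hx : 1 < x) : hypAngle a b c = 2 * Real.pi / 8 := by
  have hd : dist a b = dist b c := dist_eq_of_cosh_eq (by rw [h1, h2])
  have hs : Real.sinh (dist a b) * Real.sinh (dist b c) = x ^ 2 - 1 := by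
    rw [← hd, ← sq, Real.sinh_sq, h1]
  rw [hypAngle, hs, h1, h2, h3, ← sq, h, mul_div_assoc, div_self (by nlinarith), mul_one,
    ← Real.cos_pi_div_four, Real.arccos_cos (by positivity) (by linarith [Real.pi_pos])]
  ring

theorem cosh_dist_vtx (j k : ZMod 8) :
    Real.cosh (dist (vtx j) (vtx k)) = 17 + 12 * √2 - (16 + 12 * √2) * ck (j - k) := by
  rw [cosh_dist_eq, hyp_vtx, hyp_vtx, mink_vtxVec]; ring

theorem vtx_injective : Function.Injective vtx := by
  intro j k h
  by_contra hne
  have h1 := cosh_dist_vtx j k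
  rw [h, dist_self, Real.cosh_zero] at h1
  have h2 := ck_le_of_ne (sub_ne_zero.2 hne)
  nlinarith [sqrt_two_pos, sqrt_two_lt]

theorem cosh_dist_vtx_I (k : ZMod 8) :
    Real.cosh (dist (vtx k) UpperHalfPlane.I) = 3 + 2 * √2 := by
  rw [cosh_dist_eq, mink_comm, mink_hyp_I, hyp_vtx, neg_neg]; rfl

theorem isRegularOctagon_octagon : IsRegularOctagon vtx octagon := by
  refine ⟨vtx_injective, ⟨UpperHalfPlane.I, triHom rotT, octSym_fixes_I rotT_mem, rotT_vtx, ?_⟩,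
    octagon_eq_hull⟩
  have h2 := sqrt_two_sq
  have h := cosh_dist_vtx 0 1
  rw [zero_sub, ck_neg] at h
  refine hypAngle_eq (cosh_dist_vtx_I 0) (by rw [dist_comm]; exact cosh_dist_vtx_I 1) h ?_
    (by linarith [sqrt_two_pos])
  change _ - (_ - _ * (√2 / 2)) = _
  linear_combination (4 - 2 * √2) * h2

theorem hypAngle_vtx (k : ZMod 8) :
    hypAngle (vtx (k - 1)) (vtx k) (vtx (k + 1)) = 2 * Real.pi / 8 := by
  have h2 := sqrt_two_sq
  have e1 : ck (-1) = √2 / 2 := rfl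
  have e2 : ck (-2) = 0 := rfl
  have a1 := cosh_dist_vtx (k - 1) k
  have a2 := cosh_dist_vtx k (k + 1)
  have a3 := cosh_dist_vtx (k - 1) (k + 1)
  rw [show k - 1 - k = -1 by ring, e1] at a1
  rw [show k - (k + 1) = -1 by ring, e1] at a2
  rw [show k - 1 - (k + 1) = -2 by ring, e2] at a3
  refine hypAngle_eq a1 a2 a3 ?_ (by nlinarith [sqrt_two_pos])
  generalize √2 = q at *
  have : 17 + 12 * q - (16 + 12 * q) * (q / 2) = 5 + 4 * q := by linear_combination -6 * h2
  rw [this]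
  linear_combination (-4 - 8 * q) * h2

theorem rotT_pow_mid (n : ℕ) (k : ZMod 8) : triHom (rotT ^ n) (mid k) = mid (k + n) := by
  induction n with
  | zero => simp
  | succ n ih =>
    rw [pow_succ', map_mul, IsometryEquiv.mul_apply, ih, rotT_mid, Nat.cast_succ, add_assoc]

theorem rotT_pow_nrm (n : ℕ) (k : ZMod 8) : lin (triHom (rotT ^ n)) (nrm k) = nrm (k + n) := by
  induction n with
  | zero => simp [lin_one]
  | succ n ih =>
    rw [pow_succ', map_mul, lin_mul, ih, rotT_nrm, Nat.cast_succ, add_assoc]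

theorem rotT_pow_vtx (n : ℕ) (k : ZMod 8) : triHom (rotT ^ n) (vtx k) = vtx (k + n) := by
  induction n with
  | zero => simp
  | succ n ih =>
    rw [pow_succ', map_mul, IsometryEquiv.mul_apply, ih, rotT_vtx, Nat.cast_succ, add_assoc]

theorem refl_nrm_succ (k : ZMod 8) : refl (nrm (k + 1)) (mink_nrm_self _) =
    triHom rotT * refl (nrm k) (mink_nrm_self _) * (triHom rotT)⁻¹ := by
  refine eq_of_lin_eq fun v => ?_
  obtain ⟨w, rfl⟩ : ∃ w, lin (triHom rotT) w = v := ⟨_, lin_apply_inv _ v⟩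
  rw [lin_mul, lin_mul, lin_inv_apply, lin_refl, lin_refl, reflVec, reflVec, ← rotT_nrm, mink_lin,
    map_sub, map_smul]

theorem triRefl_zero_mid (k : ZMod 8) : triRefl 0 (mid k) = mid (-k) := by
  apply hyp_injective
  rw [hyp_apply, lin_triRefl_zero, hyp_mid, hyp_mid, midVec, midVec, ck_neg, sk_neg]
  ext i
  fin_cases i <;> simp

theorem triRefl_zero_vtx (k : ZMod 8) : triRefl 0 (vtx k) = vtx (1 - k) := by
  apply hyp_injective
  rw [hyp_apply, hyp_vtx, hyp_vtx, lin_triRefl_zero,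
    vtxVec, vtxVec, show (1 : ZMod 8) - k - 1 = -k by ring, ck_neg, sk_neg,
    ← neg_sub k 1, ck_neg, sk_neg]
  ext i
  fin_cases i <;> simp only [Fin.zero_eta, Fin.mk_one, Fin.reduceFinMk, Matrix.cons_val_zero,
    Matrix.cons_val_one, Matrix.cons_val] <;> ring

/-- The side pairing is a symmetry `d` of the octagon that carries side `k + 4` to side `k` with end
points in reverse order, followed by the reflection in side `k`. For side `0` it is `s₂ · rotT⁴ ·
s₀`, where the retraction of `s₂` cancels the rest; the other sides follow by conjugation with the
rotation, since the kernel is normal. -/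
theorem exists_gen (k : ZMod 8) : ∃ w ∈ retr.ker, ∃ d ∈ octSym,
    triHom w = refl (nrm k) (mink_nrm_self k) * triHom d ∧ triHom d (vtx (k + 4)) = vtx (k + 1) ∧
    triHom d (vtx (k + 5)) = vtx k ∧ triHom d (mid (k + 4)) = mid k := by
  induction k using zmod_rec with
  | h0 =>
    have hd : rotT ^ 4 * triSys.simple 0 ∈ octSym :=
      mul_mem (pow_mem rotT_mem 4) simple_zero_mem_octSym
    refine ⟨triSys.simple 2 * (rotT ^ 4 * triSys.simple 0), ?_, _, hd, ?_, ?_, ?_, ?_⟩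
    · change retr _ = 1
      rw [map_mul, retr_of_mem_octSym hd, retr_simple]
      change triSys.simple 0 * (triSys.simple 0 * triSys.simple 1) ^ 4 *
        ((triSys.simple 1 * triSys.simple 0) ^ 4 * triSys.simple 0) = 1
      have h : (triSys.simple 1 * triSys.simple 0) = (triSys.simple 0 * triSys.simple 1)⁻¹ := by
        rw [mul_inv_rev, triSys.inv_simple, triSys.inv_simple]
      rw [h, inv_pow, mul_assoc, mul_inv_cancel_left, triSys.simple_mul_simple_self]
    · rw [map_mul, triHom_simple]
      congr 1
      simp only [triRefl, nrm_zero]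
    all_goals
      rw [map_mul, triHom_simple, IsometryEquiv.mul_apply]
      first | rw [triRefl_zero_vtx, rotT_pow_vtx] | rw [triRefl_zero_mid, rotT_pow_mid]
      congr 1
  | hs k ih =>
    obtain ⟨w, hw, d, hd, h1, h2, h3, h4⟩ := ih
    have hinv : ∀ z, (triHom rotT)⁻¹ (triHom rotT z) = z := IsometryEquiv.inv_apply_self _
    refine ⟨rotT * w * rotT⁻¹, (MonoidHom.normal_ker retr).conj_mem w hw rotT, rotT * d * rotT⁻¹,
      mul_mem (mul_mem rotT_mem hd) (inv_mem rotT_mem), ?_, ?_, ?_, ?_⟩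
    · simp only [map_mul, map_inv, h1, refl_nrm_succ]
      group
    · rw [show k + 1 + 4 = k + 4 + 1 by ring, ← rotT_vtx, ← rotT_vtx, map_mul, map_mul, map_inv,
        IsometryEquiv.mul_apply, IsometryEquiv.mul_apply, hinv, h2]
    · rw [show k + 1 + 5 = k + 5 + 1 by ring, ← rotT_vtx, ← rotT_vtx, map_mul, map_mul, map_inv,
        IsometryEquiv.mul_apply, IsometryEquiv.mul_apply, hinv, h3]
    · rw [show k + 1 + 4 = k + 4 + 1 by ring, ← rotT_mid, ← rotT_mid, map_mul, map_mul, map_inv,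
        IsometryEquiv.mul_apply, IsometryEquiv.mul_apply, hinv, h4]

/-- The element of the surface group that maps side `k + 4` to side `k`. -/
def gen (k : ZMod 8) : ℍ ≃ᵢ ℍ := triHom (exists_gen k).choose

theorem gen_mem (k : ZMod 8) : gen k ∈ surfGroup := ⟨_, (exists_gen k).choose_spec.1, rfl⟩

theorem gen_spec (k : ZMod 8) : ∃ d ∈ octSym,
    gen k = refl (nrm k) (mink_nrm_self k) * triHom d ∧ triHom d (vtx (k + 4)) = vtx (k + 1) ∧
    triHom d (vtx (k + 5)) = vtx k ∧ triHom d (mid (k + 4)) = mid k :=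
  (exists_gen k).choose_spec.2

theorem gen_image_octagon (k : ZMod 8) :
    gen k '' octagon = refl (nrm k) (mink_nrm_self k) '' octagon := by
  obtain ⟨d, hd, h, -⟩ := gen_spec k
  conv_rhs => rw [← image_octagon_of_mem_octSym hd, image_image]
  rw [h]; rfl

theorem mem_gen_image_octagon {k : ZMod 8} {z : ℍ} :
    z ∈ gen k '' octagon ↔ refl (nrm k) (mink_nrm_self k) z ∈ octagon := by
  rw [gen_image_octagon]
  constructor
  · rintro ⟨y, hy, rfl⟩; rwa [refl_refl]
  · exact fun h => ⟨_, h, refl_refl _ _ _⟩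

theorem mink_refl_nrm_self (k : ZMod 8) (z : ℍ) :
    mink (hyp (refl (nrm k) (mink_nrm_self k) z)) (nrm k) = -mink (hyp z) (nrm k) := by
  rw [hyp_refl, reflVec, mink_sub_left, mink_smul_left, mink_nrm_self]; ring

theorem gen_mid (k : ZMod 8) : gen k (mid (k + 4)) = mid k := by
  obtain ⟨d, hd, h, -, -, h4⟩ := gen_spec k
  rw [h, IsometryEquiv.mul_apply, h4, refl_eq_self_iff, mink_mid_nrm_self]

theorem gen_image_side (k : ZMod 8) : gen k '' side vtx (k + 4) = side vtx k := by
  obtain ⟨d, hd, h, h2, h3, -⟩ := gen_spec k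
  rw [side, side, geodesicSegment_image, h, IsometryEquiv.mul_apply, IsometryEquiv.mul_apply, h2,
    show k + 4 + 1 = k + 5 by ring, h3, (refl_eq_self_iff _).2 (mink_vtx_nrm_self k),
    (refl_eq_self_iff _).2 (mink_vtx_succ_nrm k)]
  ext z
  simp only [geodesicSegment, mem_ofPred_eq]
  rw [dist_comm (vtx (k + 1)) z, dist_comm z (vtx k), dist_comm (vtx (k + 1)) (vtx k), add_comm]

theorem side_zero_eq : side vtx 0 = octagon ∩ {z | mink (hyp z) (nrm 0) = 0} := by
  ext z
  constructor
  · intro hz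
    refine ⟨isGeodesicallyConvex_octagon _ (vtx_mem_octagon _) _ (vtx_mem_octagon _) hz, ?_⟩
    obtain ⟨s, t, -, -, h⟩ := mem_geodesicSegment_iff.1 hz
    change mink _ _ = 0
    rw [h, mink_add_left, mink_smul_left, mink_smul_left, mink_vtx_nrm_self, mink_vtx_succ_nrm]
    ring
  · rintro ⟨hz, h0⟩
    have h2 := sqrt_two_sq
    have hS := inS_pos
    have hp := sqrt_two_pos
    have hlt := sqrt_two_lt
    have h0 : hyp z 0 * ((1 + √2) * 1) + hyp z 1 * ((1 + √2) * 0) - hyp z 2 * inS = 0 := h0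
    have h1 : hyp z 0 * ((1 + √2) * (√2 / 2)) + hyp z 1 * ((1 + √2) * (√2 / 2)) -
      hyp z 2 * inS ≤ 0 := hz 1
    have h7 : hyp z 0 * ((1 + √2) * (√2 / 2)) + hyp z 1 * ((1 + √2) * -(√2 / 2)) -
      hyp z 2 * inS ≤ 0 := hz 7
    -- The weights solve for the combination of the vertices `0` and `1`. Their nonnegativity comes
    -- from the inequalities of the neighbouring sides `1` and `7`.
    refine mem_geodesicSegment_iff.2
      ⟨(hyp z 2 / (3 + 2 * √2) - hyp z 1 / inS) / 2, (hyp z 2 / (3 + 2 * √2) + hyp z 1 / inS) / 2,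
        ?_, ?_, ?_⟩
    · have : hyp z 1 / inS ≤ hyp z 2 / (3 + 2 * √2) := by
        rw [div_le_div_iff₀ hS (by positivity)]
        have e : (hyp z 2 * inS - hyp z 1 * (3 + 2 * √2)) * (√2 / 2) * (√2 - 1) =
          -(hyp z 0 * ((1 + √2) * (√2 / 2)) + hyp z 1 * ((1 + √2) * (√2 / 2)) - hyp z 2 * inS) +
            (√2 / 2) * (hyp z 0 * ((1 + √2) * 1) + hyp z 1 * ((1 + √2) * 0) - hyp z 2 * inS) := by
          grind
        have h9 : 0 ≤ (hyp z 2 * inS - hyp z 1 * (3 + 2 * √2)) * ((√2 / 2) * (√2 - 1)) := by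
          rw [← mul_assoc, e, h0]; linarith
        have h8 : 0 < √2 / 2 * (√2 - 1) := mul_pos (by positivity) (by linarith [one_lt_sqrt_two])
        have := nonneg_of_mul_nonneg_left h9 h8
        linarith
      linarith
    · have : -(hyp z 1 / inS) ≤ hyp z 2 / (3 + 2 * √2) := by
        rw [← neg_div, div_le_div_iff₀ hS (by positivity)]
        have e : (hyp z 2 * inS + hyp z 1 * (3 + 2 * √2)) * (√2 / 2) * (√2 - 1) =
          -(hyp z 0 * ((1 + √2) * (√2 / 2)) + hyp z 1 * ((1 + √2) * -(√2 / 2)) - hyp z 2 * inS) +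
            (√2 / 2) * (hyp z 0 * ((1 + √2) * 1) + hyp z 1 * ((1 + √2) * 0) - hyp z 2 * inS) := by
          grind
        have h9 : 0 ≤ (hyp z 2 * inS + hyp z 1 * (3 + 2 * √2)) * ((√2 / 2) * (√2 - 1)) := by
          rw [← mul_assoc, e, h0]; linarith
        have h8 : 0 < √2 / 2 * (√2 - 1) := mul_pos (by positivity) (by linarith [one_lt_sqrt_two])
        have := nonneg_of_mul_nonneg_left h9 h8
        linarith
      linarith
    · rw [hyp_vtx, zero_add, hyp_vtx, vtxVec_zero, vtxVec_one]
      have e3 : 3 + 2 * √2 = (1 + √2) ^ 2 := by linear_combination -h2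
      have hx : hyp z 0 = hyp z 2 * inS / (1 + √2) := by
        rw [eq_div_iff (by positivity)]; linarith
      rw [e3]
      ext i
      fin_cases i
      · simp [hx]; field_simp; ring
      · simp; field_simp; ring
      · simp; field_simp; ring

theorem side_eq (k : ZMod 8) : side vtx k = octagon ∩ {z | mink (hyp z) (nrm k) = 0} := by
  induction k using zmod_rec with
  | h0 => exact side_zero_eq
  | hs k ih =>
    have h1 : side vtx (k + 1) = triHom rotT '' side vtx k := by
      rw [side, side, geodesicSegment_image, rotT_vtx, rotT_vtx]
    rw [h1, ih, image_inter (triHom rotT).injective, image_octagon_of_mem_octSym rotT_mem]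
    congr 1
    ext z
    constructor
    · rintro ⟨y, hy, rfl⟩
      change mink _ _ = 0
      rwa [← rotT_nrm, mink_hyp_lin]
    · intro hz
      refine ⟨(triHom rotT)⁻¹ z, ?_, IsometryEquiv.apply_inv_self _ _⟩
      change mink _ _ = 0
      rwa [← mink_hyp_lin (triHom rotT), IsometryEquiv.apply_inv_self, rotT_nrm]

theorem octagon_inter_gen (k : ZMod 8) : octagon ∩ gen k '' octagon = side vtx k := by
  rw [side_eq]
  ext z
  rw [mem_inter_iff, mem_inter_iff, mem_gen_image_octagon]
  refine and_congr_right fun hz => ⟨fun h => ?_, fun h => ?_⟩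
  · have := h k
    rw [mink_refl_nrm_self] at this
    exact le_antisymm (hz k) (by linarith)
  · rwa [(refl_eq_self_iff (mink_nrm_self k)).2 h]

/-! ### The octagon is a topological disk -/

theorem IsTile.image {S : Set ℍ} (hS : IsTile S) (hc : IsCompact S) {f : ℍ → ℍ}
    (hf : Continuous f) (hi : InjOn f S) : IsTile (f '' S) := by
  obtain ⟨e⟩ := hS
  have := isCompact_iff_compactSpace.1 hc
  let E : S ≃ f '' S := Equiv.Set.imageOfInjOn f S hi
  have hE : Continuous E := (hf.comp continuous_subtype_val).subtype_mk _
  exact ⟨hE.homeoOfEquivCompactToT2.symm.trans e⟩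

/-- The projective (Klein) model of the hyperbolic plane. -/
def klein (z : ℍ) : EuclideanSpace ℝ (Fin 2) := !₂[hyp z 0 / hyp z 2, hyp z 1 / hyp z 2]

theorem continuous_klein : Continuous klein := by
  have h0 : Continuous fun z : ℍ => hyp z 0 := (continuous_apply 0).comp continuous_hyp
  have h1 : Continuous fun z : ℍ => hyp z 1 := (continuous_apply 1).comp continuous_hyp
  have h2 : Continuous fun z : ℍ => hyp z 2 := (continuous_apply 2).comp continuous_hyp
  refine (PiLp.continuous_toLp 2 _).comp (continuous_pi fun i => ?_)
  fin_cases i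
  · exact h0.div h2 fun z => (hyp_two_pos z).ne'
  · exact h1.div h2 fun z => (hyp_two_pos z).ne'

theorem klein_eq_of_hyp {z : ℍ} {c : ℝ} {v : Fin 3 → ℝ} (hc : c ≠ 0) (h : hyp z = c • v) :
    klein z = !₂[v 0 / v 2, v 1 / v 2] := by
  rw [klein, h]
  simp only [Pi.smul_apply, smul_eq_mul, mul_div_mul_left _ _ hc]

theorem klein_injective : Function.Injective klein := by
  intro z w h
  have h0 := congrFun (congrArg WithLp.ofLp h) 0
  have h1 := congrFun (congrArg WithLp.ofLp h) 1
  change hyp z 0 / hyp z 2 = hyp w 0 / hyp w 2 at h0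
  change hyp z 1 / hyp z 2 = hyp w 1 / hyp w 2 at h1
  have hz := hyp_two_pos z
  have hw := hyp_two_pos w
  have e : hyp z = (hyp z 2 / hyp w 2) • hyp w := by
    ext i
    fin_cases i
    · simp; rw [div_mul_eq_mul_div, eq_div_iff hw.ne']; rw [div_eq_div_iff hz.ne' hw.ne'] at h0
      linarith
    · simp; rw [div_mul_eq_mul_div, eq_div_iff hw.ne']; rw [div_eq_div_iff hz.ne' hw.ne'] at h1
      linarith
    · simp [hw.ne']
  have h2 := mink_hyp_self z
  rw [e, mink_smul_left, mink_smul_right, mink_hyp_self] at h2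
  have h3 : hyp z 2 / hyp w 2 = 1 := by
    have : 0 < hyp z 2 / hyp w 2 := by positivity
    nlinarith
  rw [h3, one_smul] at e
  exact hyp_injective e

theorem convex_klein_image {S : Set ℍ} (hS : IsGeodesicallyConvex S) : Convex ℝ (klein '' S) := by
  rintro _ ⟨a, ha, rfl⟩ _ ⟨b, hb, rfl⟩ s t hs ht hst
  have ha2 := hyp_two_pos a
  have hb2 := hyp_two_pos b
  set v : Fin 3 → ℝ := (s / hyp a 2) • hyp a + (t / hyp b 2) • hyp b with hv
  have hv2 : v 2 = 1 := by simp [hv, ha2.ne', hb2.ne', hst]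
  have hs' : 0 ≤ s / hyp a 2 := by positivity
  have ht' : 0 ≤ t / hyp b 2 := by positivity
  have hpos : 0 < s / hyp a 2 + t / hyp b 2 := by
    rcases hs.eq_or_lt with h | h
    · have : 0 < t := by linarith
      positivity
    · positivity
  have hneg : mink v v < 0 := by
    have hab := mink_hyp_le a b
    simp only [hv, mink_add_left, mink_add_right, mink_smul_left, mink_smul_right, mink_hyp_self,
      mink_comm (hyp b) (hyp a)]
    nlinarith [mul_nonneg hs' ht', sq_pos_of_pos hpos]
  obtain ⟨z, c, hc, hz⟩ := exists_hyp_eq_smul hneg (by rw [hv2]; norm_num)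
  refine ⟨z, hS a ha b hb (mem_geodesicSegment_iff.2 ⟨c * (s / hyp a 2), c * (t / hyp b 2),
    by positivity, by positivity, by rw [hz, hv]; module⟩), ?_⟩
  rw [klein_eq_of_hyp hc.ne' hz, hv2]
  ext i
  fin_cases i <;> simp [hv, klein] <;> ring

/-- In the Klein model the octagon becomes a compact convex set with interior points, and such a set
is carried to the unit ball by a homeomorphism of the plane. -/
theorem isTile_octagon : IsTile octagon := by
  have hconv := convex_klein_image isGeodesicallyConvex_octagon
  have hcomp : IsCompact (klein '' octagon) := isCompact_octagon.image continuous_klein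
  have hintr : (interior (klein '' octagon)).Nonempty := by
    refine ⟨0, mem_interior.2 ⟨Metric.ball 0 (1 / 2), fun ξ hξ => ?_, Metric.isOpen_ball,
      Metric.mem_ball_self (by norm_num)⟩⟩
    rw [mem_ball_zero_iff] at hξ
    have hn : ξ 0 ^ 2 + ξ 1 ^ 2 < 1 / 4 := by
      have := EuclideanSpace.real_norm_sq_eq ξ
      rw [Fin.sum_univ_two] at this
      rw [← this]; nlinarith [norm_nonneg ξ]
    obtain ⟨z, c, hc, hz⟩ := exists_hyp_eq_smul (v := ![ξ 0, ξ 1, 1])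
      (by simp [mink]; nlinarith) (by simp)
    refine ⟨z, fun k => ?_, ?_⟩
    · rw [hz, mink_smul_left]
      refine mul_nonpos_of_nonneg_of_nonpos hc.le ?_
      simp only [mink, nrm, Matrix.cons_val_zero, Matrix.cons_val_one, Matrix.cons_val, one_mul]
      have h1 := ck_sq_add_sk_sq k
      have h2 : ξ 0 * ck k + ξ 1 * sk k ≤ 5 / 8 := by
        nlinarith [sq_nonneg (ξ 0 - ck k), sq_nonneg (ξ 1 - sk k)]
      have h3 := inS_sq
      have h4 := inS_pos
      have h5 := one_lt_sqrt_two
      have h6 := sqrt_two_lt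
      have h7 : 25 / 16 < inS := by nlinarith
      nlinarith
    · rw [klein_eq_of_hyp hc.ne' hz]
      ext i
      fin_cases i <;> simp
  obtain ⟨h, -, h2, -⟩ :=
    exists_homeomorph_image_interior_closure_frontier_eq_unitBall hconv hintr hcomp.isBounded
  rw [hcomp.isClosed.closure_eq] at h2
  have := isCompact_iff_compactSpace.1 isCompact_octagon
  let f : ℍ → EuclideanSpace ℝ (Fin 2) := fun z => h (klein z)
  have hf : Continuous f := h.continuous.comp continuous_klein
  have him : f '' octagon = Metric.closedBall 0 1 := by rw [← h2, image_image]
  let E : octagon ≃ f '' octagon :=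
    Equiv.Set.image f octagon (h.injective.comp klein_injective)
  have hE : Continuous E := (hf.comp continuous_subtype_val).subtype_mk _
  exact ⟨hE.homeoOfEquivCompactToT2.trans (Homeomorph.setCongr him)⟩

/-- Rotating both sides to side `0` leaves an isometry that fixes the midpoint and the normal. It
can only fix or negate the direction of the side, so it is the identity or the reflection `s₀`. -/
theorem mem_octSym_of_mid_nrm {χ : ℍ ≃ᵢ ℍ} {j k : ZMod 8} (hm : χ (mid j) = mid k)
    (hn : lin χ (nrm j) = nrm k) : ∃ d ∈ octSym, χ = triHom d := by
  set a := rotT ^ j.val with ha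
  set b := rotT ^ k.val with hb
  have hj : (j.val : ZMod 8) = j := ZMod.natCast_zmod_val j
  have hk : (k.val : ZMod 8) = k := ZMod.natCast_zmod_val k
  set ψ := (triHom b)⁻¹ * χ * triHom a with hψ
  have hψm : lin ψ (midVec 0) = midVec 0 := by
    rw [← hyp_mid, ← hyp_apply]
    congr 1
    rw [hψ, IsometryEquiv.mul_apply, IsometryEquiv.mul_apply, rotT_pow_mid, zero_add, hj, hm]
    conv_lhs => rw [← hk, ← zero_add (k.val : ZMod 8), ← rotT_pow_mid]
    exact IsometryEquiv.inv_apply_self _ _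
  have hψn : lin ψ (nrm 0) = nrm 0 := by
    rw [hψ, lin_mul, lin_mul, rotT_pow_nrm, zero_add, hj, hn]
    conv_lhs => rw [← hk, ← zero_add (k.val : ZMod 8), ← rotT_pow_nrm, lin_inv_apply]
  have hS := inS_sq
  have h2 := sqrt_two_sq
  have hm0 : midVec 0 = ![inS, 0, 1 + √2] := by
    ext i
    fin_cases i
    · change inS * 1 = inS; ring
    · change inS * 0 = 0; ring
    · rfl
  have hn0 : nrm 0 = ![1 + √2, 0, inS] := nrm_zero
  set e : Fin 3 → ℝ := ![0, 1, 0] with he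
  set u := lin ψ e with hu
  have u1 : mink (midVec 0) u = 0 := by
    rw [← hψm, hu, mink_lin, hm0, he]; simp [mink]
  have u2 : mink (nrm 0) u = 0 := by
    rw [← hψn, hu, mink_lin, hn0, he]; simp [mink]
  have u3 : mink u u = 1 := by
    rw [hu, mink_lin, he]; simp [mink]
  rw [hm0] at u1
  rw [hn0] at u2
  simp [mink] at u1 u2 u3
  have u0 : u 0 = 0 := by
    linear_combination (-inS) * u1 + (1 + √2) * u2 + u 0 * hS - u 0 * h2
  have u4 : u 2 = 0 := by
    linear_combination (-(1 + √2)) * u1 + inS * u2 + u 2 * hS - u 2 * h2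
  have u5 : u 1 = 1 ∨ u 1 = -1 := by
    rw [u0, u4] at u3
    exact mul_self_eq_one_iff.1 (by linarith)
  have hdec : ∀ v : Fin 3 → ℝ, v = (-(mink v (midVec 0))) • midVec 0 + (mink v (nrm 0)) • nrm 0 +
      v 1 • e := by
    intro v
    rw [hm0, hn0]
    ext i
    fin_cases i
    · simp [mink, he]; linear_combination v 0 * hS - v 0 * h2
    · simp [he]
    · simp [mink, he]; linear_combination v 2 * hS - v 2 * h2
  have hval : ∀ v, lin ψ v = (-(mink v (midVec 0))) • midVec 0 + (mink v (nrm 0)) • nrm 0 +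
      v 1 • u := by
    intro v
    conv_lhs => rw [hdec v, map_add, map_add, map_smul, map_smul, map_smul, hψm, hψn, ← hu]
  have hcase : ψ = 1 ∨ ψ = triRefl 0 := by
    rcases u5 with h | h
    · left
      refine eq_of_lin_eq fun v => ?_
      rw [hval, lin_one]
      conv_rhs => rw [hdec v]
      congr 2
      ext i
      fin_cases i <;> simp [he, u0, u4, h]
    · right
      refine eq_of_lin_eq fun v => ?_
      rw [hval, lin_triRefl_zero, hm0, hn0]
      ext i
      fin_cases i
      · simp [mink, u0]; linear_combination (-v 0) * hS + v 0 * h2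
      · simp [h]
      · simp [mink, u4]; linear_combination (-v 2) * hS + v 2 * h2
  have hback : χ = triHom b * ψ * (triHom a)⁻¹ := by rw [hψ]; group
  have ham : a ∈ octSym := pow_mem rotT_mem _
  have hbm : b ∈ octSym := pow_mem rotT_mem _
  rcases hcase with h | h
  · exact ⟨b * a⁻¹, mul_mem hbm (inv_mem ham), by rw [hback, h, mul_one, map_mul, map_inv]⟩
  · exact ⟨b * triSys.simple 0 * a⁻¹, mul_mem (mul_mem hbm simple_zero_mem_octSym) (inv_mem ham),
      by rw [hback, h, map_mul, map_mul, map_inv, triHom_simple]⟩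

/-! ### Null sets and intersections of lines and circles -/

theorem exists_smul_eq_of_cross {v w : Fin 3 → ℝ} (hw : w ≠ 0) (h01 : v 0 * w 1 = v 1 * w 0)
    (h02 : v 0 * w 2 = v 2 * w 0) (h12 : v 1 * w 2 = v 2 * w 1) : ∃ s : ℝ, v = s • w := by
  obtain ⟨i, hi⟩ : ∃ i, w i ≠ 0 := by
    by_contra! h
    exact hw (funext h)
  refine ⟨v i / w i, ?_⟩
  ext j
  rw [Pi.smul_apply, smul_eq_mul, div_mul_eq_mul_div, eq_div_iff hi]
  fin_cases i <;> fin_cases j <;> simp only [Fin.zero_eta, Fin.mk_one, Fin.reduceFinMk] <;>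
    linarith

/-- Two vectors orthogonal to two independent vectors are proportional. -/
theorem exists_smul_eq_of_orthogonal {d e p q : Fin 3 → ℝ} (hd : d ≠ 0)
    (hde : ¬∃ t : ℝ, e = t • d) (hp : p ≠ 0) (h1 : mink d p = 0) (h2 : mink d q = 0)
    (h3 : mink e p = 0) (h4 : mink e q = 0) : ∃ c : ℝ, q = c • p := by
  unfold mink at h1 h2 h3 h4
  set w : Fin 3 → ℝ := ![-(p 1 * q 2 - p 2 * q 1), -(p 2 * q 0 - p 0 * q 2),
    p 0 * q 1 - p 1 * q 0] with hw
  by_cases h0 : w = 0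
  · have w0 : -(p 1 * q 2 - p 2 * q 1) = 0 := congrFun h0 0
    have w1 : -(p 2 * q 0 - p 0 * q 2) = 0 := congrFun h0 1
    have w2 : p 0 * q 1 - p 1 * q 0 = 0 := congrFun h0 2
    exact exists_smul_eq_of_cross hp (by linarith) (by linarith) (by linarith)
  · have key : ∀ x : Fin 3 → ℝ, x 0 * p 0 + x 1 * p 1 - x 2 * p 2 = 0 →
        x 0 * q 0 + x 1 * q 1 - x 2 * q 2 = 0 → ∃ s : ℝ, x = s • w := fun x hx hx' => by
      refine exists_smul_eq_of_cross h0 ?_ ?_ ?_ <;>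
        simp only [hw, Matrix.cons_val_zero, Matrix.cons_val_one, Matrix.cons_val]
      · linear_combination q 2 * hx - p 2 * hx'
      · linear_combination q 1 * hx - p 1 * hx'
      · linear_combination (-q 0) * hx + p 0 * hx'
    obtain ⟨s, hs⟩ := key d h1 h2
    obtain ⟨t, ht⟩ := key e h3 h4
    have hs0 : s ≠ 0 := fun h => hd (by rw [hs, h, zero_smul])
    exact absurd ⟨t / s, by rw [ht, hs, smul_smul, div_mul_cancel₀ _ hs0]⟩ hde

/-- A straight line meets the hyperboloid in at most two points: the condition on the parameter
reduces to `t (1 - t) = 0`. -/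
theorem eq_or_eq_of_collinear {a b c : ℍ} {t : ℝ}
    (h : hyp c - hyp a = t • (hyp b - hyp a)) (hab : a ≠ b) : c = a ∨ c = b := by
  have hc : hyp c = hyp a + t • (hyp b - hyp a) := by rw [← h]; abel
  have h1 := mink_hyp_self c
  rw [hc] at h1
  simp only [mink_add_left, mink_add_right, mink_smul_left, mink_smul_right, mink_sub_left,
    mink_sub_right, mink_hyp_self, mink_comm (hyp b) (hyp a)] at h1
  have h2 : mink (hyp a) (hyp b) + 1 ≠ 0 := by
    rw [mink_hyp]
    have := Real.one_lt_cosh.2 (dist_pos.2 hab).ne'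
    linarith
  have h3 : (mink (hyp a) (hyp b) + 1) * (t * (1 - t)) = 0 := by linear_combination h1 / 2
  rcases mul_eq_zero.1 ((mul_eq_zero.1 h3).resolve_left h2) with h4 | h4
  · left; apply hyp_injective; rw [hc, h4]; simp
  · right; apply hyp_injective; rw [hc, show t = 1 by linarith]; simp

/-- Curves of constant Minkowski product with infinitely many common points have proportional
normal vectors. -/
theorem exists_smul_eq_of_infinite {p q : Fin 3 → ℝ} {α β : ℝ} (hp : p ≠ 0)
    (h : {z : ℍ | mink (hyp z) p = α ∧ mink (hyp z) q = β}.Infinite) : ∃ c : ℝ, q = c • p := by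
  obtain ⟨a, ha⟩ := h.nonempty
  obtain ⟨b, hb, hba⟩ := h.exists_notMem_finite (finite_singleton a)
  obtain ⟨c, hc, hcab⟩ := h.exists_notMem_finite (toFinite {a, b})
  simp only [mem_insert_iff, mem_singleton_iff, not_or] at hba hcab
  -- Three distinct common points give two independent difference vectors, both orthogonal to `p`
  -- and to `q`.
  refine exists_smul_eq_of_orthogonal (d := hyp b - hyp a) (e := hyp c - hyp a)
    (fun h0 => hba (hyp_injective (sub_eq_zero.1 h0))) ?_ hp ?_ ?_ ?_ ?_
  · rintro ⟨t, ht⟩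
    rcases eq_or_eq_of_collinear ht (Ne.symm hba) with h | h
    · exact hcab.1 h
    · exact hcab.2 h
  · rw [mink_sub_left, ha.1, hb.1, sub_self]
  · rw [mink_sub_left, ha.2, hb.2, sub_self]
  · rw [mink_sub_left, ha.1, hc.1, sub_self]
  · rw [mink_sub_left, ha.2, hc.2, sub_self]

theorem hyp_ne_zero (z : ℍ) : hyp z ≠ 0 := fun h => by
  have := hyp_two_pos z
  rw [h] at this
  exact lt_irrefl _ this

theorem ne_zero_of_mink_self {n : Fin 3 → ℝ} (hn : mink n n = 1) : n ≠ 0 := by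
  rintro rfl
  simp [mink] at hn

theorem dist_eq_iff_mink {z m : ℍ} {ρ : ℝ} (hρ : 0 ≤ ρ) :
    dist z m = ρ ↔ mink (hyp z) (hyp m) = -Real.cosh ρ := by
  rw [mink_hyp, neg_inj]
  exact ⟨fun h => by rw [h], fun h => eq_of_cosh_eq_cosh dist_nonneg hρ h⟩

theorem dist_le_iff_mink {z m : ℍ} {ρ : ℝ} (hρ : 0 ≤ ρ) :
    dist z m ≤ ρ ↔ -mink (hyp z) (hyp m) ≤ Real.cosh ρ := by
  rw [← cosh_dist_eq, Real.cosh_le_cosh, abs_of_nonneg dist_nonneg, abs_of_nonneg hρ]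

theorem dist_lt_iff_mink {z m : ℍ} {ρ : ℝ} (hρ : 0 ≤ ρ) :
    dist z m < ρ ↔ -mink (hyp z) (hyp m) < Real.cosh ρ := by
  rw [← cosh_dist_eq, Real.cosh_lt_cosh, abs_of_nonneg dist_nonneg, abs_of_nonneg hρ]

theorem centers_eq_of_infinite {m m' : ℍ} {ρ ρ' : ℝ} (hρ : 0 ≤ ρ) (hρ' : 0 ≤ ρ')
    (h : (Metric.sphere m ρ ∩ Metric.sphere m' ρ').Infinite) : m = m' := by
  have h' : {z : ℍ | mink (hyp z) (hyp m) = -Real.cosh ρ ∧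
      mink (hyp z) (hyp m') = -Real.cosh ρ'}.Infinite :=
    h.mono fun z hz => ⟨(dist_eq_iff_mink hρ).1 hz.1, (dist_eq_iff_mink hρ').1 hz.2⟩
  obtain ⟨c, hc⟩ := exists_smul_eq_of_infinite (hyp_ne_zero m) h'
  have h1 := mink_hyp_self m'
  rw [hc, mink_smul_left, mink_smul_right, mink_hyp_self] at h1
  have h2 := congrFun hc 2
  rw [Pi.smul_apply, smul_eq_mul] at h2
  have h3 : 0 < c := by
    by_contra! h
    nlinarith [hyp_two_pos m, hyp_two_pos m']
  have h4 : c = 1 := by nlinarith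
  rw [h4, one_smul] at hc
  exact (hyp_injective hc).symm

/-- The normal of a circle is time-like and that of a line space-like, so they are not proportional.
This is what separates the arcs of a modified octagon from straight sides. -/
theorem finite_sphere_inter_line {m : ℍ} {ρ : ℝ} (hρ : 0 ≤ ρ) {n : Fin 3 → ℝ}
    (hn : mink n n = 1) : (Metric.sphere m ρ ∩ {z | mink (hyp z) n = 0}).Finite := by
  by_contra h
  have h' : {z : ℍ | mink (hyp z) (hyp m) = -Real.cosh ρ ∧ mink (hyp z) n = 0}.Infinite :=
    Set.Infinite.mono (fun z hz => ⟨(dist_eq_iff_mink hρ).1 hz.1, hz.2⟩) h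
  obtain ⟨c, hc⟩ := exists_smul_eq_of_infinite (hyp_ne_zero m) h'
  rw [hc, mink_smul_left, mink_smul_right, mink_hyp_self] at hn
  nlinarith [sq_nonneg c]

theorem normals_eq_of_infinite {n n' : Fin 3 → ℝ} (hn : mink n n = 1) (hn' : mink n' n' = 1)
    (h : {z : ℍ | mink (hyp z) n = 0 ∧ mink (hyp z) n' = 0}.Infinite) : n' = n ∨ n' = -n := by
  obtain ⟨c, hc⟩ := exists_smul_eq_of_infinite (ne_zero_of_mink_self hn) h
  rw [hc, mink_smul_left, mink_smul_right, hn] at hn'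
  rcases mul_self_eq_one_iff.1 (show c * c = 1 by linarith) with h | h
  · left; rw [hc, h, one_smul]
  · right; rw [hc, h, neg_one_smul]

theorem finite_quadratic_roots {a b c : ℝ} (h : ¬(a = 0 ∧ b = 0 ∧ c = 0)) :
    {t : ℝ | a * t ^ 2 + b * t + c = 0}.Finite := by
  set p : Polynomial ℝ := Polynomial.C a * Polynomial.X ^ 2 + Polynomial.C b * Polynomial.X +
    Polynomial.C c with hp
  have hp0 : p ≠ 0 := fun h0 => h ⟨by simpa [hp] using congrArg (Polynomial.coeff · 2) h0,
    by simpa [hp] using congrArg (Polynomial.coeff · 1) h0,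
    by simpa [hp] using congrArg (Polynomial.coeff · 0) h0⟩
  refine (Polynomial.finite_setOfPred_isRoot hp0).subset fun t ht => ?_
  change Polynomial.eval t p = 0
  simpa [hp] using ht

theorem volume_eq_zero_of_coe {S : Set ℍ} (h : volume ((↑) '' S : Set ℂ) = 0) : volume S = 0 := by
  rw [UpperHalfPlane.volume_def]
  refine withDensity_absolutelyContinuous _ _ ?_
  rw [measurableEmbedding_coe.comap_apply, h]

/-- In half-plane coordinates the set is given by a quadratic equation in `x` and `y`. For all but
finitely many `x` it is a nonzero polynomial in `y`, and Fubini applies. Lines, circles and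
bisectors are all covered. -/
theorem volume_mink_eq {n : Fin 3 → ℝ} (hn : n ≠ 0) (α : ℝ) :
    volume {z : ℍ | mink (hyp z) n = α} = 0 := by
  refine volume_eq_zero_of_coe ?_
  set T : Set (ℝ × ℝ) := {p | (n 1 - n 2) * p.2 ^ 2 + (-2 * α) * p.2 +
    ((n 1 - n 2) * p.1 ^ 2 + 2 * n 0 * p.1 + (-(n 1 + n 2))) = 0} with hT
  have hTm : MeasurableSet T := (isClosed_eq (by fun_prop) continuous_const).measurableSet
  have hT0 : volume T = 0 := by
    rw [Measure.volume_eq_prod, Measure.measure_prod_null hTm]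
    have hfin := finite_quadratic_roots (a := n 1 - n 2) (b := 2 * n 0) (c := -(n 1 + n 2)) (by
      rintro ⟨h1, h2, h3⟩
      refine hn (funext fun i => ?_)
      fin_cases i
      · change n 0 = 0; linarith
      · change n 1 = 0; linarith
      · change n 2 = 0; linarith)
    filter_upwards [compl_mem_ae_iff.2 (hfin.measure_zero volume)] with x hx
    exact (finite_quadratic_roots (a := n 1 - n 2) (b := -2 * α)
      (c := (n 1 - n 2) * x ^ 2 + 2 * n 0 * x + (-(n 1 + n 2))) fun h => hx h.2.2).measure_zero _
  have h1 := Complex.volume_preserving_equiv_real_prod.measure_preimage hTm.nullMeasurableSet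
  rw [hT0] at h1
  refine measure_mono_null ?_ h1
  rintro _ ⟨z, hz, rfl⟩
  have hy := z.im_pos
  have hz : hyp z 0 * n 0 + hyp z 1 * n 1 - hyp z 2 * n 2 = α := hz
  rw [hyp_zero, hyp_one, hyp_two] at hz
  change (n 1 - n 2) * z.im ^ 2 + (-2 * α) * z.im +
    ((n 1 - n 2) * z.re ^ 2 + 2 * n 0 * z.re + (-(n 1 + n 2))) = 0
  rw [← hz]
  field_simp
  ring

theorem volume_sphere_eq_zero (m : ℍ) {ρ : ℝ} (hρ : 0 ≤ ρ) : volume (Metric.sphere m ρ) = 0 :=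
  measure_mono_null (fun _ hz => (dist_eq_iff_mink hρ).1 hz) (volume_mink_eq (hyp_ne_zero m) _)

theorem volume_bisector {p q : ℍ} (h : p ≠ q) : volume {z : ℍ | dist z p = dist z q} = 0 := by
  refine measure_mono_null ?_ (volume_mink_eq (n := hyp p - hyp q)
    (fun h0 => h (hyp_injective (sub_eq_zero.1 h0))) 0)
  intro z hz
  change mink _ _ = 0
  have hz : dist z p = dist z q := hz
  rw [mink_sub_right, mink_hyp, mink_hyp, hz, sub_self]

/-! ### Polar coordinates -/

theorem exists_isometry_apply_eq (a b : ℍ) : ∃ φ : ℍ ≃ᵢ ℍ, φ a = b := by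
  by_cases h : a = b
  · exact ⟨1, h⟩
  · obtain ⟨n, hn, h, -⟩ := exists_refl_swap h
    exact ⟨_, h⟩

theorem exists_polar (c : ℍ) : ∃ P : ℝ × ℝ → ℍ, Continuous P ∧
    (∀ t θ, 0 ≤ t → dist (P (t, θ)) c = t) ∧ ∀ z, ∃ θ, P (dist z c, θ) = z := by
  obtain ⟨φ, rfl⟩ := exists_isometry_apply_eq UpperHalfPlane.I c
  have hex : ∀ p : ℝ × ℝ, ∃ z : ℍ, hyp z = ![Real.sinh p.1 * Real.cos p.2,
      Real.sinh p.1 * Real.sin p.2, Real.cosh p.1] := fun p => by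
    refine exists_hyp_eq ?_ (Real.cosh_pos _)
    simp only [mink, Matrix.cons_val_zero, Matrix.cons_val_one, Matrix.cons_val]
    linear_combination Real.sinh p.1 ^ 2 * Real.cos_sq_add_sin_sq p.2 - Real.cosh_sq p.1
  choose P hP using hex
  have hcosh : ∀ z, Real.cosh (dist z UpperHalfPlane.I) = hyp z 2 := fun z => by
    rw [cosh_dist_eq, mink_comm, mink_hyp_I, neg_neg]
  refine ⟨fun p => φ (P p), φ.continuous.comp (continuous_of_hyp_comp ?_), fun t θ ht => ?_,
    fun z => ?_⟩
  · refine continuous_pi fun i => ?_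
    simp only [hP]
    fin_cases i <;> simp only [Fin.zero_eta, Fin.mk_one, Fin.reduceFinMk, Matrix.cons_val_zero,
      Matrix.cons_val_one, Matrix.cons_val] <;> fun_prop
  · rw [φ.dist_eq]
    refine eq_of_cosh_eq_cosh dist_nonneg ht ?_
    rw [hcosh, hP]; rfl
  · obtain ⟨y, rfl⟩ := φ.surjective z
    rw [φ.dist_eq]
    have h2 := hcosh y
    have hself := mink_hyp_self y
    unfold mink at hself
    have hs : Real.sinh (dist y UpperHalfPlane.I) ^ 2 = hyp y 0 ^ 2 + hyp y 1 ^ 2 := by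
      rw [Real.sinh_sq, h2]; linarith
    have hs0 : 0 ≤ Real.sinh (dist y UpperHalfPlane.I) := Real.sinh_nonneg_iff.2 dist_nonneg
    set ζ : ℂ := ⟨hyp y 0, hyp y 1⟩ with hζ
    have hnorm : ‖ζ‖ = Real.sinh (dist y UpperHalfPlane.I) := by
      rw [← abs_of_nonneg (norm_nonneg ζ), ← abs_of_nonneg hs0, ← sq_eq_sq_iff_abs_eq_abs, hs,
        Complex.sq_norm, Complex.normSq_apply]
      ring
    refine ⟨ζ.arg, congrArg φ (hyp_injective ?_)⟩
    rw [hP]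
    ext i
    fin_cases i
    · simp only [Fin.zero_eta, Matrix.cons_val_zero, ← hnorm]; exact Complex.norm_mul_cos_arg ζ
    · simp only [Fin.mk_one, Matrix.cons_val_one, ← hnorm]; exact Complex.norm_mul_sin_arg ζ
    · simp only [Fin.reduceFinMk, Matrix.cons_val, h2]

theorem isPreconnected_annulus (c : ℍ) {r r' : ℝ} (hr : 0 ≤ r) :
    IsPreconnected {z : ℍ | r < dist z c ∧ dist z c < r'} := by
  obtain ⟨P, hP, hd, hs⟩ := exists_polar c
  have : {z : ℍ | r < dist z c ∧ dist z c < r'} = P '' (Ioo r r' ×ˢ univ) := by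
    ext z
    constructor
    · rintro hz
      obtain ⟨θ, hθ⟩ := hs z
      exact ⟨(dist z c, θ), ⟨hz, mem_univ _⟩, hθ⟩
    · rintro ⟨⟨t, θ⟩, ⟨ht, -⟩, rfl⟩
      have := hd t θ (hr.trans ht.1.le)
      exact ⟨by rw [this]; exact ht.1, by rw [this]; exact ht.2⟩
  rw [this]
  exact (isPreconnected_Ioo.prod isPreconnected_univ).image P hP.continuousOn

theorem mem_closure_far {c z : ℍ} {r : ℝ} (hr : 0 < r) (hz : r ≤ dist z c) :
    z ∈ closure {w : ℍ | r < dist w c} := by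
  obtain ⟨P, hP, hd, hs⟩ := exists_polar c
  obtain ⟨θ, hθ⟩ := hs z
  have h0 := hr.le.trans hz
  have hc : Tendsto (fun t => P (t, θ)) (𝓝[>] dist z c) (𝓝 z) := by
    conv => rhs; rw [← hθ]
    exact ((hP.comp (by fun_prop : Continuous fun t : ℝ => (t, θ))).tendsto _).mono_left
      nhdsWithin_le_nhds
  refine mem_closure_of_tendsto hc ?_
  filter_upwards [self_mem_nhdsWithin] with t ht
  have ht : dist z c < t := ht
  change r < dist _ _
  rw [hd t θ (h0.trans ht.le)]
  exact hz.trans_lt ht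

/-- The point at distance `r` from `c` on the segment from `c` to `z`. -/
theorem exists_dist_eq_sub (c z : ℍ) {r : ℝ} (hr : 0 ≤ r) (hz : r ≤ dist z c) :
    ∃ p, dist p c = r ∧ dist z p = dist z c - r := by
  by_cases h : c = z
  · subst h
    rw [dist_self] at hz
    have : r = 0 := le_antisymm hz hr
    exact ⟨c, by rw [dist_self, this], by rw [dist_self, this, sub_zero]⟩
  obtain ⟨u, hu, hcu, hzu⟩ := exists_geodesic c z h
  obtain ⟨γ, hγ, h0, hγs⟩ := exists_geodesic_line hu hcu
  have hγz : γ (dist c z) = z := hyp_injective (by rw [hγs, hzu])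
  refine ⟨γ r, ?_, ?_⟩
  · conv_lhs => rw [← h0, hγ.dist_eq, Real.dist_eq, sub_zero, abs_of_nonneg hr]
  · conv_lhs => rw [← hγz, hγ.dist_eq, Real.dist_eq]
    rw [dist_comm c z, abs_of_nonneg (by linarith)]

theorem exists_ball_subset_of_closedBall_subset {U : Set ℍ} (hUo : IsOpen U) {c : ℍ} {r : ℝ}
    (hr : 0 < r) (h : Metric.closedBall c r ⊆ U) : ∃ r' > r, Metric.ball c r' ⊆ U := by
  obtain ⟨δ, hδ, hsub⟩ := (isCompact_closedBall c r).exists_thickening_subset_open hUo h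
  refine ⟨r + δ, by linarith, Subset.trans (fun z hz => ?_) hsub⟩
  rw [Metric.mem_ball] at hz
  by_cases hzr : dist z c ≤ r
  · exact Metric.self_subset_thickening hδ _ hzr
  obtain ⟨p, hp, hzp⟩ := exists_dist_eq_sub c z hr.le (not_le.1 hzr).le
  exact Metric.mem_thickening_iff.2 ⟨p, Metric.mem_closedBall.2 hp.le, by linarith⟩

/-- A thin annulus around the disk is connected and so lies in one part of any separation of the
complement. Adding the disk to that part would separate `U` itself. -/
theorem isPreconnected_diff_closedBall {U : Set ℍ} (hU : IsPreconnected U) (hUo : IsOpen U)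
    {c : ℍ} {r : ℝ} (hr : 0 < r) (h : Metric.closedBall c r ⊆ U) :
    IsPreconnected (U \ Metric.closedBall c r) := by
  obtain ⟨r', hr', hball⟩ := exists_ball_subset_of_closedBall_subset hUo hr h
  have hA := isPreconnected_annulus c (r' := r') hr.le
  set s := U \ Metric.closedBall c r with hs
  have hso : IsOpen s := hUo.sdiff Metric.isClosed_closedBall
  have hAs : {z : ℍ | r < dist z c ∧ dist z c < r'} ⊆ s := fun z hz =>
    ⟨hball hz.2, fun h => (lt_irrefl r) (hz.1.trans_le h)⟩
  have key : ∀ u v : Set ℍ, IsOpen u → IsOpen v → s ⊆ u ∪ v → s ∩ (u ∩ v) = ∅ →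
      {z : ℍ | r < dist z c ∧ dist z c < r'} ⊆ u → s ⊆ u := by
    intro u v hu hv huv hd hAu
    have h1 := (isPreconnected_iff_subset_of_disjoint.1 hU) ((u ∩ s) ∪ Metric.ball c r') (v ∩ s)
      ((hu.inter hso).union Metric.isOpen_ball) (hv.inter hso) ?_ ?_
    · rcases h1 with h1 | h1
      · intro x hx
        rcases h1 hx.1 with h2 | h2
        · exact h2.1
        · exact hAu ⟨not_le.1 hx.2, h2⟩
      · exact absurd (h1 (h (Metric.mem_closedBall_self hr.le))).2.2
          (fun h => h (Metric.mem_closedBall_self hr.le))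
    · intro x hx
      by_cases hxb : x ∈ Metric.closedBall c r
      · exact Or.inl (Or.inr (lt_of_le_of_lt hxb hr'))
      · rcases huv ⟨hx, hxb⟩ with h2 | h2
        · exact Or.inl (Or.inl ⟨h2, hx, hxb⟩)
        · exact Or.inr ⟨h2, hx, hxb⟩
    · refine eq_empty_of_forall_notMem fun x ⟨hx, h2, h3⟩ => ?_
      have hxu : x ∈ u := by
        rcases h2 with h2 | h2
        · exact h2.1
        · exact hAu ⟨not_le.1 h3.2.2, h2⟩
      exact (eq_empty_iff_forall_notMem.1 hd) x ⟨h3.2, hxu, h3.1⟩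
  refine isPreconnected_iff_subset_of_disjoint.2 fun u v hu hv huv hd => ?_
  rcases (isPreconnected_iff_subset_of_disjoint.1 hA) u v hu hv (hAs.trans huv)
    (subset_empty_iff.1 ((inter_subset_inter_left _ hAs).trans hd.subset)) with h1 | h1
  · exact Or.inl (key u v hu hv huv hd h1)
  · exact Or.inr (key v u hv hu (by rwa [union_comm]) (by rwa [inter_comm v u]) h1)

/-- Open half circles are infinite. -/
theorem infinite_halfCircle {m : ℍ} {u n : Fin 3 → ℝ} (hu : mink u u = 1) (hn : mink n n = 1)
    (hun : mink u n = 0) (hmu : mink (hyp m) u = 0) (hmn : mink (hyp m) n = 0) {ρ : ℝ}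
    (hρ : 0 < ρ) : {z : ℍ | dist z m = ρ ∧ 0 < mink (hyp z) n}.Infinite := by
  have hex : ∀ s : ℝ, ∃ z : ℍ, hyp z = Real.cosh ρ • hyp m +
      Real.sinh ρ • (Real.cos s • u + Real.sin s • n) := fun s => by
    obtain ⟨γ, -, -, h⟩ := exists_geodesic_line (z := m) (u := Real.cos s • u + Real.sin s • n)
      (by
        simp only [mink_add_left, mink_add_right, mink_smul_left, mink_smul_right, hu, hn, hun,
          mink_comm n u]
        linear_combination Real.cos_sq_add_sin_sq s)
      (by rw [mink_add_right, mink_smul_right, mink_smul_right, hmu, hmn]; ring)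
    exact ⟨γ ρ, h ρ⟩
  choose P hP using hex
  have hsinh : 0 < Real.sinh ρ := Real.sinh_pos_iff.2 hρ
  refine (Set.infinite_of_injOn_mapsTo (f := P) (s := Ioo 0 Real.pi) ?_ ?_
    (Set.Ioo_infinite Real.pi_pos))
  · intro s hs t ht hst
    have h := congrArg (fun z => mink (hyp z) u) hst
    simp only [hP, mink_add_left, mink_smul_left, hu, hmu, mink_comm n u, hun, mul_zero, zero_add,
      add_zero, mul_one] at h
    exact Real.injOn_cos (Ioo_subset_Icc_self hs) (Ioo_subset_Icc_self ht)
      (mul_left_cancel₀ hsinh.ne' h)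
  · intro s hs
    constructor
    · rw [dist_eq_iff_mink hρ.le, hP]
      simp only [mink_add_left, mink_smul_left, mink_hyp_self, mink_comm u, mink_comm n, hmu, hmn]
      ring
    · rw [hP]
      simp only [mink_add_left, mink_smul_left, hn, hmn, hun, mul_zero, zero_add, mul_one]
      exact mul_pos hsinh (Real.sin_pos_of_pos_of_lt_pi hs.1 hs.2)

/-! ### The octagon with protrusions and indentations -/

/-- A piecewise linear homeomorphism of the line that moves `0` to `f`. -/
def shift (ρ f w : ℝ) : ℝ := w + f * max 0 (1 - |w| / (2 * ρ))

theorem shift_zero (ρ f : ℝ) : shift ρ f 0 = f := by simp [shift]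

theorem shift_of_le {ρ f w : ℝ} (hρ : 0 < ρ) (hw : 2 * ρ ≤ |w|) : shift ρ f w = w := by
  have : 1 - |w| / (2 * ρ) ≤ 0 := by
    rw [sub_nonpos, le_div_iff₀ (by positivity)]; linarith
  rw [shift, max_eq_left this]; ring

theorem shift_strictMono {ρ f : ℝ} (hρ : 0 < ρ) (hf : 0 ≤ f) (hfρ : f ≤ ρ) :
    StrictMono (shift ρ f) := by
  intro a b hab
  have h1 : max 0 (1 - |a| / (2 * ρ)) ≤ max 0 (1 - |b| / (2 * ρ)) + (b - a) / (2 * ρ) := by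
    have h3 : 0 ≤ (b - a) / (2 * ρ) := div_nonneg (by linarith) (by positivity)
    refine max_le (add_nonneg (le_max_left _ _) h3) ?_
    have h2 : |b| / (2 * ρ) ≤ |a| / (2 * ρ) + (b - a) / (2 * ρ) := by
      rw [← add_div]
      refine div_le_div_of_nonneg_right ?_ (by positivity)
      have := abs_add_le a (b - a)
      rw [add_sub_cancel, abs_of_pos (show 0 < b - a by linarith)] at this
      exact this
    linarith [le_max_right 0 (1 - |b| / (2 * ρ))]
  have h2 : f * ((b - a) / (2 * ρ)) ≤ (b - a) / 2 := by
    rw [mul_div_assoc', div_le_div_iff₀ (by positivity) (by norm_num)]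
    nlinarith
  have h3 := mul_le_mul_of_nonneg_left h1 hf
  simp only [shift]
  nlinarith

theorem shift_surjective {ρ f : ℝ} (hρ : 0 < ρ) : Function.Surjective (shift ρ f) := by
  intro y
  have hc : Continuous (shift ρ f) := by unfold shift; fun_prop
  have h1 : shift ρ f (-(2 * ρ + |y|)) ≤ y := by
    rw [shift_of_le hρ]
    · linarith [neg_abs_le y]
    · rw [abs_neg, abs_of_nonneg (by positivity)]; linarith [abs_nonneg y]
  have h2 : y ≤ shift ρ f (2 * ρ + |y|) := by
    rw [shift_of_le hρ]
    · linarith [le_abs_self y]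
    · rw [abs_of_nonneg (by positivity)]; linarith [abs_nonneg y]
  obtain ⟨x, -, hx⟩ := intermediate_value_Icc (by linarith [abs_nonneg y]) hc.continuousOn ⟨h1, h2⟩
  exact ⟨x, hx⟩

/-- Coordinates adapted to the foliation of the plane by curves equidistant to a geodesic. -/
theorem exists_equidistant_coordinates : ∃ E : ℝ × ℝ → ℍ, Continuous E ∧
    (∀ b w, hyp (E (b, w)) = ![b, √(1 + b ^ 2) * Real.sinh w, √(1 + b ^ 2) * Real.cosh w]) ∧
    ∀ z, E (hyp z 0, Real.arsinh (hyp z 1 / √(1 + hyp z 0 ^ 2))) = z := by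
  have hsq : ∀ b : ℝ, √(1 + b ^ 2) ^ 2 = 1 + b ^ 2 := fun b => Real.sq_sqrt (by positivity)
  have hpos : ∀ b : ℝ, 0 < √(1 + b ^ 2) := fun b => Real.sqrt_pos.2 (by positivity)
  have hex : ∀ p : ℝ × ℝ, ∃ z : ℍ, hyp z =
      ![p.1, √(1 + p.1 ^ 2) * Real.sinh p.2, √(1 + p.1 ^ 2) * Real.cosh p.2] := fun p => by
    refine exists_hyp_eq ?_ (mul_pos (hpos _) (Real.cosh_pos _))
    simp only [mink, Matrix.cons_val_zero, Matrix.cons_val_one, Matrix.cons_val]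
    linear_combination (-(1 : ℝ)) * hsq p.1 - √(1 + p.1 ^ 2) ^ 2 * Real.cosh_sq p.2
  choose E hE using hex
  refine ⟨E, continuous_of_hyp_comp ?_, fun b w => hE (b, w), fun z => hyp_injective ?_⟩
  · refine continuous_pi fun i => ?_
    simp only [hE]
    fin_cases i <;> simp only [Fin.zero_eta, Fin.mk_one, Fin.reduceFinMk, Matrix.cons_val_zero,
      Matrix.cons_val_one, Matrix.cons_val] <;> fun_prop
  · rw [hE]
    have hself := mink_hyp_self z
    unfold mink at hself
    have h2 := hyp_two_pos z
    set b := hyp z 0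
    ext i
    fin_cases i
    · rfl
    · simp only [Fin.mk_one, Matrix.cons_val_one, Matrix.cons_val_zero, Real.sinh_arsinh]
      exact mul_div_cancel₀ _ (hpos b).ne'
    · simp only [Fin.reduceFinMk, Matrix.cons_val, Real.cosh_arsinh]
      rw [← Real.sqrt_mul (by positivity), ← Real.sqrt_sq h2.le]
      congr 1
      rw [div_pow, hsq]
      field_simp
      linarith

/-- The homeomorphism slides points along the equidistant curves `b = const`, taking the half plane
`w ≤ 0` to its union with the disk of radius `ρ`. It moves nothing at distance `3ρ` or more from the
centre, so it can be used near each side separately. -/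
theorem exists_bump_map_I {ρ : ℝ} (hρ : 0 < ρ) : ∃ h : ℍ → ℍ, Continuous h ∧
    Function.Bijective h ∧ (∀ z, 3 * ρ ≤ dist z UpperHalfPlane.I → h z = z) ∧
    ∀ z, (hyp z 1 ≤ 0 ↔ hyp (h z) 1 ≤ 0 ∨ dist (h z) UpperHalfPlane.I ≤ ρ) ∧
      (hyp z 1 < 0 ↔ hyp (h z) 1 < 0 ∨ dist (h z) UpperHalfPlane.I < ρ) := by
  obtain ⟨E, hE, hEh, hEs⟩ := exists_equidistant_coordinates
  have hpos : ∀ b : ℝ, 0 < √(1 + b ^ 2) := fun b => Real.sqrt_pos.2 (by positivity)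
  have hone : ∀ b : ℝ, 1 ≤ √(1 + b ^ 2) := fun b => by
    rw [Real.one_le_sqrt]; nlinarith [sq_nonneg b]
  -- The height at which the curve `b` leaves the disk, since `cosh` of the distance to the centre
  -- is `√(1 + b²) cosh w`; the maximum with `1` makes it zero where the curve misses the disk.
  set f : ℝ → ℝ := fun b => Real.arcosh (max 1 (Real.cosh ρ / √(1 + b ^ 2))) with hf
  have hf1 : ∀ b, Real.cosh (f b) = max 1 (Real.cosh ρ / √(1 + b ^ 2)) := fun b =>
    Real.cosh_arcosh (le_max_left _ _)
  have hf0 : ∀ b, 0 ≤ f b := fun b => Real.arcosh_nonneg (le_max_left _ _)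
  have hfρ : ∀ b, f b ≤ ρ := fun b => by
    have : Real.cosh (f b) ≤ Real.cosh ρ := by
      rw [hf1]
      exact max_le (Real.one_le_cosh ρ) (div_le_self (Real.cosh_pos ρ).le (hone b))
    rwa [Real.cosh_le_cosh, abs_of_nonneg (hf0 b), abs_of_pos hρ] at this
  have hfc : Continuous f := by
    refine Real.continuousOn_arcosh.comp_continuous ?_ fun b => mem_Ici.2 (le_max_left _ _)
    exact continuous_const.max (continuous_const.div (by fun_prop) fun b => (hpos b).ne')
  set W : ℍ → ℝ := fun z => Real.arsinh (hyp z 1 / √(1 + hyp z 0 ^ 2)) with hW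
  have h0c : Continuous fun z : ℍ => hyp z 0 := (continuous_apply 0).comp continuous_hyp
  have h1c : Continuous fun z : ℍ => hyp z 1 := (continuous_apply 1).comp continuous_hyp
  have hWc : Continuous W :=
    Real.continuous_arsinh.comp (h1c.div (by fun_prop) fun z => (hpos _).ne')
  have hWE : ∀ b w, W (E (b, w)) = w := fun b w => by
    have e0 : hyp (E (b, w)) 0 = b := by rw [hEh]; rfl
    have e1 : hyp (E (b, w)) 1 = √(1 + b ^ 2) * Real.sinh w := by rw [hEh]; rfl
    simp only [hW, e0, e1, mul_div_cancel_left₀ _ (hpos b).ne', Real.arsinh_sinh]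
  have hcosh : ∀ b w, Real.cosh (dist (E (b, w)) UpperHalfPlane.I) =
      √(1 + b ^ 2) * Real.cosh w := fun b w => by
    rw [cosh_dist_eq, mink_comm, mink_hyp_I, neg_neg, hEh]; rfl
  have hbnd : ∀ b w s : ℝ, 0 ≤ s → (dist (E (b, w)) UpperHalfPlane.I ≤ s ↔
      √(1 + b ^ 2) * Real.cosh w ≤ Real.cosh s) := fun b w s hs => by
    rw [← hcosh, Real.cosh_le_cosh, abs_of_nonneg dist_nonneg, abs_of_nonneg hs]
  have hbnd' : ∀ b w s : ℝ, 0 ≤ s → (dist (E (b, w)) UpperHalfPlane.I < s ↔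
      √(1 + b ^ 2) * Real.cosh w < Real.cosh s) := fun b w s hs => by
    rw [← hcosh, Real.cosh_lt_cosh, abs_of_nonneg dist_nonneg, abs_of_nonneg hs]
  have hle0 : ∀ b w, hyp (E (b, w)) 1 ≤ 0 ↔ w ≤ 0 := fun b w => by
    have e1 : hyp (E (b, w)) 1 = √(1 + b ^ 2) * Real.sinh w := by rw [hEh]; rfl
    rw [e1, ← Real.sinh_nonpos_iff (x := w)]
    exact ⟨fun h => nonpos_of_mul_nonpos_right h (hpos b),
      fun h => mul_nonpos_of_nonneg_of_nonpos (hpos b).le h⟩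
  have hlt0 : ∀ b w, hyp (E (b, w)) 1 < 0 ↔ w < 0 := fun b w => by
    have e1 : hyp (E (b, w)) 1 = √(1 + b ^ 2) * Real.sinh w := by rw [hEh]; rfl
    rw [e1, ← Real.sinh_neg_iff (x := w)]
    exact ⟨fun h => neg_of_mul_neg_right h (hpos b).le, fun h => mul_neg_of_pos_of_neg (hpos b) h⟩
  have hlef : ∀ b w, w ≤ f b ↔ w ≤ 0 ∨ dist (E (b, w)) UpperHalfPlane.I ≤ ρ := fun b w => by
    rw [hbnd b w ρ hρ.le, ← le_div_iff₀' (hpos b)]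
    constructor
    · intro h
      by_cases hw : w ≤ 0
      · exact Or.inl hw
      right
      have h1 : Real.cosh w ≤ Real.cosh (f b) := by
        rw [Real.cosh_le_cosh, abs_of_pos (not_le.1 hw), abs_of_nonneg (hf0 b)]; exact h
      rw [hf1] at h1
      exact (le_max_iff.1 h1).resolve_left
        (not_le.2 (Real.one_lt_cosh.2 (not_le.1 hw).ne'))
    · rintro (h | h)
      · exact h.trans (hf0 b)
      · have h1 : Real.cosh w ≤ Real.cosh (f b) := by rw [hf1]; exact h.trans (le_max_right _ _)
        rw [Real.cosh_le_cosh, abs_of_nonneg (hf0 b)] at h1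
        exact (le_abs_self w).trans h1
  have hltf : ∀ b w, w < f b ↔ w < 0 ∨ dist (E (b, w)) UpperHalfPlane.I < ρ := fun b w => by
    rw [hbnd' b w ρ hρ.le, ← lt_div_iff₀' (hpos b)]
    constructor
    · intro h
      by_cases hw : w < 0
      · exact Or.inl hw
      right
      have h1 : Real.cosh w < Real.cosh (f b) := by
        rw [Real.cosh_lt_cosh, abs_of_nonneg (not_lt.1 hw), abs_of_nonneg (hf0 b)]; exact h
      rw [hf1] at h1
      exact (lt_max_iff.1 h1).resolve_left (not_lt.2 (Real.one_le_cosh w))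
    · rintro (h | h)
      · exact h.trans_le (hf0 b)
      · have h1 : Real.cosh w < Real.cosh (f b) := by
          rw [hf1]; exact h.trans_le (le_max_right _ _)
        rw [Real.cosh_lt_cosh, abs_of_nonneg (hf0 b)] at h1
        exact (le_abs_self w).trans_lt h1
  have hmono : ∀ b, StrictMono (shift ρ (f b)) := fun b => shift_strictMono hρ (hf0 b) (hfρ b)
  set h : ℍ → ℍ := fun z => E (hyp z 0, shift ρ (f (hyp z 0)) (W z)) with hh
  have hz0 : ∀ b w, hyp (E (b, w)) 0 = b := fun b w => by rw [hEh]; rfl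
  have hhE : ∀ b w, h (E (b, w)) = E (b, shift ρ (f b) w) := fun b w => by
    simp only [hh, hz0, hWE]
  refine ⟨h, ?_, ⟨?_, ?_⟩, ?_, ?_⟩
  · refine hE.comp (h0c.prodMk ?_)
    unfold shift
    exact hWc.add ((hfc.comp h0c).mul (continuous_const.max
      (continuous_const.sub (hWc.abs.div_const _))))
  · intro z z' hzz
    rw [← hEs z, ← hEs z', hhE, hhE] at hzz
    have e0 := congrArg (fun z => hyp z 0) hzz
    simp only [hz0] at e0
    have e1 := congrArg W hzz
    simp only [hWE] at e1
    rw [← e0] at e1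
    rw [← hEs z, ← hEs z', ← e0]
    have e2 := (hmono _).injective e1
    rw [e2]
  · intro z
    obtain ⟨w, hw⟩ := shift_surjective (f := f (hyp z 0)) hρ (W z)
    exact ⟨E (hyp z 0, w), by rw [hhE, hw]; exact hEs z⟩
  · intro z hz
    rw [← hEs z] at hz ⊢
    rw [hhE]
    congr 2
    set b := hyp z 0
    change 3 * ρ ≤ dist (E (b, W z)) _ at hz
    change shift ρ (f b) (W z) = W z
    by_cases hw : 2 * ρ ≤ |W z|
    · exact shift_of_le hρ hw
    by_cases hfb : f b = 0
    · rw [hfb, shift]; ring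
    exfalso
    -- A point that really moves has `√(1 + b²) < cosh ρ` and `|w| < 2ρ`, so its distance to the
    -- centre is less than `3ρ` by the addition formula for `cosh`.
    have hs : √(1 + b ^ 2) < Real.cosh ρ := by
      have h1 : 1 < max 1 (Real.cosh ρ / √(1 + b ^ 2)) := by
        rw [← hf1]; exact Real.one_lt_cosh.2 hfb
      have h2 := (lt_max_iff.1 h1).resolve_left (lt_irrefl _)
      rwa [one_lt_div (hpos b)] at h2
    have h1 : Real.cosh (3 * ρ) ≤ √(1 + b ^ 2) * Real.cosh (W z) := by
      rw [← hcosh, Real.cosh_le_cosh, abs_of_nonneg dist_nonneg, abs_of_pos (by positivity)]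
      exact hz
    have h2 : Real.cosh (W z) < Real.cosh (2 * ρ) := by
      rw [Real.cosh_lt_cosh, abs_of_pos (show 0 < 2 * ρ by positivity)]; exact not_le.1 hw
    have h3 : Real.cosh (3 * ρ) =
        Real.cosh ρ * Real.cosh (2 * ρ) + Real.sinh ρ * Real.sinh (2 * ρ) := by
      rw [← Real.cosh_add]; congr 1; ring
    have h4 : 0 < Real.sinh ρ * Real.sinh (2 * ρ) :=
      mul_pos (Real.sinh_pos_iff.2 hρ) (Real.sinh_pos_iff.2 (by positivity))
    have h5 := mul_lt_mul'' hs h2 (hpos b).le (Real.cosh_pos _).le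
    linarith
  · intro z
    rw [← hEs z, hhE]
    change (hyp (E (_, W z)) 1 ≤ 0 ↔ _) ∧ (hyp (E (_, W z)) 1 < 0 ↔ _)
    set b := hyp z 0
    rw [hle0, hlt0, hle0, hlt0]
    change (W z ≤ 0 ↔ shift ρ (f b) (W z) ≤ 0 ∨ dist (E (b, shift ρ (f b) (W z))) _ ≤ ρ) ∧
      (W z < 0 ↔ shift ρ (f b) (W z) < 0 ∨ dist (E (b, shift ρ (f b) (W z))) _ < ρ)
    rw [← hlef, ← hltf]
    constructor
    · rw [← (hmono b).le_iff_le, shift_zero]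
    · rw [← (hmono b).lt_iff_lt, shift_zero]

/-- Move the centre to `m`, then correct the direction by the reflection whose normal is the
difference of the two directions; it fixes the centre because both directions are tangent there. -/
theorem exists_isometry_frame {m : ℍ} {n : Fin 3 → ℝ} (hn : mink n n = 1)
    (hmn : mink (hyp m) n = 0) :
    ∃ φ : ℍ ≃ᵢ ℍ, φ UpperHalfPlane.I = m ∧ lin φ ![0, 1, 0] = n := by
  obtain ⟨φ, rfl⟩ := exists_isometry_apply_eq UpperHalfPlane.I m
  set e : Fin 3 → ℝ := ![0, 1, 0] with he
  set k := lin φ⁻¹ n with hk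
  have hφk : lin φ k = n := lin_apply_inv φ n
  have hk1 : mink k k = 1 := by rw [hk, mink_lin, hn]
  have hk2 : k 2 = 0 := by
    rw [← hφk, mink_hyp_lin, mink_hyp_I] at hmn
    linarith
  have he1 : mink e e = 1 := by simp [mink, he]
  by_cases hek : e = k
  · exact ⟨φ, rfl, by rw [hek, hφk]⟩
  set d := e - k with hd
  have hd0 : d ≠ 0 := sub_ne_zero.2 hek
  have hd2 : d 2 = 0 := by
    rw [hd, Pi.sub_apply, hk2, he]; simp
  have hdd : 0 < mink d d := mink_self_pos_of_orthogonal (z := UpperHalfPlane.I)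
    (by rw [mink_hyp_I, hd2, neg_zero]) hd0
  set c := (√(mink d d))⁻¹ with hc
  have hcc : c ^ 2 * mink d d = 1 := by
    rw [hc, inv_pow, Real.sq_sqrt hdd.le, inv_mul_cancel₀ hdd.ne']
  have hu : mink (c • d) (c • d) = 1 := by
    rw [mink_smul_left, mink_smul_right]; linarith
  refine ⟨φ * refl (c • d) hu, ?_, ?_⟩
  · rw [IsometryEquiv.mul_apply, (refl_eq_self_iff hu).2]
    rw [mink_hyp_I, Pi.smul_apply, hd2, smul_zero, neg_zero]
  · rw [lin_mul, lin_refl, ← hφk]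
    congr 1
    have h1 : 2 * mink e d = mink d d := by
      simp only [hd, mink_sub_left, mink_sub_right, he1, hk1, mink_comm k e]; ring
    rw [reflVec, mink_smul_right, smul_smul]
    have h2 : 2 * (c * mink e d) * c = 1 := by linear_combination c ^ 2 * h1 + hcc
    rw [h2, one_smul, hd]; abel

theorem exists_bump_map {ρ : ℝ} (hρ : 0 < ρ) {m : ℍ} {n : Fin 3 → ℝ} (hn : mink n n = 1)
    (hmn : mink (hyp m) n = 0) : ∃ h : ℍ → ℍ, Continuous h ∧
    Function.Bijective h ∧ (∀ z, 3 * ρ ≤ dist z m → h z = z) ∧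
    ∀ z, (mink (hyp z) n ≤ 0 ↔ mink (hyp (h z)) n ≤ 0 ∨ dist (h z) m ≤ ρ) ∧
      (mink (hyp z) n < 0 ↔ mink (hyp (h z)) n < 0 ∨ dist (h z) m < ρ) := by
  obtain ⟨φ, rfl, rfl⟩ := exists_isometry_frame hn hmn
  obtain ⟨h, hc, hb, hfar, hnear⟩ := exists_bump_map_I hρ
  have e1 : ∀ z : ℍ, hyp z 1 = mink (hyp z) ![0, 1, 0] := fun z => by simp [mink]
  refine ⟨fun z => φ (h (φ.symm z)), φ.continuous.comp (hc.comp φ.symm.continuous),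
    φ.bijective.comp (hb.comp φ.symm.bijective), fun z hz => ?_, fun z => ?_⟩
  · obtain ⟨y, rfl⟩ := φ.surjective z
    rw [φ.dist_eq] at hz
    simp only [φ.symm_apply_apply, hfar y hz]
  · obtain ⟨y, rfl⟩ := φ.surjective z
    have := hnear y
    simp only [φ.symm_apply_apply, φ.dist_eq, mink_hyp_lin, ← e1]
    exact this

/-! ### The modified octagon as a homeomorphic image of the octagon -/

theorem mid_injective : Function.Injective mid := by
  intro j k h
  by_contra hne
  have h1 := mink_mid_nrm_neg hne
  rw [h, mink_mid_nrm_self] at h1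
  exact lt_irrefl _ h1

/-- The radius is so small that within `4ρ` of the midpoint of a side only that side restricts the
octagon, and that these neighbourhoods are disjoint. Every later question about a protrusion becomes
local. -/
theorem exists_rad : ∃ ρ : ℝ, 0 < ρ ∧
    (∀ j k : ZMod 8, j ≠ k → ∀ z, dist z (mid k) ≤ 4 * ρ → mink (hyp z) (nrm j) < 0) ∧
    ∀ j k : ZMod 8, j ≠ k → 8 * ρ < dist (mid j) (mid k) := by
  have h1 : ∀ j k : ZMod 8, ∀ᶠ ρ in 𝓝[>] (0 : ℝ),
      j ≠ k → ∀ z, dist z (mid k) ≤ 4 * ρ → mink (hyp z) (nrm j) < 0 := by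
    intro j k
    by_cases hjk : j = k
    · exact Eventually.of_forall fun ρ h => absurd hjk h
    obtain ⟨ε, hε, h⟩ := Metric.isOpen_iff.1 (isOpen_mink_lt (nrm j) 0) (mid k)
      (mink_mid_nrm_neg (Ne.symm hjk))
    filter_upwards [Ioo_mem_nhdsGT (show (0 : ℝ) < ε / 4 by positivity)] with ρ hρ _ z hz
    exact h (Metric.mem_ball.2 (hz.trans_lt (by linarith [hρ.2])))
  have h2 : ∀ j k : ZMod 8, ∀ᶠ ρ in 𝓝[>] (0 : ℝ), j ≠ k → 8 * ρ < dist (mid j) (mid k) := by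
    intro j k
    by_cases hjk : j = k
    · exact Eventually.of_forall fun ρ h => absurd hjk h
    have hd : 0 < dist (mid j) (mid k) := dist_pos.2 (mid_injective.ne hjk)
    filter_upwards [Ioo_mem_nhdsGT (show (0 : ℝ) < dist (mid j) (mid k) / 8 by positivity)]
      with ρ hρ _
    linarith [hρ.2]
  obtain ⟨ρ, hρ1, hρ2, hρ⟩ := ((eventually_all.2 fun j => eventually_all.2 (h1 j)).and
    ((eventually_all.2 fun j => eventually_all.2 (h2 j)).and self_mem_nhdsWithin)).exists
  exact ⟨ρ, hρ, hρ1, hρ2⟩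

/-- The radius of the protrusions. -/
def rad : ℝ := exists_rad.choose

theorem rad_pos : 0 < rad := exists_rad.choose_spec.1

theorem mink_nrm_neg_of_near {j k : ZMod 8} (hjk : j ≠ k) {z : ℍ}
    (hz : dist z (mid k) ≤ 4 * rad) : mink (hyp z) (nrm j) < 0 :=
  exists_rad.choose_spec.2.1 j k hjk z hz

theorem lt_dist_mid {j k : ZMod 8} (hjk : j ≠ k) : 8 * rad < dist (mid j) (mid k) :=
  exists_rad.choose_spec.2.2 j k hjk

theorem eq_of_near {j k : ZMod 8} {z : ℍ} (hj : dist z (mid j) ≤ 4 * rad)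
    (hk : dist z (mid k) ≤ 4 * rad) : j = k := by
  by_contra h
  have := lt_dist_mid h
  have := dist_triangle_left (mid j) (mid k) z
  linarith

/-- The sides that carry a protrusion. -/
def bump (k : ZMod 8) : Prop := k.val < 4

theorem bump_add_four (k : ZMod 8) : bump (k + 4) ↔ ¬bump k := by
  revert k; unfold bump; decide

/-- The octagon with protrusions on the sides `0, …, 3` and indentations on the sides
`4, …, 7`. -/
def modTile : Set ℍ := {z | (z ∈ octagon ∧ ∀ k, ¬bump k → rad ≤ dist z (mid k)) ∨
  ∃ k, bump k ∧ dist z (mid k) ≤ rad}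

/-- The interior of `modTile`. -/
def modOpen : Set ℍ := {z | (z ∈ interior octagon ∧ ∀ k, ¬bump k → rad < dist z (mid k)) ∨
  ∃ k, bump k ∧ dist z (mid k) < rad}

theorem mem_octagon_iff_near {k : ZMod 8} {z : ℍ} (hz : dist z (mid k) ≤ 4 * rad) :
    z ∈ octagon ↔ mink (hyp z) (nrm k) ≤ 0 := by
  refine ⟨fun h => h k, fun h j => ?_⟩
  by_cases hjk : j = k
  · rw [hjk]; exact h
  · exact (mink_nrm_neg_of_near hjk hz).le

theorem mem_interior_octagon_iff_near {k : ZMod 8} {z : ℍ} (hz : dist z (mid k) ≤ 4 * rad) :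
    z ∈ interior octagon ↔ mink (hyp z) (nrm k) < 0 := by
  rw [octagon_interior_eq]
  refine ⟨fun h => h k, fun h j => ?_⟩
  by_cases hjk : j = k
  · rw [hjk]; exact h
  · exact mink_nrm_neg_of_near hjk hz

theorem mem_modTile_iff_bump {k : ZMod 8} (hk : bump k) {z : ℍ} (hz : dist z (mid k) ≤ 4 * rad) :
    z ∈ modTile ↔ mink (hyp z) (nrm k) ≤ 0 ∨ dist z (mid k) ≤ rad := by
  have hr := rad_pos
  constructor
  · rintro (⟨h, -⟩ | ⟨j, hj, h⟩)
    · exact Or.inl (h k)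
    · rw [eq_of_near hz (h.trans (by linarith))]; exact Or.inr h
  · rintro (h | h)
    · refine Or.inl ⟨(mem_octagon_iff_near hz).2 h, fun j hj => ?_⟩
      by_contra hcon
      exact hj (eq_of_near hz ((not_le.1 hcon).le.trans (by linarith)) ▸ hk)
    · exact Or.inr ⟨k, hk, h⟩

theorem mem_modTile_iff_dent {k : ZMod 8} (hk : ¬bump k) {z : ℍ}
    (hz : dist z (mid k) ≤ 4 * rad) :
    z ∈ modTile ↔ mink (hyp z) (nrm k) ≤ 0 ∧ rad ≤ dist z (mid k) := by
  have hr := rad_pos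
  constructor
  · rintro (⟨h, h'⟩ | ⟨j, hj, h⟩)
    · exact ⟨h k, h' k hk⟩
    · exact absurd (eq_of_near hz (h.trans (by linarith)) ▸ hj) hk
  · rintro ⟨h, h'⟩
    refine Or.inl ⟨(mem_octagon_iff_near hz).2 h, fun j hj => ?_⟩
    by_contra hcon
    rw [eq_of_near ((not_le.1 hcon).le.trans (by linarith)) hz] at hcon
    exact hcon h'

theorem mem_modOpen_iff_bump {k : ZMod 8} (hk : bump k) {z : ℍ} (hz : dist z (mid k) ≤ 4 * rad) :
    z ∈ modOpen ↔ mink (hyp z) (nrm k) < 0 ∨ dist z (mid k) < rad := by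
  have hr := rad_pos
  constructor
  · rintro (⟨h, -⟩ | ⟨j, hj, h⟩)
    · exact Or.inl ((mem_interior_octagon_iff_near hz).1 h)
    · rw [eq_of_near hz (h.le.trans (by linarith))]; exact Or.inr h
  · rintro (h | h)
    · refine Or.inl ⟨(mem_interior_octagon_iff_near hz).2 h, fun j hj => ?_⟩
      by_contra hcon
      exact hj (eq_of_near hz ((not_lt.1 hcon).trans (by linarith)) ▸ hk)
    · exact Or.inr ⟨k, hk, h⟩

theorem mem_modOpen_iff_dent {k : ZMod 8} (hk : ¬bump k) {z : ℍ}
    (hz : dist z (mid k) ≤ 4 * rad) :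
    z ∈ modOpen ↔ mink (hyp z) (nrm k) < 0 ∧ rad < dist z (mid k) := by
  have hr := rad_pos
  constructor
  · rintro (⟨h, h'⟩ | ⟨j, hj, h⟩)
    · exact ⟨(mem_interior_octagon_iff_near hz).1 h, h' k hk⟩
    · exact absurd (eq_of_near hz (h.le.trans (by linarith)) ▸ hj) hk
  · rintro ⟨h, h'⟩
    refine Or.inl ⟨(mem_interior_octagon_iff_near hz).2 h, fun j hj => ?_⟩
    by_contra hcon
    rw [eq_of_near ((not_lt.1 hcon).trans (by linarith)) hz] at hcon
    exact hcon h'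

theorem mem_modTile_iff_far {z : ℍ} (hz : ∀ k, rad < dist z (mid k)) :
    z ∈ modTile ↔ z ∈ octagon := by
  constructor
  · rintro (⟨h, -⟩ | ⟨j, -, h⟩)
    · exact h
    · exact absurd h (not_le.2 (hz j))
  · exact fun h => Or.inl ⟨h, fun k _ => (hz k).le⟩

theorem mem_modOpen_iff_far {z : ℍ} (hz : ∀ k, rad < dist z (mid k)) :
    z ∈ modOpen ↔ z ∈ interior octagon := by
  constructor
  · rintro (⟨h, -⟩ | ⟨j, -, h⟩)
    · exact h
    · exact absurd h (not_lt.2 (hz j).le)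
  · exact fun h => Or.inl ⟨h, fun k _ => hz k⟩

/-- A map that carries the octagon to `modTile` near one of its sides. -/
theorem exists_side_map (k : ZMod 8) : ∃ h : ℍ → ℍ, Continuous h ∧ Function.Bijective h ∧
    (∀ z, 3 * rad ≤ dist z (mid k) → h z = z) ∧
    ∀ z, dist z (mid k) < 3 * rad → dist (h z) (mid k) < 3 * rad ∧
      (z ∈ octagon ↔ h z ∈ modTile) ∧ (z ∈ interior octagon ↔ h z ∈ modOpen) := by
  have hr := rad_pos
  have hin : ∀ h : ℍ → ℍ, Function.Injective h → (∀ z, 3 * rad ≤ dist z (mid k) → h z = z) →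
      ∀ z, dist z (mid k) < 3 * rad → dist (h z) (mid k) < 3 * rad := by
    intro h hi hfar z hz
    by_contra hcon
    have := hi (hfar _ (not_lt.1 hcon))
    rw [this] at hcon
    exact hcon hz
  by_cases hk : bump k
  · obtain ⟨h, hc, hb, hfar, hnear⟩ := exists_bump_map hr (mink_nrm_self k) (mink_mid_nrm_self k)
    refine ⟨h, hc, hb, hfar, fun z hz => ?_⟩
    have h1 := hin h hb.1 hfar z hz
    have h2 : dist z (mid k) ≤ 4 * rad := by linarith
    have h3 : dist (h z) (mid k) ≤ 4 * rad := by linarith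
    rw [mem_octagon_iff_near h2, mem_interior_octagon_iff_near h2, mem_modTile_iff_bump hk h3,
      mem_modOpen_iff_bump hk h3]
    exact ⟨h1, hnear z⟩
  · obtain ⟨h, hc, hb, hfar, hnear⟩ := exists_bump_map (m := mid k) (n := -nrm k) hr
      (by rw [mink_neg_left, mink_neg_right, neg_neg, mink_nrm_self])
      (by rw [mink_neg_right, mink_mid_nrm_self, neg_zero])
    refine ⟨h, hc, hb, hfar, fun z hz => ?_⟩
    have h1 := hin h hb.1 hfar z hz
    have h2 : dist z (mid k) ≤ 4 * rad := by linarith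
    have h3 : dist (h z) (mid k) ≤ 4 * rad := by linarith
    rw [mem_octagon_iff_near h2, mem_interior_octagon_iff_near h2, mem_modTile_iff_dent hk h3,
      mem_modOpen_iff_dent hk h3]
    obtain ⟨h4, h5⟩ := hnear z
    simp only [mink_neg_right, neg_nonpos, neg_neg_iff_pos] at h4 h5
    refine ⟨h1, ?_, ?_⟩
    · rw [← not_lt, h5, not_or, not_lt, not_lt]
    · rw [← not_le, h4, not_or, not_le, not_le]

/-- The eight side maps move points only in disjoint neighbourhoods of the midpoints, so their
composition acts like a single one of them near each side. -/
theorem exists_octagon_map : ∃ H : ℍ → ℍ, Continuous H ∧ Function.Bijective H ∧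
    ∀ z, (z ∈ octagon ↔ H z ∈ modTile) ∧ (z ∈ interior octagon ↔ H z ∈ modOpen) := by
  have hr := rad_pos
  have key : ∀ s : Finset (ZMod 8), ∃ H : ℍ → ℍ, Continuous H ∧ Function.Bijective H ∧
      (∀ z, (∀ k ∈ s, 3 * rad ≤ dist z (mid k)) → H z = z) ∧
      ∀ k ∈ s, ∀ z, dist z (mid k) < 3 * rad → dist (H z) (mid k) < 3 * rad ∧
        (z ∈ octagon ↔ H z ∈ modTile) ∧ (z ∈ interior octagon ↔ H z ∈ modOpen) := by
    intro s
    induction s using Finset.induction_on with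
    | empty =>
      exact ⟨id, continuous_id, Function.bijective_id, fun _ _ => rfl,
        fun k hk => absurd hk (Finset.notMem_empty k)⟩
    | insert a s has ih =>
      obtain ⟨H, hc, hb, hfar, hnear⟩ := ih
      obtain ⟨h, hc', hb', hfar', hnear'⟩ := exists_side_map a
      refine ⟨H ∘ h, hc.comp hc', hb.comp hb', fun z hz => ?_, fun k hk z hz => ?_⟩
      · rw [Function.comp_apply, hfar' z (hz a (Finset.mem_insert_self a s)),
          hfar z fun k hk => hz k (Finset.mem_insert_of_mem hk)]
      · rw [Function.comp_apply]
        by_cases hka : k = a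
        · subst hka
          obtain ⟨h1, h2⟩ := hnear' z hz
          rw [hfar (h z)]
          · exact ⟨h1, h2⟩
          · intro j hj
            by_contra hcon
            have hjk : j = k := eq_of_near (z := h z) (by linarith [not_le.1 hcon]) (by linarith)
            exact has (hjk ▸ hj)
        · rw [hfar' z]
          · exact hnear k ((Finset.mem_insert.1 hk).resolve_left hka) z hz
          · by_contra hcon
            exact hka (eq_of_near (z := z) (by linarith) (by linarith [not_le.1 hcon]))
  obtain ⟨H, hc, hb, hfar, hnear⟩ := key Finset.univ
  refine ⟨H, hc, hb, fun z => ?_⟩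
  by_cases hz : ∃ k, dist z (mid k) < 3 * rad
  · obtain ⟨k, hk⟩ := hz
    exact (hnear k (Finset.mem_univ k) z hk).2
  · push Not at hz
    have h1 : ∀ k, rad < dist z (mid k) := fun k => lt_of_lt_of_le (by linarith) (hz k)
    rw [hfar z fun k _ => hz k, mem_modTile_iff_far h1, mem_modOpen_iff_far h1]
    exact ⟨Iff.rfl, Iff.rfl⟩

theorem exists_octagon_map_image : ∃ H : ℍ → ℍ, Continuous H ∧ Function.Injective H ∧
    H '' octagon = modTile ∧ H '' interior octagon = modOpen := by
  obtain ⟨H, hc, hb, h⟩ := exists_octagon_map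
  refine ⟨H, hc, hb.1, ?_, ?_⟩
  · ext z
    obtain ⟨y, rfl⟩ := hb.2 z
    rw [hb.1.mem_set_image, (h y).1]
  · ext z
    obtain ⟨y, rfl⟩ := hb.2 z
    rw [hb.1.mem_set_image, (h y).2]

theorem isTile_modTile : IsTile modTile := by
  obtain ⟨H, hc, hi, h, -⟩ := exists_octagon_map_image
  rw [← h]
  exact isTile_octagon.image isCompact_octagon hc hi.injOn

theorem isCompact_modTile : IsCompact modTile := by
  obtain ⟨H, hc, hi, h, -⟩ := exists_octagon_map_image
  rw [← h]
  exact isCompact_octagon.image hc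

theorem modOpen_subset : modOpen ⊆ modTile := by
  rintro z (⟨h, h'⟩ | ⟨k, hk, h⟩)
  · exact Or.inl ⟨interior_subset h, fun k hk => (h' k hk).le⟩
  · exact Or.inr ⟨k, hk, h.le⟩

theorem isOpen_modOpen : IsOpen modOpen := by
  have : modOpen = (interior octagon ∩ ⋂ k ∈ {k : ZMod 8 | ¬bump k}, {z | rad < dist z (mid k)}) ∪
      ⋃ k ∈ {k : ZMod 8 | bump k}, Metric.ball (mid k) rad := by
    ext z
    simp [modOpen]
  rw [this]
  refine (isOpen_interior.inter ((toFinite _).isOpen_biInter fun k _ => ?_)).union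
    (isOpen_biUnion fun k _ => Metric.isOpen_ball)
  exact isOpen_lt continuous_const (continuous_id.dist continuous_const)

theorem closure_modOpen : closure modOpen = modTile := by
  refine Subset.antisymm (closure_minimal modOpen_subset isCompact_modTile.isClosed) ?_
  obtain ⟨H, hc, hi, h, h'⟩ := exists_octagon_map_image
  rw [← h, ← h']
  conv_lhs => rw [← closure_interior_octagon]
  exact image_closure_subset_closure_image hc

theorem isConnected_modOpen : IsConnected modOpen := by
  obtain ⟨H, hc, hi, h, h'⟩ := exists_octagon_map_image
  rw [← h']
  exact isConnected_interior_octagon.image H hc.continuousOn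

theorem modOpen_subset_interior : modOpen ⊆ interior modTile :=
  interior_maximal modOpen_subset isOpen_modOpen

theorem closure_interior_modTile : closure (interior modTile) = modTile :=
  Subset.antisymm (closure_minimal interior_subset isCompact_modTile.isClosed)
    (closure_modOpen.symm.subset.trans (closure_mono modOpen_subset_interior))

theorem isConnected_interior_modTile : IsConnected (interior modTile) :=
  isConnected_modOpen.subset_closure modOpen_subset_interior
    (interior_subset.trans closure_modOpen.symm.subset)


/-! ### The two tilings -/

/-- `S` is a prototile for `Γ`: its translates cover the plane, and their interiors are disjoint. -/
structure IsPrototile (Γ : Subgroup (ℍ ≃ᵢ ℍ)) (S : Set ℍ) : Prop where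
  eq_one : ∀ γ ∈ Γ, (interior (γ '' S) ∩ interior S).Nonempty → γ = 1
  cover : ∀ z, ∃ γ ∈ Γ, z ∈ γ '' S

theorem image_interior_isometry (φ : ℍ ≃ᵢ ℍ) (S : Set ℍ) :
    interior (φ '' S) = φ '' interior S := (φ.toHomeomorph.image_interior S).symm

theorem image_frontier_isometry (φ : ℍ ≃ᵢ ℍ) (S : Set ℍ) :
    frontier (φ '' S) = φ '' frontier S := (φ.toHomeomorph.image_frontier S).symm

theorem image_closure_isometry (φ : ℍ ≃ᵢ ℍ) (S : Set ℍ) :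
    closure (φ '' S) = φ '' closure S := (φ.toHomeomorph.image_closure S).symm

theorem mem_image_isometry {φ : ℍ ≃ᵢ ℍ} {S : Set ℍ} {z : ℍ} : z ∈ φ '' S ↔ φ⁻¹ z ∈ S := by
  constructor
  · rintro ⟨y, hy, rfl⟩; rwa [IsometryEquiv.inv_apply_self]
  · exact fun h => ⟨_, h, IsometryEquiv.apply_inv_self _ _⟩

theorem IsPrototile.eq_of_inter {Γ : Subgroup (ℍ ≃ᵢ ℍ)} {S : Set ℍ} (h : IsPrototile Γ S)
    {γ γ' : ℍ ≃ᵢ ℍ} (hγ : γ ∈ Γ) (hγ' : γ' ∈ Γ)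
    (hne : (interior (γ '' S) ∩ interior (γ' '' S)).Nonempty) : γ = γ' := by
  have h1 := h.eq_one (γ'⁻¹ * γ) (mul_mem (inv_mem hγ') hγ) ?_
  · exact (inv_mul_eq_one.1 h1).symm
  · obtain ⟨z, hz, hz'⟩ := hne
    rw [image_interior_isometry, mem_image_isometry] at hz hz'
    refine ⟨γ'⁻¹ z, ?_, hz'⟩
    rw [image_interior_isometry, mem_image_isometry, mul_inv_rev, inv_inv, IsometryEquiv.mul_apply,
      IsometryEquiv.apply_inv_self]
    exact hz

theorem IsPrototile.move_inj {Γ : Subgroup (ℍ ≃ᵢ ℍ)} {K : NonemptyCompacts ℍ}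
    (h : IsPrototile Γ K) (hK : (interior (K : Set ℍ)).Nonempty) {γ γ' : ℍ ≃ᵢ ℍ} (hγ : γ ∈ Γ)
    (hγ' : γ' ∈ Γ) (he : move γ K = move γ' K) : γ = γ' := by
  refine h.eq_of_inter hγ hγ' ?_
  rw [← coe_move, ← coe_move, he, inter_self, coe_move, image_interior_isometry]
  exact hK.image _

theorem IsPrototile.isTiling {Γ : Subgroup (ℍ ≃ᵢ ℍ)} {K : NonemptyCompacts ℍ}
    (h : IsPrototile Γ K) (hK : IsTile (K : Set ℍ)) : IsTiling {K} (translates Γ K) := by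
  refine ⟨⟨?_, ?_⟩, ?_, ?_⟩
  · rintro _ ⟨γ, -, rfl⟩
    exact ⟨K, rfl, γ, rfl⟩
  · rintro _ ⟨γ, hγ, rfl⟩ _ ⟨γ', hγ', rfl⟩ hne
    refine disjoint_iff_inter_eq_empty.2 (not_nonempty_iff_eq_empty.1 fun hn => hne ?_)
    rw [h.eq_of_inter hγ hγ' hn]
  · rintro _ ⟨γ, -, rfl⟩
    exact hK.image K.isCompact γ.continuous γ.injective.injOn
  · refine eq_univ_of_forall fun z => ?_
    obtain ⟨γ, hγ, hz⟩ := h.cover z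
    exact mem_biUnion ⟨γ, hγ, rfl⟩ hz

theorem isPrototile_octagon : IsPrototile surfGroup octagon :=
  ⟨fun _ hγ h => eq_one_of_surfGroup_interior hγ h, exists_surfGroup_mem_octagon⟩

theorem mem_gen_image_interior {k : ZMod 8} {z : ℍ} :
    (gen k)⁻¹ z ∈ interior octagon ↔ refl (nrm k) (mink_nrm_self k) z ∈ interior octagon := by
  rw [← mem_image_isometry, ← image_interior_isometry, gen_image_octagon, image_interior_isometry,
    mem_image_isometry, inv_eq_of_mul_eq_one_left (refl_mul_self _ _)]

theorem dist_gen_inv (k : ZMod 8) (z : ℍ) : dist ((gen k)⁻¹ z) (mid (k + 4)) = dist z (mid k) := by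
  rw [← (gen k).dist_eq, IsometryEquiv.apply_inv_self, gen_mid]

theorem dist_refl_nrm (k : ZMod 8) (z : ℍ) :
    dist (refl (nrm k) (mink_nrm_self k) z) (mid k) = dist z (mid k) := by
  conv_lhs => rw [← (refl_eq_self_iff (mink_nrm_self k)).2 (mink_mid_nrm_self k)]
  exact (refl _ _).dist_eq _ _

/-- Away from the side lines, the modified octagon is the octagon without its indentations together
with translates of these indentations by the side pairings. It is thus equidecomposable with the
octagon under the surface group. -/
theorem modOpen_decomp {z : ℍ} (hz : z ∈ modOpen) (h0 : ∀ k, mink (hyp z) (nrm k) ≠ 0) :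
    (z ∈ interior octagon ∧ ∀ k, ¬bump k → rad < dist z (mid k)) ∨
    ∃ k, bump k ∧ (gen k)⁻¹ z ∈ interior octagon ∧ dist ((gen k)⁻¹ z) (mid (k + 4)) < rad := by
  have hr := rad_pos
  rcases hz with h | ⟨k, hk, h⟩
  · exact Or.inl h
  have hnear : dist z (mid k) ≤ 4 * rad := by linarith
  rcases lt_or_gt_of_ne (h0 k) with h1 | h1
  · refine Or.inl ⟨(mem_interior_octagon_iff_near hnear).2 h1, fun j hj => ?_⟩
    by_contra hcon
    exact hj (eq_of_near hnear ((not_lt.1 hcon).trans (by linarith)) ▸ hk)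
  · refine Or.inr ⟨k, hk, ?_, by rwa [dist_gen_inv]⟩
    rw [mem_gen_image_interior, mem_interior_octagon_iff_near (by rwa [dist_refl_nrm]),
      mink_refl_nrm_self]
    linarith

/-- Pieces of a fundamental tile have been moved by elements of the group, so the result is again
fundamental. A point removed in an indentation is covered by the protrusion of a neighbour. -/
theorem isPrototile_modTile : IsPrototile surfGroup modTile := by
  have hr := rad_pos
  refine ⟨fun γ hγ hne => ?_, fun z => ?_⟩
  · have hsub : interior modTile ⊆ closure modOpen :=
      interior_subset.trans closure_modOpen.symm.subset
    rw [image_interior_isometry] at hne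
    obtain ⟨x, hx, hx'⟩ := hne
    have hγo : IsOpen (γ '' interior modTile) := γ.toHomeomorph.isOpenMap _ isOpen_interior
    obtain ⟨x1, ⟨h1, h1'⟩, h1''⟩ := mem_closure_iff.1 (hsub hx') _ (hγo.inter isOpen_interior)
      ⟨hx, hx'⟩
    have h2 : x1 ∈ closure (γ '' modOpen) := by
      rw [image_closure_isometry]; exact image_mono hsub h1
    obtain ⟨x2, h3, h3'⟩ := mem_closure_iff.1 h2 _ isOpen_modOpen h1''
    -- An overlap is open and nonempty, hence of positive area. It therefore contains a point off
    -- all side lines, where the decomposition applies to both tiles.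
    have hO : IsOpen (modOpen ∩ γ '' modOpen) :=
      isOpen_modOpen.inter (γ.toHomeomorph.isOpenMap _ isOpen_modOpen)
    have hpos := hO.measure_pos volume ⟨x2, h3, h3'⟩
    have hnull : volume (⋃ k, ({z : ℍ | mink (hyp z) (nrm k) = 0} ∪
        {z : ℍ | mink (hyp z) (lin γ (nrm k)) = 0})) = 0 := by
      refine measure_iUnion_null fun k => measure_union_null
        (volume_mink_eq (ne_zero_of_mink_self (mink_nrm_self k)) _)
        (volume_mink_eq (ne_zero_of_mink_self (by rw [mink_lin, mink_nrm_self])) _)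
    obtain ⟨y, ⟨hy, hy'⟩, hyn⟩ : ∃ y ∈ modOpen ∩ γ '' modOpen, y ∉ (⋃ k,
        ({z : ℍ | mink (hyp z) (nrm k) = 0} ∪ {z : ℍ | mink (hyp z) (lin γ (nrm k)) = 0})) := by
      by_contra! hcon
      exact hpos.ne' (measure_mono_null hcon hnull)
    simp only [mem_iUnion, mem_union, mem_ofPred_eq, not_exists, not_or] at hyn
    obtain ⟨y', hy', rfl⟩ := hy'
    have hd := modOpen_decomp hy fun k => (hyn k).1
    have hd' := modOpen_decomp hy' fun k => by
      have := (hyn k).2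
      rwa [mink_hyp_lin] at this
    -- Both pieces come back to the interior of the octagon, so simple transitivity determines `γ`
    -- and identifies the two preimages. In the mixed cases one point would lie both inside and
    -- outside an indentation.
    have key : ∀ s s' : ℍ ≃ᵢ ℍ, s ∈ surfGroup → s' ∈ surfGroup → s⁻¹ (γ y') ∈ interior octagon →
        s'⁻¹ y' ∈ interior octagon → γ = s * s'⁻¹ ∧ s⁻¹ (γ y') = s'⁻¹ y' := by
      intro s s' hs hs' ho ho'
      have h1 := isPrototile_octagon.eq_one (s⁻¹ * γ * s')
        (mul_mem (mul_mem (inv_mem hs) hγ) hs') ⟨s⁻¹ (γ y'), ?_, ho⟩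
      · have h2 : γ = s * s'⁻¹ := by
          calc γ = s * (s⁻¹ * γ * s') * s'⁻¹ := by group
            _ = s * s'⁻¹ := by rw [h1, mul_one]
        refine ⟨h2, ?_⟩
        rw [h2, IsometryEquiv.mul_apply, IsometryEquiv.inv_apply_self]
      · rw [image_interior_isometry]
        refine ⟨s'⁻¹ y', ho', ?_⟩
        simp [IsometryEquiv.mul_apply]
    rcases hd with ⟨h4, h5⟩ | ⟨k, hk, h4, h5⟩ <;> rcases hd' with ⟨h6, h7⟩ | ⟨j, hj, h6, h7⟩
    · have := (key 1 1 (one_mem _) (one_mem _) (by simpa using h4) (by simpa using h6)).1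
      simpa using this
    · have := (key 1 (gen j) (one_mem _) (gen_mem j) (by simpa using h4) h6).2
      rw [inv_one] at this
      change γ y' = _ at this
      rw [← this] at h7
      exact absurd h7 (not_lt.2 (h5 _ fun hb => (bump_add_four j).1 hb hj).le)
    · have := (key (gen k) 1 (gen_mem k) (one_mem _) h4 (by simpa using h6)).2
      rw [inv_one] at this
      change _ = y' at this
      rw [this] at h5
      exact absurd h5 (not_lt.2 (h7 _ fun hb => (bump_add_four k).1 hb hk).le)
    · obtain ⟨h8, h9⟩ := key (gen k) (gen j) (gen_mem k) (gen_mem j) h4 h6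
      rw [h9] at h5
      have := eq_of_near (h5.le.trans (by linarith)) (h7.le.trans (by linarith))
      rw [h8, add_right_cancel this, mul_inv_cancel]
  · obtain ⟨γ, hγ, y, hy, rfl⟩ := exists_surfGroup_mem_octagon z
    by_cases hm : y ∈ modTile
    · exact ⟨γ, hγ, y, hm, rfl⟩
    obtain ⟨k, hk, hd⟩ : ∃ k, ¬bump k ∧ dist y (mid k) < rad := by
      by_contra! hcon
      exact hm (Or.inl ⟨hy, hcon⟩)
    obtain ⟨j, rfl⟩ : ∃ j, j + 4 = k := ⟨k - 4, sub_add_cancel k 4⟩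
    have hj : bump j := by rwa [bump_add_four, not_not] at hk
    refine ⟨γ * (gen j)⁻¹, mul_mem hγ (inv_mem (gen_mem j)), gen j y, Or.inr ⟨j, hj, ?_⟩, ?_⟩
    · rw [← gen_mid j, (gen j).dist_eq]; exact hd.le
    · rw [IsometryEquiv.mul_apply, IsometryEquiv.inv_apply_self]

/-! ### Half disks as protrusions and indentations -/

theorem exists_frame {m : ℍ} {n : Fin 3 → ℝ} (hn : mink n n = 1) (hmn : mink (hyp m) n = 0) :
    ∃ u, mink u u = 1 ∧ mink u n = 0 ∧ mink (hyp m) u = 0 ∧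
      ∀ v, v = (-mink v (hyp m)) • hyp m + mink v u • u + mink v n • n := by
  obtain ⟨φ, rfl, rfl⟩ := exists_isometry_frame hn hmn
  refine ⟨lin φ ![1, 0, 0], ?_, ?_, ?_, fun v => ?_⟩
  · rw [mink_lin]; simp [mink]
  · rw [mink_lin]; simp [mink]
  · rw [mink_hyp_lin, mink_hyp_I]; simp
  · obtain ⟨w, rfl⟩ : ∃ w, lin φ w = v := ⟨_, lin_apply_inv φ v⟩
    rw [hyp_apply, mink_lin, mink_lin, mink_lin, ← map_smul, ← map_smul, ← map_smul, ← map_add,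
      ← map_add, mink_comm w, mink_hyp_I, hyp_I]
    congr 1
    ext i
    fin_cases i <;> simp [mink]

/-- The part of a line inside a disk centred on it. -/
theorem exists_chord {m : ℍ} {n : Fin 3 → ℝ} (hn : mink n n = 1) (hmn : mink (hyp m) n = 0)
    {ρ : ℝ} (hρ : 0 < ρ) : ∃ a b : ℍ, a ≠ b ∧
      geodesicSegment a b = {z | mink (hyp z) n = 0 ∧ dist z m ≤ ρ} := by
  obtain ⟨u, hu, hun, hmu, hdec⟩ := exists_frame hn hmn
  obtain ⟨γ, hγ, h0, hγs⟩ := exists_geodesic_line hu hmu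
  have hs : 0 < Real.sinh ρ := Real.sinh_pos_iff.2 hρ
  have hc := Real.cosh_pos ρ
  have hcs := Real.cosh_sq ρ
  refine ⟨γ (-ρ), γ ρ, fun h => ?_, ?_⟩
  · have := hγ.injective h
    linarith
  ext z
  rw [mem_geodesicSegment_iff]
  simp only [hγs, Real.cosh_neg, Real.sinh_neg, mem_ofPred_eq]
  have hgen : ∀ s t : ℝ, s • (Real.cosh ρ • hyp m + -Real.sinh ρ • u) +
      t • (Real.cosh ρ • hyp m + Real.sinh ρ • u) =
      ((s + t) * Real.cosh ρ) • hyp m + ((t - s) * Real.sinh ρ) • u := fun s t => by module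
  simp only [hgen]
  have hA : ∀ z : ℍ, Real.cosh (dist z m) = -mink (hyp z) (hyp m) := fun z => cosh_dist_eq z m
  constructor
  · rintro ⟨s, t, hs0, ht0, h⟩
    have e1 : mink (hyp z) (hyp m) = -((s + t) * Real.cosh ρ) := by
      rw [h, mink_add_left, mink_smul_left, mink_smul_left, mink_hyp_self, mink_comm u, hmu]; ring
    refine ⟨by rw [h, mink_add_left, mink_smul_left, mink_smul_left, hmn, hun]; ring, ?_⟩
    rw [dist_le_iff_mink hρ.le, e1, neg_neg]
    have e2 := mink_hyp_self z
    rw [h] at e2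
    simp only [mink_add_left, mink_add_right, mink_smul_left, mink_smul_right, mink_hyp_self, hu,
      hmu, mink_comm u (hyp m)] at e2
    have e3 : (s + t) ^ 2 ≤ 1 := by nlinarith [mul_nonneg hs0 ht0, sq_nonneg (Real.sinh ρ)]
    have e4 : s + t ≤ 1 := by nlinarith
    nlinarith
  · rintro ⟨h1, h2⟩
    rw [dist_le_iff_mink hρ.le] at h2
    set A := -mink (hyp z) (hyp m)
    set B := mink (hyp z) u
    have hz : hyp z = A • hyp m + B • u := by
      have := hdec (hyp z)
      rwa [h1, zero_smul, add_zero] at this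
    have e2 := mink_hyp_self z
    rw [hz] at e2
    simp only [mink_add_left, mink_add_right, mink_smul_left, mink_smul_right, mink_hyp_self, hu,
      hmu, mink_comm u (hyp m)] at e2
    have hA1 : 1 ≤ A := by linarith [mink_hyp_le z m]
    have hB : B ^ 2 ≤ Real.sinh ρ ^ 2 := by nlinarith
    have hBA : |B / Real.sinh ρ| ≤ A / Real.cosh ρ := by
      rw [abs_div, abs_of_pos hs, div_le_div_iff₀ hs hc]
      refine abs_le_of_sq_le_sq' ?_ (by positivity) |>.2
      rw [mul_pow, mul_pow, sq_abs]
      nlinarith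
    obtain ⟨h3, h4⟩ := abs_le.1 hBA
    refine ⟨(A / Real.cosh ρ - B / Real.sinh ρ) / 2, (A / Real.cosh ρ + B / Real.sinh ρ) / 2,
      by linarith, by linarith, ?_⟩
    rw [hz]
    congr 2
    · field_simp; ring
    · field_simp; ring

theorem isBody_halfDisk {m : ℍ} {n : Fin 3 → ℝ} (hn : mink n n = 1) (hmn : mink (hyp m) n = 0)
    {ρ : ℝ} (hρ : 0 < ρ) : IsBody {z : ℍ | 0 ≤ mink (hyp z) n ∧ dist z m ≤ ρ} := by
  have hcl : IsClosed {z : ℍ | 0 ≤ mink (hyp z) n ∧ dist z m ≤ ρ} :=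
    (isClosed_le continuous_const (continuous_mink continuous_hyp continuous_const)).inter
      Metric.isClosed_closedBall
  refine ⟨Metric.isCompact_of_isClosed_isBounded hcl
    (Metric.isBounded_closedBall.subset fun z hz => hz.2), ⟨⟨m, hmn.ge, by simpa using hρ.le⟩,
    isPreconnected_of_forall m fun z hz => ⟨geodesicSegment z m, ?_, right_mem_geodesicSegment _ _,
      left_mem_geodesicSegment _ _, (isConnected_geodesicSegment _ _).isPreconnected⟩⟩, ?_⟩
  · intro p hp
    constructor
    · obtain ⟨s, t, hs, -, h⟩ := mem_geodesicSegment_iff.1 hp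
      rw [h, mink_add_left, mink_smul_left, mink_smul_left, hmn, mul_zero, add_zero]
      exact mul_nonneg hs hz.1
    · have hp : dist z p + dist p m = dist z m := hp
      linarith [hz.2, dist_nonneg (x := z) (y := p)]
  · refine Subset.antisymm (closure_minimal interior_subset hcl) fun z hz => ?_
    obtain ⟨γ, hγ, h0, hγs⟩ := exists_geodesic_line hn hmn
    set q := γ (ρ / 2) with hq
    have hqn : 0 < mink (hyp q) n := by
      rw [hq, hγs, mink_add_left, mink_smul_left, mink_smul_left, hmn, hn, mul_zero, zero_add,
        mul_one]
      exact Real.sinh_pos_iff.2 (by positivity)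
    have hqm : dist q m < ρ := by
      rw [hq, ← h0, hγ.dist_eq, Real.dist_eq, sub_zero, abs_of_pos (by positivity)]; linarith
    have hO : {z : ℍ | 0 < mink (hyp z) n ∧ dist z m < ρ} ⊆
        interior {z : ℍ | 0 ≤ mink (hyp z) n ∧ dist z m ≤ ρ} :=
      interior_maximal (fun z hz => ⟨hz.1.le, hz.2.le⟩)
        ((isOpen_lt continuous_const (continuous_mink continuous_hyp continuous_const)).inter
          Metric.isOpen_ball)
    refine closure_mono hO ?_
    by_cases hzq : z = q
    · rw [hzq]; exact subset_closure ⟨hqn, hqm⟩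
    rw [Metric.mem_closure_iff]
    intro ε hε
    obtain ⟨p, hp, s, t, hs, ht, h⟩ := exists_near_mem_segment hzq hε
    refine ⟨p, ⟨?_, ?_⟩, hp⟩
    · rw [h, mink_add_left, mink_smul_left, mink_smul_left]
      nlinarith [mul_nonneg hs hz.1, mul_pos ht hqn]
    · have h1 := (dist_le_iff_mink hρ.le).1 hz.2
      have h2 := (dist_lt_iff_mink hρ.le).1 hqm
      rw [dist_lt_iff_mink hρ.le, h, mink_add_left, mink_smul_left, mink_smul_left]
      have h3 := mink_hyp_self p
      rw [h] at h3
      simp only [mink_add_left, mink_add_right, mink_smul_left, mink_smul_right, mink_hyp_self,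
        mink_comm (hyp q) (hyp z)] at h3
      have h4 := mink_hyp_le z q
      have h5 : s + t ≤ 1 := by nlinarith [mul_nonneg hs ht.le]
      have h6 := Real.cosh_pos ρ
      nlinarith [mul_le_mul_of_nonneg_left h1 hs, mul_lt_mul_of_pos_left h2 ht]

theorem mem_gen_image_near {k : ZMod 8} {z : ℍ} (hz : dist z (mid k) ≤ 4 * rad) :
    z ∈ gen k '' octagon ↔ 0 ≤ mink (hyp z) (nrm k) := by
  rw [mem_gen_image_octagon, mem_octagon_iff_near (by rwa [dist_refl_nrm]), mink_refl_nrm_self,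
    neg_nonpos]

theorem protrusion_eq (k : ZMod 8) : gen k '' octagon ∩ Metric.closedBall (mid k) rad =
    {z | 0 ≤ mink (hyp z) (nrm k) ∧ dist z (mid k) ≤ rad} := by
  have hr := rad_pos
  ext z
  refine and_congr_left fun hz => mem_gen_image_near ?_
  have : dist z (mid k) ≤ rad := hz
  linarith

theorem indentation_eq (k : ZMod 8) :
    (gen k).symm '' (gen k '' octagon ∩ Metric.closedBall (mid k) rad) =
      octagon ∩ Metric.closedBall (mid (k + 4)) rad := by
  ext z
  constructor
  · rintro ⟨_, ⟨⟨y, hy, rfl⟩, hd⟩, rfl⟩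
    rw [IsometryEquiv.symm_apply_apply]
    refine ⟨hy, ?_⟩
    rwa [Metric.mem_closedBall, ← (gen k).dist_eq, gen_mid]
  · rintro ⟨hz, hd⟩
    refine ⟨gen k z, ⟨⟨z, hz, rfl⟩, ?_⟩, IsometryEquiv.symm_apply_apply _ _⟩
    rwa [Metric.mem_closedBall, ← gen_mid k, (gen k).dist_eq]

/-- A point on the circle of an indentation is the limit of points moved away from the midpoint
along the radius. The sign of the product with the normal of the side does not change on a radius,
so these points stay in the octagon. -/
theorem closure_octagon_diff : closure (octagon \ ⋃ k ∈ {k : ZMod 8 | ¬bump k},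
    octagon ∩ Metric.closedBall (mid k) rad) =
      {z | z ∈ octagon ∧ ∀ k, ¬bump k → rad ≤ dist z (mid k)} := by
  have hr := rad_pos
  have hmem : ∀ z, z ∈ octagon → (∀ k, ¬bump k → rad < dist z (mid k)) → z ∈ octagon \
      ⋃ k ∈ {k : ZMod 8 | ¬bump k}, octagon ∩ Metric.closedBall (mid k) rad := by
    refine fun z hz h => ⟨hz, fun hcon => ?_⟩
    obtain ⟨k, hk, -, hd⟩ := mem_iUnion₂.1 hcon
    exact not_le.2 (h k hk) hd
  refine Subset.antisymm (closure_minimal ?_ ?_) ?_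
  · rintro z ⟨hz, h⟩
    refine ⟨hz, fun k hk => ?_⟩
    by_contra hcon
    exact h (mem_biUnion hk ⟨hz, (not_le.1 hcon).le⟩)
  · refine isClosed_octagon.inter ?_
    have : {z : ℍ | ∀ k, ¬bump k → rad ≤ dist z (mid k)} =
        ⋂ k ∈ {k : ZMod 8 | ¬bump k}, {z | rad ≤ dist z (mid k)} := by ext z; simp
    change IsClosed {z : ℍ | ∀ k, ¬bump k → rad ≤ dist z (mid k)}
    rw [this]
    exact isClosed_biInter fun k _ => isClosed_le continuous_const (by fun_prop)
  · rintro z ⟨hz, h⟩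
    by_cases hall : ∀ k, ¬bump k → rad < dist z (mid k)
    · exact subset_closure (hmem z hz hall)
    push Not at hall
    obtain ⟨k, hk, hd⟩ := hall
    have hd' : dist (mid k) z = rad := by rw [dist_comm]; exact le_antisymm hd (h k hk)
    obtain ⟨u, hu, hmu, hzu⟩ := exists_geodesic (mid k) z (by
      rintro rfl; rw [dist_self] at hd'; linarith)
    obtain ⟨γ, hγ, h0, hγs⟩ := exists_geodesic_line hu hmu
    have hγz : γ rad = z := hyp_injective (by rw [hγs, hzu, hd'])
    have hun : mink u (nrm k) ≤ 0 := by
      have h1 := hz k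
      rw [hzu, mink_add_left, mink_smul_left, mink_smul_left, mink_mid_nrm_self, mul_zero,
        zero_add, hd'] at h1
      exact nonpos_of_mul_nonpos_right h1 (Real.sinh_pos_iff.2 hr)
    have hlim : Tendsto γ (𝓝[>] rad) (𝓝 z) := by
      rw [← hγz]
      exact (hγ.continuous.tendsto _).mono_left nhdsWithin_le_nhds
    refine mem_closure_of_tendsto hlim ?_
    filter_upwards [Ioo_mem_nhdsGT (show rad < 4 * rad by linarith)] with t ht
    have hdt : dist (γ t) (mid k) = t := by
      rw [← h0, hγ.dist_eq, Real.dist_eq, sub_zero, abs_of_pos (by linarith [ht.1])]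
    refine hmem _ ((mem_octagon_iff_near (by rw [hdt]; exact ht.2.le)).2 ?_) fun j hj => ?_
    · rw [hγs, mink_add_left, mink_smul_left, mink_smul_left, mink_mid_nrm_self, mul_zero,
        zero_add]
      exact mul_nonpos_of_nonneg_of_nonpos
        (Real.sinh_nonneg_iff.2 (by linarith [ht.1])) hun
    · by_contra hcon
      have hjk : j = k := eq_of_near ((not_lt.1 hcon).trans (by linarith))
        (by rw [hdt]; exact ht.2.le)
      rw [hjk, hdt] at hcon
      exact hcon ht.1

theorem isModifiedOctagon_modTile : IsModifiedOctagon vtx surfGroup octagon modTile := by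
  have hr := rad_pos
  have hchord := fun k : ZMod 8 => exists_chord (mink_nrm_self k) (mink_mid_nrm_self k) hr
  choose a b hab hseg using hchord
  let p : Fin 4 → ZMod 8 := fun i => ((i : ℕ) : ZMod 8)
  have hbump : ∀ i, bump (p i) := by unfold bump; decide
  have hsurj : ∀ k, bump k → ∃ i, p i = k := by unfold bump; decide
  -- The protrusions sit on the sides `0, …, 3`, each paired with the opposite side.
  refine ⟨p, fun i => p i + 4, fun i => gen (p i),
    fun i => gen (p i) '' octagon ∩ Metric.closedBall (mid (p i)) rad, fun i => a (p i),
    fun i => b (p i), by decide, fun i => ⟨gen_mem _, gen_image_side _, octagon_inter_gen _⟩,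
    fun i => ⟨?_, inter_subset_left, hab _, ?_, ?_⟩, ?_, ?_⟩
  · simp only [protrusion_eq]
    exact isBody_halfDisk (mink_nrm_self _) (mink_mid_nrm_self _) hr
  · intro z hz
    rw [hseg] at hz
    have hnear : dist z (mid (p i)) ≤ 4 * rad := by linarith [hz.2]
    rw [side_eq]
    refine ⟨⟨(mem_octagon_iff_near hnear).2 hz.1.le, hz.1⟩, ?_⟩
    rintro (rfl | rfl)
    -- A vertex also lies on the neighbouring side, whose product vanishes there but is negative
    -- near the midpoint of this side.
    · have h1 := mink_nrm_neg_of_near (j := p i - 1) (by simp; decide) hnear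
      have h2 := mink_vtx_succ_nrm (p i - 1)
      rw [sub_add_cancel] at h2
      linarith
    · have h1 := mink_nrm_neg_of_near (j := p i + 1) (by simp; decide) hnear
      rw [mink_vtx_nrm_self] at h1
      exact lt_irrefl _ h1
  · rw [hseg]
    ext z
    constructor
    · rintro ⟨⟨hz, hd⟩, hf⟩
      have hd : dist z (mid (p i)) ≤ rad := hd
      have hnear : dist z (mid (p i)) ≤ 4 * rad := by linarith
      refine ⟨le_antisymm ?_ ((mem_gen_image_near hnear).1 hz), hd⟩
      by_contra hcon
      refine hf.2 ?_
      rw [image_interior_isometry, mem_image_isometry, mem_gen_image_interior,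
        mem_interior_octagon_iff_near (by rwa [dist_refl_nrm]), mink_refl_nrm_self]
      linarith [not_le.1 hcon]
    · rintro ⟨h0, hd⟩
      have hnear : dist z (mid (p i)) ≤ 4 * rad := by linarith
      have hz := (mem_gen_image_near hnear).2 h0.ge
      refine ⟨⟨hz, hd⟩, subset_closure hz, fun hcon => ?_⟩
      rw [image_interior_isometry, mem_image_isometry, mem_gen_image_interior,
        mem_interior_octagon_iff_near (by rwa [dist_refl_nrm]), mink_refl_nrm_self] at hcon
      linarith
  · intro i j hij
    simp only [indentation_eq]
    refine disjoint_left.2 fun z hz hz' => hij ?_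
    have h1 : dist z (mid (p i + 4)) ≤ rad := hz.2
    have h2 : dist z (mid (p j + 4)) ≤ rad := hz'.2
    have h3 := eq_of_near (h1.trans (by linarith)) (h2.trans (by linarith))
    have : ∀ i j : Fin 4, p i + 4 = p j + 4 → i = j := by decide
    exact this i j h3
  · simp only [indentation_eq]
    have hU : (⋃ i, octagon ∩ Metric.closedBall (mid (p i + 4)) rad) =
        ⋃ k ∈ {k : ZMod 8 | ¬bump k}, octagon ∩ Metric.closedBall (mid k) rad := by
      ext z
      simp only [mem_iUnion]
      constructor
      · rintro ⟨i, h⟩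
        exact ⟨p i + 4, fun hb => (bump_add_four _).1 hb (hbump i), h⟩
      · rintro ⟨k, hk, h⟩
        obtain ⟨i, hi⟩ := hsurj (k - 4) (by
          have := bump_add_four (k - 4)
          rw [sub_add_cancel] at this
          by_contra hcon
          exact hk (this.2 hcon))
        exact ⟨i, by rwa [hi, sub_add_cancel]⟩
    rw [hU, closure_octagon_diff]
    ext z
    constructor
    · rintro (h | ⟨k, hk, hd⟩)
      · exact Or.inl h
      · have hnear : dist z (mid k) ≤ 4 * rad := by linarith
        rcases le_total (mink (hyp z) (nrm k)) 0 with h1 | h1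
        · refine Or.inl ⟨(mem_octagon_iff_near hnear).2 h1, fun j hj => ?_⟩
          by_contra hcon
          exact hj (eq_of_near hnear ((not_le.1 hcon).le.trans (by linarith)) ▸ hk)
        · obtain ⟨i, rfl⟩ := hsurj k hk
          exact Or.inr (mem_iUnion.2 ⟨i, (mem_gen_image_near hnear).2 h1, hd⟩)
    · rintro (h | h)
      · exact Or.inl h
      · obtain ⟨i, -, hd⟩ := mem_iUnion.1 h
        exact Or.inr ⟨p i, hbump i, hd⟩

/-! ### Rigidity of tilings that contain a modified octagon -/

/-- The octagon as a compact set. -/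
def octBody : NonemptyCompacts ℍ :=
  ⟨⟨octagon, isCompact_octagon⟩, ⟨_, interior_subset I_mem_interior_octagon⟩⟩

/-- The modified octagon as a compact set. -/
def modBody : NonemptyCompacts ℍ :=
  ⟨⟨modTile, isCompact_modTile⟩, isConnected_modOpen.nonempty.mono modOpen_subset⟩

theorem coe_octBody : (octBody : Set ℍ) = octagon := rfl

/-- Local finiteness: nearby bodies have disjoint interiors of area bounded below, and bounded
diameter keeps them in a bounded region. -/
theorem IsPacking.finite_near {B P : Set (NonemptyCompacts ℍ)} (hB : B.Finite)
    (hintr : ∀ β ∈ B, (interior (β : Set ℍ)).Nonempty) (hP : IsPacking B P) (z : ℍ) (R : ℝ) :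
    {K ∈ P | ((K : Set ℍ) ∩ Metric.closedBall z R).Nonempty}.Finite := by
  rcases B.eq_empty_or_nonempty with hBe | hBn
  · refine Set.Finite.subset finite_empty fun K hK => ?_
    obtain ⟨β, hβ, -⟩ := hP.1 K hK.1
    rw [hBe] at hβ
    exact hβ
  obtain ⟨β₀, hβ₀, hmin⟩ := exists_min_image B (fun β => volume (interior (β : Set ℍ))) hB hBn
  obtain ⟨β₁, hβ₁, hmax⟩ := exists_max_image B (fun β => Metric.diam (β : Set ℍ)) hB hBn
  refine finite_of_disjoint_of_volume_le (S := fun K : NonemptyCompacts ℍ => interior (K : Set ℍ))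
    (A := Metric.closedBall z (R + Metric.diam (β₁ : Set ℍ))) Metric.isBounded_closedBall
    (isOpen_interior.measure_pos volume (hintr β₀ hβ₀)) (fun K _ => isOpen_interior.measurableSet)
    (hP.2.subset fun K hK => hK.1) ?_ ?_
  · rintro K ⟨hK, -⟩
    obtain ⟨β, hβ, φ, rfl⟩ := hP.1 K hK
    rw [coe_move, image_interior_isometry, volume_image_isometry]
    exact hmin β hβ
  · rintro K ⟨hK, x, hx, hxz⟩ y hy
    have hy := interior_subset hy
    have hd : dist y x ≤ Metric.diam (K : Set ℍ) :=
      Metric.dist_le_diam_of_mem K.isCompact.isBounded hy hx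
    obtain ⟨β, hβ, φ, rfl⟩ := hP.1 K hK
    rw [coe_move, φ.isometry.diam_image] at hd
    have := hmax β hβ
    have := dist_triangle y x z
    rw [Metric.mem_closedBall] at hxz ⊢
    linarith

theorem eq_of_mem_interior_of_mem {P B : Set (NonemptyCompacts ℍ)} (hP : IsPacking B P)
    {K L : NonemptyCompacts ℍ} (hK : K ∈ P) (hL : L ∈ P)
    (hLc : closure (interior (L : Set ℍ)) = L) {z : ℍ} (hz : z ∈ interior (K : Set ℍ))
    (hzL : z ∈ (L : Set ℍ)) : K = L := by
  by_contra hne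
  rw [← hLc] at hzL
  obtain ⟨y, hy, hy'⟩ := mem_closure_iff.1 hzL _ isOpen_interior hz
  exact disjoint_left.1 (hP.2 hK hL hne) hy hy'

/-- By local finiteness the union of the other nearby bodies is closed, and it contains points
arbitrarily close to `z`. -/
theorem exists_mem_of_mem_closure_compl {B P : Set (NonemptyCompacts ℍ)} (hB : B.Finite)
    (hintr : ∀ β ∈ B, (interior (β : Set ℍ)).Nonempty) (hP : IsPacking B P)
    (hcov : covered P = univ) {K : NonemptyCompacts ℍ} {z : ℍ} (hz : z ∈ closure (K : Set ℍ)ᶜ) :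
    ∃ L ∈ P, L ≠ K ∧ z ∈ (L : Set ℍ) := by
  set F := {L ∈ P | ((L : Set ℍ) ∩ Metric.closedBall z 1).Nonempty} with hF
  have hfin : F.Finite := hP.finite_near hB hintr z 1
  have hcl : IsClosed (⋃ L ∈ F \ {K}, (L : Set ℍ)) :=
    (hfin.subset sdiff_subset).isClosed_biUnion fun L _ => L.isCompact.isClosed
  have hmem : z ∈ ⋃ L ∈ F \ {K}, (L : Set ℍ) := by
    rw [← hcl.closure_eq, mem_closure_iff_nhds]
    intro U hU
    obtain ⟨y, ⟨hyU, hy1⟩, hyK⟩ := mem_closure_iff_nhds.1 hz _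
      (inter_mem hU (Metric.closedBall_mem_nhds z one_pos))
    have hy : y ∈ covered P := by rw [hcov]; trivial
    obtain ⟨L, hL, hyL⟩ := mem_iUnion₂.1 hy
    refine ⟨y, hyU, mem_biUnion ⟨⟨hL, y, hyL, hy1⟩, ?_⟩ hyL⟩
    rintro rfl
    exact hyK hyL
  obtain ⟨L, hL, hzL⟩ := mem_iUnion₂.1 hmem
  exact ⟨L, hL.1.1, hL.2, hzL⟩

theorem frontier_octagon_subset :
    frontier octagon ⊆ ⋃ k, {z : ℍ | mink (hyp z) (nrm k) = 0} := by
  intro z hz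
  rw [isClosed_octagon.frontier_eq, octagon_interior_eq] at hz
  by_contra hcon
  rw [mem_iUnion, not_exists] at hcon
  exact hz.2 fun k => lt_of_le_of_ne (hz.1 k) (hcon k)

theorem frontier_modTile_subset : frontier modTile ⊆
    ⋃ k, ({z : ℍ | mink (hyp z) (nrm k) = 0} ∪ Metric.sphere (mid k) rad) := by
  intro z hz
  rw [isCompact_modTile.isClosed.frontier_eq] at hz
  by_contra hcon
  rw [mem_iUnion, not_exists] at hcon
  refine hz.2 (modOpen_subset_interior ?_)
  rcases hz.1 with ⟨h, h'⟩ | ⟨k, hk, h⟩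
  · refine Or.inl ⟨?_, fun k hk => lt_of_le_of_ne (h' k hk) fun he => hcon k (Or.inr he.symm)⟩
    rw [octagon_interior_eq]
    exact fun k => lt_of_le_of_ne (h k) fun he => hcon k (Or.inl he)
  · exact Or.inr ⟨k, hk, lt_of_le_of_ne h fun he => hcon k (Or.inr he)⟩

theorem image_line (χ : ℍ ≃ᵢ ℍ) (n : Fin 3 → ℝ) :
    χ '' {z | mink (hyp z) n = 0} = {z | mink (hyp z) (lin χ n) = 0} := by
  ext z
  obtain ⟨y, rfl⟩ := χ.surjective z
  rw [χ.injective.mem_set_image]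
  change _ ↔ mink _ _ = 0
  rw [mink_hyp_lin]; rfl

theorem finite_sphere_inter_frontier_octagon (χ : ℍ ≃ᵢ ℍ) (m : ℍ) :
    (Metric.sphere m rad ∩ χ '' frontier octagon).Finite := by
  refine (finite_iUnion fun k => finite_sphere_inter_line (m := m) rad_pos.le
    (n := lin χ (nrm k)) (by rw [mink_lin, mink_nrm_self])).subset ?_
  rintro z ⟨hz, hz'⟩
  have := image_mono frontier_octagon_subset hz'
  rw [image_iUnion] at this
  obtain ⟨k, hk⟩ := mem_iUnion.1 this
  rw [image_line] at hk
  exact mem_iUnion.2 ⟨k, hz, hk⟩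

/-- The boundary of a modified octagon lies on finitely many lines and circles. A circle shares
infinitely many points with one of these only if it has the same centre as one of the circles. -/
theorem exists_mid_of_infinite {χ : ℍ ≃ᵢ ℍ} {m : ℍ}
    (h : (Metric.sphere m rad ∩ χ '' frontier modTile).Infinite) : ∃ j, χ (mid j) = m := by
  by_contra! hcon
  have hfin : ∀ k, (Metric.sphere m rad ∩ ({z : ℍ | mink (hyp z) (lin χ (nrm k)) = 0} ∪
      Metric.sphere (χ (mid k)) rad)).Finite := fun k => by
    rw [inter_union_distrib_left]
    refine (finite_sphere_inter_line rad_pos.le (by rw [mink_lin, mink_nrm_self])).union ?_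
    by_contra hinf
    exact hcon k (centers_eq_of_infinite rad_pos.le rad_pos.le hinf).symm
  refine h ((finite_iUnion hfin).subset ?_)
  rintro z ⟨hz, hz'⟩
  have := image_mono frontier_modTile_subset hz'
  rw [image_iUnion] at this
  obtain ⟨k, hk⟩ := mem_iUnion.1 this
  rw [image_union, image_line, χ.image_sphere] at hk
  exact mem_iUnion.2 ⟨k, hz, hk⟩

/-- The half circle in the boundary of the modified octagon at the side `k`. -/
def arc (k : ZMod 8) : Set ℍ := {z | dist z (mid k) = rad ∧
  (bump k → 0 < mink (hyp z) (nrm k)) ∧ (¬bump k → mink (hyp z) (nrm k) < 0)}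

theorem infinite_arc (k : ZMod 8) : (arc k).Infinite := by
  obtain ⟨u, hu, hun, hmu, -⟩ := exists_frame (mink_nrm_self k) (mink_mid_nrm_self k)
  by_cases hk : bump k
  · exact (infinite_halfCircle hu (mink_nrm_self k) hun hmu (mink_mid_nrm_self k) rad_pos).mono
      fun z hz => ⟨hz.1, fun _ => hz.2, fun h => absurd hk h⟩
  · refine (infinite_halfCircle (n := -nrm k) hu ?_ ?_ hmu ?_ rad_pos).mono fun z hz =>
      ⟨hz.1, fun h => absurd h hk, fun _ => ?_⟩
    · rw [mink_neg_left, mink_neg_right, neg_neg, mink_nrm_self]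
    · rw [mink_neg_right, hun, neg_zero]
    · rw [mink_neg_right, mink_mid_nrm_self, neg_zero]
    · have := hz.2
      rw [mink_neg_right] at this
      linarith

theorem arc_subset_modTile (k : ZMod 8) : arc k ⊆ modTile := by
  have hr := rad_pos
  rintro z ⟨h1, h2, h3⟩
  by_cases hk : bump k
  · exact Or.inr ⟨k, hk, h1.le⟩
  · exact (mem_modTile_iff_dent hk (by rw [h1]; linarith)).2 ⟨(h3 hk).le, h1.ge⟩

theorem arc_subset_closure_compl (k : ZMod 8) : arc k ⊆ closure modTileᶜ := by
  have hr := rad_pos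
  rintro z ⟨h1, h2, h3⟩
  obtain ⟨P, hP, hd, hs⟩ := exists_polar (mid k)
  obtain ⟨θ, hθ⟩ := hs z
  rw [h1] at hθ
  have hlim : Tendsto (fun t => P (t, θ)) (𝓝 rad) (𝓝 z) := by
    rw [← hθ]
    exact (hP.comp (by fun_prop : Continuous fun t : ℝ => (t, θ))).tendsto _
  by_cases hk : bump k
  · have hU := hlim.eventually ((isOpen_lt continuous_const
      (continuous_mink continuous_hyp continuous_const)).mem_nhds (h2 hk))
    refine mem_closure_of_tendsto (hlim.mono_left (nhdsWithin_le_nhds (s := Ioi rad))) ?_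
    filter_upwards [nhdsWithin_le_nhds hU,
      Ioo_mem_nhdsGT (show rad < 4 * rad by linarith)] with t ht ht'
    have hdt := hd t θ (by linarith [ht'.1])
    intro hmem
    rcases (mem_modTile_iff_bump hk (by rw [hdt]; exact ht'.2.le)).1 hmem with h | h
    · exact absurd h (not_le.2 ht)
    · rw [hdt] at h; linarith [ht'.1]
  · refine mem_closure_of_tendsto (hlim.mono_left (nhdsWithin_le_nhds (s := Iio rad))) ?_
    filter_upwards [Ioo_mem_nhdsLT hr] with t ht'
    have hdt := hd t θ ht'.1.le
    intro hmem
    have h := ((mem_modTile_iff_dent hk (by rw [hdt]; linarith [ht'.2])).1 hmem).2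
    rw [hdt] at h; linarith [ht'.2]

/-- If `n + n'` is nonzero, travelling from `m` in the direction of `-(n + n')` enters both half
planes at once. -/
theorem neg_of_halfPlanes_disjoint {m : ℍ} {n n' : Fin 3 → ℝ} (hn : mink n n = 1)
    (hn' : mink n' n' = 1) (hmn : mink (hyp m) n = 0) (hmn' : mink (hyp m) n' = 0) {r : ℝ}
    (hr : 0 < r) (h : ∀ z, dist z m = r → mink (hyp z) n < 0 → ¬mink (hyp z) n' < 0) :
    n' = -n := by
  by_contra hne
  set d := n + n' with hd
  have hd0 : d ≠ 0 := fun h0 => hne (eq_neg_of_add_eq_zero_right h0)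
  have hmd : mink (hyp m) d = 0 := by rw [hd, mink_add_right, hmn, hmn', add_zero]
  have hdd := mink_self_pos_of_orthogonal hmd hd0
  have e1 : mink d n = mink d d / 2 := by
    simp only [hd, mink_add_left, mink_add_right, hn, hn', mink_comm n' n]; ring
  have e2 : mink d n' = mink d d / 2 := by
    simp only [hd, mink_add_left, mink_add_right, hn, hn', mink_comm n' n]; ring
  set c := (√(mink d d))⁻¹ with hc
  have hc0 : 0 < c := inv_pos.2 (Real.sqrt_pos.2 hdd)
  have hcc : c ^ 2 * mink d d = 1 := by
    rw [hc, inv_pow, Real.sq_sqrt hdd.le, inv_mul_cancel₀ hdd.ne']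
  obtain ⟨γ, hγ, h0, hγs⟩ := exists_geodesic_line (z := m) (u := (-c) • d)
    (by rw [mink_smul_left, mink_smul_right]; linarith) (by rw [mink_smul_right, hmd, mul_zero])
  have hs : 0 < Real.sinh r := Real.sinh_pos_iff.2 hr
  refine h (γ r) ?_ ?_ ?_
  · rw [← h0, hγ.dist_eq, Real.dist_eq, sub_zero, abs_of_pos hr]
  · rw [hγs, mink_add_left, mink_smul_left, mink_smul_left, mink_smul_left, hmn, e1]
    nlinarith [mul_pos hs (mul_pos hc0 hdd)]
  · rw [hγs, mink_add_left, mink_smul_left, mink_smul_left, mink_smul_left, hmn', e2]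
    nlinarith [mul_pos hs (mul_pos hc0 hdd)]

/-- Two non-overlapping modified octagons that share infinitely many points of an arc are
adjacent along a side. -/
theorem adjacent_of_infinite {χ : ℍ ≃ᵢ ℍ} {k : ZMod 8}
    (hd : Disjoint (interior modTile) (χ '' interior modTile))
    (h : (arc k ∩ χ '' frontier modTile).Infinite) :
    ∃ j, χ (mid j) = mid k ∧ lin χ (nrm j) = -nrm k ∧ (bump j ↔ ¬bump k) := by
  have hr := rad_pos
  obtain ⟨j, hj⟩ := exists_mid_of_infinite (h.mono (inter_subset_inter_left _ fun z hz => hz.1))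
  have hdist : ∀ z, dist (χ⁻¹ z) (mid j) = dist z (mid k) := fun z => by
    rw [← χ.dist_eq, IsometryEquiv.apply_inv_self, hj]
  have hmink : ∀ z, mink (hyp (χ⁻¹ z)) (nrm j) = mink (hyp z) (lin χ (nrm j)) := fun z => by
    rw [← mink_hyp_lin χ, IsometryEquiv.apply_inv_self]
  have hopen : ∀ z k, dist z (mid k) = 2 * rad → mink (hyp z) (nrm k) < 0 →
      z ∈ interior modTile := by
    intro z k hz hzn
    refine modOpen_subset_interior ?_
    by_cases hk : bump k
    · exact (mem_modOpen_iff_bump hk (by rw [hz]; linarith)).2 (Or.inl hzn)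
    · exact (mem_modOpen_iff_dent hk (by rw [hz]; linarith)).2 ⟨hzn, by rw [hz]; linarith⟩
  have hneg : lin χ (nrm j) = -nrm k := by
    refine neg_of_halfPlanes_disjoint (m := mid k) (mink_nrm_self k)
      (by rw [mink_lin, mink_nrm_self]) (mink_mid_nrm_self k)
      (by rw [← hj, mink_hyp_lin, mink_mid_nrm_self]) (show 0 < 2 * rad by linarith)
      fun z hz h1 h2 => ?_
    refine disjoint_left.1 hd (hopen z k hz h1) (mem_image_isometry.2 (hopen _ j ?_ ?_))
    · rw [hdist, hz]
    · rw [hmink]; exact h2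
  refine ⟨j, hj, hneg, ?_⟩
  obtain ⟨z, ⟨h1, h2, h3⟩, hz⟩ := h.nonempty
  rw [mem_image_isometry, isCompact_modTile.isClosed.frontier_eq] at hz
  have hnear : dist (χ⁻¹ z) (mid j) ≤ 4 * rad := by rw [hdist, h1]; linarith
  have hmj : mink (hyp (χ⁻¹ z)) (nrm j) = -mink (hyp z) (nrm k) := by
    rw [hmink, hneg, mink_neg_right]
  -- Two protrusions would overlap along the arc, and two indentations would leave a gap there; only
  -- a protrusion against an indentation remains.
  by_cases hk : bump k <;> by_cases hbj : bump j
  · exact absurd (modOpen_subset_interior ((mem_modOpen_iff_bump hbj hnear).2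
      (Or.inl (by rw [hmj]; linarith [h2 hk])))) hz.2
  · exact ⟨fun h => absurd h hbj, fun h => absurd hk h⟩
  · exact ⟨fun _ => hk, fun _ => hbj⟩
  · have := ((mem_modTile_iff_dent hbj hnear).1 hz.1).1
    rw [hmj] at this
    linarith [h3 hk]

theorem finite_bodies : ({octBody, modBody} : Set (NonemptyCompacts ℍ)).Finite := toFinite _

theorem closure_interior_bodies {β : NonemptyCompacts ℍ} (hβ : β ∈ ({octBody, modBody} :
    Set (NonemptyCompacts ℍ))) : closure (interior (β : Set ℍ)) = β := by
  rcases hβ with rfl | rfl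
  · exact closure_interior_octagon
  · exact closure_interior_modTile

theorem interior_bodies_nonempty {β : NonemptyCompacts ℍ} (hβ : β ∈ ({octBody, modBody} :
    Set (NonemptyCompacts ℍ))) : (interior (β : Set ℍ)).Nonempty := by
  rcases hβ with rfl | rfl
  · exact ⟨_, I_mem_interior_octagon⟩
  · exact isConnected_interior_modTile.nonempty

theorem closure_interior_of_packing {P : Set (NonemptyCompacts ℍ)}
    (hP : IsPacking {octBody, modBody} P) {K : NonemptyCompacts ℍ} (hK : K ∈ P) :
    closure (interior (K : Set ℍ)) = K := by
  obtain ⟨β, hβ, φ, rfl⟩ := hP.1 K hK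
  rw [coe_move, image_interior_isometry, image_closure_isometry, closure_interior_bodies hβ]

/-- The infinite arc is covered by finitely many other bodies, so one of them contains infinitely
many of its points, necessarily on its boundary. An octagon has straight sides and cannot; a
modified octagon must be adjacent along a side. -/
theorem exists_adjacent {P : Set (NonemptyCompacts ℍ)} (hP : IsPacking {octBody, modBody} P)
    (hcov : covered P = univ) {φ : ℍ ≃ᵢ ℍ} (hφ : move φ modBody ∈ P) (k : ZMod 8) :
    ∃ ψ : ℍ ≃ᵢ ℍ, move ψ modBody ∈ P ∧ ∃ j, ψ (mid j) = φ (mid k) ∧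
      lin ψ (nrm j) = -lin φ (nrm k) ∧ (bump j ↔ ¬bump k) := by
  set K := move φ modBody with hK
  set F := {L ∈ P | ((L : Set ℍ) ∩ Metric.closedBall (φ (mid k)) rad).Nonempty} with hF
  have hfin : F.Finite :=
    hP.finite_near finite_bodies (fun β hβ => interior_bodies_nonempty hβ) _ _
  have hsub : φ '' arc k ⊆ ⋃ L ∈ F \ {K}, (φ '' arc k ∩ L) := by
    rintro _ ⟨z, hz, rfl⟩
    have hzc : φ z ∈ closure (K : Set ℍ)ᶜ := by
      rw [hK, coe_move, ← image_compl_eq φ.bijective, image_closure_isometry]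
      exact mem_image_of_mem φ (arc_subset_closure_compl k hz)
    obtain ⟨L, hL, hLK, hzL⟩ := exists_mem_of_mem_closure_compl finite_bodies
      (fun β hβ => interior_bodies_nonempty hβ) hP hcov hzc
    refine mem_biUnion ⟨⟨hL, φ z, hzL, ?_⟩, hLK⟩ ⟨mem_image_of_mem φ hz, hzL⟩
    rw [Metric.mem_closedBall, φ.dist_eq, hz.1]
  obtain ⟨L, hL, hinf⟩ : ∃ L ∈ F \ {K}, (φ '' arc k ∩ L).Infinite := by
    by_contra! hcon
    exact (infinite_arc k).image φ.injective.injOn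
      (((hfin.subset sdiff_subset).biUnion hcon).subset hsub)
  have hLP : L ∈ P := hL.1.1
  have hdisj := hP.2 hφ hLP (fun h => hL.2 h.symm)
  obtain ⟨β, hβ, ψ, rfl⟩ := hP.1 L hLP
  have hfr : φ '' arc k ∩ (move ψ β : Set ℍ) ⊆ φ '' arc k ∩ frontier (move ψ β : Set ℍ) := by
    rintro z ⟨hz, hzL⟩
    refine ⟨hz, ?_⟩
    rw [(move ψ β).isCompact.isClosed.frontier_eq]
    refine ⟨hzL, fun hzi => hL.2 (eq_of_mem_interior_of_mem hP hLP hφ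
      (closure_interior_of_packing hP hφ) hzi (image_mono (arc_subset_modTile k) hz))⟩
  have hinf2 := hinf.mono hfr
  have harc : φ '' arc k ⊆ Metric.sphere (φ (mid k)) rad := by
    rintro _ ⟨z, hz, rfl⟩
    rw [Metric.mem_sphere, φ.dist_eq]
    exact hz.1
  rcases hβ with rfl | rfl
  · refine absurd ((finite_sphere_inter_frontier_octagon ψ (φ (mid k))).subset ?_) hinf2
    rw [coe_move, image_frontier_isometry]
    exact inter_subset_inter_left _ harc
  · have hA : Disjoint (interior modTile) ((φ⁻¹ * ψ : ℍ ≃ᵢ ℍ) '' interior modTile) := by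
      have hdisj : Disjoint (interior (φ '' modTile)) (interior (ψ '' modTile)) := hdisj
      rw [image_interior_isometry, image_interior_isometry] at hdisj
      refine disjoint_left.2 ?_
      rintro _ hz ⟨y, hy, rfl⟩
      refine disjoint_left.1 hdisj (mem_image_of_mem φ hz) ⟨y, hy, ?_⟩
      rw [IsometryEquiv.mul_apply, IsometryEquiv.apply_inv_self]
    have hB : (arc k ∩ (φ⁻¹ * ψ : ℍ ≃ᵢ ℍ) '' frontier modTile).Infinite := by
      refine Set.Infinite.mono ?_ (hinf2.image (f := ⇑(φ⁻¹ : ℍ ≃ᵢ ℍ))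
        (φ⁻¹ : ℍ ≃ᵢ ℍ).injective.injOn)
      rintro _ ⟨_, ⟨⟨z, hz, rfl⟩, hzL⟩, rfl⟩
      rw [coe_move, image_frontier_isometry] at hzL
      obtain ⟨y, hy, hyz⟩ := hzL
      refine ⟨by rwa [IsometryEquiv.inv_apply_self], y, hy, ?_⟩
      rw [IsometryEquiv.mul_apply, hyz]
    obtain ⟨j, h1, h2, h3⟩ := adjacent_of_infinite hA hB
    refine ⟨ψ, hLP, j, ?_, ?_, h3⟩
    · rw [← h1, IsometryEquiv.mul_apply, IsometryEquiv.apply_inv_self]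
    · rw [← map_neg, ← h2, lin_mul, lin_apply_inv]

/-- Induction on words in the generators. The first two generators only change the symmetry `d`, and
the third crosses a side to the neighbour found by `exists_adjacent`. So modified octagons occupy
every octagon position, up to a symmetry of the octagon. -/
theorem exists_octSym_of_tiling {P : Set (NonemptyCompacts ℍ)}
    (hP : IsPacking {octBody, modBody} P) (hcov : covered P = univ) {φ : ℍ ≃ᵢ ℍ}
    (hφ : move φ modBody ∈ P) (w : TriGroup) :
    ∃ d ∈ octSym, move (φ * triHom w * triHom d) modBody ∈ P := by
  refine triSys.simple_induction_right
    (p := fun w => ∃ d ∈ octSym, move (φ * triHom w * triHom d) modBody ∈ P) w ?_ ?_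
  · exact ⟨1, one_mem _, by rwa [map_one, mul_one, mul_one]⟩
  · rintro w i ⟨d, hd, h⟩
    have haux : ∀ s ∈ octSym, ∃ d ∈ octSym, move (φ * triHom (w * s) * triHom d) modBody ∈ P :=
      fun s hs => ⟨s⁻¹ * d, mul_mem (inv_mem hs) hd, by
        rw [mul_assoc, ← map_mul, mul_assoc w, mul_inv_cancel_left, map_mul, ← mul_assoc]
        exact h⟩
    fin_cases i
    · exact haux _ simple_zero_mem_octSym
    · exact haux _ simple_one_mem_octSym
    · change ∃ d ∈ octSym, move (φ * triHom (w * triSys.simple 2) * triHom d) modBody ∈ P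
      obtain ⟨e, he⟩ := exists_lin_nrm_of_mem_octSym hd
      set k := e.symm 0 with hk
      have hdk : lin (triHom d) (nrm k) = root 2 := by
        rw [he, hk, e.apply_symm_apply, nrm_zero]
      obtain ⟨ψ, hψ, j, h1, h2, -⟩ := exists_adjacent hP hcov h k
      set Φ := φ * triHom w * triHom d with hΦ
      set R := refl (nrm k) (mink_nrm_self k) with hR
      have hRR : R * R = 1 := refl_mul_self _ _
      obtain ⟨d', hd', hχ⟩ := mem_octSym_of_mid_nrm (χ := R * Φ⁻¹ * ψ) (j := j) (k := k)
        (by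
          rw [IsometryEquiv.mul_apply, IsometryEquiv.mul_apply, h1, IsometryEquiv.inv_apply_self,
            hR, refl_eq_self_iff, mink_mid_nrm_self])
        (by
          rw [lin_mul, lin_mul, h2, map_neg, lin_inv_apply, hR, lin_refl, reflVec, mink_neg_left,
            mink_nrm_self]
          module)
      -- Since `d` carries side `k` to side `0`, crossing side `k` of the present tile amounts to
      -- multiplying the word by the third generator.
      have hconj : triHom d * R = triRefl 2 * triHom d := by
        refine eq_of_lin_eq fun v => ?_
        rw [lin_mul, lin_mul, hR, triRefl, lin_refl, lin_refl, reflVec, reflVec, ← hdk, mink_lin,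
          map_sub, map_smul]
      refine ⟨d * d', mul_mem hd hd', ?_⟩
      convert hψ using 2
      calc φ * triHom (w * triSys.simple 2) * triHom (d * d')
          = φ * triHom w * (triRefl 2 * triHom d) * triHom d' := by
            rw [map_mul, map_mul, triHom_simple]; group
        _ = Φ * R * (R * Φ⁻¹ * ψ) := by rw [← hconj, hχ, hΦ]; group
        _ = Φ * (R * R) * Φ⁻¹ * ψ := by group
        _ = ψ := by rw [hRR]; group

/-- A tiling by octagons and modified octagons that contains a modified octagon contains no
octagon. -/
theorem octBody_notMem_of_tiling {P : Set (NonemptyCompacts ℍ)}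
    (hP : IsPacking {octBody, modBody} P) (hcov : covered P = univ) {φ : ℍ ≃ᵢ ℍ}
    (hφ : move φ modBody ∈ P) (θ : ℍ ≃ᵢ ℍ) : move θ octBody ∉ P := by
  intro hθ
  have hr := rad_pos
  set z := θ UpperHalfPlane.I with hz
  have hzi : z ∈ interior (move θ octBody : Set ℍ) := by
    rw [coe_move, image_interior_isometry]
    exact mem_image_of_mem θ I_mem_interior_octagon
  -- The centre of the supposed octagon lies in some octagon position. There it is in the modified
  -- octagon or in one of its indentations, and the latter is filled by the neighbour's protrusion.
  obtain ⟨ψ, hψ, hzψ⟩ : ∃ ψ : ℍ ≃ᵢ ℍ, move ψ modBody ∈ P ∧ z ∈ (move ψ modBody : Set ℍ) := by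
    obtain ⟨w, hw⟩ := exists_triHom_mem_octagon (φ⁻¹ z)
    obtain ⟨d, hd, h⟩ := exists_octSym_of_tiling hP hcov hφ w⁻¹
    set Φ := φ * triHom w⁻¹ * triHom d with hΦ
    have hy : Φ⁻¹ z ∈ octagon := by
      rw [← image_octagon_of_mem_octSym (inv_mem hd)]
      refine ⟨triHom w (φ⁻¹ z), hw, ?_⟩
      rw [hΦ, map_inv, map_inv]
      simp [IsometryEquiv.mul_apply]
    by_cases hm : Φ⁻¹ z ∈ modTile
    · exact ⟨Φ, h, mem_image_isometry.2 hm⟩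
    obtain ⟨k, hk, hd⟩ : ∃ k, ¬bump k ∧ dist (Φ⁻¹ z) (mid k) < rad := by
      by_contra! hcon
      exact hm (Or.inl ⟨hy, hcon⟩)
    obtain ⟨ψ, hψ, j, h1, -, h3⟩ := exists_adjacent hP hcov h k
    refine ⟨ψ, hψ, mem_image_isometry.2 (Or.inr ⟨j, h3.2 hk, ?_⟩)⟩
    rw [← ψ.dist_eq, IsometryEquiv.apply_inv_self, h1, ← (Φ⁻¹ : ℍ ≃ᵢ ℍ).dist_eq,
      IsometryEquiv.inv_apply_self]
    exact hd.le
  have heq := eq_of_mem_interior_of_mem hP hθ hψ (closure_interior_of_packing hP hψ) hzi hzψ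
  have hfr : θ '' frontier octagon = ψ '' frontier modTile := by
    rw [← image_frontier_isometry, ← image_frontier_isometry]
    exact congrArg (fun K : NonemptyCompacts ℍ => frontier (K : Set ℍ)) heq
  -- The octagon and the modified octagon would be the same body, but an arc of the latter cannot
  -- lie on the sides of an octagon.
  refine ((infinite_arc 0).image (f := ψ) ψ.injective.injOn)
    ((finite_sphere_inter_frontier_octagon θ (ψ (mid 0))).subset ?_)
  rintro _ ⟨y, hy, rfl⟩
  refine ⟨by rw [Metric.mem_sphere, ψ.dist_eq]; exact hy.1, ?_⟩
  rw [hfr]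
  refine mem_image_of_mem ψ ?_
  rw [frontier_eq_closure_inter_closure]
  exact ⟨subset_closure (arc_subset_modTile 0 hy), arc_subset_closure_compl 0 hy⟩

/-! ### Octagons near modified octagons waste area -/

/-- Closed balls are compact, so isometries that move one point a bounded amount converge pointwise
along an ultrafilter. The limit of the inverses provides the inverse of the limit. -/
theorem exists_ultralimit {ι : Type*} (U : Ultrafilter ι) {ψ : ι → ℍ ≃ᵢ ℍ} {z₀ : ℍ} {R : ℝ}
    (h : ∀ᶠ n in U, dist (ψ n z₀) z₀ ≤ R) :
    ∃ χ : ℍ ≃ᵢ ℍ, ∀ z, Tendsto (fun n => ψ n z) U (𝓝 (χ z)) := by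
  have key : ∀ ψ : ι → ℍ ≃ᵢ ℍ, (∀ᶠ n in U, dist (ψ n z₀) z₀ ≤ R) →
      ∀ z, ∃ y, Tendsto (fun n => ψ n z) U (𝓝 y) := by
    intro ψ h z
    obtain ⟨y, -, hy⟩ := (isCompact_closedBall z₀ (R + dist z z₀)).ultrafilter_le_nhds'
      (U.map fun n => ψ n z) (by
        rw [Ultrafilter.mem_map]
        filter_upwards [h] with n hn
        have := dist_triangle (ψ n z) (ψ n z₀) z₀
        rw [(ψ n).dist_eq] at this
        exact Metric.mem_closedBall.2 (by linarith))
    exact ⟨y, hy⟩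
  choose f hf using key ψ h
  choose g hg using key (fun n => (ψ n)⁻¹) (by
    filter_upwards [h] with n hn
    rwa [← (ψ n).dist_eq, IsometryEquiv.apply_inv_self, dist_comm])
  have hfi : Isometry f := Isometry.of_dist_eq fun z w => by
    have h1 := (hf z).dist (hf w)
    simp only [(ψ _).dist_eq] at h1
    exact (tendsto_nhds_unique h1 tendsto_const_nhds)
  have hfg : ∀ z, f (g z) = z := fun z => by
    refine tendsto_nhds_unique (hf (g z)) ?_
    rw [tendsto_iff_dist_tendsto_zero]
    have h1 := (tendsto_iff_dist_tendsto_zero.1 (hg z))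
    refine h1.congr fun n => ?_
    rw [← (ψ n).dist_eq, IsometryEquiv.apply_inv_self, dist_comm]
  exact ⟨IsometryEquiv.mk' f g hfg hfi, hf⟩

theorem tendsto_isometry_apply {ι : Type*} {l : Filter ι} {ψ : ι → ℍ ≃ᵢ ℍ} {χ : ℍ ≃ᵢ ℍ}
    (h : ∀ z, Tendsto (fun n => ψ n z) l (𝓝 (χ z))) {x : ι → ℍ} {y : ℍ}
    (hx : Tendsto x l (𝓝 y)) : Tendsto (fun n => ψ n (x n)) l (𝓝 (χ y)) := by
  rw [tendsto_iff_dist_tendsto_zero] at hx ⊢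
  have h1 := hx.add (tendsto_iff_dist_tendsto_zero.1 (h y))
  rw [add_zero] at h1
  refine squeeze_zero (fun _ => dist_nonneg) (fun n => ?_) h1
  have := dist_triangle (ψ n (x n)) (ψ n y) (χ y)
  rwa [(ψ n).dist_eq] at this

theorem tendsto_isometry_inv {ι : Type*} {l : Filter ι} {ψ : ι → ℍ ≃ᵢ ℍ} {χ : ℍ ≃ᵢ ℍ}
    (h : ∀ z, Tendsto (fun n => ψ n z) l (𝓝 (χ z))) (z : ℍ) :
    Tendsto (fun n => (ψ n)⁻¹ z) l (𝓝 (χ⁻¹ z)) := by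
  have h1 := tendsto_iff_dist_tendsto_zero.1 (h (χ⁻¹ z))
  rw [IsometryEquiv.apply_inv_self] at h1
  rw [tendsto_iff_dist_tendsto_zero]
  refine h1.congr fun n => ?_
  rw [← (ψ n).dist_eq ((ψ n)⁻¹ z), IsometryEquiv.apply_inv_self, dist_comm]

theorem limit_subset {ι : Type*} {l : Filter ι} [l.NeBot] {ψ ψ' : ι → ℍ ≃ᵢ ℍ} {χ χ' : ℍ ≃ᵢ ℍ}
    (h : ∀ z, Tendsto (fun n => ψ n z) l (𝓝 (χ z)))
    (h' : ∀ z, Tendsto (fun n => ψ' n z) l (𝓝 (χ' z))) {β β' : NonemptyCompacts ℍ}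
    (he : ∀ᶠ n in l, move (ψ n) β = move (ψ' n) β') :
    (move χ β : Set ℍ) ⊆ move χ' β' := by
  rintro _ ⟨b, hb, rfl⟩
  refine mem_image_isometry.2 (β'.isCompact.isClosed.mem_of_tendsto
    (tendsto_isometry_apply (tendsto_isometry_inv h') (h b)) ?_)
  filter_upwards [he] with n hn
  have : ψ n b ∈ (move (ψ' n) β' : Set ℍ) := by rw [← hn]; exact mem_image_of_mem _ hb
  exact mem_image_isometry.1 this

/-- The limit of a sequence of packings `P n`, seen from the frames `θ n`. -/
def limitPacking {ι : Type*} (U : Ultrafilter ι) (B : Set (NonemptyCompacts ℍ))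
    (P : ι → Set (NonemptyCompacts ℍ)) (θ : ι → ℍ ≃ᵢ ℍ) : Set (NonemptyCompacts ℍ) :=
  {K | ∃ β ∈ B, ∃ (ψ : ι → ℍ ≃ᵢ ℍ) (χ : ℍ ≃ᵢ ℍ), (∀ᶠ n in U, move (θ n * ψ n) β ∈ P n) ∧
    (∀ z, Tendsto (fun n => ψ n z) U (𝓝 (χ z))) ∧ K = move χ β}

/-- If two limit bodies overlap in an interior point, their approximants overlap for almost every
index and so coincide; then the limits coincide too. -/
theorem isPacking_limitPacking {ι : Type*} (U : Ultrafilter ι) {B : Set (NonemptyCompacts ℍ)}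
    {P : ι → Set (NonemptyCompacts ℍ)} (θ : ι → ℍ ≃ᵢ ℍ) (hP : ∀ n, IsPacking B (P n)) :
    IsPacking B (limitPacking U B P θ) := by
  refine ⟨fun K hK => ?_, ?_⟩
  · obtain ⟨β, hβ, ψ, χ, -, -, rfl⟩ := hK
    exact ⟨β, hβ, χ, rfl⟩
  · rintro _ ⟨β, hβ, ψ, χ, h1, h2, rfl⟩ _ ⟨β', hβ', ψ', χ', h1', h2', rfl⟩ hne
    refine disjoint_left.2 fun z hz hz' => hne ?_
    have key : ∀ {ψ : ι → ℍ ≃ᵢ ℍ} {χ : ℍ ≃ᵢ ℍ} {β : NonemptyCompacts ℍ},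
        (∀ z, Tendsto (fun n => ψ n z) U (𝓝 (χ z))) → z ∈ interior (move χ β : Set ℍ) →
        ∀ᶠ n in U, θ n z ∈ interior (move (θ n * ψ n) β : Set ℍ) := by
      intro ψ χ β h2 hz
      rw [coe_move, image_interior_isometry, mem_image_isometry] at hz
      filter_upwards [(tendsto_isometry_inv h2 z).eventually (isOpen_interior.mem_nhds hz)]
        with n hn
      rw [coe_move, image_interior_isometry, mem_image_isometry, mul_inv_rev,
        IsometryEquiv.mul_apply, IsometryEquiv.inv_apply_self]
      exact hn
    have he : ∀ᶠ n in U, move (ψ n) β = move (ψ' n) β' := by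
      filter_upwards [key h2 hz, key h2' hz', h1, h1'] with n a1 a2 a3 a4
      have : move (θ n * ψ n) β = move (θ n * ψ' n) β' := by
        by_contra hcon
        exact disjoint_left.1 ((hP n).2 a3 a4 hcon) a1 a2
      rw [move_mul, move_mul] at this
      exact move_injective _ this
    exact SetLike.coe_injective ((limit_subset h2 h2' he).antisymm
      (limit_subset h2' h2 (he.mono fun n hn => hn.symm)))

theorem exists_mem_limitPacking {ι : Type*} (U : Ultrafilter ι) {B : Set (NonemptyCompacts ℍ)}
    {P : ι → Set (NonemptyCompacts ℍ)} {θ : ι → ℍ ≃ᵢ ℍ} {β : NonemptyCompacts ℍ} (hβ : β ∈ B)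
    {z : ℍ} {ε : ℝ}
    (h : ∀ᶠ n in U, ∃ ψ : ℍ ≃ᵢ ℍ, move (θ n * ψ) β ∈ P n ∧ ∃ b ∈ (β : Set ℍ), dist (ψ b) z ≤ ε) :
    ∃ χ : ℍ ≃ᵢ ℍ, move χ β ∈ limitPacking U B P θ ∧
      ((move χ β : Set ℍ) ∩ Metric.closedBall z ε).Nonempty := by
  obtain ⟨b₀, hb₀⟩ := β.nonempty
  have h' : ∀ n, ∃ (ψ : ℍ ≃ᵢ ℍ) (b : ℍ), (∃ ψ : ℍ ≃ᵢ ℍ, move (θ n * ψ) β ∈ P n ∧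
      ∃ b ∈ (β : Set ℍ), dist (ψ b) z ≤ ε) → move (θ n * ψ) β ∈ P n ∧ b ∈ (β : Set ℍ) ∧
        dist (ψ b) z ≤ ε := fun n => by
    by_cases hn : ∃ ψ : ℍ ≃ᵢ ℍ, move (θ n * ψ) β ∈ P n ∧ ∃ b ∈ (β : Set ℍ), dist (ψ b) z ≤ ε
    · obtain ⟨ψ, h1, b, h2, h3⟩ := hn
      exact ⟨ψ, b, fun _ => ⟨h1, h2, h3⟩⟩
    · exact ⟨1, z, fun h => absurd h hn⟩
  choose ψ b hψb using h'
  have hev : ∀ᶠ n in U, move (θ n * ψ n) β ∈ P n ∧ b n ∈ (β : Set ℍ) ∧ dist (ψ n (b n)) z ≤ ε :=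
    h.mono fun n hn => hψb n hn
  obtain ⟨χ, hχ⟩ := exists_ultralimit U (ψ := ψ) (z₀ := b₀)
    (R := Metric.diam (β : Set ℍ) + ε + dist z b₀) (by
      filter_upwards [hev] with n ⟨_, h2, h3⟩
      have a1 := Metric.dist_le_diam_of_mem β.isCompact.isBounded hb₀ h2
      have a2 := dist_triangle4 (ψ n b₀) (ψ n (b n)) z b₀
      rw [(ψ n).dist_eq] at a2
      linarith)
  obtain ⟨y, hy, hyl⟩ := β.isCompact.ultrafilter_le_nhds' (U.map b) (by
    rw [Ultrafilter.mem_map]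
    filter_upwards [hev] with n hn using hn.2.1)
  refine ⟨χ, ⟨β, hβ, ψ, χ, hev.mono fun n hn => hn.1, hχ, rfl⟩, χ y, mem_image_of_mem _ hy, ?_⟩
  have hlim := tendsto_isometry_apply hχ (show Tendsto b U (𝓝 y) from hyl)
  exact le_of_tendsto (hlim.dist tendsto_const_nhds) (hev.mono fun n hn => hn.2.2)

theorem isClosed_covered {B P : Set (NonemptyCompacts ℍ)} (hB : B.Finite)
    (hintr : ∀ β ∈ B, (interior (β : Set ℍ)).Nonempty) (hP : IsPacking B P) :
    IsClosed (covered P) := by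
  refine isClosed_of_closure_subset fun z hz => ?_
  set F := {L ∈ P | ((L : Set ℍ) ∩ Metric.closedBall z 1).Nonempty} with hF
  have hcl : IsClosed (⋃ L ∈ F, (L : Set ℍ)) :=
    (hP.finite_near hB hintr z 1).isClosed_biUnion fun L _ => L.isCompact.isClosed
  have hmem : z ∈ ⋃ L ∈ F, (L : Set ℍ) := by
    rw [← hcl.closure_eq, mem_closure_iff_nhds]
    intro V hV
    obtain ⟨y, ⟨hyV, hy1⟩, hy⟩ := mem_closure_iff_nhds.1 hz _
      (inter_mem hV (Metric.closedBall_mem_nhds z one_pos))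
    obtain ⟨L, hL, hyL⟩ := mem_iUnion₂.1 hy
    exact ⟨y, hyV, mem_biUnion ⟨hL, y, hyL, hy1⟩ hyL⟩
  obtain ⟨L, hL, hzL⟩ := mem_iUnion₂.1 hmem
  exact mem_biUnion hL.1 hzL

/-- Compactness. Failing constants give packings with `R` tending to infinity and uncovered area
tending to zero, seen from an octagon. Their ultralimit covers the plane and contains an octagon as
well as a modified octagon at bounded distance, contrary to `octBody_notMem_of_tiling`. -/
theorem exists_waste : ∃ R ε : ℝ, 0 < R ∧ 0 < ε ∧ ∀ P : Set (NonemptyCompacts ℍ),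
    IsPacking {octBody, modBody} P → ∀ θ φ : ℍ ≃ᵢ ℍ, move θ octBody ∈ P → move φ modBody ∈ P →
    (∃ x ∈ (move θ octBody : Set ℍ), ∃ y ∈ (move φ modBody : Set ℍ), dist x y ≤ 1) →
    ENNReal.ofReal ε ≤ volume (Metric.closedBall (θ UpperHalfPlane.I) R \ covered P) := by
  by_contra! hcon
  have hcon' := fun n : ℕ => hcon (n + 1) (1 / (n + 1)) (by positivity) (by positivity)
  choose P hP θ φ hθ hφ hnear hvol using hcon'
  set U : Ultrafilter ℕ := hyperfilter ℕ
  have hU : (U : Filter ℕ) ≤ atTop := Nat.hyperfilter_le_atTop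
  set B : Set (NonemptyCompacts ℍ) := {octBody, modBody} with hB
  have hlim := isPacking_limitPacking U θ hP
  have hintr : ∀ β ∈ B, (interior (β : Set ℍ)).Nonempty := fun β hβ => interior_bodies_nonempty hβ
  have hcov : covered (limitPacking U B P θ) = univ := by
    have hcl := isClosed_covered finite_bodies hintr hlim
    refine eq_univ_of_forall fun z => ?_
    rw [← hcl.closure_eq, Metric.mem_closure_iff]
    intro ε hε
    have hev : ∀ᶠ n in U, ∃ β ∈ B, ∃ ψ : ℍ ≃ᵢ ℍ, move (θ n * ψ) β ∈ P n ∧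
        ∃ b ∈ (β : Set ℍ), dist (ψ b) z ≤ ε / 2 := by
      have hv : 0 < volume (Metric.ball z (ε / 2)) :=
        Metric.isOpen_ball.measure_pos volume ⟨z, Metric.mem_ball_self (by positivity)⟩
      have h1 : ∀ᶠ n : ℕ in atTop, ENNReal.ofReal (1 / ((n : ℝ) + 1)) <
          volume (Metric.ball z (ε / 2)) := by
        have := ENNReal.tendsto_ofReal (tendsto_one_div_add_atTop_nhds_zero_nat (𝕜 := ℝ))
        rw [ENNReal.ofReal_zero] at this
        exact this.eventually (gt_mem_nhds hv)
      have h2 : ∀ᶠ n : ℕ in atTop, ε / 2 + dist z UpperHalfPlane.I ≤ (n : ℝ) + 1 := by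
        filter_upwards [eventually_ge_atTop ⌈ε / 2 + dist z UpperHalfPlane.I⌉₊] with n hn
        have := Nat.ceil_le.1 hn
        linarith
      filter_upwards [hU h1, hU h2] with n h1 h2
      -- If no body came within `ε / 2` of the point, a ball of fixed area would be uncovered, more
      -- than the allowed `1 / (n + 1)` for large `n`.
      by_contra hno
      refine absurd (hvol n) (not_lt.2 (h1.le.trans ?_))
      rw [← volume_image_isometry (θ n)]
      refine measure_mono ?_
      rintro _ ⟨x, hx, rfl⟩
      rw [Metric.mem_ball] at hx
      constructor
      · rw [Metric.mem_closedBall, (θ n).dist_eq]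
        linarith [dist_triangle x z UpperHalfPlane.I]
      · intro hc
        obtain ⟨K, hK, hxK⟩ := mem_iUnion₂.1 hc
        obtain ⟨β, hβ, ψ, rfl⟩ := (hP n).1 K hK
        obtain ⟨b, hb, hbx⟩ := hxK
        refine hno ⟨β, hβ, (θ n)⁻¹ * ψ, by rwa [mul_inv_cancel_left], b, hb, ?_⟩
        have hbx : ψ b = θ n x := hbx
        rw [IsometryEquiv.mul_apply, hbx, IsometryEquiv.inv_apply_self]
        exact hx.le
    have hor : (∀ᶠ n in U, ∃ ψ : ℍ ≃ᵢ ℍ, move (θ n * ψ) octBody ∈ P n ∧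
        ∃ b ∈ (octBody : Set ℍ), dist (ψ b) z ≤ ε / 2) ∨ (∀ᶠ n in U, ∃ ψ : ℍ ≃ᵢ ℍ,
        move (θ n * ψ) modBody ∈ P n ∧ ∃ b ∈ (modBody : Set ℍ), dist (ψ b) z ≤ ε / 2) := by
      rw [← Ultrafilter.eventually_or]
      filter_upwards [hev] with n ⟨β, hβ, h⟩
      rcases hβ with rfl | rfl
      · exact Or.inl h
      · exact Or.inr h
    have hfin : ∀ β ∈ B, (∀ᶠ n in U, ∃ ψ : ℍ ≃ᵢ ℍ, move (θ n * ψ) β ∈ P n ∧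
        ∃ b ∈ (β : Set ℍ), dist (ψ b) z ≤ ε / 2) →
        ∃ y ∈ covered (limitPacking U B P θ), dist z y < ε := by
      intro β hβ h
      obtain ⟨χ, hχ, y, hy, hyz⟩ := exists_mem_limitPacking U hβ h
      refine ⟨y, mem_biUnion hχ hy, ?_⟩
      rw [Metric.mem_closedBall, dist_comm] at hyz
      linarith
    rcases hor with h | h
    · exact hfin _ (Or.inl rfl) h
    · exact hfin _ (Or.inr rfl) h
  obtain ⟨χ, hχ, -⟩ := exists_mem_limitPacking U (B := B) (P := P) (θ := θ) (β := modBody)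
    (z := UpperHalfPlane.I) (ε := 1 + Metric.diam octagon) (Or.inr rfl) (Eventually.of_forall
      fun n => by
        obtain ⟨_, ⟨x, hx, rfl⟩, _, ⟨y, hy, rfl⟩, hxy⟩ := hnear n
        refine ⟨(θ n)⁻¹ * φ n, by rw [mul_inv_cancel_left]; exact hφ n, y, hy, ?_⟩
        rw [← (θ n).dist_eq, IsometryEquiv.mul_apply, IsometryEquiv.apply_inv_self]
        have h1 := dist_triangle_left (φ n y) (θ n UpperHalfPlane.I) (θ n x)
        have h2 := Metric.dist_le_diam_of_mem isCompact_octagon.isBounded hx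
          (interior_subset I_mem_interior_octagon)
        rw [(θ n).dist_eq x] at h1
        linarith)
  refine octBody_notMem_of_tiling hlim hcov hχ 1
    ⟨octBody, Or.inl rfl, fun _ => 1, 1, Eventually.of_forall fun n => ?_, fun z => ?_, rfl⟩
  · rw [mul_one]; exact hθ n
  · exact tendsto_const_nhds

/-! ### Areas of tiles, the isoperimetric inequality, and wasted area -/

instance smulInvariantMeasure_isom : SMulInvariantMeasure (ℍ ≃ᵢ ℍ) ℍ volume :=
  ⟨fun φ _ hs => (measurePreserving_isometry φ).measure_preimage hs.nullMeasurableSet⟩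

instance measurableConstSMul_isom : MeasurableConstSMul (ℍ ≃ᵢ ℍ) ℍ :=
  ⟨fun φ => φ.continuous.measurable⟩

theorem volume_closedBall_isometry (φ : ℍ ≃ᵢ ℍ) (z : ℍ) (R : ℝ) :
    volume (Metric.closedBall (φ z) R) = volume (Metric.closedBall z R) := by
  rw [← volume_image_isometry φ (Metric.closedBall z R), IsometryEquiv.image_closedBall]

theorem volume_closedBall_eq (z : ℍ) (R : ℝ) :
    volume (Metric.closedBall z R) = volume (Metric.closedBall UpperHalfPlane.I R) := by
  obtain ⟨φ, hφ⟩ := exists_isometry_apply_eq UpperHalfPlane.I z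
  rw [← hφ, volume_closedBall_isometry]

theorem volume_frontier_octagon : volume (frontier octagon) = 0 := by
  refine measure_mono_null frontier_octagon_subset (measure_iUnion_null fun k => ?_)
  exact volume_mink_eq (ne_zero_of_mink_self (mink_nrm_self k)) 0

theorem volume_frontier_modTile : volume (frontier modTile) = 0 := by
  refine measure_mono_null frontier_modTile_subset (measure_iUnion_null fun k => ?_)
  exact measure_union_null (volume_mink_eq (ne_zero_of_mink_self (mink_nrm_self k)) 0)
    (volume_sphere_eq_zero _ rad_pos.le)

theorem volume_interior_of_frontier {S : Set ℍ} (h : volume (frontier S) = 0) :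
    volume (interior S) = volume S := by
  refine le_antisymm (measure_mono interior_subset) ?_
  calc volume S ≤ volume (interior S ∪ frontier S) :=
        measure_mono fun z hz => by
          by_cases hi : z ∈ interior S
          · exact Or.inl hi
          · exact Or.inr ⟨subset_closure hz, hi⟩
    _ ≤ volume (interior S) := (measure_union_le _ _).trans (by rw [h, add_zero])

theorem IsPrototile.countable {Γ : Subgroup (ℍ ≃ᵢ ℍ)} {S : Set ℍ} (h : IsPrototile Γ S)
    (hS : (interior S).Nonempty) : Countable Γ := by
  have hd : (univ : Set Γ).PairwiseDisjoint fun γ => interior ((γ : ℍ ≃ᵢ ℍ) '' S) := by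
    intro γ _ γ' _ hne
    refine disjoint_iff_inter_eq_empty.2 (not_nonempty_iff_eq_empty.1 fun hn => hne ?_)
    exact Subtype.ext (h.eq_of_inter γ.2 γ'.2 hn)
  refine countable_univ_iff.1 (hd.countable_of_isOpen (fun _ _ => isOpen_interior) fun γ _ => ?_)
  rw [image_interior_isometry]
  exact hS.image _

open scoped Pointwise in
theorem IsPrototile.isFundamentalDomain {Γ : Subgroup (ℍ ≃ᵢ ℍ)} {S : Set ℍ}
    (h : IsPrototile Γ S) (hS : IsClosed S) (hf : volume (frontier S) = 0) :
    IsFundamentalDomain Γ S volume where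
  nullMeasurableSet := hS.measurableSet.nullMeasurableSet
  ae_covers := Eventually.of_forall fun z => by
    obtain ⟨γ, hγ, hz⟩ := h.cover z
    exact ⟨⟨γ, hγ⟩⁻¹, mem_image_isometry.1 hz⟩
  aedisjoint := fun γ γ' hne => by
    have e : ∀ δ : Γ, (δ • S : Set ℍ) = (δ : ℍ ≃ᵢ ℍ) '' S := fun _ => rfl
    have hae : ∀ δ : Γ, (δ • S : Set ℍ) =ᵐ[volume] interior ((δ : ℍ ≃ᵢ ℍ) '' S) := by
      intro δ
      rw [e]
      refine (interior_ae_eq_of_null_frontier ?_).symm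
      rw [image_frontier_isometry, volume_image_isometry, hf]
    have hd : Disjoint (interior ((γ : ℍ ≃ᵢ ℍ) '' S)) (interior ((γ' : ℍ ≃ᵢ ℍ) '' S)) := by
      refine disjoint_iff_inter_eq_empty.2 (not_nonempty_iff_eq_empty.1 fun hn => hne ?_)
      exact Subtype.ext (h.eq_of_inter γ.2 γ'.2 hn)
    exact hd.aedisjoint.congr (hae γ) (hae γ')

theorem countable_surfGroup : Countable surfGroup :=
  isPrototile_octagon.countable ⟨_, I_mem_interior_octagon⟩

theorem isFundamentalDomain_octagon : IsFundamentalDomain surfGroup octagon volume :=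
  isPrototile_octagon.isFundamentalDomain isCompact_octagon.isClosed volume_frontier_octagon

/-- Both are fundamental domains of the same group, so no computation of areas is needed. -/
theorem volume_modTile : volume modTile = volume octagon := by
  have := countable_surfGroup
  exact (isPrototile_modTile.isFundamentalDomain isCompact_modTile.isClosed
    volume_frontier_modTile).measure_eq isFundamentalDomain_octagon

theorem volume_octagon_ne_top : volume octagon ≠ ∞ := isCompact_octagon.measure_ne_top

theorem volume_octagon_pos : 0 < volume octagon :=
  (isOpen_interior.measure_pos volume ⟨_, I_mem_interior_octagon⟩).trans_le
    (measure_mono interior_subset)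

theorem volume_move (φ : ℍ ≃ᵢ ℍ) (K : NonemptyCompacts ℍ) :
    volume (move φ K : Set ℍ) = volume (K : Set ℍ) := volume_image_isometry φ K

theorem volume_interior_of_packing {P : Set (NonemptyCompacts ℍ)}
    (hP : IsPacking {octBody, modBody} P) {K : NonemptyCompacts ℍ} (hK : K ∈ P) :
    volume (interior (K : Set ℍ)) = volume octagon := by
  obtain ⟨β, hβ, φ, rfl⟩ := hP.1 K hK
  rw [coe_move, image_interior_isometry, volume_image_isometry]
  rcases hβ with rfl | rfl
  · exact volume_interior_of_frontier volume_frontier_octagon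
  · exact (volume_interior_of_frontier volume_frontier_modTile).trans volume_modTile

/-! ### The isoperimetric inequality and the count of wasted area -/

/-- The map `x + iy ↦ x + iy/e` on complex numbers. -/
def squeezeLin : ℂ →L[ℝ] ℂ :=
  LinearMap.toContinuousLinearMap
    (Matrix.toLin Complex.basisOneI Complex.basisOneI !![1, 0; 0, (Real.exp 1)⁻¹])

theorem squeezeLin_apply (z : ℂ) : squeezeLin z = ⟨z.re, (Real.exp 1)⁻¹ * z.im⟩ := by
  rw [squeezeLin, LinearMap.coe_toContinuousLinearMap', Matrix.toLin_apply]
  generalize (Real.exp 1)⁻¹ = a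
  apply Complex.ext <;> simp [Matrix.mulVec, dotProduct, Fin.sum_univ_two]

theorem squeezeLin_det : squeezeLin.det = (Real.exp 1)⁻¹ := by
  rw [ContinuousLinearMap.det, squeezeLin, LinearMap.coe_toContinuousLinearMap,
    LinearMap.det_toLin, Matrix.det_fin_two]
  simp

/-- Linear isoperimetric inequality: moving every point a unit distance along its vertical geodesic
multiplies areas by `e`. -/
theorem volume_thickening_ge {Ω : Set ℍ} (hΩ : MeasurableSet Ω) :
    2 * volume Ω ≤ volume {z | ∃ w ∈ Ω, dist z w ≤ 1} := by
  have he := Real.exp_pos 1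
  -- Dividing the height by `e` moves each point by distance `1`. It scales Euclidean area by `1/e`
  -- and the density `1/y²` by `e²`, so hyperbolic area grows by the factor `e ≥ 2`.
  set f : ℍ → ℍ := fun z => ⟨squeezeLin z, by
    rw [squeezeLin_apply]; exact mul_pos (inv_pos.2 he) z.im_pos⟩ with hf
  have hsub : f '' Ω ⊆ {z | ∃ w ∈ Ω, dist z w ≤ 1} := by
    rintro _ ⟨w, hw, rfl⟩
    refine ⟨w, hw, ?_⟩
    have hre : (f w).re = w.re := by
      change (squeezeLin w).re = _; rw [squeezeLin_apply]; rfl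
    have him : (f w).im = (Real.exp 1)⁻¹ * w.im := by
      change (squeezeLin w).im = _; rw [squeezeLin_apply]; rfl
    rw [UpperHalfPlane.dist_of_re_eq hre, him, Real.log_mul (inv_ne_zero he.ne') w.im_ne_zero,
      Real.log_inv, Real.log_exp, Real.dist_eq]
    rw [show -1 + Real.log w.im - Real.log w.im = -1 by ring]
    simp
  refine le_trans ?_ (measure_mono hsub)
  have hinj : Set.InjOn squeezeLin ((↑) '' Ω : Set ℂ) := by
    intro a _ b _ hab
    rw [squeezeLin_apply, squeezeLin_apply, Complex.mk.injEq] at hab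
    exact Complex.ext hab.1 (mul_left_cancel₀ (inv_ne_zero he.ne') hab.2)
  have hm := measurableEmbedding_coe.measurableSet_image.2 hΩ
  have main := lintegral_image_eq_lintegral_abs_det_fderiv_mul volume hm
    (fun x _ => squeezeLin.hasFDerivWithinAt) hinj
    (fun z => ((1 / ‖z.im‖₊) ^ 2 : NNReal))
  have himg : ((↑) '' (f '' Ω) : Set ℂ) = squeezeLin '' ((↑) '' Ω) := by
    rw [image_image, image_image]
  rw [volume_eq_lintegral, volume_eq_lintegral, himg, main,
    ← lintegral_const_mul' _ _ ENNReal.ofNat_ne_top]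
  refine lintegral_mono fun z => ?_
  rw [squeezeLin_det, squeezeLin_apply, abs_of_pos (inv_pos.2 he)]
  change 2 * _ ≤ _
  have h2 : (2 : ℝ) ≤ Real.exp 1 := by linarith [Real.add_one_le_exp (1 : ℝ)]
  have e1 : ∀ x : ℝ, (((1 / ‖x‖₊) ^ 2 : ℝ≥0) : ℝ≥0∞) = ENNReal.ofReal ((1 / |x|) ^ 2) := by
    intro x
    rw [← ENNReal.ofReal_coe_nnreal]
    simp
  rw [e1, e1, ← ENNReal.ofReal_mul (inv_pos.2 he).le, ← ENNReal.ofReal_ofNat 2,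
    ← ENNReal.ofReal_mul (by norm_num)]
  refine ENNReal.ofReal_le_ofReal ?_
  have h0 : 0 ≤ (1 / |z.im|) ^ 2 := by positivity
  have : (Real.exp 1)⁻¹ * (1 / |(Real.exp 1)⁻¹ * z.im|) ^ 2 =
      Real.exp 1 * (1 / |z.im|) ^ 2 := by
    rw [abs_mul, abs_of_pos (inv_pos.2 he), one_div, mul_inv, inv_inv, mul_pow, one_div]
    field_simp
  calc (2 : ℝ) * (1 / |z.im|) ^ 2 ≤ Real.exp 1 * (1 / |z.im|) ^ 2 := by gcongr
    _ = _ := this.symm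

theorem card_mul_volume_le {P : Set (NonemptyCompacts ℍ)} (hP : IsPacking {octBody, modBody} P)
    {s : Finset (NonemptyCompacts ℍ)} (hs : (s : Set (NonemptyCompacts ℍ)) ⊆ P) {A : Set ℍ}
    (hA : ∀ K ∈ s, (K : Set ℍ) ⊆ A) : s.card * volume octagon ≤ volume A := by
  calc s.card * volume octagon = ∑ K ∈ s, volume (interior (K : Set ℍ)) := by
        rw [Finset.sum_congr rfl fun K hK => volume_interior_of_packing hP (hs hK),
          Finset.sum_const, nsmul_eq_mul]
    _ = volume (⋃ K ∈ s, interior (K : Set ℍ)) :=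
        (measure_biUnion_finset (hP.2.subset hs) fun _ _ => isOpen_interior.measurableSet).symm
    _ ≤ volume A := measure_mono (iUnion₂_subset fun K hK => interior_subset.trans (hA K hK))

/-- In a packing by octagons and modified octagons, the area left uncovered is bounded below by a
constant times the number of octagons, if that number is finite. -/
theorem exists_waste_bound : ∃ κ : ℝ, 0 < κ ∧ ∀ P : Set (NonemptyCompacts ℍ),
    IsPacking {octBody, modBody} P → ∀ J : Finset (NonemptyCompacts ℍ),
    (J : Set (NonemptyCompacts ℍ)) ⊆ P → (∀ K ∈ J, ∃ θ : ℍ ≃ᵢ ℍ, K = move θ octBody) →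
    (∀ K ∈ P, K ∉ J → ∃ φ : ℍ ≃ᵢ ℍ, K = move φ modBody) → volume (covered P)ᶜ ≠ ∞ →
    κ * J.card ≤ volume.real (covered P)ᶜ := by
  classical
  obtain ⟨R, ε, hR, hε, hwaste⟩ := exists_waste
  obtain ⟨D, hD⟩ := isCompact_octagon.isBounded.subset_closedBall UpperHalfPlane.I
  set A := volume.real octagon with hAdef
  have hA : 0 < A := ENNReal.toReal_pos volume_octagon_pos.ne' volume_octagon_ne_top
  set V₁ := volume.real (Metric.closedBall UpperHalfPlane.I (D + 1)) with hV₁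
  set V₂ := volume.real (Metric.closedBall UpperHalfPlane.I (R + D)) with hV₂
  have hb : ∀ z : ℍ, ∀ ρ, volume (Metric.closedBall z ρ) ≠ ∞ := fun z ρ =>
    (isCompact_closedBall z ρ).measure_ne_top
  -- With `N` octagons, `N₁` of them near a modified octagon, and waste `W`, the two estimates are
  -- `N A ≤ W + N₁ V₁` and `N₁ ε A ≤ V₂ W`. Eliminating `N₁` gives this constant.
  refine ⟨ε * A ^ 2 / (ε * A + V₁ * V₂), by positivity, fun P hP J hJP hJ hrest hW => ?_⟩
  set W := volume.real (covered P)ᶜ with hWdef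
  choose! θ hθ using hJ
  have hball : ∀ K ∈ J, (K : Set ℍ) ⊆ Metric.closedBall (θ K UpperHalfPlane.I) D := by
    intro K hK
    have := image_mono (f := θ K) hD
    rw [IsometryEquiv.image_closedBall] at this
    exact (congrArg SetLike.coe (hθ K hK)).subset.trans this
  have hcl : IsClosed (covered P) :=
    isClosed_covered finite_bodies (fun β hβ => interior_bodies_nonempty hβ) hP
  set J₁ := J.filter fun K : NonemptyCompacts ℍ => ∃ L ∈ P, L ∉ J ∧ ∃ x ∈ (K : Set ℍ), ∃ y ∈ (L : Set ℍ), dist x y ≤ 1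
    with hJ₁
  have hJ₁J : J₁ ⊆ J := Finset.filter_subset _ _
  -- the neighbourhood of the octagons
  have hcard : J.card * A ≤ W + J₁.card * V₁ := by
    set Ω : Set ℍ := ⋃ K ∈ J, (K : Set ℍ) with hΩ
    have hΩm : MeasurableSet Ω := J.measurableSet_biUnion fun K _ => K.isCompact.isClosed.measurableSet
    have hΩv : J.card * volume octagon ≤ volume Ω :=
      card_mul_volume_le hP hJP fun K hK => subset_biUnion_of_mem (u := fun K : NonemptyCompacts ℍ =>
        (K : Set ℍ)) hK
    have hΩt : volume Ω ≠ ∞ := by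
      refine ne_of_lt ((measure_biUnion_finset_le _ _).trans_lt (ENNReal.sum_lt_top.2 fun K _ => ?_))
      exact K.isCompact.measure_lt_top
    -- The unit neighbourhood of the octagons has at least twice their area. Its new part is
    -- uncovered or lies in other bodies, and the latter happens only near octagons of `J₁`.
    have hsub : {z | ∃ w ∈ Ω, dist z w ≤ 1} ⊆
        Ω ∪ ((covered P)ᶜ ∪ ⋃ K ∈ J₁, Metric.closedBall (θ K UpperHalfPlane.I) (D + 1)) := by
      rintro z ⟨w, hw, hzw⟩
      by_cases hz : z ∈ Ω
      · exact Or.inl hz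
      by_cases hzc : z ∈ covered P
      · obtain ⟨L, hL, hzL⟩ := mem_iUnion₂.1 hzc
        obtain ⟨K, hK, hwK⟩ := mem_iUnion₂.1 hw
        have hLJ : L ∉ J := fun h => hz (mem_iUnion₂.2 ⟨L, h, hzL⟩)
        refine Or.inr (Or.inr (mem_iUnion₂.2 ⟨K, Finset.mem_filter.2
          ⟨hK, L, hL, hLJ, w, hwK, z, hzL, by rwa [dist_comm]⟩, ?_⟩))
        have := Metric.mem_closedBall.1 (hball K hK hwK)
        rw [Metric.mem_closedBall]
        linarith [dist_triangle z w (θ K UpperHalfPlane.I)]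
      · exact Or.inr (Or.inl hzc)
    have h1 := (volume_thickening_ge hΩm).trans ((measure_mono hsub).trans ((measure_union_le _ _).trans
      (add_le_add_right (measure_union_le _ _) _)))
    rw [two_mul] at h1
    have h2 := hΩv.trans ((ENNReal.add_le_add_iff_left hΩt).1 h1)
    have h3 : volume (⋃ K ∈ J₁, Metric.closedBall (θ K UpperHalfPlane.I) (D + 1)) ≤
        J₁.card * volume (Metric.closedBall UpperHalfPlane.I (D + 1)) := by
      refine (measure_biUnion_finset_le _ _).trans ?_
      rw [Finset.sum_congr rfl fun K _ => volume_closedBall_eq _ _, Finset.sum_const, nsmul_eq_mul]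
    have h4 := h2.trans (add_le_add_right h3 _)
    have h5 := ENNReal.toReal_mono (ENNReal.add_ne_top.2 ⟨hW, ENNReal.mul_ne_top
      (ENNReal.natCast_ne_top _) (hb _ _)⟩) h4
    rwa [ENNReal.toReal_add hW (ENNReal.mul_ne_top (ENNReal.natCast_ne_top _) (hb _ _)),
      ENNReal.toReal_mul, ENNReal.toReal_mul, ENNReal.toReal_natCast, ENNReal.toReal_natCast] at h5
  -- every octagon next to a modified octagon wastes area nearby
  have hwasted : J₁.card * ε * A ≤ V₂ * W := by
    have h1 : J₁.card * ENNReal.ofReal ε ≤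
        ∑ K ∈ J₁, volume (Metric.closedBall (θ K UpperHalfPlane.I) R \ covered P) := by
      rw [← nsmul_eq_mul, ← Finset.sum_const]
      refine Finset.sum_le_sum fun K hK => ?_
      obtain ⟨hKJ, L, hL, hLJ, x, hx, y, hy, hxy⟩ := Finset.mem_filter.1 hK
      obtain ⟨φ, rfl⟩ := hrest L hL hLJ
      refine hwaste P hP (θ K) φ ?_ hL ?_
      · rw [← hθ K hKJ]; exact hJP hKJ
      · rw [← hθ K hKJ]; exact ⟨x, hx, y, hy, hxy⟩
    have hm : ∀ K ∈ J₁, MeasurableSet (Metric.closedBall (θ K UpperHalfPlane.I) R \ covered P) :=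
      fun K _ => Metric.isClosed_closedBall.measurableSet.diff hcl.measurableSet
    -- Double counting. The octagons whose balls of radius `R` contain a given point fit without
    -- overlap into a ball of radius `R + D`, so a wasted point is counted at most `V₂ / A` times.
    have h2 : (∑ K ∈ J₁, volume (Metric.closedBall (θ K UpperHalfPlane.I) R \ covered P)) *
        volume octagon ≤ volume (Metric.closedBall UpperHalfPlane.I (R + D)) *
          volume (covered P)ᶜ := by
      rw [Finset.sum_congr rfl fun K hK => (lintegral_indicator_one (hm K hK)).symm,
        ← lintegral_finsetSum _ fun K hK => measurable_one.indicator (hm K hK),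
        ← lintegral_mul_const' _ _ volume_octagon_ne_top, ← lintegral_indicator_const
          hcl.measurableSet.compl]
      refine lintegral_mono fun z => ?_
      by_cases hz : z ∈ covered P
      · rw [Finset.sum_eq_zero fun K _ => indicator_of_notMem (fun h => h.2 hz) _, zero_mul]
        exact zero_le
      · rw [indicator_of_mem (s := (covered P)ᶜ) hz]
        have h3 := card_mul_volume_le hP (A := Metric.closedBall z (R + D))
          (s := J₁.filter fun K => z ∈ Metric.closedBall (θ K UpperHalfPlane.I) R)
          (fun K hK => hJP (hJ₁J (Finset.mem_filter.1 hK).1)) fun K hK y hy => by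
            have hK' := Finset.mem_filter.1 hK
            have a := Metric.mem_closedBall.1 (hball K (hJ₁J hK'.1) hy)
            have b := Metric.mem_closedBall'.1 hK'.2
            rw [Metric.mem_closedBall]
            linarith [dist_triangle y (θ K UpperHalfPlane.I) z]
        rw [volume_closedBall_eq z] at h3
        refine le_trans (mul_le_mul_left ?_ _) h3
        rw [Finset.card_filter, Nat.cast_sum]
        refine Finset.sum_le_sum fun K _ => ?_
        by_cases hzK : z ∈ Metric.closedBall (θ K UpperHalfPlane.I) R
        · rw [if_pos hzK, indicator_of_mem (mem_sdiff_of_mem hzK hz)]; simp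
        · rw [indicator_of_notMem fun h => hzK h.1]; exact zero_le
    have h4 := (mul_le_mul_left h1 (volume octagon)).trans h2
    have h5 := ENNReal.toReal_mono (ENNReal.mul_ne_top (hb _ _) hW) h4
    rwa [ENNReal.toReal_mul, ENNReal.toReal_mul, ENNReal.toReal_mul, ENNReal.toReal_natCast,
      ENNReal.toReal_ofReal hε.le] at h5
  have hV₁0 : 0 ≤ V₁ := ENNReal.toReal_nonneg
  have hV₂0 : 0 ≤ V₂ := ENNReal.toReal_nonneg
  rw [div_mul_eq_mul_div, div_le_iff₀ (by positivity)]
  have h1 := mul_le_mul_of_nonneg_left hcard (mul_pos hε hA).le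
  have h2 := mul_le_mul_of_nonneg_left hwasted hV₁0
  nlinarith

/-- Replacing finitely many members of a covering of the plane. -/
theorem sum_volume_add_le {ι : Type*} {s : Set ι} {f : ι → Set ℍ} {a b : Finset ι}
    (hs : ⋃ i ∈ s, f i = univ) (hab : Disjoint (s \ a) b)
    (hd : ((s \ a) ∪ b : Set ι).PairwiseDisjoint fun i => interior (f i))
    (hc : ∀ i ∈ s, closure (interior (f i)) = f i) (hf : ∀ i ∈ b, volume (frontier (f i)) = 0) :
    ∑ i ∈ b, volume (f i) + volume (⋃ i ∈ ((s \ a) ∪ b : Set ι), f i)ᶜ ≤ ∑ i ∈ a, volume (f i) := by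
  rw [Finset.sum_congr rfl fun i hi => (volume_interior_of_frontier (hf i hi)).symm,
    ← measure_biUnion_finset (hd.subset subset_union_right) fun _ _ => isOpen_interior.measurableSet,
    ← measure_union' ?_ (Finset.measurableSet_biUnion _ fun _ _ => isOpen_interior.measurableSet)]
  · refine (measure_mono ?_).trans (measure_biUnion_finset_le _ _)
    -- A point of a new body's interior, or one now uncovered, was covered before; the body that
    -- covered it must have been removed, since bodies that stay are disjoint from the new
    -- interiors.
    intro z hz
    obtain ⟨i, hi, hzi⟩ := mem_iUnion₂.1 (hs.symm.subset (mem_univ z))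
    by_cases hia : i ∈ a
    · exact mem_iUnion₂.2 ⟨i, hia, hzi⟩
    exfalso
    rcases hz with hz | hz
    · obtain ⟨j, hj, hzj⟩ := mem_iUnion₂.1 hz
      have hij : i ≠ j := fun h => Set.disjoint_left.1 hab ⟨hi, hia⟩ (h ▸ hj)
      have := hd (Or.inl ⟨hi, hia⟩) (Or.inr hj) hij
      rw [← hc i hi] at hzi
      exact Set.disjoint_left.1 (this.closure_left isOpen_interior) hzi hzj
    · exact hz (mem_iUnion₂.2 ⟨i, Or.inl ⟨hi, hia⟩, hzi⟩)
  · refine Set.disjoint_left.2 fun z hz hz' => hz' ?_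
    obtain ⟨j, hj, hzj⟩ := mem_iUnion₂.1 hz
    exact mem_iUnion₂.2 ⟨j, Or.inr hj, interior_subset hzj⟩

/-! ### The modified octagon with a hole, and complete saturation -/

/-- The closed disk of radius `r` about `c` is a small part of the modified octagon. -/
structure IsHole (c : ℍ) (r : ℝ) : Prop where
  pos : 0 < r
  subset : Metric.closedBall c r ⊆ interior modTile
  small : 2 * volume (Metric.closedBall c r) < volume octagon

theorem volume_ball_eq_closedBall (c : ℍ) {r : ℝ} (hr : 0 < r) :
    volume (Metric.ball c r) = volume (Metric.closedBall c r) := by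
  refine le_antisymm (measure_mono Metric.ball_subset_closedBall) ?_
  rw [← Metric.ball_union_sphere]
  exact (measure_union_le _ _).trans (by rw [volume_sphere_eq_zero c hr.le, add_zero])

theorem volume_closedBall_ne_top (c : ℍ) (r : ℝ) : volume (Metric.closedBall c r) ≠ ∞ :=
  (isCompact_closedBall c r).measure_ne_top

variable {c : ℍ} {r : ℝ}

theorem IsHole.closure_sdiff (h : IsHole c r) :
    closure (interior modTile \ Metric.closedBall c r) = modTile \ Metric.ball c r := by
  apply Subset.antisymm
  · refine closure_minimal (sdiff_subset_sdiff interior_subset Metric.ball_subset_closedBall) ?_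
    exact (isCompact_modTile.diff Metric.isOpen_ball).isClosed
  · rintro z ⟨hz, hzb⟩
    have e : interior modTile \ Metric.closedBall c r =
        interior modTile ∩ {w | r < dist w c} := by
      ext w
      simp [Metric.mem_closedBall]
    have ho : IsOpen {w : ℍ | r < dist w c} :=
      isOpen_lt continuous_const (continuous_id.dist continuous_const)
    have hzr : r ≤ dist z c := not_lt.1 hzb
    rw [e]
    rcases hzr.lt_or_eq with hlt | heq
    · rw [inter_comm]
      refine ho.inter_closure ⟨hlt, ?_⟩
      rwa [closure_interior_modTile]
    · exact isOpen_interior.inter_closure ⟨h.subset heq.symm.le, mem_closure_far h.pos hzr⟩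

theorem IsHole.nonempty_sdiff (h : IsHole c r) :
    (interior modTile \ Metric.closedBall c r).Nonempty := by
  by_contra hn
  have hsub : interior modTile ⊆ Metric.closedBall c r := by
    rwa [not_nonempty_iff_eq_empty, sdiff_eq_empty] at hn
  have h1 := measure_mono (μ := volume) hsub
  rw [volume_interior_of_frontier volume_frontier_modTile, volume_modTile] at h1
  have h2 := h.small
  rw [two_mul] at h2
  exact absurd (h2.trans_le h1) (not_lt.2 le_self_add)

/-- The modified octagon with the open disk of radius `r` about `c` removed. -/
def holeBody (h : IsHole c r) : NonemptyCompacts ℍ :=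
  ⟨⟨modTile \ Metric.ball c r, isCompact_modTile.diff Metric.isOpen_ball⟩, by
    have := h.nonempty_sdiff.closure
    rwa [h.closure_sdiff] at this⟩

theorem coe_holeBody (h : IsHole c r) : (holeBody h : Set ℍ) = modTile \ Metric.ball c r := rfl

variable (h : IsHole c r)

theorem subset_interior_holeBody :
    interior modTile \ Metric.closedBall c r ⊆ interior (holeBody h : Set ℍ) :=
  interior_maximal (sdiff_subset_sdiff interior_subset Metric.ball_subset_closedBall)
    (isOpen_interior.sdiff Metric.isClosed_closedBall)

theorem closure_interior_holeBody : closure (interior (holeBody h : Set ℍ)) = holeBody h := by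
  apply Subset.antisymm
  · exact closure_minimal interior_subset (holeBody h).isCompact.isClosed
  · refine Subset.trans ?_ (closure_mono (subset_interior_holeBody h))
    rw [h.closure_sdiff, coe_holeBody]

theorem isConnected_interior_holeBody : IsConnected (interior (holeBody h : Set ℍ)) := by
  refine ⟨h.nonempty_sdiff.mono (subset_interior_holeBody h), ?_⟩
  refine (isPreconnected_diff_closedBall isConnected_interior_modTile.isPreconnected
    isOpen_interior h.pos h.subset).subset_closure (subset_interior_holeBody h) ?_
  rw [h.closure_sdiff]
  exact interior_subset

theorem isBody_holeBody : IsBody (holeBody h : Set ℍ) := by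
  refine ⟨(holeBody h).isCompact, ?_, closure_interior_holeBody h⟩
  rw [← closure_interior_holeBody h]
  exact (isConnected_interior_holeBody h).closure

theorem frontier_holeBody_subset :
    frontier (holeBody h : Set ℍ) ⊆ frontier modTile ∪ Metric.sphere c r := by
  rw [coe_holeBody, sdiff_eq]
  refine (frontier_inter_subset _ _).trans (union_subset_union inter_subset_left ?_)
  rw [frontier_compl]
  exact inter_subset_right.trans Metric.frontier_ball_subset_sphere

theorem volume_frontier_holeBody : volume (frontier (holeBody h : Set ℍ)) = 0 :=
  measure_mono_null (frontier_holeBody_subset h)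
    (measure_union_null volume_frontier_modTile (volume_sphere_eq_zero c h.pos.le))

theorem volume_holeBody_add :
    volume (holeBody h : Set ℍ) + volume (Metric.closedBall c r) = volume octagon := by
  rw [← volume_ball_eq_closedBall c h.pos, coe_holeBody, ← volume_modTile]
  have := measure_sdiff_add_inter (μ := volume) modTile (Metric.isOpen_ball (x := c)
    (ε := r)).measurableSet
  rwa [inter_eq_self_of_subset_right
    (Metric.ball_subset_closedBall.trans (h.subset.trans interior_subset))] at this

theorem volume_real_holeBody :
    volume.real (holeBody h : Set ℍ) = volume.real octagon - volume.real (Metric.closedBall c r) := by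
  rw [measureReal_def, measureReal_def, measureReal_def, ← volume_holeBody_add h,
    ENNReal.toReal_add (holeBody h).isCompact.measure_ne_top (volume_closedBall_ne_top c r)]
  ring

theorem volume_closedBall_lt_holeBody :
    volume (Metric.closedBall c r) < volume (holeBody h : Set ℍ) := by
  have h1 := h.small
  rw [← volume_holeBody_add h, two_mul] at h1
  exact (ENNReal.add_lt_add_iff_right (volume_closedBall_ne_top c r)).1 h1

theorem volume_holeBody_lt : volume (holeBody h : Set ℍ) < volume octagon := by
  rw [← volume_holeBody_add h]
  exact ENNReal.lt_add_right (holeBody h).isCompact.measure_ne_top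
    (Metric.measure_closedBall_pos volume c h.pos).ne'

variable {h}

theorem isConnected_interior_of_copy {β : NonemptyCompacts ℍ} (hβ : β ∈ ({octBody, holeBody h} :
    Set (NonemptyCompacts ℍ))) (φ : ℍ ≃ᵢ ℍ) : IsConnected (interior (move φ β : Set ℍ)) := by
  rw [coe_move, image_interior_isometry]
  refine IsConnected.image ?_ _ φ.continuous.continuousOn
  rcases hβ with rfl | rfl
  · exact isConnected_interior_octagon
  · exact isConnected_interior_holeBody h

theorem volume_frontier_of_copy {β : NonemptyCompacts ℍ} (hβ : β ∈ ({octBody, holeBody h} :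
    Set (NonemptyCompacts ℍ))) (φ : ℍ ≃ᵢ ℍ) : volume (frontier (move φ β : Set ℍ)) = 0 := by
  rw [coe_move, image_frontier_isometry, volume_image_isometry]
  rcases hβ with rfl | rfl
  · exact volume_frontier_octagon
  · exact volume_frontier_holeBody h

theorem volume_closedBall_lt_of_copy {β : NonemptyCompacts ℍ} (hβ : β ∈ ({octBody, holeBody h} :
    Set (NonemptyCompacts ℍ))) (φ : ℍ ≃ᵢ ℍ) :
    volume (Metric.closedBall c r) < volume (interior (move φ β : Set ℍ)) := by
  rw [volume_interior_of_frontier (volume_frontier_of_copy hβ φ), volume_move]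
  rcases hβ with rfl | rfl
  · exact (volume_closedBall_lt_holeBody h).trans (volume_holeBody_lt h)
  · exact volume_closedBall_lt_holeBody h

/-- A connected set of large area cannot sneak into the hole. -/
theorem disjoint_of_disjoint_hole (h : IsHole c r) {O : Set ℍ} (hO : IsPreconnected O)
    (hv : volume (Metric.closedBall c r) < volume O) {φ : ℍ ≃ᵢ ℍ}
    (hd : Disjoint O (φ '' (interior modTile \ Metric.closedBall c r))) :
    Disjoint O (φ '' interior modTile) := by
  rw [image_sdiff φ.injective] at hd
  refine Set.disjoint_left.2 fun z hz hz' => ?_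
  have hu : IsOpen (φ '' interior modTile) := φ.toHomeomorph.isOpenMap _ isOpen_interior
  have hw : IsOpen (φ '' Metric.closedBall c r)ᶜ :=
    (φ.toHomeomorph.isClosedMap _ Metric.isClosed_closedBall).isOpen_compl
  have hcov : O ⊆ φ '' interior modTile ∪ (φ '' Metric.closedBall c r)ᶜ := fun x _ => by
    by_cases hx : x ∈ φ '' Metric.closedBall c r
    · exact Or.inl (image_mono h.subset hx)
    · exact Or.inr hx
  have hempty : O ∩ (φ '' interior modTile ∩ (φ '' Metric.closedBall c r)ᶜ) = ∅ :=
    disjoint_iff_inter_eq_empty.1 hd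
  -- The set `O` misses the ring between hole and boundary of the tile, so being connected it is
  -- either inside the hole, where it is too large to fit, or outside the tile.
  rcases isPreconnected_iff_subset_of_disjoint.1 hO _ _ hu hw hcov hempty with hsub | hsub
  · refine absurd (measure_mono (μ := volume) (fun x hx => ?_ : O ⊆ φ '' Metric.closedBall c r)) ?_
    · by_contra hx'
      exact Set.disjoint_left.1 hd hx ⟨hsub hx, hx'⟩
    · rw [volume_image_isometry]
      exact not_le.2 hv
  · exact Set.disjoint_left.1 hd hz ⟨hz', hsub hz⟩

theorem isPacking_translates {B : Set (NonemptyCompacts ℍ)} {Γ : Subgroup (ℍ ≃ᵢ ℍ)}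
    {K : NonemptyCompacts ℍ} {S : Set ℍ} (hK : K ∈ B) (hS : IsPrototile Γ S)
    (hKS : (K : Set ℍ) ⊆ S) : IsPacking B (translates Γ K) := by
  refine ⟨?_, ?_⟩
  · rintro _ ⟨γ, -, rfl⟩
    exact ⟨K, hK, γ, rfl⟩
  · rintro _ ⟨γ, hγ, rfl⟩ _ ⟨γ', hγ', rfl⟩ hne
    refine Set.disjoint_left.2 fun z hz hz' => hne ?_
    rw [hS.eq_of_inter hγ hγ' ⟨z, interior_mono (image_mono hKS) hz,
      interior_mono (image_mono hKS) hz'⟩]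

theorem covered_translates {Γ : Subgroup (ℍ ≃ᵢ ℍ)} {K : NonemptyCompacts ℍ}
    (hK : IsPrototile Γ K) : covered (translates Γ K) = univ :=
  eq_univ_of_forall fun z => by
    obtain ⟨γ, hγ, hz⟩ := hK.cover z
    exact mem_iUnion₂.2 ⟨move γ K, ⟨γ, hγ, rfl⟩, hz⟩

/-- The tiling by octagons, as a packing by octagons and holed modified octagons. -/
def octPacking (h : IsHole c r) : PackingSpace {octBody, holeBody h} :=
  ⟨translates surfGroup octBody,
    isPacking_translates (mem_insert _ _) isPrototile_octagon Subset.rfl, fun β _ φ => by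
    obtain ⟨z, hz⟩ := (move φ β).nonempty
    obtain ⟨K, hK, hzK⟩ := mem_iUnion₂.1
      ((covered_translates (K := octBody) isPrototile_octagon).symm.subset (mem_univ z))
    exact ⟨K, hK, z, hz, hzK⟩⟩

/-- The packing by holed modified octagons. -/
def holePacking (h : IsHole c r) : PackingSpace {octBody, holeBody h} :=
  ⟨translates surfGroup (holeBody h), isPacking_translates (mem_insert_of_mem _ rfl)
    isPrototile_modTile sdiff_subset, fun β hβ φ => by
    by_contra! hno
    have hO := isConnected_interior_of_copy hβ φ
    obtain ⟨z, hz⟩ := hO.nonempty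
    obtain ⟨γ, hγ, hzγ⟩ := isPrototile_modTile.cover z
    have hdis : Disjoint (move φ β : Set ℍ) (move γ (holeBody h) : Set ℍ) :=
      disjoint_iff_inter_eq_empty.2 (hno _ ⟨γ, hγ, rfl⟩)
    -- A copy that touched no body would, being too large for a hole, avoid the open tile around one
    -- of its interior points. That point is then on the boundary of the tile, hence in its holed
    -- body.
    have hd := disjoint_of_disjoint_hole (φ := γ) h hO.isPreconnected
      (volume_closedBall_lt_of_copy hβ φ) (hdis.mono interior_subset
        (image_mono ((subset_interior_holeBody h).trans interior_subset)))
    refine Set.disjoint_left.1 hd hz ?_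
    by_contra hz'
    refine Set.disjoint_left.1 hdis (interior_subset hz) ?_
    obtain ⟨w, hw, rfl⟩ := hzγ
    exact ⟨w, ⟨hw, fun hwb => hz' ⟨w, h.subset (Metric.ball_subset_closedBall hwb), rfl⟩⟩, rfl⟩⟩

/-- The packing covers the plane, so the interiors of the replacements must fit into the bodies
taken out. -/
theorem isCompletelySaturated_octPacking (h : IsHole c r) :
    IsCompletelySaturated {octBody, holeBody h} (octPacking h).1 := by
  refine ⟨(octPacking h).2.1, fun P' P'' _ hdis hpack => ?_⟩
  refine le_self_add.trans (sum_volume_add_le (f := fun K : NonemptyCompacts ℍ => (K : Set ℍ))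
    (covered_translates (K := octBody) isPrototile_octagon) hdis hpack.2 ?_ ?_)
  · rintro _ ⟨γ, -, rfl⟩
    rw [coe_move, image_interior_isometry, image_closure_isometry]
    exact congrArg _ closure_interior_octagon
  · intro K hK
    obtain ⟨β, hβ, φ, rfl⟩ := hpack.1 K (Or.inr hK)
    exact volume_frontier_of_copy hβ φ

/-- Filling the holes. -/
theorem exists_fill (h : IsHole c r) : ∃ F : NonemptyCompacts ℍ → NonemptyCompacts ℍ,
    (∀ γ ∈ surfGroup, F (move γ (holeBody h)) = move γ modBody) ∧
    (∀ φ : ℍ ≃ᵢ ℍ, ∃ ψ : ℍ ≃ᵢ ℍ, move φ (holeBody h) = move ψ (holeBody h) ∧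
      F (move φ (holeBody h)) = move ψ modBody) ∧
    ∀ φ : ℍ ≃ᵢ ℍ, F (move φ octBody) = move φ octBody := by
  classical
  -- A holed body may come from several isometries, and the filled tile might depend on the choice.
  -- A representative in the surface group is preferred, so that the bodies of the periodic packing
  -- are filled to the tiling.
  refine ⟨fun K => if h₁ : ∃ γ ∈ surfGroup, K = move γ (holeBody h) then move h₁.choose modBody else
    if h₂ : ∃ φ : ℍ ≃ᵢ ℍ, K = move φ (holeBody h) then move h₂.choose modBody else K, ?_, ?_, ?_⟩
  · intro γ hγ
    have h₁ : ∃ γ' ∈ surfGroup, move γ (holeBody h) = move γ' (holeBody h) := ⟨γ, hγ, rfl⟩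
    beta_reduce
    rw [dif_pos h₁]
    congr 1
    refine isPrototile_modTile.eq_of_inter h₁.choose_spec.1 hγ ?_
    obtain ⟨z, hz⟩ := (isConnected_interior_of_copy (h := h) (mem_insert_of_mem _ rfl) γ).nonempty
    refine ⟨z, ?_, interior_mono (image_mono sdiff_subset) hz⟩
    rw [h₁.choose_spec.2] at hz
    exact interior_mono (image_mono sdiff_subset) hz
  · intro φ
    beta_reduce
    split_ifs with h₁ h₂
    · exact ⟨_, h₁.choose_spec.2, rfl⟩
    · exact ⟨_, h₂.choose_spec, rfl⟩
    · exact absurd ⟨φ, rfl⟩ h₂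
  · intro φ
    have hne : ∀ ψ, move φ octBody ≠ move ψ (holeBody h) := fun ψ he => by
      have := congrArg (fun K : NonemptyCompacts ℍ => volume (K : Set ℍ)) he
      simp only [volume_move] at this
      exact (volume_holeBody_lt h).ne this.symm
    beta_reduce
    rw [dif_neg (fun ⟨γ, _, he⟩ => hne γ he), dif_neg (fun ⟨ψ, he⟩ => hne ψ he)]

theorem disjoint_fill {F : NonemptyCompacts ℍ → NonemptyCompacts ℍ}
    (hF₂ : ∀ φ : ℍ ≃ᵢ ℍ, ∃ ψ : ℍ ≃ᵢ ℍ, move φ (holeBody h) = move ψ (holeBody h) ∧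
      F (move φ (holeBody h)) = move ψ modBody)
    (hF₃ : ∀ φ : ℍ ≃ᵢ ℍ, F (move φ octBody) = move φ octBody) {O : Set ℍ} (hO : IsPreconnected O)
    (hv : volume (Metric.closedBall c r) < volume O) {β : NonemptyCompacts ℍ}
    (hβ : β ∈ ({octBody, holeBody h} : Set (NonemptyCompacts ℍ))) (φ : ℍ ≃ᵢ ℍ)
    (hd : Disjoint O (interior (move φ β : Set ℍ))) :
    Disjoint O (interior (F (move φ β) : Set ℍ)) := by
  rcases hβ with rfl | rfl
  · rwa [hF₃]
  · obtain ⟨ψ, h1, h2⟩ := hF₂ φ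
    rw [h2, coe_move, image_interior_isometry]
    refine disjoint_of_disjoint_hole h hO hv (hd.mono_right ?_)
    rw [h1, coe_move, image_interior_isometry]
    exact image_mono (subset_interior_holeBody h)

/-- Filling all holes before and after the exchange gives bodies of equal area `A`. The periodic
packing becomes a tiling, so the number of new bodies times `A`, plus the waste, is at most the
number of old ones times `A`. Each new octagon gains one hole area but costs `κ`, at least two hole
areas, in waste. -/
theorem isCompletelySaturated_holePacking (h : IsHole c r) {κ : ℝ}
    (hκ : ∀ P : Set (NonemptyCompacts ℍ), IsPacking {octBody, modBody} P →
      ∀ J : Finset (NonemptyCompacts ℍ), (J : Set (NonemptyCompacts ℍ)) ⊆ P →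
      (∀ K ∈ J, ∃ θ : ℍ ≃ᵢ ℍ, K = move θ octBody) →
      (∀ K ∈ P, K ∉ J → ∃ φ : ℍ ≃ᵢ ℍ, K = move φ modBody) → volume (covered P)ᶜ ≠ ∞ →
      κ * J.card ≤ volume.real (covered P)ᶜ)
    (hr : 2 * volume.real (Metric.closedBall c r) ≤ κ) :
    IsCompletelySaturated {octBody, holeBody h} (holePacking h).1 := by
  classical
  refine ⟨(holePacking h).2.1, fun P' P'' hP' hdis hpack => ?_⟩
  obtain ⟨F, hF₁, hF₂, hF₃⟩ := exists_fill h
  set P := (holePacking h).1 with hPdef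
  set Q : Set (NonemptyCompacts ℍ) := (P \ P') ∪ P'' with hQ
  have hPt : P = translates surfGroup (holeBody h) := rfl
  have hintr : ∀ K ∈ Q, interior (K : Set ℍ) ⊆ interior (F K : Set ℍ) := by
    intro K hK
    obtain ⟨β, hβ, φ, rfl⟩ := hpack.1 K hK
    rcases hβ with rfl | rfl
    · rw [hF₃]
    · obtain ⟨ψ, h1, h2⟩ := hF₂ φ
      rw [h2, h1]
      exact interior_mono (image_mono sdiff_subset)
  have hcopy : ∀ K ∈ Q, ∃ β ∈ ({octBody, modBody} : Set (NonemptyCompacts ℍ)),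
      ∃ φ : ℍ ≃ᵢ ℍ, F K = move φ β := by
    intro K hK
    obtain ⟨β, hβ, φ, rfl⟩ := hpack.1 K hK
    rcases hβ with rfl | rfl
    · exact ⟨octBody, Or.inl rfl, φ, hF₃ φ⟩
    · obtain ⟨ψ, -, h2⟩ := hF₂ φ
      exact ⟨modBody, Or.inr rfl, ψ, h2⟩
  -- The two bodies are filled one after the other. The second step applies because the first body,
  -- once filled, is still connected and too large for a hole.
  have hFd : Q.PairwiseDisjoint fun K => interior (F K : Set ℍ) := by
    intro K hK L hL hne
    have h0 := hpack.2 hK hL hne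
    obtain ⟨β, hβ, φ, rfl⟩ := hpack.1 K hK
    obtain ⟨β', hβ', ψ, rfl⟩ := hpack.1 L hL
    have h1 := disjoint_fill hF₂ hF₃ (isConnected_interior_of_copy hβ' ψ).isPreconnected
      (volume_closedBall_lt_of_copy hβ' ψ) hβ φ h0.symm
    obtain ⟨β₁, hβ₁, φ₁, he⟩ := hcopy _ hK
    refine disjoint_fill hF₂ hF₃ (O := interior (F (move φ β) : Set ℍ)) ?_ ?_ hβ' ψ h1.symm
    · rw [he, coe_move, image_interior_isometry]
      refine IsPreconnected.image ?_ _ φ₁.continuous.continuousOn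
      rcases hβ₁ with rfl | rfl
      · exact isConnected_interior_octagon.isPreconnected
      · exact isConnected_interior_modTile.isPreconnected
    · exact (volume_closedBall_lt_of_copy hβ φ).trans_le (measure_mono (hintr _ hK))
  have hFinj : Q.InjOn F := by
    intro K hK L hL he
    by_contra hne
    obtain ⟨β, hβ, φ, hφ⟩ := hcopy K hK
    have h1 : Disjoint (interior (F K : Set ℍ)) (interior (F L : Set ℍ)) := hFd hK hL hne
    rw [← he, hφ, coe_move, image_interior_isometry] at h1
    exact ((interior_bodies_nonempty hβ).image φ).ne_empty (disjoint_self.1 h1)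
  have hFP : IsPacking {octBody, modBody} (F '' Q) := by
    refine ⟨?_, ?_⟩
    · rintro _ ⟨K, hK, rfl⟩
      exact hcopy K hK
    · rintro _ ⟨K, hK, rfl⟩ _ ⟨L, hL, rfl⟩ hne
      exact hFd hK hL fun he => hne (by rw [he])
  have hcov : covered (F '' Q) = ⋃ K ∈ Q, (F K : Set ℍ) := biUnion_image
  have hvolF : ∀ K ∈ Q, volume (F K : Set ℍ) = volume octagon := by
    intro K hK
    obtain ⟨β, hβ, φ, hφ⟩ := hcopy K hK
    rw [hφ, volume_move]
    rcases hβ with rfl | rfl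
    · rfl
    · exact volume_modTile
  have hvolP : ∀ K ∈ P', volume (F K : Set ℍ) = volume octagon := by
    intro K hK
    obtain ⟨γ, hγ, rfl⟩ := hP' hK
    rw [hF₁ γ hγ, volume_move]
    exact volume_modTile
  have hmain : ∑ K ∈ P'', volume (F K : Set ℍ) + volume (covered (F '' Q))ᶜ ≤
      ∑ K ∈ P', volume (F K : Set ℍ) := by
    rw [hcov]
    refine sum_volume_add_le (s := P) (f := fun K => (F K : Set ℍ)) ?_ hdis hFd ?_ ?_
    · refine eq_univ_of_forall fun z => ?_
      obtain ⟨γ, hγ, hz⟩ := isPrototile_modTile.cover z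
      refine mem_iUnion₂.2 ⟨move γ (holeBody h), ⟨γ, hγ, rfl⟩, ?_⟩
      rw [hF₁ γ hγ]
      exact hz
    · rintro _ ⟨γ, hγ, rfl⟩
      rw [hF₁ γ hγ, coe_move, image_interior_isometry, image_closure_isometry]
      exact congrArg _ closure_interior_modTile
    · intro K hK
      obtain ⟨β, hβ, φ, hφ⟩ := hcopy K (Or.inr hK)
      rw [hφ, coe_move, image_frontier_isometry, volume_image_isometry]
      rcases hβ with rfl | rfl
      · exact volume_frontier_octagon
      · exact volume_frontier_modTile
  rw [Finset.sum_congr rfl fun K hK => hvolF K (Or.inr hK), Finset.sum_congr rfl hvolP,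
    Finset.sum_const, Finset.sum_const, nsmul_eq_mul, nsmul_eq_mul] at hmain
  have hfin : (P'.card : ℝ≥0∞) * volume octagon ≠ ∞ :=
    ENNReal.mul_ne_top (ENNReal.natCast_ne_top _) volume_octagon_ne_top
  have hW : volume (covered (F '' Q))ᶜ ≠ ∞ := ne_top_of_le_ne_top hfin (le_add_self.trans hmain)
  -- Bodies kept from the periodic packing are holed, so all octagons of the new packing are among
  -- the finitely many new bodies.
  set J₀ := P''.filter fun K => ∃ θ : ℍ ≃ᵢ ℍ, K = move θ octBody with hJ₀
  have hJ₀Q : ∀ K ∈ J₀, K ∈ Q := fun K hK => Or.inr (Finset.mem_filter.1 hK).1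
  have hwaste := hκ (F '' Q) hFP (J₀.image F) ?_ ?_ ?_ hW
  · rw [Finset.card_image_of_injOn (hFinj.mono hJ₀Q)] at hwaste
    have hsum : ∑ K ∈ P'', volume (K : Set ℍ) = J₀.card * volume octagon +
        (P''.filter fun K => ¬∃ θ : ℍ ≃ᵢ ℍ, K = move θ octBody).card *
          volume (holeBody h : Set ℍ) := by
      rw [← Finset.sum_filter_add_sum_filter_not P'' fun K => ∃ θ : ℍ ≃ᵢ ℍ, K = move θ octBody]
      congr 1
      · rw [← nsmul_eq_mul, ← Finset.sum_const]
        refine Finset.sum_congr rfl fun K hK => ?_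
        obtain ⟨θ, rfl⟩ := (Finset.mem_filter.1 hK).2
        exact volume_move _ _
      · rw [← nsmul_eq_mul, ← Finset.sum_const]
        refine Finset.sum_congr rfl fun K hK => ?_
        obtain ⟨hKP, hKo⟩ := Finset.mem_filter.1 hK
        obtain ⟨β, hβ, φ, rfl⟩ := hpack.1 K (Or.inr hKP)
        rcases hβ with rfl | rfl
        · exact absurd ⟨φ, rfl⟩ hKo
        · exact volume_move _ _
    have hsum' : ∑ K ∈ P', volume (K : Set ℍ) = P'.card * volume (holeBody h : Set ℍ) := by
      rw [← nsmul_eq_mul, ← Finset.sum_const]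
      refine Finset.sum_congr rfl fun K hK => ?_
      obtain ⟨γ, -, rfl⟩ := hP' hK
      exact volume_move _ _
    have hcard := Finset.card_filter_add_card_filter_not (s := P'') fun K : NonemptyCompacts ℍ =>
      ∃ θ : ℍ ≃ᵢ ℍ, K = move θ octBody
    set n₁ := J₀.card with hn₁
    set n₂ := (P''.filter fun K => ¬∃ θ : ℍ ≃ᵢ ℍ, K = move θ octBody).card with hn₂
    have hHt : volume (holeBody h : Set ℍ) ≠ ∞ := (holeBody h).isCompact.measure_ne_top
    have hmulO : ∀ n : ℕ, (n : ℝ≥0∞) * volume octagon ≠ ∞ := fun n =>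
      ENNReal.mul_ne_top (ENNReal.natCast_ne_top _) volume_octagon_ne_top
    have hmulH : ∀ n : ℕ, (n : ℝ≥0∞) * volume (holeBody h : Set ℍ) ≠ ∞ := fun n =>
      ENNReal.mul_ne_top (ENNReal.natCast_ne_top _) hHt
    rw [hsum, hsum']
    rw [← ENNReal.toReal_le_toReal (ENNReal.add_ne_top.2 ⟨hmulO _, hmulH _⟩) (hmulH _),
      ENNReal.toReal_add (hmulO _) (hmulH _), ENNReal.toReal_mul, ENNReal.toReal_mul,
      ENNReal.toReal_mul, ENNReal.toReal_natCast, ENNReal.toReal_natCast, ENNReal.toReal_natCast]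
    rw [← ENNReal.toReal_le_toReal (ENNReal.add_ne_top.2 ⟨hmulO _, hW⟩) hfin,
      ENNReal.toReal_add (hmulO _) hW, ENNReal.toReal_mul, ENNReal.toReal_mul,
      ENNReal.toReal_natCast, ENNReal.toReal_natCast] at hmain
    simp only [← measureReal_def] at hmain ⊢
    rw [volume_real_holeBody]
    have hA : 0 < volume.real octagon :=
      ENNReal.toReal_pos volume_octagon_pos.ne' volume_octagon_ne_top
    have hδ : 2 * volume.real (Metric.closedBall c r) ≤ volume.real octagon := by
      have := ENNReal.toReal_mono volume_octagon_ne_top h.small.le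
      rwa [ENNReal.toReal_mul, ENNReal.toReal_ofNat] at this
    rw [← hcard, Nat.cast_add] at hmain
    have hn₁0 : (0 : ℝ) ≤ n₁ := Nat.cast_nonneg _
    have hδ0 : 0 ≤ volume.real (Metric.closedBall c r) := measureReal_nonneg
    generalize volume.real octagon = A at *
    generalize volume.real (Metric.closedBall c r) = δ at *
    generalize volume.real (covered (F '' Q))ᶜ = W at *
    generalize (P'.card : ℝ) = n' at *
    generalize (n₁ : ℝ) = a at *
    generalize (n₂ : ℝ) = b at *
    -- With hole area `δ`, it remains to show `a A + b (A - δ) ≤ n' (A - δ)`. Multiply `(a + b) A +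
    -- W ≤ n' A` by `A - δ`; since `W ≥ 2 δ a` and `A ≥ 2 δ`, the waste contributes at least `δ a
    -- A`.
    have h1 : 2 * δ * a ≤ W := (mul_le_mul_of_nonneg_right hr hn₁0).trans hwaste
    have h2 := mul_le_mul_of_nonneg_right hmain (by linarith : 0 ≤ A - δ)
    have h3 : 0 ≤ (W - 2 * δ * a) * (A - δ) := mul_nonneg (by linarith) (by linarith)
    have h4 : 0 ≤ δ * a * (A - 2 * δ) := mul_nonneg (mul_nonneg hδ0 hn₁0) (by linarith)
    refine le_of_mul_le_mul_right (a := A) ?_ hA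
    nlinarith
  · rw [Finset.coe_image]
    exact image_mono hJ₀Q
  · intro K hK
    obtain ⟨L, hL, rfl⟩ := Finset.mem_image.1 hK
    obtain ⟨θ, rfl⟩ := (Finset.mem_filter.1 hL).2
    exact ⟨θ, hF₃ θ⟩
  · rintro _ ⟨L, hL, rfl⟩ hLJ
    obtain ⟨β, hβ, φ, he⟩ := hpack.1 L hL
    rcases hβ with rfl | rfl
    · refine absurd (Finset.mem_image_of_mem F (Finset.mem_filter.2 ⟨?_, φ, he⟩)) hLJ
      rcases hL with hL | hL
      · obtain ⟨γ, -, hγ⟩ := hL.1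
        have := congrArg (fun K : NonemptyCompacts ℍ => volume (K : Set ℍ)) (he.symm.trans hγ)
        simp only [volume_move] at this
        exact absurd this.symm (volume_holeBody_lt h).ne
      · exact hL
    · obtain ⟨ψ, -, h2⟩ := hF₂ φ
      exact ⟨ψ, by rw [he, h2]⟩

/-! ### The topology of the space of packings -/

/-- The isometry given by a matrix. -/
def toIsom : SL(2, ℝ) →* (ℍ ≃ᵢ ℍ) where
  toFun g := IsometryEquiv.constSMul g
  map_one' := by ext z; simp
  map_mul' g h := by ext z; simp [mul_smul]

theorem toIsom_apply (g : SL(2, ℝ)) (z : ℍ) : toIsom g z = g • z := by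
  simp [toIsom]

theorem toIsom_inv_apply (g : SL(2, ℝ)) (z : ℍ) : (toIsom g)⁻¹ z = g⁻¹ • z := by
  rw [← map_inv, toIsom_apply]

theorem mem_orientedIsom_iff {φ : ℍ ≃ᵢ ℍ} : φ ∈ orientedIsom ↔ ∃ g, toIsom g = φ :=
  ⟨fun ⟨g, hg⟩ => ⟨g, IsometryEquiv.ext fun z => by rw [toIsom_apply, hg]⟩,
    fun ⟨g, hg⟩ => ⟨g, fun z => by rw [← hg, toIsom_apply]⟩⟩

theorem continuous_move_toIsom (K : NonemptyCompacts ℍ) :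
    Continuous fun g : SL(2, ℝ) => move (toIsom g) K := by
  have h := Continuous.nonemptyCompacts_map' (f := fun _ : SL(2, ℝ) => K)
    (g := fun (g : SL(2, ℝ)) (z : ℍ) => g • z) continuous_const continuous_smul
  convert h using 2 with g
  exact SetLike.coe_injective (image_congr fun z _ => toIsom_apply g z)

theorem continuous_move (φ : ℍ ≃ᵢ ℍ) : Continuous (move φ) := φ.continuous.nonemptyCompacts_map

section PackingSpaceTopology

variable {B : Set (NonemptyCompacts ℍ)}

theorem PackingSpace.act_mul (φ ψ : ℍ ≃ᵢ ℍ) (P : PackingSpace B) :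
    P.act (φ * ψ) = (P.act ψ).act φ :=
  Subtype.ext (by
    change move (φ * ψ) '' P.1 = move φ '' (move ψ '' P.1)
    simp only [image_image, move_mul])

theorem PackingSpace.act_one (P : PackingSpace B) : P.act 1 = P :=
  Subtype.ext (by
    change move 1 '' P.1 = P.1
    simp only [move_one, image_id'])

theorem isOpen_meets {U : Set (NonemptyCompacts ℍ)} (hU : IsOpen U) :
    IsOpen {P : PackingSpace B | (P.1 ∩ U).Nonempty} :=
  isOpen_generateFrom_of_mem (Or.inl ⟨U, hU, rfl⟩)

theorem isOpen_avoids {C : Set (NonemptyCompacts ℍ)} (hC : IsCompact C) :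
    IsOpen {P : PackingSpace B | P.1 ∩ C = ∅} :=
  isOpen_generateFrom_of_mem (Or.inr ⟨C, hC, rfl⟩)

theorem PackingSpace.continuous_act (φ : ℍ ≃ᵢ ℍ) :
    Continuous (PackingSpace.act φ : PackingSpace B → PackingSpace B) := by
  refine continuous_generateFrom_iff.2 ?_
  rintro _ (⟨U, hU, rfl⟩ | ⟨C, hC, rfl⟩)
  · convert isOpen_meets (B := B) (hU.preimage (continuous_move φ)) using 1
    ext P
    change (move φ '' P.1 ∩ U).Nonempty ↔ (P.1 ∩ move φ ⁻¹' U).Nonempty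
    rw [← image_inter_preimage, image_nonempty]
  · convert isOpen_avoids (B := B) (hC.image (continuous_move φ⁻¹)) using 1
    ext P
    have : move φ⁻¹ '' C = move φ ⁻¹' C := by
      refine congrFun (image_eq_preimage_of_inverse (fun K => ?_) (fun K => ?_)) C
      · rw [← move_mul, mul_inv_cancel, move_one]
      · rw [← move_mul, inv_mul_cancel, move_one]
    change move φ '' P.1 ∩ C = ∅ ↔ P.1 ∩ move φ⁻¹ '' C = ∅
    rw [this, ← image_inter_preimage, image_eq_empty]

/-- The action of an isometry is a homeomorphism. -/
def PackingSpace.actHomeo (φ : ℍ ≃ᵢ ℍ) : PackingSpace B ≃ₜ PackingSpace B where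
  toFun := PackingSpace.act φ
  invFun := PackingSpace.act φ⁻¹
  left_inv P := by rw [← PackingSpace.act_mul, inv_mul_cancel, PackingSpace.act_one]
  right_inv P := by rw [← PackingSpace.act_mul, mul_inv_cancel, PackingSpace.act_one]
  continuous_toFun := PackingSpace.continuous_act φ
  continuous_invFun := PackingSpace.continuous_act φ⁻¹

theorem exists_closedBall_of_isCompact {C : Set (NonemptyCompacts ℍ)} (hC : IsCompact C) :
    ∃ D, ∀ K ∈ C, (K : Set ℍ) ⊆ Metric.closedBall UpperHalfPlane.I D := by
  obtain ⟨D, hD⟩ := (NonemptyCompacts.isCompact_biUnion_coe_of_isCompact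
    hC).isBounded.subset_closedBall UpperHalfPlane.I
  exact ⟨D, fun K hK => (subset_biUnion_of_mem (u := fun K : NonemptyCompacts ℍ =>
    (K : Set ℍ)) hK).trans hD⟩

theorem PackingSpace.finite_subset (hB : B.Finite) (hintr : ∀ β ∈ B, (interior (β : Set ℍ)).Nonempty)
    (P : PackingSpace B) (z : ℍ) (D : ℝ) :
    {K ∈ P.1 | (K : Set ℍ) ⊆ Metric.closedBall z D}.Finite :=
  (IsPacking.finite_near hB hintr P.2.1 z D).subset fun K hK =>
    ⟨hK.1, by rw [inter_eq_self_of_subset_left hK.2]; exact K.nonempty⟩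

/-- Avoiding a compact set of bodies is an open condition on `g`, because for `g` near `g₀` only
finitely many bodies of `P` can be moved into that set. -/
theorem PackingSpace.continuous_act_toIsom (hB : B.Finite) (hintr : ∀ β ∈ B, (interior (β : Set ℍ)).Nonempty)
    (P : PackingSpace B) :
    Continuous fun g : SL(2, ℝ) => P.act (toIsom g) := by
  refine continuous_generateFrom_iff.2 ?_
  rintro _ (⟨U, hU, rfl⟩ | ⟨C, hC, rfl⟩)
  · have : (fun g : SL(2, ℝ) => P.act (toIsom g)) ⁻¹' {P | (P.1 ∩ U).Nonempty} =
        ⋃ K ∈ P.1, (fun g : SL(2, ℝ) => move (toIsom g) K) ⁻¹' U := by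
      ext g
      change (move (toIsom g) '' P.1 ∩ U).Nonempty ↔ _
      simp only [mem_iUnion, mem_preimage, exists_prop]
      constructor
      · rintro ⟨_, ⟨K, hK, rfl⟩, hU⟩
        exact ⟨K, hK, hU⟩
      · rintro ⟨K, hK, hU⟩
        exact ⟨_, ⟨K, hK, rfl⟩, hU⟩
    rw [this]
    exact isOpen_biUnion fun K _ => hU.preimage (continuous_move_toIsom K)
  · refine isOpen_iff_mem_nhds.2 fun g₀ hg₀ => ?_
    have hg₀ : move (toIsom g₀) '' P.1 ∩ C = ∅ := hg₀
    obtain ⟨D, hD⟩ := exists_closedBall_of_isCompact hC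
    set z₀ := (g₀⁻¹ • UpperHalfPlane.I : ℍ)
    have hfin := P.finite_subset hB hintr z₀ (D + 1)
    have hc : ∀ᶠ g : SL(2, ℝ) in 𝓝 g₀, dist (g⁻¹ • UpperHalfPlane.I) z₀ < 1 := by
      have : Continuous fun g : SL(2, ℝ) => dist (g⁻¹ • UpperHalfPlane.I) z₀ :=
        (continuous_inv.smul continuous_const).dist continuous_const
      exact this.tendsto g₀ |>.eventually (gt_mem_nhds (by rw [dist_self]; exact one_pos))
    have hK : ∀ᶠ g : SL(2, ℝ) in 𝓝 g₀,
        ∀ K ∈ {K ∈ P.1 | (K : Set ℍ) ⊆ Metric.closedBall z₀ (D + 1)}, move (toIsom g) K ∉ C := by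
      refine (eventually_all_finite hfin).2 fun K hK => ?_
      exact (continuous_move_toIsom K).tendsto g₀ |>.eventually (hC.isClosed.isOpen_compl.mem_nhds
        fun hKC => (hg₀.subset ⟨⟨K, hK.1, rfl⟩, hKC⟩ : _ ∈ (∅ : Set _)))
    filter_upwards [hc, hK] with g hg hgK
    refine eq_empty_of_forall_notMem ?_
    rintro _ ⟨⟨K, hKP, rfl⟩, hKC⟩
    refine hgK K ⟨hKP, fun z hz => ?_⟩ hKC
    have h1 := hD _ hKC ⟨z, hz, rfl⟩
    have h2 : dist (toIsom g z) UpperHalfPlane.I = dist z (g⁻¹ • UpperHalfPlane.I) := by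
      rw [toIsom_apply, ← dist_smul g z, smul_inv_smul]
    rw [Metric.mem_closedBall, h2] at h1
    rw [Metric.mem_closedBall]
    linarith [dist_triangle z (g⁻¹ • UpperHalfPlane.I) z₀]

/-- A body of one packing that is absent from the other has a compact neighbourhood free of the
other's bodies, by local finiteness; meeting its interior and avoiding it separate the two packings.
The property is used to make compact pieces of orbits measurable. -/
theorem t2Space_packingSpace (hB : B.Finite) (hintr : ∀ β ∈ B, (interior (β : Set ℍ)).Nonempty)
    : T2Space (PackingSpace B) := by
  have key : ∀ P Q : PackingSpace B, ∀ K ∈ P.1, K ∉ Q.1 →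
      ∃ u v : Set (PackingSpace B), IsOpen u ∧ IsOpen v ∧ P ∈ u ∧ Q ∈ v ∧ Disjoint u v := by
    intro P Q K hK hKQ
    obtain ⟨D, hD⟩ := K.isCompact.isBounded.subset_ball UpperHalfPlane.I
    have hfin := Q.finite_subset hB hintr UpperHalfPlane.I D
    have hV : IsOpen ({L : NonemptyCompacts ℍ | (L : Set ℍ) ⊆ Metric.ball UpperHalfPlane.I D} \
        {K ∈ Q.1 | (K : Set ℍ) ⊆ Metric.closedBall UpperHalfPlane.I D}) :=
      (NonemptyCompacts.isOpen_subsets_of_isOpen Metric.isOpen_ball).sdiff hfin.isClosed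
    obtain ⟨C, hC, hKC, hCV⟩ := exists_compact_subset hV ⟨hD, fun h => hKQ h.1⟩
    refine ⟨_, _, isOpen_meets (isOpen_interior (s := C)), isOpen_avoids hC, ⟨K, hK, hKC⟩, ?_, ?_⟩
    · refine eq_empty_of_forall_notMem fun L hL => ?_
      have := hCV hL.2
      exact this.2 ⟨hL.1, this.1.trans Metric.ball_subset_closedBall⟩
    · refine Set.disjoint_left.2 ?_
      rintro R ⟨L, hL, hLC⟩ hR
      exact (hR.subset ⟨hL, interior_subset hLC⟩ : L ∈ (∅ : Set _))
  refine ⟨fun P Q hne => ?_⟩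
  by_cases hsub : P.1 ⊆ Q.1
  · obtain ⟨K, hK, hKP⟩ := not_subset.1 fun h => hne (Subtype.ext (hsub.antisymm h))
    obtain ⟨u, v, hu, hv, hQ, hP, hd⟩ := key Q P K hK hKP
    exact ⟨v, u, hv, hu, hP, hQ, hd.symm⟩
  · obtain ⟨K, hK, hKQ⟩ := not_subset.1 hsub
    exact key P Q K hK hKQ

/-- The bodies that contain `p` have bounded diameter, so they range over a compact set. Leaving `p`
uncovered means avoiding this set, a subbasic open condition. -/
theorem isClosed_setOf_covers (hB : B.Finite)
    (p : ℍ) : IsClosed {P : PackingSpace B | p ∈ covered P.1} := by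
  obtain ⟨D, hD⟩ : ∃ D, ∀ β ∈ B, Metric.diam (β : Set ℍ) ≤ D := by
    obtain ⟨D, hD⟩ := (hB.image fun β : NonemptyCompacts ℍ => Metric.diam (β : Set ℍ)).bddAbove
    exact ⟨D, fun β hβ => hD ⟨β, hβ, rfl⟩⟩
  have hC : IsCompact ({K : NonemptyCompacts ℍ | (K : Set ℍ) ⊆ Metric.closedBall p D} ∩
      {K | ((K : Set ℍ) ∩ {p}).Nonempty}) :=
    (NonemptyCompacts.isCompact_subsets_of_isCompact (isCompact_closedBall p D)).inter_right
      (NonemptyCompacts.isClosed_inter_nonempty_of_isClosed isClosed_singleton)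
  rw [← isOpen_compl_iff]
  convert isOpen_avoids (B := B) hC using 1
  ext P
  change p ∉ covered P.1 ↔ _
  rw [mem_ofPred_eq, ← not_nonempty_iff_eq_empty, not_iff_not]
  constructor
  · intro hp
    obtain ⟨K, hK, hpK⟩ := mem_iUnion₂.1 hp
    refine ⟨K, hK, fun z hz => ?_, p, hpK, rfl⟩
    obtain ⟨β, hβ, φ, rfl⟩ := P.2.1.1 K hK
    have h1 := Metric.dist_le_diam_of_mem (move φ β).isCompact.isBounded hz hpK
    rw [coe_move, φ.isometry.diam_image] at h1
    exact h1.trans (hD β hβ)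
  · rintro ⟨K, hK, -, q, hqK, rfl⟩
    exact mem_iUnion₂.2 ⟨K, hK, hqK⟩

end PackingSpaceTopology

/-! ### Haar measure on the group of Möbius transformations -/

instance locallyCompactSpace_sl : LocallyCompactSpace SL(2, ℝ) :=
  have : LocallyCompactSpace (Matrix (Fin 2) (Fin 2) ℝ) :=
    inferInstanceAs (LocallyCompactSpace (Fin 2 → Fin 2 → ℝ))
  Matrix.SpecialLinearGroup.isClosedEmbedding_val.locallyCompactSpace

instance secondCountableTopology_sl : SecondCountableTopology SL(2, ℝ) :=
  have : SecondCountableTopology (Matrix (Fin 2) (Fin 2) ℝ) :=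
    inferInstanceAs (SecondCountableTopology (Fin 2 → Fin 2 → ℝ))
  Matrix.SpecialLinearGroup.isClosedEmbedding_val.isEmbedding.secondCountableTopology

instance measurableSpace_sl : MeasurableSpace SL(2, ℝ) := borel _

instance borelSpace_sl : BorelSpace SL(2, ℝ) := ⟨rfl⟩

/-- Haar measure on `SL(2, ℝ)`. -/
abbrev haarSL : Measure SL(2, ℝ) := Measure.haar

/-- The modular character takes values in a commutative group, while `SL(2, ℝ)` is its own
commutator subgroup. -/
theorem modularCharacterFun_sl (g : SL(2, ℝ)) : Measure.modularCharacterFun g = 1 := by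
  have h1 := Abelianization.commutator_subset_ker
    (MonoidHom.toHomUnits (Measure.modularCharacter (G := SL(2, ℝ))))
  rw [Matrix.SL2.commutator_eq_top (a := (2 : ℝ)) (by norm_num)
    (by norm_num)] at h1
  have h2 : (MonoidHom.toHomUnits (Measure.modularCharacter (G := SL(2, ℝ)))) g = 1 :=
    h1 (Subgroup.mem_top g)
  exact congrArg Units.val h2

instance isMulRightInvariant_haarSL : haarSL.IsMulRightInvariant :=
  ⟨fun g => by
    rw [Measure.map_right_mul_eq_modularCharacterFun_smul, modularCharacterFun_sl, one_smul]⟩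

theorem sl_neg_smul (g : SL(2, ℝ)) (z : ℍ) : -g • z = g • z := by
  ext1
  rw [coe_specialLinearGroup_apply, coe_specialLinearGroup_apply]
  simp only [Matrix.SpecialLinearGroup.coe_neg, Matrix.neg_apply, map_neg, Complex.ofReal_neg,
    neg_mul]
  rw [← neg_add, ← neg_add, neg_div_neg_eq]

theorem toIsom_neg (g : SL(2, ℝ)) : toIsom (-g) = toIsom g :=
  IsometryEquiv.ext fun z => by rw [toIsom_apply, toIsom_apply, sl_neg_smul]

theorem eq_one_or_neg_of_toIsom {g : SL(2, ℝ)} (h : toIsom g = 1) : g = 1 ∨ g = -1 := by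
  have hfix : ∀ z : ℍ, (g 0 0 : ℂ) * z + g 0 1 = z * (g 1 0 * z + g 1 1) := by
    intro z
    have h1 : g • z = z := by rw [← toIsom_apply, h]; rfl
    have h2 := congrArg UpperHalfPlane.coe h1
    rw [coe_specialLinearGroup_apply] at h2
    exact (div_eq_iff (by simpa [denom] using denom_ne_zero (g : GL (Fin 2) ℝ) z)).1 h2
  have e1 := hfix UpperHalfPlane.I
  have e2 := hfix ⟨2 * Complex.I, by simp⟩
  have hdet := g.det_coe
  rw [Matrix.det_fin_two] at hdet
  simp only [UpperHalfPlane.coe_I, Complex.ext_iff] at e1 e2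
  simp at e1 e2
  have hc : g 1 0 = 0 := by linarith [e1.1, e2.1]
  have hb : g 0 1 = 0 := by linarith [e1.1]
  rw [hb, hc, e1.2] at hdet
  have hd : (g 1 1 - 1) * (g 1 1 + 1) = 0 := by linarith
  rcases mul_eq_zero.1 hd with hd | hd
  · left
    ext i j
    fin_cases i <;> fin_cases j <;> simp [hb, hc, e1.2] <;> linarith
  · right
    ext i j
    fin_cases i <;> fin_cases j <;> simp [hb, hc, e1.2] <;> linarith

/-- The pushforward of Haar measure under the inverse orbit map is proportional to area. -/
theorem volume_mul_haarSL {A B : Set ℍ} (hA : MeasurableSet A) (hB : MeasurableSet B) :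
    volume A * haarSL {g | g⁻¹ • UpperHalfPlane.I ∈ B} =
      volume B * haarSL {g | g • UpperHalfPlane.I ∈ A} := by
  have ha : Measurable fun p : ℍ × SL(2, ℝ) => p.2 • p.1 :=
    (continuous_snd.smul continuous_fst).measurable
  have hb : Measurable fun p : ℍ × SL(2, ℝ) => p.2⁻¹ • p.1 :=
    (continuous_snd.inv.smul continuous_fst).measurable
  have hS : MeasurableSet {p : ℍ × SL(2, ℝ) | p.1 ∈ A ∧ p.2⁻¹ • p.1 ∈ B} :=
    (measurable_fst hA).inter (hb hB)
  have hT : MeasurableSet {p : ℍ × SL(2, ℝ) | p.1 ∈ B ∧ p.2 • p.1 ∈ A} :=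
    (measurable_fst hB).inter (ha hA)
  have key : ∀ (C : Set ℍ) (D : ℍ → Set SL(2, ℝ)), MeasurableSet C →
      (∀ z, haarSL (D z) = haarSL (D UpperHalfPlane.I)) →
      ∫⁻ z, haarSL {g | z ∈ C ∧ g ∈ D z} = volume C * haarSL (D UpperHalfPlane.I) := by
    intro C D hC hD
    have : (fun z => haarSL {g | z ∈ C ∧ g ∈ D z}) =
        C.indicator fun _ => haarSL (D UpperHalfPlane.I) := by
      ext z
      by_cases hz : z ∈ C
      · rw [indicator_of_mem hz, ← hD z]
        simp [hz]
      · rw [indicator_of_notMem hz]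
        simp [hz]
    rw [this, lintegral_indicator_const hC, mul_comm]
  have e1 : (volume.prod haarSL) {p : ℍ × SL(2, ℝ) | p.1 ∈ A ∧ p.2⁻¹ • p.1 ∈ B} =
      volume A * haarSL {g | g⁻¹ • UpperHalfPlane.I ∈ B} := by
    rw [Measure.prod_apply hS]
    refine key A (fun z => {g | g⁻¹ • z ∈ B}) hA fun z => ?_
    obtain ⟨h, rfl⟩ := MulAction.exists_smul_eq SL(2, ℝ) UpperHalfPlane.I z
    rw [← measure_preimage_mul haarSL h⁻¹ {g | g⁻¹ • UpperHalfPlane.I ∈ B}]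
    congr 1
    ext g
    simp [mul_smul]
  have e2 : (volume.prod haarSL) {p : ℍ × SL(2, ℝ) | p.1 ∈ B ∧ p.2 • p.1 ∈ A} =
      volume B * haarSL {g | g • UpperHalfPlane.I ∈ A} := by
    rw [Measure.prod_apply hT]
    refine key B (fun z => {g | g • z ∈ A}) hB fun z => ?_
    obtain ⟨h, rfl⟩ := MulAction.exists_smul_eq SL(2, ℝ) UpperHalfPlane.I z
    rw [← measure_preimage_mul_right haarSL h {g | g • UpperHalfPlane.I ∈ A}]
    congr 1
    ext g
    simp [mul_smul]
  rw [← e1, ← e2, Measure.prod_apply_symm hS, Measure.prod_apply_symm hT]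
  -- Both sides are the product measure of a set of pairs. For fixed `g` the two slices are
  -- exchanged by `g`, which preserves area; the other order of integration gives the stated
  -- products.
  refine lintegral_congr fun g => ?_
  symm
  rw [← volume_image_isometry (toIsom g) ((fun x => (x, g)) ⁻¹' _)]
  congr 1
  ext z
  rw [mem_image_isometry, toIsom_inv_apply]
  simp [and_comm]

/-! ### A fundamental domain for the surface group in the matrix group -/

/-- Half of `SL(2, ℝ)`: it contains one of each pair `g`, `-g`. -/
def halfSL : Set SL(2, ℝ) := {g | 0 < g 1 0 ∨ g 1 0 = 0 ∧ 0 < g 1 1}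

theorem neg_mem_halfSL {g : SL(2, ℝ)} : -g ∈ halfSL ↔ g ∉ halfSL := by
  have hdet := g.det_coe
  rw [Matrix.det_fin_two] at hdet
  simp only [halfSL, mem_ofPred_eq, Matrix.SpecialLinearGroup.coe_neg, Matrix.neg_apply,
    Left.neg_pos_iff, neg_eq_zero, not_or, not_and, not_lt]
  constructor
  · rintro (h | ⟨h, h'⟩)
    · exact ⟨h.le, fun h0 => absurd h0 h.ne⟩
    · exact ⟨h.le, fun _ => h'.le⟩
  · rintro ⟨h, h'⟩
    rcases h.lt_or_eq with h | h
    · exact Or.inl h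
    · refine Or.inr ⟨h, lt_of_le_of_ne (h' h) fun h0 => ?_⟩
      rw [h, h0] at hdet
      simp at hdet

theorem measurableSet_halfSL : MeasurableSet halfSL := by
  have h : ∀ i j, Measurable fun g : SL(2, ℝ) => g i j := fun i j =>
    ((continuous_apply j).comp (Matrix.SpecialLinearGroup.continuous_apply id continuous_id
      i)).measurable
  exact (measurableSet_lt measurable_const (h 1 0)).union
    ((measurableSet_eq_fun (h 1 0) measurable_const).inter
      (measurableSet_lt measurable_const (h 1 1)))

theorem haarSL_eq_two_mul {S : Set SL(2, ℝ)} (hS : ∀ g, -g ∈ S ↔ g ∈ S) :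
    haarSL S = 2 * haarSL (S ∩ halfSL) := by
  rw [← measure_inter_add_sdiff S measurableSet_halfSL, two_mul]
  congr 1
  rw [← measure_preimage_mul haarSL (-1) (S ∩ halfSL)]
  congr 1
  ext g
  simp only [mem_preimage, mem_inter_iff, neg_mul, one_mul, hS, neg_mem_halfSL, Set.mem_sdiff]

/-- The matrices that represent elements of the surface group. -/
def surfGroupSL : Subgroup SL(2, ℝ) := surfGroup.comap toIsom

theorem countable_surfGroupSL : Countable surfGroupSL := by
  have := countable_surfGroup
  have h : ((surfGroupSL : Subgroup SL(2, ℝ)) : Set SL(2, ℝ)) =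
      ⋃ γ ∈ (surfGroup : Set (ℍ ≃ᵢ ℍ)), {g | toIsom g = γ} := by
    ext g
    simp [surfGroupSL]
  refine Set.Countable.to_subtype ?_
  rw [h]
  refine Set.Countable.biUnion (Set.to_countable _) fun γ _ => Set.Finite.countable ?_
  rcases {g | toIsom g = γ}.eq_empty_or_nonempty with h0 | ⟨g₀, hg₀⟩
  · rw [h0]; exact finite_empty
  refine (toFinite {g₀, -g₀}).subset fun g hg => ?_
  have hg : toIsom g = γ := hg
  have hg₀ : toIsom g₀ = γ := hg₀
  have h1 : toIsom (g₀⁻¹ * g) = 1 := by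
    rw [map_mul, map_inv, hg, hg₀, inv_mul_cancel]
  rcases eq_one_or_neg_of_toIsom h1 with h2 | h2
  · exact Or.inl (inv_mul_eq_one.1 h2).symm
  · right
    rw [mem_singleton_iff, inv_mul_eq_iff_eq_mul.1 h2, mul_neg, mul_one]

theorem countable_surfGroupSL_op : Countable surfGroupSL.op :=
  have := countable_surfGroupSL
  Function.Injective.countable
    (f := fun γ : surfGroupSL.op => (⟨MulOpposite.unop (γ : SL(2, ℝ)ᵐᵒᵖ), γ.2⟩ : surfGroupSL))
    fun _ _ h => Subtype.ext (MulOpposite.unop_injective (congrArg Subtype.val h))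

/-- A fundamental domain for right translations by `surfGroupSL`. -/
def domainSL : Set SL(2, ℝ) := {g | g⁻¹ • UpperHalfPlane.I ∈ octagon} ∩ halfSL

theorem measurable_inv_smul_I : Measurable fun g : SL(2, ℝ) => g⁻¹ • UpperHalfPlane.I :=
  (continuous_inv.smul continuous_const).measurable

theorem exists_mul_mem_surfGroupSL (g : SL(2, ℝ)) :
    ∃ d ∈ surfGroupSL, (g * d)⁻¹ • UpperHalfPlane.I ∈ octagon := by
  obtain ⟨δ, hδ, hz⟩ := isPrototile_octagon.cover (g⁻¹ • UpperHalfPlane.I)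
  obtain ⟨d, rfl⟩ := mem_orientedIsom_iff.1 (surfGroup_le_orientedIsom hδ)
  refine ⟨d, hδ, ?_⟩
  rwa [mem_image_isometry, toIsom_inv_apply, ← mul_smul, ← mul_inv_rev] at hz

-- The matrix `-1` acts trivially on the plane, and `halfSL` removes this ambiguity. Otherwise the
-- domain is the preimage of the octagon under `g ↦ g⁻¹ • I`; distinct octagons overlap in a null
-- set, and `volume_mul_haarSL` carries this to Haar measure.
open scoped Pointwise in
theorem isFundamentalDomain_domainSL : IsFundamentalDomain surfGroupSL.op domainSL haarSL := by
  have := countable_surfGroup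
  refine IsFundamentalDomain.mk'' ((measurable_inv_smul_I isCompact_octagon.measurableSet).inter
    measurableSet_halfSL).nullMeasurableSet (Eventually.of_forall fun g => ?_) (fun γ hγ => ?_)
    fun γ => (measurePreserving_mul_right haarSL (MulOpposite.unop
      (γ : SL(2, ℝ)ᵐᵒᵖ))).quasiMeasurePreserving
  · obtain ⟨d, hd, hgd⟩ := exists_mul_mem_surfGroupSL g
    by_cases hH : g * d ∈ halfSL
    · exact ⟨⟨MulOpposite.op d, hd⟩, hgd, hH⟩
    · have hd' : -d ∈ surfGroupSL := by
        change toIsom (-d) ∈ surfGroup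
        rwa [toIsom_neg]
      refine ⟨⟨MulOpposite.op (-d), hd'⟩, ?_, ?_⟩
      · change (g * -d)⁻¹ • UpperHalfPlane.I ∈ octagon
        rwa [mul_neg, ← toIsom_apply, map_inv, toIsom_neg, ← map_inv, toIsom_apply]
      · change g * -d ∈ halfSL
        rwa [mul_neg, neg_mem_halfSL]
  · obtain ⟨γ, hγΓ⟩ := γ
    set d := MulOpposite.unop γ with hd
    have hdΓ : toIsom d ∈ surfGroup := hγΓ
    by_cases h1 : toIsom d = 1
    · refine Disjoint.aedisjoint (Set.disjoint_left.2 ?_)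
      rintro _ ⟨g, hg, rfl⟩ hg'
      rcases eq_one_or_neg_of_toIsom h1 with h2 | h2
      · exact hγ (Subtype.ext (MulOpposite.unop_injective h2))
      · have : g * d ∈ halfSL := hg'.2
        rw [h2, mul_neg, mul_one, neg_mem_halfSL] at this
        exact this hg.2
    · have hnull : volume (octagon ∩ (toIsom d⁻¹) '' octagon) = 0 := by
        have h2 := isFundamentalDomain_octagon.aedisjoint (i := (1 : surfGroup))
          (j := ⟨toIsom d⁻¹, by rw [map_inv]; exact inv_mem hdΓ⟩) fun h => h1 (inv_eq_one.1
            ((map_inv toIsom d).symm.trans (congrArg Subtype.val h).symm))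
        have h3 : volume (((1 : surfGroup) • octagon) ∩ ((toIsom d⁻¹) '' octagon)) = 0 := h2
        rwa [one_smul] at h3
      have hm : MeasurableSet (octagon ∩ (toIsom d⁻¹) '' octagon) :=
        isCompact_octagon.measurableSet.inter
          (isCompact_octagon.image (toIsom d⁻¹).continuous).measurableSet
      have h4 := volume_mul_haarSL isCompact_octagon.measurableSet hm
      rw [hnull, zero_mul, mul_eq_zero] at h4
      refine measure_mono_null ?_ (h4.resolve_left volume_octagon_pos.ne')
      rintro _ ⟨⟨g, hg, rfl⟩, hg'⟩
      refine ⟨hg'.1, mem_image_isometry.2 ?_⟩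
      change (toIsom d⁻¹)⁻¹ ((g * d)⁻¹ • UpperHalfPlane.I) ∈ octagon
      rw [toIsom_inv_apply, inv_inv, ← mul_smul, mul_inv_rev, mul_inv_cancel_left]
      exact hg.1

theorem isCompact_inv_smul_mem : IsCompact {g : SL(2, ℝ) | g⁻¹ • UpperHalfPlane.I ∈ octagon} :=
  (Homeomorph.inv SL(2, ℝ)).isCompact_preimage.2
    (isProperMap_smul_I.isCompact_preimage isCompact_octagon)

theorem haarSL_domainSL_ne_top : haarSL domainSL ≠ ∞ :=
  ne_top_of_le_ne_top isCompact_inv_smul_mem.measure_ne_top (measure_mono inter_subset_left)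

theorem haarSL_domainSL_ne_zero : haarSL domainSL ≠ 0 := by
  have := countable_surfGroupSL_op
  exact isFundamentalDomain_domainSL.measure_ne_zero (NeZero.ne haarSL)

/-- In the domain with normalised Haar measure, the point `g⁻¹ • I` is distributed like a uniformly
random point of the octagon. This links average density with area. -/
theorem haarSL_inter_domainSL {S : Set ℍ} (hS : MeasurableSet S) :
    haarSL ({g | g⁻¹ • UpperHalfPlane.I ∈ S} ∩ domainSL) * volume octagon =
      volume (octagon ∩ S) * haarSL domainSL := by
  have hneg : ∀ (T : Set ℍ) (g : SL(2, ℝ)), -g ∈ {g : SL(2, ℝ) | g⁻¹ • UpperHalfPlane.I ∈ T} ↔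
      g ∈ {g : SL(2, ℝ) | g⁻¹ • UpperHalfPlane.I ∈ T} := fun T g => by
    rw [mem_ofPred_eq, mem_ofPred_eq, ← toIsom_inv_apply, toIsom_neg, toIsom_inv_apply]
  have hO := isCompact_octagon.measurableSet
  have h1 := volume_mul_haarSL hO (hO.inter hS)
  have h2 := volume_mul_haarSL hO hO
  rw [ENNReal.mul_right_inj volume_octagon_pos.ne' volume_octagon_ne_top] at h2
  rw [← h2, haarSL_eq_two_mul (hneg _), haarSL_eq_two_mul (hneg octagon), mul_left_comm,
    mul_left_comm (volume (octagon ∩ S)),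
    ENNReal.mul_right_inj two_ne_zero ENNReal.ofNat_ne_top] at h1
  rw [mul_comm (haarSL _) (volume octagon), domainSL, ← h1, ← inter_assoc]
  congr 3
  ext g
  exact and_comm

/-! ### The ergodic measure carried by the orbit of a periodic packing -/

section OrbitMeasure

variable {B : Set (NonemptyCompacts ℍ)}

theorem mem_covered_act {φ : ℍ ≃ᵢ ℍ} {P : PackingSpace B} {z : ℍ} :
    z ∈ covered (P.act φ).1 ↔ φ⁻¹ z ∈ covered P.1 := by
  constructor
  · intro h
    obtain ⟨_, ⟨K, hK, rfl⟩, hz⟩ := mem_iUnion₂.1 h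
    exact mem_iUnion₂.2 ⟨K, hK, mem_image_isometry.1 hz⟩
  · intro h
    obtain ⟨K, hK, hz⟩ := mem_iUnion₂.1 h
    exact mem_iUnion₂.2 ⟨_, ⟨K, hK, rfl⟩, mem_image_isometry.2 hz⟩

/-- The image of Haar measure on the orbit of a packing. -/
def orbitMeasure (X : PackingSpace B) : Measure (PackingSpace B) :=
  (haarSL domainSL)⁻¹ • (haarSL.restrict domainSL).map fun g => X.act (toIsom g)

variable {X : PackingSpace B}

theorem orbitMeasure_apply (hB : B.Finite) (hintr : ∀ β ∈ B, (interior (β : Set ℍ)).Nonempty)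
    {E : Set (PackingSpace B)} (hE : MeasurableSet E) :
    orbitMeasure X E =
      (haarSL domainSL)⁻¹ * haarSL ((fun g => X.act (toIsom g)) ⁻¹' E ∩ domainSL) := by
  have hπ := (X.continuous_act_toIsom hB hintr).measurable
  rw [orbitMeasure, Measure.smul_apply, Measure.map_apply hπ hE, Measure.restrict_apply (hπ hE),
    smul_eq_mul]

theorem orbitMeasure_eq_zero_iff (hB : B.Finite) (hintr : ∀ β ∈ B, (interior (β : Set ℍ)).Nonempty)
    {E : Set (PackingSpace B)} (hE : MeasurableSet E) :
    orbitMeasure X E = 0 ↔ haarSL ((fun g => X.act (toIsom g)) ⁻¹' E ∩ domainSL) = 0 := by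
  rw [orbitMeasure_apply hB hintr hE, mul_eq_zero,
    or_iff_right (ENNReal.inv_ne_zero.2 haarSL_domainSL_ne_top)]

theorem preimage_smul_act (hX : ∀ γ ∈ surfGroup, X.act γ = X)
    (E : Set (PackingSpace B)) (γ : surfGroupSL.op) :
    (fun x => γ • x) ⁻¹' ((fun g => X.act (toIsom g)) ⁻¹' E) =
      (fun g => X.act (toIsom g)) ⁻¹' E := by
  ext g
  change X.act (toIsom (g * MulOpposite.unop (γ : SL(2, ℝ)ᵐᵒᵖ))) ∈ E ↔ X.act (toIsom g) ∈ E
  rw [map_mul, PackingSpace.act_mul, hX _ γ.2]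

-- A left translate of the domain is again a fundamental domain for the right action. Sets of
-- matrices that are pulled back from the orbit are invariant under the right action, so they have
-- the same measure in both domains.
open scoped Pointwise in
theorem orbitMeasure_mem_invariantMeasures (hB : B.Finite) (hintr : ∀ β ∈ B, (interior (β : Set ℍ)).Nonempty)
    (hX : ∀ γ ∈ surfGroup, X.act γ = X)
    : orbitMeasure X ∈ invariantMeasures B := by
  have := countable_surfGroupSL_op
  refine ⟨⟨?_⟩, fun φ hφ E hE => ?_⟩
  · rw [orbitMeasure_apply hB hintr MeasurableSet.univ, preimage_univ, univ_inter]
    exact ENNReal.inv_mul_cancel haarSL_domainSL_ne_zero haarSL_domainSL_ne_top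
  · obtain ⟨h, rfl⟩ := mem_orientedIsom_iff.1 hφ
    have hE' : MeasurableSet (PackingSpace.act (toIsom h) '' E) :=
      (PackingSpace.actHomeo (B := B) (toIsom h)).measurableEmbedding.measurableSet_image.2 hE
    rw [orbitMeasure_apply hB hintr hE, orbitMeasure_apply hB hintr hE']
    congr 1
    have hm := (X.continuous_act_toIsom hB hintr).measurable hE
    have e : (fun g => X.act (toIsom g)) ⁻¹' (PackingSpace.act (toIsom h) '' E) =
        h • ((fun g => X.act (toIsom g)) ⁻¹' E) := by
      ext g
      rw [Set.mem_smul_set_iff_inv_smul_mem]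
      change X.act (toIsom g) ∈ PackingSpace.actHomeo (toIsom h) '' E ↔
        X.act (toIsom (h⁻¹ * g)) ∈ E
      rw [Homeomorph.image_eq_preimage_symm, mem_preimage, map_mul, PackingSpace.act_mul, map_inv]
      rfl
    rw [e, ← measure_smul haarSL h⁻¹ (h • _ ∩ domainSL), Set.smul_set_inter, inv_smul_smul]
    exact (isFundamentalDomain_domainSL.smul_of_comm h⁻¹).measure_set_eq
      isFundamentalDomain_domainSL hm (preimage_smul_act hX E)

/-- The image of a compact set containing the domain is compact, hence closed and measurable, and
lies in the orbit. This avoids the question whether the whole orbit is measurable. -/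
theorem orbitMeasure_compl_orbit (hB : B.Finite) (hintr : ∀ β ∈ B, (interior (β : Set ℍ)).Nonempty)
    : orbitMeasure X X.orbitᶜ = 0 := by
  have := t2Space_packingSpace hB hintr
  have hc := isCompact_inv_smul_mem.image (X.continuous_act_toIsom hB hintr)
  refine measure_mono_null (compl_subset_compl.2 ?_)
    ((orbitMeasure_eq_zero_iff hB hintr hc.measurableSet.compl).2 ?_)
  · rintro _ ⟨g, -, rfl⟩
    exact ⟨toIsom g, mem_orientedIsom_iff.2 ⟨g, rfl⟩, rfl⟩
  · exact measure_mono_null (fun g hg => hg.1 ⟨g, hg.2.1, rfl⟩) measure_empty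

/-- A component `ν` of a convex decomposition has an invariant density with respect to `μ`. Pulled
back to the group, the density is almost everywhere unchanged by each left translation, hence almost
everywhere constant, and both measures have total mass one. -/
theorem orbitMeasure_mem_ergodicMeasures (hB : B.Finite) (hintr : ∀ β ∈ B, (interior (β : Set ℍ)).Nonempty)
    (hX : ∀ γ ∈ surfGroup, X.act γ = X)
    : orbitMeasure X ∈ ergodicMeasures B := by
  have := countable_surfGroupSL_op
  have hμ := orbitMeasure_mem_invariantMeasures hB hintr hX
  have hπ := (X.continuous_act_toIsom hB hintr).measurable
  refine ⟨hμ, fun ν hν ν₂ _ ⟨a, b, ha, _, _, hab⟩ => ?_⟩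
  set μ := orbitMeasure X with hμdef
  have hμp : IsProbabilityMeasure μ := hμ.1
  have hνp : IsProbabilityMeasure ν := hν.1
  have hac : ν ≪ μ := Measure.AbsolutelyContinuous.mk fun E _ hE => by
    rw [← hab, Measure.add_apply, add_eq_zero, Measure.smul_apply] at hE
    have h1 := hE.1
    rw [ENNReal.smul_def, smul_eq_mul, mul_eq_zero] at h1
    exact h1.resolve_left (ENNReal.coe_ne_zero.2 ha.ne')
  set f := ν.rnDeriv μ with hf
  have hfm : Measurable f := Measure.measurable_rnDeriv ν μ
  have hfν : μ.withDensity f = ν := Measure.withDensity_rnDeriv_eq ν μ hac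
  have himg : ∀ (h : SL(2, ℝ)) (E : Set (PackingSpace B)), PackingSpace.act (toIsom h) '' E =
      PackingSpace.act (toIsom h)⁻¹ ⁻¹' E := fun h E =>
    (PackingSpace.actHomeo (B := B) (toIsom h)).image_eq_preimage_symm E
  have hmp : ∀ h : SL(2, ℝ), MeasurePreserving (PackingSpace.act (B := B) (toIsom h)) μ μ := by
    intro h
    refine ⟨(PackingSpace.continuous_act _).measurable, Measure.ext fun E hE => ?_⟩
    rw [Measure.map_apply (PackingSpace.continuous_act _).measurable hE]
    have := hμ.2 (toIsom h⁻¹) (mem_orientedIsom_iff.2 ⟨_, rfl⟩) E hE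
    rwa [himg, map_inv, inv_inv] at this
  have hinv : ∀ h : SL(2, ℝ), ∀ᵐ x ∂μ, f (PackingSpace.act (toIsom h) x) = f x := by
    intro h
    have hact := (PackingSpace.continuous_act (B := B) (toIsom h)).measurable
    refine ae_eq_of_forall_setLIntegral_eq_of_sigmaFinite (hfm.comp hact) hfm fun E hE _ => ?_
    have hE' : MeasurableSet (PackingSpace.act (toIsom h) '' E) :=
      (PackingSpace.actHomeo (B := B) (toIsom h)).measurableEmbedding.measurableSet_image.2 hE
    have h1 := (hmp h).setLIntegral_comp_preimage hE' hfm
    have hinj : Function.Injective (PackingSpace.act (B := B) (toIsom h)) :=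
      (PackingSpace.actHomeo (B := B) (toIsom h)).injective
    rw [preimage_image_eq _ hinj] at h1
    refine h1.trans ?_
    rw [← withDensity_apply f hE', ← withDensity_apply f hE, hfν]
    exact hν.2 _ (mem_orientedIsom_iff.2 ⟨h, rfl⟩) E hE
  set F : SL(2, ℝ) → ℝ≥0∞ := fun g => f (X.act (toIsom g)) with hF
  have hFm : Measurable F := hfm.comp hπ
  have hFinv : ∀ h : SL(2, ℝ), ∀ᵐ g ∂haarSL, F (h * g) = F g := by
    intro h
    set N : Set (PackingSpace B) := {x | ¬ f (PackingSpace.act (toIsom h) x) = f x} with hN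
    have hNm : MeasurableSet N := (measurableSet_eq_fun
      (hfm.comp (PackingSpace.continuous_act _).measurable) hfm).compl
    have h0 := (orbitMeasure_eq_zero_iff hB hintr hNm).1 (ae_iff.1 (hinv h))
    -- The exceptional set is null in the domain and invariant under the right action, so it is null
    -- in the whole group.
    have h1 := isFundamentalDomain_domainSL.measure_zero_of_invariant _ (fun γ => ?_) h0
    · rw [ae_iff]
      refine measure_mono_null (fun g hg => ?_) h1
      change ¬ f (PackingSpace.act (toIsom h) (X.act (toIsom g))) = f (X.act (toIsom g))
      rw [← PackingSpace.act_mul, ← map_mul]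
      exact hg
    · rw [← Set.preimage_smul_inv]
      exact preimage_smul_act hX N γ⁻¹
  -- Fubini exchanges the quantifiers: some single `g₀` satisfies `F (h g₀) = F g₀` for almost all
  -- `h`, and right invariance of Haar measure makes `h g₀` an almost arbitrary element.
  have hFinv' : ∀ᵐ g ∂haarSL, ∀ᵐ h ∂haarSL, F (h * g) = F g :=
    (Measure.ae_ae_comm (p := fun h g => F (h * g) = F g) (measurableSet_eq_fun
      (hFm.comp measurable_mul) (hFm.comp measurable_snd))).1 (Eventually.of_forall hFinv)
  obtain ⟨g₀, hg₀⟩ := hFinv'.exists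
  have hconst : ∀ᵐ g ∂haarSL, F g = F g₀ := by
    have := (measurePreserving_mul_right haarSL g₀⁻¹).quasiMeasurePreserving.ae hg₀
    filter_upwards [this] with g hg
    rwa [inv_mul_cancel_right] at hg
  have hfc : ∀ᵐ x ∂μ, f x = F g₀ := by
    refine ae_iff.2 ((orbitMeasure_eq_zero_iff hB hintr
      (measurableSet_eq_fun hfm measurable_const).compl).2 ?_)
    exact measure_mono_null inter_subset_left (ae_iff.1 hconst)
  have hνc : ν = F g₀ • μ := by
    rw [← hfν, withDensity_congr_ae hfc, withDensity_const]
  have h1 : ν univ = F g₀ * μ univ := by rw [hνc]; rfl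
  rw [measure_univ, measure_univ, mul_one] at h1
  rw [hνc, ← h1, one_smul]

theorem averageDensity_orbitMeasure (hB : B.Finite) (hintr : ∀ β ∈ B, (interior (β : Set ℍ)).Nonempty)
    : averageDensity (orbitMeasure X) =
    volume.real (octagon ∩ covered X.1) / volume.real octagon := by
  have hS := (isClosed_setOf_covers (B := B) hB UpperHalfPlane.I).measurableSet
  have h1 : averageDensity (orbitMeasure X) =
      (orbitMeasure X).real {P : PackingSpace B | UpperHalfPlane.I ∈ covered P.1} :=
    integral_indicator_one hS
  rw [h1, measureReal_def, orbitMeasure_apply hB hintr hS]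
  have h2 : (fun g => X.act (toIsom g)) ⁻¹' {P | UpperHalfPlane.I ∈ covered P.1} =
      {g | g⁻¹ • UpperHalfPlane.I ∈ covered X.1} := by
    ext g
    rw [mem_preimage, mem_ofPred_eq, mem_covered_act, toIsom_inv_apply, mem_ofPred_eq]
  have h3 := haarSL_inter_domainSL (isClosed_covered hB hintr X.2.1).measurableSet
  have h4 := congrArg ENNReal.toReal h3
  rw [ENNReal.toReal_mul, ENNReal.toReal_mul] at h4
  rw [h2, ENNReal.toReal_mul, ENNReal.toReal_inv, inv_mul_eq_div]
  exact (div_eq_div_iff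
    (ENNReal.toReal_ne_zero.2 ⟨haarSL_domainSL_ne_zero, haarSL_domainSL_ne_top⟩)
    (ENNReal.toReal_ne_zero.2 ⟨volume_octagon_pos.ne', volume_octagon_ne_top⟩)).2 h4

end OrbitMeasure

/-! ### Fundamental domains of symmetry groups -/

-- A domain of the subgroup is made of as many pieces as there are cosets, each of the measure of a
-- domain of the whole group. The octagon can then be compared with any domain of a full symmetry
-- group, which may be larger than the surface group.
open scoped Pointwise in
theorem measure_inter_eq_card_mul {G α : Type*} [Group G] [MulAction G α] [MeasurableSpace α]
    {μ : Measure α} [MeasurableConstSMul G α] [SMulInvariantMeasure G α μ] [Countable G]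
    {H : Subgroup G} {D F A : Set α} (hD : IsFundamentalDomain H D μ)
    (hF : IsFundamentalDomain G F μ) (hA : ∀ g : G, g • A = A) :
    μ (A ∩ D) = ENat.card (G ⧸ H) * μ (A ∩ F) := by
  have hbij : Function.Bijective fun p : (G ⧸ H) × H => p.1.out * (p.2 : G) := by
    constructor
    · rintro ⟨q, γ⟩ ⟨q', γ'⟩ h
      have h : q.out * (γ : G) = q'.out * (γ' : G) := h
      have hq : q = q' := by
        have := congrArg (QuotientGroup.mk (s := H)) h
        rwa [QuotientGroup.mk_mul_of_mem _ γ.2, QuotientGroup.mk_mul_of_mem _ γ'.2,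
          QuotientGroup.out_eq', QuotientGroup.out_eq'] at this
      subst hq
      rw [Subtype.ext (mul_left_cancel h)]
    · intro s
      refine ⟨⟨QuotientGroup.mk s, ⟨(QuotientGroup.mk (s := H) s).out⁻¹ * s, ?_⟩⟩, ?_⟩
      · rw [← QuotientGroup.eq, QuotientGroup.out_eq']
      · exact mul_inv_cancel_left _ _
  have hterm : ∀ (q : G ⧸ H) (γ : H), μ ((q.out * (γ : G)) • (A ∩ D) ∩ F) =
      μ (q.out⁻¹ • (A ∩ F) ∩ γ • D) := fun q γ => by
    rw [← measure_smul μ q.out⁻¹ ((q.out * (γ : G)) • (A ∩ D) ∩ F), Set.smul_set_inter, mul_smul,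
      inv_smul_smul, Set.smul_set_inter, hA, Set.smul_set_inter, hA, inter_right_comm]
    rfl
  calc μ (A ∩ D) = ∑' g : G, μ (g • (A ∩ D) ∩ F) := hF.measure_eq_tsum _
    _ = ∑' p : (G ⧸ H) × H, μ ((p.1.out * (p.2 : G)) • (A ∩ D) ∩ F) :=
        ((Equiv.ofBijective _ hbij).tsum_eq fun g : G => μ (g • (A ∩ D) ∩ F)).symm
    _ = ∑' (q : G ⧸ H) (γ : H), μ (q.out⁻¹ • (A ∩ F) ∩ γ • D) := by
        rw [ENNReal.tsum_prod']
        exact tsum_congr fun q => tsum_congr fun γ => hterm q γ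
    _ = ∑' _ : G ⧸ H, μ (A ∩ F) := by
        refine tsum_congr fun q => ?_
        rw [← hD.measure_eq_tsum' (q.out⁻¹ • (A ∩ F)), measure_smul]
    _ = _ := ENNReal.tsum_const _

open scoped Pointwise in
/-- A properly discontinuous group of isometries has a fundamental domain, given by the points
that are no farther from a generic base point than from its other images. -/
theorem exists_isFundamentalDomain {S : Subgroup (ℍ ≃ᵢ ℍ)}
    (hfin : ∀ (p : ℍ) (R : ℝ), {s | s ∈ S ∧ dist (s p) p ≤ R}.Finite) :
    Countable S ∧ ∃ F : Set ℍ, IsFundamentalDomain S F := by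
  have hcount : Countable S := by
    have h : (S : Set (ℍ ≃ᵢ ℍ)) =
        ⋃ n : ℕ, {s | s ∈ S ∧ dist (s UpperHalfPlane.I) UpperHalfPlane.I ≤ n} := by
      ext s
      simp only [mem_iUnion, mem_ofPred_eq, exists_and_left]
      exact ⟨fun h => ⟨h, exists_nat_ge _⟩, fun h => h.1⟩
    refine Set.Countable.to_subtype (s := (S : Set (ℍ ≃ᵢ ℍ))) ?_
    rw [h]
    exact countable_iUnion fun n => (hfin _ _).countable
  refine ⟨hcount, ?_⟩
  -- A nontrivial `s` moves some point `q`, and its fixed points lie on the bisector of `q` and `s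
  -- q`, a null set. A point with trivial stabiliser therefore exists.
  have hgen : ∀ᵐ p : ℍ, ∀ s : S, s ≠ 1 → (s : ℍ ≃ᵢ ℍ) p ≠ p := by
    refine ae_all_iff.2 fun s => ?_
    by_cases hs : s = 1
    · exact Eventually.of_forall fun p h => absurd hs h
    obtain ⟨q, hq⟩ : ∃ q, (s : ℍ ≃ᵢ ℍ) q ≠ q := by
      by_contra! hcon
      exact hs (Subtype.ext (IsometryEquiv.ext hcon))
    rw [ae_iff]
    refine measure_mono_null (fun p hp => ?_) (volume_bisector hq.symm)
    have hp : (s : ℍ ≃ᵢ ℍ) p = p := by simpa [hs] using hp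
    change dist p q = dist p ((s : ℍ ≃ᵢ ℍ) q)
    conv_rhs => rw [← hp]
    exact ((s : ℍ ≃ᵢ ℍ).dist_eq p q).symm
  obtain ⟨p, hp⟩ := hgen.exists
  have hclosed : IsClosed {z : ℍ | ∀ s : S, dist z p ≤ dist z ((s : ℍ ≃ᵢ ℍ) p)} := by
    simp only [ofPred_forall]
    exact isClosed_iInter fun s => isClosed_le (continuous_id.dist continuous_const)
      (continuous_id.dist continuous_const)
  refine ⟨{z | ∀ s : S, dist z p ≤ dist z ((s : ℍ ≃ᵢ ℍ) p)}, IsFundamentalDomain.mk''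
    hclosed.measurableSet.nullMeasurableSet (Eventually.of_forall fun z => ?_) (fun g hg => ?_)
    fun g => (measurePreserving_smul g volume).quasiMeasurePreserving⟩
  · have hf : {s : ℍ ≃ᵢ ℍ | s ∈ S ∧ dist z (s p) ≤ dist z p}.Finite := by
      refine (hfin p (dist z p + dist z p)).subset fun s hs => ⟨hs.1, ?_⟩
      linarith [dist_triangle_left (s p) p z, hs.2]
    obtain ⟨s, hs, hmin⟩ := exists_min_image _ (fun s : ℍ ≃ᵢ ℍ => dist z (s p)) hf
      ⟨1, one_mem S, le_rfl⟩
    refine ⟨⟨s⁻¹, inv_mem hs.1⟩, fun t => ?_⟩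
    change dist (s⁻¹ z) p ≤ dist (s⁻¹ z) ((t : ℍ ≃ᵢ ℍ) p)
    rw [← s.dist_eq, ← s.dist_eq (s⁻¹ z), IsometryEquiv.apply_inv_self]
    by_cases ht : dist z (s ((t : ℍ ≃ᵢ ℍ) p)) ≤ dist z p
    · exact hmin (s * t) ⟨mul_mem hs.1 t.2, ht⟩
    · exact hs.2.trans (not_le.1 ht).le
  -- A point in two of these cells is equally far from `p` and from `g p`.
  · refine measure_mono_null ?_ (volume_bisector (hp g hg).symm)
    rintro _ ⟨⟨w, hw, rfl⟩, hz⟩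
    refine le_antisymm (hz g) ?_
    have h1 : dist w p ≤ dist w ((g : ℍ ≃ᵢ ℍ)⁻¹ p) := hw g⁻¹
    rw [← (g : ℍ ≃ᵢ ℍ).dist_eq, ← (g : ℍ ≃ᵢ ℍ).dist_eq w, IsometryEquiv.apply_inv_self] at h1
    exact h1

theorem exists_combination_nrm (v : Fin 3 → ℝ) :
    ∃ x y z : ℝ, v = x • nrm 0 + y • nrm 2 + z • nrm 4 := by
  have hs := inS_pos.ne'
  have hA : (1 + √2) ≠ 0 := by positivity
  refine ⟨(v 2 / inS - v 1 / (1 + √2) + v 0 / (1 + √2)) / 2, v 1 / (1 + √2),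
    (v 2 / inS - v 1 / (1 + √2) - v 0 / (1 + √2)) / 2, ?_⟩
  have e0 : nrm 0 = ![(1 + √2) * 1, (1 + √2) * 0, inS] := rfl
  have e2 : nrm 2 = ![(1 + √2) * 0, (1 + √2) * 1, inS] := rfl
  have e4 : nrm 4 = ![(1 + √2) * -1, (1 + √2) * 0, inS] := rfl
  rw [e0, e2, e4]
  ext i
  fin_cases i
  · simp; field_simp; ring
  · simp; field_simp
  · simp; field_simp; ring

/-- A set whose boundary consists of segments of the lines of the octagon, and of circular arcs,
has finitely many symmetries. -/
theorem finite_stabilizer {K : Set ℍ} {c : ℍ} {r : ℝ} (hr : 0 ≤ r)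
    (hinf : ∀ k, (frontier K ∩ {z | mink (hyp z) (nrm k) = 0}).Infinite)
    (hsub : frontier K ⊆ (⋃ k, ({z : ℍ | mink (hyp z) (nrm k) = 0} ∪ Metric.sphere (mid k) rad)) ∪
      Metric.sphere c r) : {φ : ℍ ≃ᵢ ℍ | φ '' K = K}.Finite := by
  -- A symmetry carries infinitely many boundary points on a side line to boundary points on the
  -- image line. A line that is not a side line meets the listed lines and circles in only finitely
  -- many points, so the normals are permuted up to sign, and three of them determine the symmetry.
  have hmem : ∀ φ : ℍ ≃ᵢ ℍ, φ '' K = K → ∀ k, lin φ (nrm k) ∈ range nrm ∪ range (-nrm) := by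
    intro φ hφ k
    by_contra hno
    have hn : mink (lin φ (nrm k)) (lin φ (nrm k)) = 1 := by rw [mink_lin, mink_nrm_self]
    refine (hinf k).image φ.injective.injOn ?_
    have hfin : ∀ j, ({z : ℍ | mink (hyp z) (nrm j) = 0} ∩
        {z | mink (hyp z) (lin φ (nrm k)) = 0}).Finite := fun j => by
      by_contra hj
      rcases normals_eq_of_infinite (mink_nrm_self j) hn hj with h | h
      · exact hno (Or.inl ⟨j, h.symm⟩)
      · exact hno (Or.inr ⟨j, h.symm⟩)
    refine ((finite_iUnion fun j => (hfin j).union (finite_sphere_inter_line (m := mid j)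
      rad_pos.le hn)).union (finite_sphere_inter_line (m := c) hr hn)).subset ?_
    rw [image_inter φ.injective, image_line, ← image_frontier_isometry, hφ]
    rintro z ⟨hz, hzl⟩
    rcases hsub hz with hz | hz
    · obtain ⟨j, hz | hz⟩ := mem_iUnion.1 hz
      · exact Or.inl (mem_iUnion.2 ⟨j, Or.inl ⟨hz, hzl⟩⟩)
      · exact Or.inl (mem_iUnion.2 ⟨j, Or.inr ⟨hz, hzl⟩⟩)
    · exact Or.inr ⟨hz, hzl⟩
  have hT : (range nrm ∪ range (-nrm)).Finite := (finite_range _).union (finite_range _)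
  refine Set.Finite.of_finite_image (f := fun φ => (lin φ (nrm 0), lin φ (nrm 2), lin φ (nrm 4)))
    ((hT.prod (hT.prod hT)).subset ?_) ?_
  · rintro _ ⟨φ, hφ, rfl⟩
    exact ⟨hmem φ hφ 0, hmem φ hφ 2, hmem φ hφ 4⟩
  · intro φ _ ψ _ h
    simp only [Prod.mk.injEq] at h
    refine eq_of_lin_eq fun v => ?_
    obtain ⟨x, y, z, rfl⟩ := exists_combination_nrm v
    simp only [map_add, map_smul, h.1, h.2.1, h.2.2]

/-- A symmetry that moves `p` a bounded amount takes `K` to one of finitely many nearby bodies, and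
the image of `K` determines it up to the finite stabiliser of `K`. -/
theorem symmetryGroup_finite {B P : Set (NonemptyCompacts ℍ)} (hB : B.Finite)
    (hintr : ∀ β ∈ B, (interior (β : Set ℍ)).Nonempty) (hP : IsPacking B P)
    {K : NonemptyCompacts ℍ} (hK : K ∈ P) (hfin : {φ : ℍ ≃ᵢ ℍ | φ '' (K : Set ℍ) = K}.Finite)
    (p : ℍ) (R : ℝ) : {s | s ∈ symmetryGroup P ∧ dist (s p) p ≤ R}.Finite := by
  obtain ⟨q, hq⟩ := K.nonempty
  refine Set.Finite.of_finite_fibers (fun s => move s K) ((IsPacking.finite_near hB hintr hP p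
    (dist q p + R)).subset ?_) ?_
  · rintro _ ⟨s, ⟨hs, hd⟩, rfl⟩
    refine ⟨hs.2.subset ⟨K, hK, rfl⟩, s q, ⟨q, hq, rfl⟩, ?_⟩
    rw [Metric.mem_closedBall]
    linarith [dist_triangle (s q) (s p) p, s.dist_eq q p]
  · rintro _ ⟨s₀, -, rfl⟩
    refine Set.Finite.subset (hfin.image fun φ => s₀ * φ) ?_
    rintro s ⟨-, hs⟩
    have hs : move s K = move s₀ K := hs
    refine ⟨s₀⁻¹ * s, ?_, mul_inv_cancel_left _ _⟩
    change ((move (s₀⁻¹ * s) K : NonemptyCompacts ℍ) : Set ℍ) = K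
    rw [move_mul, hs, ← move_mul, inv_mul_cancel, move_one]

theorem image_covered_of_mem_symmetryGroup {P : Set (NonemptyCompacts ℍ)} {s : ℍ ≃ᵢ ℍ}
    (hs : s ∈ symmetryGroup P) : s '' covered P = covered P := by
  conv_rhs => rw [← hs.2]
  rw [covered, covered, biUnion_image, image_iUnion₂]
  rfl

theorem hasPeriodicDensity_of_finite {P : Set (NonemptyCompacts ℍ)}
    (hle : surfGroup ≤ symmetryGroup P)
    (hfin : ∀ (p : ℍ) (R : ℝ), {s | s ∈ symmetryGroup P ∧ dist (s p) p ≤ R}.Finite) :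
    HasPeriodicDensity P (volume.real (octagon ∩ covered P) / volume.real octagon) := by
  obtain ⟨hcount, hex⟩ := exists_isFundamentalDomain hfin
  refine ⟨hex, fun F hF => ?_⟩
  have hD : IsFundamentalDomain (surfGroup.subgroupOf (symmetryGroup P)) octagon volume :=
    isFundamentalDomain_octagon.preimage_of_equiv (f := id) (Measure.QuasiMeasurePreserving.id _)
      (e := (Subgroup.subgroupOfEquivOfLe hle).symm) (Equiv.bijective _) fun g z => rfl
  have h1 := measure_inter_eq_card_mul hD hF (A := univ) fun g => smul_set_univ
  have h2 := measure_inter_eq_card_mul hD hF (A := covered P) fun g =>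
    image_covered_of_mem_symmetryGroup g.2
  rw [univ_inter, univ_inter] at h1
  set κ : ℝ≥0∞ := ((ENat.card (symmetryGroup P ⧸ surfGroup.subgroupOf (symmetryGroup P)) : ℕ∞) :
    ℝ≥0∞) with hκ
  have hpos := volume_octagon_pos
  have hne := volume_octagon_ne_top
  rw [h1] at hpos hne
  obtain ⟨hκ0, hF0⟩ := mul_ne_zero_iff.1 hpos.ne'
  have hκt : κ ≠ ∞ := fun h => hne (by rw [h, ENNReal.top_mul hF0])
  have hFt : volume F ≠ ∞ := fun h => hne (by rw [h, ENNReal.mul_top hκ0])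
  refine ⟨hF0, hFt, ?_⟩
  rw [inter_comm octagon, measureReal_def (s := covered P ∩ octagon), h2,
    measureReal_def (s := octagon), h1, ENNReal.toReal_mul, ENNReal.toReal_mul,
    mul_div_mul_left _ _ (ENNReal.toReal_ne_zero.2 ⟨hκ0, hκt⟩), inter_comm F]
  rfl

/-! ### Densities of the two packings -/

/-- Points of the side at distance between `rad` and `2 * rad` from its midpoint are boundary points
of the octagon and of the modified octagon alike. -/
theorem exists_side_points (k : ZMod 8) : ∃ E : Set ℍ, E.Infinite ∧
    E ⊆ {z | mink (hyp z) (nrm k) = 0} ∧ E ⊆ octagon \ interior octagon ∧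
    E ⊆ modTile \ interior modTile := by
  have hr := rad_pos
  obtain ⟨u, hu, hun, hmu, -⟩ := exists_frame (mink_nrm_self k) (mink_mid_nrm_self k)
  obtain ⟨γ, hγ, hγ0, hγs⟩ := exists_geodesic_line hu hmu
  have hline : ∀ s, mink (hyp (γ s)) (nrm k) = 0 := fun s => by
    rw [hγs, mink_add_left, mink_smul_left, mink_smul_left, hun, mink_mid_nrm_self]
    ring
  have hdist : ∀ s ∈ Ioo rad (2 * rad), dist (γ s) (mid k) = s := fun s hs => by
    rw [← hγ0, hγ.dist_eq, Real.dist_eq, sub_zero, abs_of_pos (hr.trans hs.1)]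
  have hoct : ∀ s ∈ Ioo rad (2 * rad), γ s ∈ octagon := fun s hs =>
    (mem_octagon_iff_near (k := k) (by rw [hdist s hs]; linarith [hs.2])).2 (hline s).le
  have hintr : ∀ s, γ s ∉ interior octagon := fun s hs => by
    rw [octagon_interior_eq] at hs
    exact (hs k).ne (hline s)
  have hfar : ∀ s ∈ Ioo rad (2 * rad), ∀ j, rad < dist (γ s) (mid j) := fun s hs j => by
    by_contra hj
    have : j = k := eq_of_near (z := γ s) (by linarith) (by rw [hdist s hs]; linarith [hs.2])
    rw [this, hdist s hs] at hj
    exact hj hs.1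
  refine ⟨γ '' Ioo rad (2 * rad), (Ioo_infinite (by linarith)).image hγ.injective.injOn, ?_, ?_, ?_⟩
  · rintro _ ⟨s, -, rfl⟩
    exact hline s
  · rintro _ ⟨s, hs, rfl⟩
    exact ⟨hoct s hs, hintr s⟩
  · rintro _ ⟨s, hs, rfl⟩
    refine ⟨(mem_modTile_iff_far (hfar s hs)).2 (hoct s hs), fun hi => hintr s ?_⟩
    have ho : IsOpen {z : ℍ | ∀ j, rad < dist z (mid j)} := by
      simp only [ofPred_forall]
      exact isOpen_iInter_of_finite fun j =>
        isOpen_lt continuous_const (continuous_id.dist continuous_const)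
    exact interior_maximal (fun z hz => (mem_modTile_iff_far hz.2).1 (interior_subset hz.1))
      (isOpen_interior.inter ho) ⟨hi, hfar s hs⟩

theorem finite_stabilizer_octBody : {φ : ℍ ≃ᵢ ℍ | φ '' (octBody : Set ℍ) = octBody}.Finite := by
  refine finite_stabilizer (c := mid 0) rad_pos.le (fun k => ?_) ?_
  · obtain ⟨E, hE, h1, h2, -⟩ := exists_side_points k
    refine hE.mono fun z hz => ⟨?_, h1 hz⟩
    rw [coe_octBody, isCompact_octagon.isClosed.frontier_eq]
    exact h2 hz
  · exact frontier_octagon_subset.trans ((iUnion_mono fun k => subset_union_left).trans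
      subset_union_left)

theorem finite_stabilizer_holeBody {c : ℍ} {r : ℝ} (h : IsHole c r) :
    {φ : ℍ ≃ᵢ ℍ | φ '' (holeBody h : Set ℍ) = holeBody h}.Finite := by
  refine finite_stabilizer h.pos.le (fun k => ?_) ((frontier_holeBody_subset h).trans
    (union_subset_union_left _ frontier_modTile_subset))
  obtain ⟨E, hE, h1, -, h3⟩ := exists_side_points k
  refine hE.mono fun z hz => ⟨?_, h1 hz⟩
  rw [(holeBody h).isCompact.isClosed.frontier_eq]
  exact ⟨⟨(h3 hz).1, fun hb => (h3 hz).2 (h.subset (Metric.ball_subset_closedBall hb))⟩,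
    fun hi => (h3 hz).2 (interior_mono sdiff_subset hi)⟩

theorem surfGroup_le_symmetryGroup (K : NonemptyCompacts ℍ) :
    surfGroup ≤ symmetryGroup (translates surfGroup K) := by
  refine fun γ hγ => ⟨surfGroup_le_orientedIsom hγ, Subset.antisymm ?_ ?_⟩
  · rintro _ ⟨_, ⟨δ, hδ, rfl⟩, rfl⟩
    exact ⟨γ * δ, mul_mem hγ hδ, (move_mul _ _ _).symm⟩
  · rintro _ ⟨δ, hδ, rfl⟩
    exact ⟨move (γ⁻¹ * δ) K, ⟨_, mul_mem (inv_mem hγ) hδ, rfl⟩, by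
      rw [← move_mul, mul_inv_cancel_left]⟩

theorem isPeriodic_translates (K : NonemptyCompacts ℍ) : IsPeriodic (translates surfGroup K) :=
  ⟨octagon, isCompact_octagon, fun z => by
    obtain ⟨γ, hγ, hz⟩ := isPrototile_octagon.cover z
    exact ⟨γ⁻¹, inv_mem (surfGroup_le_symmetryGroup K hγ), mem_image_isometry.1 hz⟩⟩

theorem hasDensity_of_eq_translates {B : Set (NonemptyCompacts ℍ)} (hB : B.Finite)
    (hintr : ∀ β ∈ B, (interior (β : Set ℍ)).Nonempty) {X : PackingSpace B}
    {K : NonemptyCompacts ℍ} (hX : X.1 = translates surfGroup K)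
    (hK : {φ : ℍ ≃ᵢ ℍ | φ '' (K : Set ℍ) = K}.Finite) :
    HasDensity X (volume.real (octagon ∩ covered X.1) / volume.real octagon) := by
  have hle : surfGroup ≤ symmetryGroup X.1 := hX ▸ surfGroup_le_symmetryGroup K
  have hKX : K ∈ X.1 := hX ▸ ⟨1, one_mem _, (move_one K).symm⟩
  exact ⟨hasPeriodicDensity_of_finite hle (symmetryGroup_finite hB hintr X.2.1 hKX hK),
    orbitMeasure X, orbitMeasure_mem_ergodicMeasures hB hintr fun γ hγ => Subtype.ext (hle hγ).2,
    orbitMeasure_compl_orbit hB hintr, averageDensity_orbitMeasure hB hintr⟩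

theorem finite_holed_bodies {c : ℍ} {r : ℝ} (h : IsHole c r) :
    ({octBody, holeBody h} : Set (NonemptyCompacts ℍ)).Finite := toFinite _

theorem interior_holed_bodies_nonempty {c : ℍ} {r : ℝ} (h : IsHole c r) :
    ∀ β ∈ ({octBody, holeBody h} : Set (NonemptyCompacts ℍ)), (interior (β : Set ℍ)).Nonempty := by
  rintro β (rfl | rfl)
  · exact ⟨_, I_mem_interior_octagon⟩
  · exact (isConnected_interior_holeBody h).nonempty

variable {c : ℍ} {r : ℝ}

theorem hasDensity_octPacking (h : IsHole c r) : HasDensity (octPacking h) 1 := by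
  have h1 := hasDensity_of_eq_translates (finite_holed_bodies h) (interior_holed_bodies_nonempty h)
    (X := octPacking h) rfl finite_stabilizer_octBody
  have h2 : covered (octPacking h).1 = univ :=
    covered_translates (K := octBody) isPrototile_octagon
  rwa [h2, inter_univ, div_self] at h1
  exact (ENNReal.toReal_pos volume_octagon_pos.ne' volume_octagon_ne_top).ne'

theorem eq_of_mem_interior_modTile {γ γ' : ℍ ≃ᵢ ℍ} (hγ : γ ∈ surfGroup) (hγ' : γ' ∈ surfGroup)
    {z : ℍ} (hz : z ∈ γ '' interior modTile) (hz' : z ∈ γ' '' modTile) : γ = γ' := by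
  refine isPrototile_modTile.eq_of_inter hγ hγ' ?_
  rw [← closure_interior_modTile, ← image_closure_isometry, ← image_interior_isometry] at hz'
  rw [← image_interior_isometry] at hz
  exact mem_closure_iff.1 hz' _ isOpen_interior hz

/-- Holes are not covered. -/
theorem disjoint_hole_covered (h : IsHole c r) {γ : ℍ ≃ᵢ ℍ} (hγ : γ ∈ surfGroup) :
    Disjoint (γ '' Metric.ball c r) (covered (holePacking h).1) := by
  refine Set.disjoint_left.2 fun z hz hzc => ?_
  obtain ⟨_, ⟨γ', hγ', rfl⟩, hz'⟩ := mem_iUnion₂.1 hzc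
  have := eq_of_mem_interior_modTile hγ hγ'
    (image_mono (Metric.ball_subset_closedBall.trans h.subset) hz) (image_mono sdiff_subset hz')
  subst this
  rw [mem_image_isometry] at hz
  exact (mem_image_isometry.1 hz').2 hz

theorem hasDensity_holePacking (h : IsHole c r) : HasDensity (holePacking h)
    (volume.real (holeBody h : Set ℍ) / volume.real octagon) := by
  have := countable_surfGroup
  have h1 := hasDensity_of_eq_translates (finite_holed_bodies h) (interior_holed_bodies_nonempty h)
    (X := holePacking h) rfl (finite_stabilizer_holeBody h)
  convert h1 using 2
  have hm := (isClosed_covered (finite_holed_bodies h) (interior_holed_bodies_nonempty h)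
    (holePacking h).2.1).measurableSet
  -- The covered set is invariant, so the octagon may be exchanged for the modified octagon, in
  -- which it is exactly the holed body.
  have h2 := isFundamentalDomain_octagon.measure_set_eq (isPrototile_modTile.isFundamentalDomain
    isCompact_modTile.isClosed volume_frontier_modTile) hm fun γ => ?_
  · have h3 : covered (holePacking h).1 ∩ modTile = holeBody h := by
      apply Subset.antisymm
      · rintro z ⟨hz, hzm⟩
        refine ⟨hzm, fun hzb => Set.disjoint_left.1 (disjoint_hole_covered h (one_mem surfGroup))
          ⟨z, hzb, rfl⟩ hz⟩
      · exact fun z hz => ⟨mem_iUnion₂.2 ⟨holeBody h, ⟨1, one_mem _, (move_one _).symm⟩, hz⟩, hz.1⟩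
    rw [measureReal_def, measureReal_def, inter_comm octagon, h2, h3]
  · have h4 := image_covered_of_mem_symmetryGroup (surfGroup_le_symmetryGroup (holeBody h) γ.2)
    have h5 : covered (holePacking h).1 = covered (translates surfGroup (holeBody h)) := rfl
    rw [h5]
    conv_lhs => rw [← h4]
    exact preimage_image_eq _ (γ : ℍ ≃ᵢ ℍ).injective

/-! ### Optimal density, and the fraction covered in large balls -/

theorem averageDensity_le_one {B : Set (NonemptyCompacts ℍ)} {μ : Measure (PackingSpace B)}
    (hμ : μ ∈ ergodicMeasures B) : averageDensity μ ≤ 1 := by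
  have := hμ.1.1
  have h1 := norm_integral_le_of_norm_le_const (μ := μ) (C := 1) (f := {P : PackingSpace B |
    UpperHalfPlane.I ∈ covered P.1}.indicator fun _ => (1 : ℝ)) (Eventually.of_forall fun P => by
      by_cases hP : P ∈ {P : PackingSpace B | UpperHalfPlane.I ∈ covered P.1}
      · rw [indicator_of_mem hP, norm_one]
      · rw [indicator_of_notMem hP, norm_zero]; exact zero_le_one)
  rw [probReal_univ, mul_one] at h1
  exact (le_abs_self _).trans h1

theorem optimalDensity_holed (h : IsHole c r) : optimalDensity {octBody, holeBody h} = 1 := by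
  obtain ⟨-, μ, hμ, -, hμ1⟩ := hasDensity_octPacking h
  exact IsGreatest.csSup_eq ⟨⟨μ, hμ, hμ1⟩, by
    rintro _ ⟨ν, hν, rfl⟩
    exact averageDensity_le_one hν⟩

/-- The boundary layer of a large ball is not negligible here. Instead, each point of the ball is
close to a tile lying entirely inside, so the ball is covered by boundedly enlarged copies of such
tiles, and each of them contributes a whole hole. -/
theorem volume_closedBall_mul_le (h : IsHole c r) {D : ℝ} (hD : 0 ≤ D)
    (hDm : modTile ⊆ Metric.closedBall UpperHalfPlane.I D) (p : ℍ) {R : ℝ} (hR : 2 * D ≤ R) :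
    volume (Metric.closedBall p R) * volume (Metric.ball c r) ≤
      volume (Metric.closedBall p R \ covered (holePacking h).1) *
        volume (Metric.closedBall UpperHalfPlane.I (3 * D)) := by
  have := countable_surfGroup
  set N := {γ : surfGroup // (γ : ℍ ≃ᵢ ℍ) '' modTile ⊆ Metric.closedBall p R} with hN
  have hball : ∀ γ : ℍ ≃ᵢ ℍ, γ '' modTile ⊆ Metric.closedBall (γ UpperHalfPlane.I) D := fun γ => by
    rw [← IsometryEquiv.image_closedBall]
    exact image_mono hDm
  have h1 : volume (Metric.closedBall p R) ≤
      ∑' _ : N, volume (Metric.closedBall UpperHalfPlane.I (3 * D)) := by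
    have hsub : Metric.closedBall p R ⊆
        ⋃ γ : N, Metric.closedBall ((γ.1 : ℍ ≃ᵢ ℍ) UpperHalfPlane.I) (3 * D) := by
      intro z hz
      rw [Metric.mem_closedBall] at hz
      -- Step back towards the centre by at most `2 * D`; a tile containing the new point has
      -- diameter at most `2 * D` and stays within the ball.
      obtain ⟨q, hq, hzq⟩ : ∃ q, dist q p ≤ R - 2 * D ∧ dist z q ≤ 2 * D := by
        rcases le_total (dist z p) (R - 2 * D) with hle | hle
        · exact ⟨z, hle, by rw [dist_self]; linarith⟩
        · obtain ⟨q, hq, hzq⟩ := exists_dist_eq_sub p z (by linarith) hle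
          exact ⟨q, hq.le, by rw [hzq]; linarith⟩
      obtain ⟨γ, hγ, hqγ⟩ := isPrototile_modTile.cover q
      have hqI := Metric.mem_closedBall.1 (hball γ hqγ)
      refine mem_iUnion.2 ⟨⟨⟨γ, hγ⟩, fun w hw => ?_⟩, ?_⟩
      · have hwI := Metric.mem_closedBall.1 (hball γ hw)
        rw [Metric.mem_closedBall]
        linarith [dist_triangle w q p, dist_triangle_right w q (γ UpperHalfPlane.I)]
      · rw [Metric.mem_closedBall]
        linarith [dist_triangle z q (γ UpperHalfPlane.I)]
    refine (measure_mono hsub).trans ((measure_iUnion_le _).trans_eq ?_)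
    exact tsum_congr fun γ => volume_closedBall_eq _ _
  have h2 : ∑' _ : N, volume (Metric.ball c r) ≤
      volume (Metric.closedBall p R \ covered (holePacking h).1) := by
    have hsub : ⋃ γ : N, (γ.1 : ℍ ≃ᵢ ℍ) '' Metric.ball c r ⊆
        Metric.closedBall p R \ covered (holePacking h).1 := by
      refine iUnion_subset fun γ z hz => ⟨γ.2 (image_mono (Metric.ball_subset_closedBall.trans
        (h.subset.trans interior_subset)) hz), ?_⟩
      exact Set.disjoint_left.1 (disjoint_hole_covered h γ.1.2) hz
    refine le_trans (le_of_eq ?_) (measure_mono hsub)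
    rw [measure_iUnion]
    · exact tsum_congr fun γ => (volume_image_isometry _ _).symm
    · intro γ γ' hne
      refine Set.disjoint_left.2 fun z hz hz' => hne (Subtype.ext (Subtype.ext ?_))
      have hsub := Metric.ball_subset_closedBall.trans h.subset
      exact eq_of_mem_interior_modTile γ.1.2 γ'.1.2 (image_mono hsub hz)
        (image_mono (hsub.trans interior_subset) hz')
    · exact fun γ => ((γ.1 : ℍ ≃ᵢ ℍ).toHomeomorph.isOpenMap _ Metric.isOpen_ball).measurableSet
  refine (mul_le_mul_left h1 _).trans (le_trans (le_of_eq ?_) (mul_le_mul_left h2 _))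
  rw [ENNReal.tsum_const, ENNReal.tsum_const, mul_assoc, mul_assoc, mul_comm (volume _)]

/-- An optimal measure has average density `1`, but the covered fraction of large balls is at most
`1 - δ / V`, where `δ` is the area of a hole and `V` that of a fixed ball. -/
theorem not_isOptimallyDense_holePacking (h : IsHole c r) : ¬IsOptimallyDense (holePacking h) := by
  rintro ⟨μ, -, hμ, -, hlim⟩
  rw [hμ, optimalDensity_holed] at hlim
  obtain ⟨D, hD⟩ := isCompact_modTile.isBounded.subset_closedBall UpperHalfPlane.I
  obtain ⟨z₀, hz₀⟩ := h.nonempty_sdiff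
  have hD0 : 0 ≤ D := dist_nonneg.trans (Metric.mem_closedBall.1 (hD (interior_subset hz₀.1)))
  set V := volume.real (Metric.closedBall UpperHalfPlane.I (3 * D)) with hV
  set δ := volume.real (Metric.ball c r) with hδ
  have hδt : volume (Metric.ball c r) ≠ ∞ :=
    ne_top_of_le_ne_top (volume_closedBall_ne_top c r) (measure_mono Metric.ball_subset_closedBall)
  have hδ0 : 0 < δ := ENNReal.toReal_pos (Metric.measure_ball_pos volume c h.pos).ne' hδt
  have hle : ∀ᶠ R : ℝ in atTop, volume.real (covered (holePacking h).1 ∩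
      Metric.closedBall UpperHalfPlane.I R) / volume.real (Metric.closedBall UpperHalfPlane.I R) ≤
        1 - δ / V := by
    filter_upwards [eventually_ge_atTop (2 * D), eventually_gt_atTop 0] with R hR hR0
    have hbt := volume_closedBall_ne_top UpperHalfPlane.I R
    have hm := (isClosed_covered (finite_holed_bodies h) (interior_holed_bodies_nonempty h)
      (holePacking h).2.1).measurableSet
    have hst : volume (Metric.closedBall UpperHalfPlane.I R \ covered (holePacking h).1) ≠ ∞ :=
      ne_top_of_le_ne_top hbt (measure_mono sdiff_subset)
    have h1 := ENNReal.toReal_mono (ENNReal.mul_ne_top hst (volume_closedBall_ne_top _ _))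
      (volume_closedBall_mul_le h hD0 hD UpperHalfPlane.I hR)
    rw [ENNReal.toReal_mul, ENNReal.toReal_mul] at h1
    have h2 := measureReal_inter_add_sdiff (μ := volume)
      (s := Metric.closedBall UpperHalfPlane.I R) hm hbt
    have hb0 : 0 < volume.real (Metric.closedBall UpperHalfPlane.I R) :=
      ENNReal.toReal_pos (Metric.measure_closedBall_pos volume _ hR0).ne' hbt
    have hV0 : 0 < V := by
      refine lt_of_le_of_ne measureReal_nonneg fun h0 => ?_
      have h3 : (volume (Metric.closedBall UpperHalfPlane.I (3 * D))).toReal = 0 := h0.symm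
      rw [h3, mul_zero] at h1
      exact absurd h1 (not_le.2 (mul_pos hb0 hδ0))
    have h3 : δ / V * volume.real (Metric.closedBall UpperHalfPlane.I R) ≤
        volume.real (Metric.closedBall UpperHalfPlane.I R \ covered (holePacking h).1) := by
      rw [div_mul_eq_mul_div, div_le_iff₀ hV0, mul_comm δ]
      exact h1
    rw [div_le_iff₀ hb0, inter_comm, sub_mul, one_mul]
    linarith
  have h1 := le_of_tendsto (hlim UpperHalfPlane.I) hle
  have hV0 : 0 < V := by
    have h2 : δ / V ≤ 0 := by linarith
    refine ENNReal.toReal_pos (fun h0 => ?_) (volume_closedBall_ne_top _ _)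
    have h3 := volume_closedBall_mul_le h hD0 hD UpperHalfPlane.I
      (R := 2 * D + 1) (by linarith)
    rw [h0, mul_zero, nonpos_iff_eq_zero, mul_eq_zero] at h3
    rcases h3 with h3 | h3
    · exact (Metric.measure_closedBall_pos volume _ (by linarith)).ne' h3
    · exact (Metric.measure_ball_pos volume c h.pos).ne' h3
  linarith [div_pos hδ0 hV0]

/-- Small disks are holes of small area. -/
theorem exists_isHole {κ : ℝ} (hκ : 0 < κ) (hc : c ∈ interior modTile) : ∃ r₀ > 0, ∀ r : ℝ,
    0 < r → r < r₀ → IsHole c r ∧ 2 * volume.real (Metric.closedBall c r) ≤ κ := by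
  have h0 : volume ({c} : Set ℍ) = 0 := by
    rw [← Metric.sphere_zero]
    exact volume_sphere_eq_zero c le_rfl
  have hlim := tendsto_measure_cthickening_of_isCompact (μ := volume) (isCompact_singleton (x := c))
  rw [h0] at hlim
  have hpos : 0 < min (volume octagon / 2) (ENNReal.ofReal (κ / 2)) :=
    lt_min (ENNReal.half_pos volume_octagon_pos.ne') (ENNReal.ofReal_pos.2 (by positivity))
  obtain ⟨r₁, hr₁, h₁⟩ := Metric.eventually_nhds_iff.1 (hlim.eventually (gt_mem_nhds hpos))
  obtain ⟨r₂, hr₂, h₂⟩ := Metric.isOpen_iff.1 isOpen_interior c hc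
  refine ⟨min r₁ r₂, lt_min hr₁ hr₂, fun r hr hrr => ?_⟩
  have h3 := h₁ (y := r) (by
    rw [Real.dist_eq, sub_zero, abs_of_pos hr]; exact hrr.trans_le (min_le_left _ _))
  rw [Metric.cthickening_singleton c hr.le, lt_min_iff] at h3
  refine ⟨⟨hr, (Metric.closedBall_subset_ball (hrr.trans_le (min_le_right _ _))).trans h₂, ?_⟩, ?_⟩
  · have := ENNReal.mul_lt_of_lt_div' h3.1
    exact this
  · have := ENNReal.toReal_mono ENNReal.ofReal_ne_top h3.2.le
    rw [ENNReal.toReal_ofReal (by positivity)] at this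
    change 2 * (volume (Metric.closedBall c r)).toReal ≤ κ
    linarith

end HypPacking

end

open HypPacking in
theorem mainTheorem6 :
    ∃ (v : ZMod 8 → ℍ) (β₁ β₂' : NonemptyCompacts ℍ) (Γ : Subgroup (ℍ ≃ᵢ ℍ)),
      -- `β₁` is a regular octagon with all interior angles equal to `2π/8`
      IsRegularOctagon v β₁ ∧ (∀ k, hypAngle (v (k - 1)) (v k) (v (k + 1)) = 2 * Real.pi / 8) ∧
      -- the translates of `β₁` under the group `Γ` form a tiling, each tile occurring once
      Γ ≤ orientedIsom ∧ IsTiling {β₁} (translates Γ β₁) ∧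
      (∀ γ ∈ Γ, ∀ γ' ∈ Γ, move γ β₁ = move γ' β₁ → γ = γ') ∧
      -- `β₂'` is `β₁` with protrusions and indentations; its translates also form a tiling
      IsModifiedOctagon v Γ β₁ β₂' ∧ IsTiling {β₂'} (translates Γ β₂') ∧
      -- `β₂` is `β₂'` with any sufficiently small hole removed
      ∀ c ∈ interior (β₂' : Set ℍ), ∃ r₀ > 0, ∀ r : ℝ, 0 < r → r < r₀ →
        ∃ β₂ : NonemptyCompacts ℍ, (β₂ : Set ℍ) = (β₂' : Set ℍ) \ Metric.ball c r ∧
          Metric.closedBall c r ⊆ interior (β₂' : Set ℍ) ∧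
          IsBody (β₁ : Set ℍ) ∧ IsBody (β₂ : Set ℍ) ∧
          optimalDensity {β₁, β₂} = 1 ∧
          volume.real (β₂ : Set ℍ) / volume.real (β₁ : Set ℍ) < 1 ∧
          ∃ T P : PackingSpace {β₁, β₂},
            T.1 = translates Γ β₁ ∧ IsPeriodic T.1 ∧
            IsCompletelySaturated {β₁, β₂} T.1 ∧ HasDensity T 1 ∧
            P.1 = translates Γ β₂ ∧ IsPeriodic P.1 ∧
            IsCompletelySaturated {β₁, β₂} P.1 ∧
            HasDensity P (volume.real (β₂ : Set ℍ) / volume.real (β₁ : Set ℍ)) ∧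
            ¬ IsOptimallyDense P := by
  -- The waste constant concerns only the octagon and the unholed modified octagon, so it is
  -- available before the hole is chosen and fixes how small the hole must be.
  obtain ⟨κ, hκ0, hκ⟩ := exists_waste_bound
  refine ⟨vtx, octBody, modBody, surfGroup, isRegularOctagon_octagon, hypAngle_vtx,
    surfGroup_le_orientedIsom, isPrototile_octagon.isTiling (K := octBody) isTile_octagon,
    fun γ hγ γ' hγ' he => isPrototile_octagon.move_inj (K := octBody)
      ⟨_, I_mem_interior_octagon⟩ hγ hγ' he,
    isModifiedOctagon_modTile, isPrototile_modTile.isTiling (K := modBody) isTile_modTile,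
    fun c hc => ?_⟩
  obtain ⟨r₀, hr₀, hr⟩ := exists_isHole hκ0 hc
  refine ⟨r₀, hr₀, fun r h0 h1 => ?_⟩
  obtain ⟨h, hsmall⟩ := hr r h0 h1
  have hlt : volume.real (holeBody h : Set ℍ) < volume.real octagon :=
    (ENNReal.toReal_lt_toReal (holeBody h).isCompact.measure_ne_top
      isCompact_octagon.measure_ne_top).2 (volume_holeBody_lt h)
  exact ⟨holeBody h, rfl, h.subset, isBody_octagon, isBody_holeBody h, optimalDensity_holed h,
    (div_lt_one (measureReal_nonneg.trans_lt hlt)).2 hlt, octPacking h, holePacking h,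
    rfl, isPeriodic_translates octBody, isCompletelySaturated_octPacking h, hasDensity_octPacking h,
    rfl, isPeriodic_translates (holeBody h), isCompletelySaturated_holePacking h hκ hsmall,
    hasDensity_holePacking h, not_isOptimallyDense_holePacking h⟩
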